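/- **Setting.** Let $\sigma>0$ and let $\mu$ be a symmetric probability measure on $\mathbb R$ with variance $\sigma^2$ and fourth cumulant $\kappa_4=\int x^4\,d\mu-3\sigma^4$ that satisfies a Poincaré inequality: there is $C>0$ with $\int|f-\int f\,d\mu|^2\,d\mu\le C\int|f'|^2\,d\mu$ for every $C^1$ function $f:\mathbb R\to\mathbb C$ with $f,f'\in L^2(\mu)$. Let $\theta_1>\dots>\theta_J$ be real numbers with $\theta_{j_0}=0$, let $k_j\ge 1$ ($j\ne j_0$) be integers and $r=\sum_{j\ne j_0}k_j$. On a probability space consider, for every $N$, the matrix $M_N=\frac1{\sqrt N}W_N+A_N$, where * (complex case) $W_N$ is an $N\times N$ random Hermitian matrix such that the $N^2$ variables $(W_N)_{ii}$, $\sqrt2\,\mathrm{Re}(W_N)_{ij}$, $\sqrt2\,\mathrm{Im}(W_N)_{ij}$ ($i<j$) are i.i.d. with law $\mu$; respectively (real case) $W_N$ is an $N\times N$ random real symmetric matrix such that the $\frac{N(N+1)}2$ variables $\frac1{\sqrt2}(W_N)_{ii}$, $(W_N)_{ij}$ ($i<j$) are i.i.d. with law $\mu$; * for $N\ge r$, $A_N$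 is a deterministic Hermitian (resp. real symmetric) matrix whose eigenvalues are the $\theta_j$, $j\neq j_0$, with multiplicity $k_j$, and $0$ with multiplicity $N-r$. No assumption is made on the joint law of the $W_N$ for different $N$. Let $\mu_{sc}$ be the semicircle law with density $\frac1{2\pi\sigma^2}\sqrt{4\sigma^2-x^2}$ on $[-2\sigma,2\sigma]$, let $s$ have law $\mu_{sc}$, $g_\sigma(z)=\mathbb E[(z-s)^{-1}]$, and for $z\in\mathbb C\setminus\mathbb R$ let $L_\sigma(z)=g_\sigma(z)^{-1}\,\mathbb E[(z-s)^{-2}]\,E_\sigma(z)$ with $$E_\sigma(z)=\sum_{j\ne j_0}k_j\frac{\theta_j}{z-\sigma^2g_\sigma(z)-\theta_j}+\frac{\kappa_4}2g_\sigma(z)^4\quad\text{(complex case)},$$ $$E_\sigma(z)=\sum_{j\ne j_0}k_j\frac{\theta_j}{z-\sigma^2g_\sigma(z)-\theta_j}+\kappa_4\,g_\sigma(z)^4+\sigma^2\,\mathbb E[(z-s)^{-2}]\quad\text{(real case)}.$$ Let $K_\sigma=[-2\sigma,2\sigma]\cup\{\theta_j+\sigma^2/\theta_j:\ |\theta_j|>\sigma\}$,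 and write $\operatorname{tr}_N=\frac1N\operatorname{Tr}$. **Statement.** In both cases there is a distribution $\Lambda_\sigma$ on $\mathbb R$ with compact support contained in $K_\sigma$ whose Stieltjes transform $z\mapsto\Lambda_\sigma\big(\frac1{z-x}\big)$ equals $L_\sigma$ on $\mathbb C\setminus\mathbb R$, and: 1. for every $\varphi\in C_c^\infty(\mathbb R,\mathbb R)$, the random variables $\operatorname{tr}_N\varphi(M_N)$, $N\ge r$, are integrable, and as $N\to\infty$ $$\mathbb E[\operatorname{tr}_N\varphi(M_N)]=\int\varphi\,d\mu_{sc}+\frac1N\Lambda_\sigma(\varphi)+O\Big(\frac1{N^2}\Big);$$ 2. for every $\varphi\in C^\infty(\mathbb R,\mathbb R)$ that is constant outside a compact set and satisfies $\operatorname{supp}(\varphi)\cap K_\sigma=\emptyset$, almost surely, as $N\to\infty$, $$\operatorname{tr}_N\varphi(M_N)=O\big(N^{-4/3}\big).$$ -/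

import Mathlib

open MeasureTheory ProbabilityTheory Filter Topology Asymptotics
open scoped Distributions

noncomputable section

namespace DeformedWigner

/-! ### The random matrix model -/

/-- The Poincaré inequality for a measure on the real line. -/
def SatisfiesPoincare (μ : Measure ℝ) : Prop :=
  ∃ C : ℝ, 0 < C ∧ ∀ f : ℝ → ℂ, ContDiff ℝ 1 f → MemLp f 2 μ → MemLp (deriv f) 2 μ →
    ∫ x, ‖f x - ∫ y, f y ∂μ‖ ^ 2 ∂μ ≤ C * ∫ x, ‖deriv f x‖ ^ 2 ∂μ

/-- The assumptions on the common distribution `μ` of the entries: a symmetric probability measure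
of variance `σ ^ 2` satisfying a Poincaré inequality. -/
structure IsEntryLaw (μ : Measure ℝ) (σ : ℝ) : Prop where
  isProbabilityMeasure : IsProbabilityMeasure μ
  symmetric : μ.map (fun x => -x) = μ
  memLp_two : MemLp (fun x : ℝ => x) 2 μ
  variance_eq : variance (fun x : ℝ => x) μ = σ ^ 2
  poincare : SatisfiesPoincare μ

/-- The fourth cumulant of `μ`: fourth central moment minus three times the squared variance. -/
def fourthCumulant (μ : Measure ℝ) : ℝ :=
  centralMoment (fun x : ℝ => x) 4 μ - 3 * variance (fun x : ℝ => x) μ ^ 2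

/-- The `N ^ 2` real coordinates of a Hermitian matrix: `W i i` on the diagonal, and for `i < j`
the number `√2 * Re (W i j)` at the index `(i, j)` and `√2 * Im (W i j)` at the index `(j, i)`. -/
def hermitianCoord {N : ℕ} (W : Matrix (Fin N) (Fin N) ℂ) (p : Fin N × Fin N) : ℝ :=
  if p.1 = p.2 then (W p.1 p.1).re
  else if p.1 < p.2 then √2 * (W p.1 p.2).re
  else √2 * (W p.2 p.1).im

/-- The `N * (N + 1) / 2` coordinates of a real symmetric matrix: `W i i / √2` and `W i j`
for `i < j`. -/
def symmetricCoord {N : ℕ} (W : Matrix (Fin N) (Fin N) ℝ)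
    (p : {p : Fin N × Fin N // p.1 ≤ p.2}) : ℝ :=
  if p.1.1 = p.1.2 then W p.1.1 p.1.1 / √2 else W p.1.1 p.1.2

/-- Hermitian Wigner matrix: its `N ^ 2` real coordinates are i.i.d. with law `μ`. -/
structure IsHermitianWigner {Ω : Type*} [MeasurableSpace Ω] (P : Measure Ω) (μ : Measure ℝ)
    {N : ℕ} (W : Ω → Matrix (Fin N) (Fin N) ℂ) : Prop where
  isHermitian : ∀ ω, (W ω).IsHermitian
  hasLaw : ∀ p, HasLaw (fun ω => hermitianCoord (W ω) p) μ P
  indep : iIndepFun (fun p ω => hermitianCoord (W ω) p) P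

/-- Real symmetric Wigner matrix: its `N * (N + 1) / 2` coordinates are i.i.d. with law `μ`. -/
structure IsSymmetricWigner {Ω : Type*} [MeasurableSpace Ω] (P : Measure Ω) (μ : Measure ℝ)
    {N : ℕ} (W : Ω → Matrix (Fin N) (Fin N) ℝ) : Prop where
  isSymm : ∀ ω, (W ω).IsSymm
  hasLaw : ∀ p, HasLaw (fun ω => symmetricCoord (W ω) p) μ P
  indep : iIndepFun (fun p ω => symmetricCoord (W ω) p) P

/-- The rank `r = ∑_{j ≠ j₀} k j` of the deformation. -/
def spikeRank {J : ℕ} (j₀ : Fin J) (k : Fin J → ℕ) : ℕ :=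
  ∑ j ∈ Finset.univ.erase j₀, k j

/-- `A` is Hermitian (symmetric if `𝕜 = ℝ`), with eigenvalues among the `θ j`, and the eigenvalue
`θ j`, `j ≠ j₀`, has multiplicity `k j`.  (Hence the remaining eigenvalue `θ j₀ = 0` has
multiplicity `N - r`.) -/
def IsDeformation {𝕜 : Type*} [RCLike 𝕜] {J : ℕ} (θ : Fin J → ℝ) (j₀ : Fin J) (k : Fin J → ℕ)
    {N : ℕ} (A : Matrix (Fin N) (Fin N) 𝕜) : Prop :=
  ∃ U ∈ Matrix.unitaryGroup (Fin N) 𝕜, ∃ d : Fin N → ℝ,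
    A = U * Matrix.diagonal (fun i => (d i : 𝕜)) * star U ∧
    (∀ i, ∃ j, d i = θ j) ∧
    ∀ j, j ≠ j₀ → Nat.card {i // d i = θ j} = k j

/-- The deformed Wigner matrix `M_N = N ^ (-1/2) W_N + A_N`. -/
def deformed {𝕜 : Type*} [RCLike 𝕜] {N : ℕ} (W A : Matrix (Fin N) (Fin N) 𝕜) :
    Matrix (Fin N) (Fin N) 𝕜 :=
  ((√(N : ℝ))⁻¹ : ℝ) • W + A

/-- `tr_N φ(M)`: normalized trace of `φ(M)`, where `φ(M)` is given by the functional calculus of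
Hermitian matrices. -/
def trN {𝕜 : Type*} [RCLike 𝕜] {N : ℕ} (φ : ℝ → ℝ) (M : Matrix (Fin N) (Fin N) 𝕜) : ℝ :=
  RCLike.re (Matrix.trace (cfc φ M)) / N

/-! ### The limiting objects -/

/-- The semicircle law with variance `σ ^ 2`. -/
def semicircle (σ : ℝ) : Measure ℝ :=
  (volume.restrict (Set.Icc (-2 * σ) (2 * σ))).withDensity
    (fun x => ENNReal.ofReal (1 / (2 * Real.pi * σ ^ 2) * √(4 * σ ^ 2 - x ^ 2)))

/-- `g_σ(z) = E[(z - s)⁻¹]`, with `s` semicircular of variance `σ ^ 2`. -/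
def gSC (σ : ℝ) (z : ℂ) : ℂ := ∫ x, (z - (x : ℂ))⁻¹ ∂(semicircle σ)

/-- `E[(z - s)⁻²]`, with `s` semicircular of variance `σ ^ 2`. -/
def gSC₂ (σ : ℝ) (z : ℂ) : ℂ := ∫ x, ((z - (x : ℂ)) ^ 2)⁻¹ ∂(semicircle σ)

/-- The contribution `∑_{j ≠ j₀} k j * θ j / (z - σ ^ 2 * g_σ(z) - θ j)` of the deformation. -/
def spikeTerm (σ : ℝ) {J : ℕ} (θ : Fin J → ℝ) (j₀ : Fin J) (k : Fin J → ℕ) (z : ℂ) : ℂ :=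
  ∑ j ∈ Finset.univ.erase j₀, (k j : ℂ) * ((θ j : ℂ) / (z - (σ : ℂ) ^ 2 * gSC σ z - (θ j : ℂ)))

/-- The function `L_σ` in the Hermitian case. -/
def LHermitian (μ : Measure ℝ) (σ : ℝ) {J : ℕ} (θ : Fin J → ℝ) (j₀ : Fin J) (k : Fin J → ℕ)
    (z : ℂ) : ℂ :=
  (gSC σ z)⁻¹ * gSC₂ σ z *
    (spikeTerm σ θ j₀ k z + (fourthCumulant μ : ℂ) / 2 * gSC σ z ^ 4)

/-- The function `L_σ` in the real symmetric case. -/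
def LSymmetric (μ : Measure ℝ) (σ : ℝ) {J : ℕ} (θ : Fin J → ℝ) (j₀ : Fin J) (k : Fin J → ℕ)
    (z : ℂ) : ℂ :=
  (gSC σ z)⁻¹ * gSC₂ σ z *
    (spikeTerm σ θ j₀ k z + (fourthCumulant μ : ℂ) * gSC σ z ^ 4 + (σ : ℂ) ^ 2 * gSC₂ σ z)

/-- The set `K_σ(θ_1, …, θ_J)`: the interval `[-2σ, 2σ]` together with the points
`ρ_{θ j} = θ j + σ ^ 2 / θ j` for those `j` with `θ j > σ` or `θ j < -σ`. -/
def spectrumSet (σ : ℝ) {J : ℕ} (θ : Fin J → ℝ) : Set ℝ :=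
  Set.Icc (-2 * σ) (2 * σ) ∪ {x | ∃ j, (σ < θ j ∨ θ j < -σ) ∧ x = θ j + σ ^ 2 / θ j}

/-- `Λ` is a (real) distribution on `ℝ` with compact support and its Stieltjes transform
`z ↦ Λ (x ↦ (z - x)⁻¹)` is `l` on `ℂ \ ℝ`.  As usual for compactly supported distributions, `Λ` is
applied to the smooth function `x ↦ (z - x)⁻¹` by replacing its real and imaginary parts with test
functions `u`, `v` that agree with them in a neighbourhood of the support of `Λ`. -/
def HasStieltjesTransform (Λ : 𝓓'((⊤ : TopologicalSpace.Opens ℝ), ℝ)) (l : ℂ → ℂ) : Prop :=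
  IsCompact (Distribution.dsupport Λ) ∧
    ∀ z : ℂ, z.im ≠ 0 → ∀ u v : 𝓓((⊤ : TopologicalSpace.Opens ℝ), ℝ),
      (∀ᶠ x in 𝓝ˢ (Distribution.dsupport Λ), u x = ((z - (x : ℂ))⁻¹).re ∧ v x = ((z - (x : ℂ))⁻¹).im) →
      l z = (Λ u : ℂ) + (Λ v : ℂ) * Complex.I

end DeformedWigner

end

noncomputable section

namespace DeformedWigner

/-! ### Moments of the entry law -/

/-- A smooth bounded approximation of the identity with derivative in `[0, 1]`. -/
def softClip (s x : ℝ) : ℝ := s * Real.arctan (x / s)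

lemma hasDerivAt_softClip {s : ℝ} (hs : 0 < s) (x : ℝ) :
    HasDerivAt (softClip s) (1 / (1 + (x / s) ^ 2)) x := by
  have h := (((hasDerivAt_id x).div_const s).arctan).const_mul s
  refine h.congr_deriv ?_
  simp only [id]
  field_simp

lemma contDiff_softClip (s : ℝ) : ContDiff ℝ 1 (softClip s) := by
  unfold softClip
  exact contDiff_const.mul (Real.contDiff_arctan.comp (contDiff_id.div_const s))

lemma abs_arctan_le (t : ℝ) : |Real.arctan t| ≤ |t| := by
  wlog ht : 0 ≤ t generalizing t
  · have := this (-t) (by linarith)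
    rwa [Real.arctan_neg, abs_neg, abs_neg] at this
  rw [abs_of_nonneg ht, abs_of_nonneg (Real.arctan_nonneg.2 ht)]
  have h2 := Real.arctan_lt_pi_div_two t
  by_contra! h
  have hlt := Real.lt_tan (lt_of_le_of_lt ht h) h2
  rw [Real.tan_arctan] at hlt
  linarith

lemma abs_softClip_le {s : ℝ} (hs : 0 < s) (x : ℝ) : |softClip s x| ≤ |x| := by
  rw [softClip, abs_mul, abs_of_pos hs]
  calc s * |Real.arctan (x / s)| ≤ s * |x / s| := 
        mul_le_mul_of_nonneg_left (abs_arctan_le _) hs.le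
    _ = |x| := by rw [abs_div, abs_of_pos hs]; field_simp

lemma abs_softClip_le_const {s : ℝ} (hs : 0 < s) (x : ℝ) : |softClip s x| ≤ s * (Real.pi / 2) := by
  rw [softClip, abs_mul, abs_of_pos hs]
  gcongr
  exact abs_le.2 ⟨(Real.neg_pi_div_two_lt_arctan _).le, (Real.arctan_lt_pi_div_two _).le⟩

lemma tendsto_softClip (x : ℝ) :
    Tendsto (fun n : ℕ => softClip (n + 1 : ℝ) x) atTop (𝓝 x) := by
  rcases eq_or_ne x 0 with rfl | hx
  · simp [softClip]
  have h1 : HasDerivAt Real.arctan 1 0 := by simpa using Real.hasDerivAt_arctan 0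
  have h2 := h1.tendsto_slope
  have h3 : Tendsto (fun n : ℕ => x / (n + 1 : ℝ)) atTop (𝓝[≠] 0) := by
    rw [tendsto_nhdsWithin_iff]
    refine ⟨?_, Eventually.of_forall fun n => div_ne_zero hx (by positivity)⟩
    exact tendsto_const_nhds.div_atTop (tendsto_atTop_add_const_right _ _ tendsto_natCast_atTop_atTop)
  have h4 := (h2.comp h3).const_mul x
  rw [mul_one] at h4
  refine h4.congr fun n => ?_
  have : (n + 1 : ℝ) ≠ 0 := by positivity
  simp [slope, softClip]
  field_simp

variable {μ : Measure ℝ} {σ : ℝ}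

lemma IsEntryLaw.integral_odd (hμ : IsEntryLaw μ σ) {E : Type*} [NormedAddCommGroup E]
    [NormedSpace ℝ E] {f : ℝ → E} (hf : ∀ x, f (-x) = -f x) : ∫ x, f x ∂μ = 0 := by
  have h : ∫ x, f x ∂μ = ∫ x, f (-x) ∂μ := by
    conv_lhs => rw [← hμ.symmetric]
    exact integral_map_equiv (MeasurableEquiv.neg ℝ) f
  simp only [hf, integral_neg] at h
  have h2 : (2 : ℝ) • ∫ x, f x ∂μ = 0 := by
    rw [two_smul]
    nth_rewrite 2 [h]
    simp
  exact (smul_eq_zero.1 h2).resolve_left two_ne_zero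

lemma IsEntryLaw.integral_sq (hμ : IsEntryLaw μ σ) : ∫ x, x ^ 2 ∂μ = σ ^ 2 := by
  rw [← hμ.variance_eq, variance_eq_integral (by fun_prop)]
  simp [hμ.integral_odd (f := fun x => x) (fun _ => rfl)]

lemma IsEntryLaw.fourthCumulant_eq (hμ : IsEntryLaw μ σ) :
    fourthCumulant μ = ∫ x, x ^ 4 ∂μ - 3 * σ ^ 4 := by
  rw [fourthCumulant, hμ.variance_eq, centralMoment]
  simp [hμ.integral_odd (f := fun x => x) (fun _ => rfl)]
  ring

lemma IsEntryLaw.poincare_bounded (hμ : IsEntryLaw μ σ) {C : ℝ}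
    (hC : ∀ f : ℝ → ℂ, ContDiff ℝ 1 f → MemLp f 2 μ → MemLp (deriv f) 2 μ →
      ∫ x, ‖f x - ∫ y, f y ∂μ‖ ^ 2 ∂μ ≤ C * ∫ x, ‖deriv f x‖ ^ 2 ∂μ)
    {f f' : ℝ → ℂ} (hf' : Continuous f') (hd : ∀ x, HasDerivAt f (f' x) x) {K K' : ℝ}
    (hK : ∀ x, ‖f x‖ ≤ K) (hK' : ∀ x, ‖f' x‖ ≤ K') :
    ∫ x, ‖f x - ∫ y, f y ∂μ‖ ^ 2 ∂μ ≤ C * ∫ x, ‖f' x‖ ^ 2 ∂μ := by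
  have := hμ.isProbabilityMeasure
  have hderiv : deriv f = f' := funext fun x => (hd x).deriv
  have hcont : Continuous f := continuous_iff_continuousAt.2 fun x => (hd x).continuousAt
  have := hC f (contDiff_one_iff_deriv.2 ⟨fun x => (hd x).differentiableAt, hderiv ▸ hf'⟩)
    (MemLp.of_bound hcont.aestronglyMeasurable K (Eventually.of_forall hK))
    (hderiv ▸ MemLp.of_bound hf'.aestronglyMeasurable K' (Eventually.of_forall hK'))
  rwa [hderiv] at this

lemma integral_norm_sub_integral_sq {α : Type*} [MeasurableSpace α] {P : Measure α}
    [IsProbabilityMeasure P] {f : α → ℂ} (hf : MemLp f 2 P) :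
    ∫ x, ‖f x - ∫ y, f y ∂P‖ ^ 2 ∂P = ∫ x, ‖f x‖ ^ 2 ∂P - ‖∫ x, f x ∂P‖ ^ 2 := by
  set m := ∫ y, f y ∂P
  have hfi : Integrable f P := hf.integrable one_le_two
  have h1 : ∀ x, ‖f x - m‖ ^ 2 = ‖f x‖ ^ 2 - 2 * (f x * (starRingEnd ℂ) m).re + ‖m‖ ^ 2 := by
    intro x
    rw [← Complex.normSq_eq_norm_sq, Complex.normSq_sub, Complex.normSq_eq_norm_sq,
      Complex.normSq_eq_norm_sq]
    ring
  have hi : Integrable (fun x => (f x * (starRingEnd ℂ) m).re) P := (hfi.mul_const _).re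
  have h2 : ∫ x, (f x * (starRingEnd ℂ) m).re ∂P = ‖m‖ ^ 2 := by
    have := integral_re (𝕜 := ℂ) (hfi.mul_const ((starRingEnd ℂ) m))
    simp only [RCLike.re_eq_complex_re] at this
    rw [this, integral_mul_const, Complex.mul_conj, Complex.normSq_eq_norm_sq,
      Complex.ofReal_re]
  have hsq : Integrable (fun x => ‖f x‖ ^ 2) P := hf.norm.integrable_sq
  simp_rw [h1]
  rw [integral_add (f := fun x => ‖f x‖ ^ 2 - 2 * (f x * (starRingEnd ℂ) m).re)
      (hsq.sub (hi.const_mul 2)) (integrable_const _),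
    integral_sub hsq (hi.const_mul 2), integral_const_mul, h2]
  simp
  ring

/-- A bound on the moments of the truncations, uniform in the truncation level. -/
lemma IsEntryLaw.exists_softClip_moment_bound (hμ : IsEntryLaw μ σ) :
    ∃ K : ℝ, ∀ s : ℝ, 0 < s → ∫ x, softClip s x ^ 6 ∂μ ≤ K := by
  have := hμ.isProbabilityMeasure
  obtain ⟨C, hC0, hC⟩ := hμ.poincare
  have hcont : ∀ s, Continuous (softClip s) := fun s => (contDiff_softClip s).continuous
  have hint : ∀ s : ℝ, 0 < s → ∀ k : ℕ, Integrable (fun x => softClip s x ^ k) μ := by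
    intro s hs k
    refine Integrable.of_bound ((hcont s).pow k).aestronglyMeasurable ((s * (Real.pi / 2)) ^ k)
      (Eventually.of_forall fun x => ?_)
    rw [Real.norm_eq_abs, abs_pow]
    exact pow_le_pow_left₀ (abs_nonneg _) (abs_softClip_le_const hs x) k
  have key : ∀ s : ℝ, 0 < s → ∀ k : ℕ,
      ∫ x, softClip s x ^ (2 * (k + 1)) ∂μ ≤ (∫ x, softClip s x ^ (k + 1) ∂μ) ^ 2
        + C * (k + 1) ^ 2 * ∫ x, softClip s x ^ (2 * k) ∂μ := by
    intro s hs k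
    have hb := fun x => abs_softClip_le_const hs x
    set b := s * (Real.pi / 2)
    have hP := hμ.poincare_bounded hC (f := fun x => ((softClip s x ^ (k + 1) : ℝ) : ℂ))
      (f' := fun x => (((k + 1 : ℕ) * softClip s x ^ k * (1 / (1 + (x / s) ^ 2)) : ℝ) : ℂ))
      (K := b ^ (k + 1)) (K' := (k + 1 : ℕ) * b ^ k * 1)
      (by
        refine Complex.continuous_ofReal.comp (((continuous_const).mul ((hcont s).pow k)).mul ?_)
        refine continuous_const.div (by fun_prop) fun x => by positivity)
      (fun x => by
        have := ((hasDerivAt_softClip hs x).pow (k + 1)).ofReal_comp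
        simpa using this)
      (fun x => by
        rw [Complex.norm_real, Real.norm_eq_abs, abs_pow]
        exact pow_le_pow_left₀ (abs_nonneg _) (hb x) _)
      (fun x => by
        rw [Complex.norm_real, Real.norm_eq_abs, abs_mul, abs_mul, abs_pow, Nat.abs_cast]
        gcongr
        · exact hb x
        · rw [abs_of_nonneg (by positivity)]
          exact div_le_one_of_le₀ (by nlinarith [sq_nonneg (x / s)]) (by positivity))
    rw [integral_norm_sub_integral_sq (f := fun x => ((softClip s x ^ (k + 1) : ℝ) : ℂ)) (MemLp.of_bound
      (Complex.continuous_ofReal.comp ((hcont s).pow (k + 1))).aestronglyMeasurable (b ^ (k + 1))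
      (Eventually.of_forall fun x => by
        rw [Complex.norm_real, Real.norm_eq_abs, abs_pow]
        exact pow_le_pow_left₀ (abs_nonneg _) (hb x) _))] at hP
    have e1 : ∀ x, ‖((softClip s x ^ (k + 1) : ℝ) : ℂ)‖ ^ 2 = softClip s x ^ (2 * (k + 1)) := by
      intro x
      rw [Complex.norm_real, Real.norm_eq_abs, sq_abs, ← pow_mul, mul_comm]
    have e2 : ‖∫ x, ((softClip s x ^ (k + 1) : ℝ) : ℂ) ∂μ‖ ^ 2
        = (∫ x, softClip s x ^ (k + 1) ∂μ) ^ 2 := by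
      rw [integral_complex_ofReal, Complex.norm_real, Real.norm_eq_abs, sq_abs]
    have e3 : ∫ x, ‖(((k + 1 : ℕ) * softClip s x ^ k * (1 / (1 + (x / s) ^ 2)) : ℝ) : ℂ)‖ ^ 2 ∂μ
        ≤ ∫ x, (k + 1) ^ 2 * softClip s x ^ (2 * k) ∂μ := by
      refine integral_mono_of_nonneg (Eventually.of_forall fun x => by positivity)
        ((hint s hs _).const_mul _) (Eventually.of_forall fun x => ?_)
      simp only
      rw [Complex.norm_real, Real.norm_eq_abs, sq_abs, mul_pow, mul_pow, ← pow_mul, mul_comm k 2]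
      push_cast
      have h1 : (1 / (1 + (x / s) ^ 2)) ^ 2 ≤ 1 := by
        refine pow_le_one₀ (by positivity) ?_
        exact div_le_one_of_le₀ (by nlinarith [sq_nonneg (x / s)]) (by positivity)
      have h2 : 0 ≤ ((k : ℝ) + 1) ^ 2 * softClip s x ^ (2 * k) := by
        rw [pow_mul]; positivity
      nlinarith
    simp_rw [e1] at hP
    rw [e2] at hP
    rw [integral_const_mul] at e3
    nlinarith [mul_le_mul_of_nonneg_left e3 hC0.le]
  have h2 : ∀ s : ℝ, 0 < s → ∫ x, softClip s x ^ 2 ∂μ ≤ σ ^ 2 := by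
    intro s hs
    rw [← hμ.integral_sq]
    refine integral_mono (hint s hs 2) hμ.memLp_two.integrable_sq fun x => ?_
    exact sq_le_sq.2 (abs_softClip_le hs x)
  have h20 : ∀ s : ℝ, 0 ≤ ∫ x, softClip s x ^ 2 ∂μ := fun s =>
    integral_nonneg fun x => sq_nonneg _
  refine ⟨C * 3 ^ 2 * ((σ ^ 2) ^ 2 + C * 2 ^ 2 * σ ^ 2), fun s hs => ?_⟩
  have k1 := key s hs 1
  have k2 := key s hs 2
  rw [hμ.integral_odd (f := fun x => softClip s x ^ (2 + 1)) (fun x => by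
    simp [softClip, neg_div, Real.arctan_neg, Odd.neg_pow (by decide : Odd (2 + 1))])] at k2
  norm_num at k1 k2 ⊢
  have h3 : (∫ x, softClip s x ^ 2 ∂μ) ^ 2 ≤ (σ ^ 2) ^ 2 := pow_le_pow_left₀ (h20 s) (h2 s hs) 2
  have h4 : C * 4 * ∫ x, softClip s x ^ 2 ∂μ ≤ C * 4 * σ ^ 2 := by gcongr; exact h2 s hs
  refine k2.trans ?_
  have : C * 9 * ∫ x, softClip s x ^ 4 ∂μ ≤ C * 9 * ((σ ^ 2) ^ 2 + C * 4 * σ ^ 2) := by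
    gcongr; linarith
  linarith

lemma IsEntryLaw.integrable_pow_six (hμ : IsEntryLaw μ σ) : Integrable (fun x => x ^ 6) μ := by
  have := hμ.isProbabilityMeasure
  obtain ⟨K, hK⟩ := hμ.exists_softClip_moment_bound
  refine ⟨by fun_prop, ?_⟩
  have h6 : ∀ t : ℝ, 0 ≤ t ^ 6 := fun t => by positivity
  have hF : ∫⁻ x, ENNReal.ofReal (x ^ 6) ∂μ ≤ ENNReal.ofReal K := by
    calc ∫⁻ x, ENNReal.ofReal (x ^ 6) ∂μ
        = ∫⁻ x, liminf (fun n : ℕ => ENNReal.ofReal (softClip (n + 1 : ℝ) x ^ 6)) atTop ∂μ := by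
          refine lintegral_congr fun x => (Tendsto.liminf_eq ?_).symm
          exact (ENNReal.continuous_ofReal.tendsto _).comp ((tendsto_softClip x).pow 6)
      _ ≤ liminf (fun n : ℕ => ∫⁻ x, ENNReal.ofReal (softClip (n + 1 : ℝ) x ^ 6) ∂μ) atTop :=
          lintegral_liminf_le fun n =>
            (((contDiff_softClip _).continuous.pow 6).measurable).ennreal_ofReal
      _ ≤ ENNReal.ofReal K := by
          refine Filter.liminf_le_of_le (by isBoundedDefault) fun b hb => ?_
          obtain ⟨n, hn⟩ := hb.exists
          refine hn.trans ?_
          have hn0 : (0 : ℝ) < n + 1 := by positivity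
          rw [← ofReal_integral_eq_lintegral_ofReal _ (Eventually.of_forall fun x => h6 _)]
          · exact ENNReal.ofReal_le_ofReal (hK _ hn0)
          · refine Integrable.of_bound ((contDiff_softClip _).continuous.pow 6).aestronglyMeasurable
              (((n + 1 : ℝ) * (Real.pi / 2)) ^ 6) (Eventually.of_forall fun x => ?_)
            rw [Real.norm_eq_abs, abs_pow]
            exact pow_le_pow_left₀ (abs_nonneg _) (abs_softClip_le_const hn0 x) _
  rw [hasFiniteIntegral_iff_norm]
  simp only [Real.norm_eq_abs, abs_of_nonneg (h6 _)]
  exact hF.trans_lt ENNReal.ofReal_lt_top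

lemma IsEntryLaw.integrable_pow (hμ : IsEntryLaw μ σ) {k : ℕ} (hk : k ≤ 6) :
    Integrable (fun x => x ^ k) μ := by
  have := hμ.isProbabilityMeasure
  refine Integrable.mono' ((integrable_const 1).add hμ.integrable_pow_six) (by fun_prop)
    (Eventually.of_forall fun x => ?_)
  simp only [Pi.add_apply, norm_pow, Real.norm_eq_abs]
  have h6 : x ^ 6 = |x| ^ 6 := by rw [← abs_pow, abs_of_nonneg (by positivity)]
  rw [h6]
  rcases le_total |x| 1 with h | h
  · nlinarith [pow_le_one₀ (n := k) (abs_nonneg x) h, pow_nonneg (abs_nonneg x) 6]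
  · nlinarith [pow_le_pow_right₀ h hk]

/-! ### Poincaré inequality for product measures -/

/-- The Poincaré inequality with constant `C` for bounded `C¹` functions with bounded derivative. -/
def HasPoincareConst (μ : Measure ℝ) (C : ℝ) : Prop :=
  ∀ (f f' : ℝ → ℂ) (K K' : ℝ), Continuous f' → (∀ x, HasDerivAt f (f' x) x) →
    (∀ x, ‖f x‖ ≤ K) → (∀ x, ‖f' x‖ ≤ K') →
    ∫ x, ‖f x - ∫ y, f y ∂μ‖ ^ 2 ∂μ ≤ C * ∫ x, ‖f' x‖ ^ 2 ∂μ

lemma IsEntryLaw.exists_hasPoincareConst {μ : Measure ℝ} {σ : ℝ} (hμ : IsEntryLaw μ σ) :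
    ∃ C, 0 < C ∧ HasPoincareConst μ C := by
  obtain ⟨C, hC0, hC⟩ := hμ.poincare
  exact ⟨C, hC0, fun f f' K K' hf' hd hK hK' => hμ.poincare_bounded hC hf' hd hK hK'⟩

lemma norm_integral_sq_le {α : Type*} [MeasurableSpace α] {P : Measure α}
    [IsProbabilityMeasure P] {f : α → ℂ} (hf : MemLp f 2 P) :
    ‖∫ x, f x ∂P‖ ^ 2 ≤ ∫ x, ‖f x‖ ^ 2 ∂P := by
  have h := integral_norm_sub_integral_sq hf
  have h0 : 0 ≤ ∫ x, ‖f x - ∫ y, f y ∂P‖ ^ 2 ∂P := integral_nonneg fun x => by positivity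
  linarith

lemma memLp_two_of_continuous_bounded {α : Type*} [MeasurableSpace α] [TopologicalSpace α]
    [OpensMeasurableSpace α] [SecondCountableTopology α] {P : Measure α} [IsProbabilityMeasure P]
    {f : α → ℂ} (hf : Continuous f) {K : ℝ} (hK : ∀ x, ‖f x‖ ≤ K) : MemLp f 2 P :=
  MemLp.of_bound hf.aestronglyMeasurable K (Eventually.of_forall hK)

lemma HasPoincareConst.pi_fin {μ : Measure ℝ} [IsProbabilityMeasure μ] {C : ℝ}
    (hC : HasPoincareConst μ C) (hC0 : 0 ≤ C) (n : ℕ) :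
    ∀ (F : (Fin n → ℝ) → ℂ) (F' : Fin n → (Fin n → ℝ) → ℂ) (K K' : ℝ), Continuous F →
      (∀ p, Continuous (F' p)) → (∀ x, ‖F x‖ ≤ K) → (∀ p x, ‖F' p x‖ ≤ K') →
      (∀ p x t, HasDerivAt (fun s => F (Function.update x p s)) (F' p (Function.update x p t)) t) →
      ∫ x, ‖F x - ∫ y, F y ∂(Measure.pi fun _ : Fin n => μ)‖ ^ 2 ∂(Measure.pi fun _ : Fin n => μ)
        ≤ C * ∑ p, ∫ x, ‖F' p x‖ ^ 2 ∂(Measure.pi fun _ : Fin n => μ) := by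
  induction n with
  | zero =>
    intro F F' K K' _ _ _ _ _
    have h : ∀ x, F x - ∫ y, F y ∂(Measure.pi fun _ : Fin 0 => μ) = 0 := by
      intro x
      rw [show F = fun _ => F x from funext fun y => congrArg F (Subsingleton.elim _ _)]
      simp
    simp [h]
  | succ n ih =>
    intro F F' K K' hF hF' hK hK' hd
    set π := Measure.pi fun _ : Fin n => μ with hπ
    have hmp := (measurePreserving_piFinSuccAbove (fun _ : Fin (n + 1) => μ) 0).symm
    have hcons : ∀ q : ℝ × (Fin n → ℝ),
        (MeasurableEquiv.piFinSuccAbove (fun _ : Fin (n + 1) => ℝ) 0).symm q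
          = Fin.cons q.1 q.2 := by
      intro q
      simp [MeasurableEquiv.piFinSuccAbove, Fin.insertNthEquiv]
    have hint : ∀ {E : Type} [NormedAddCommGroup E] [NormedSpace ℝ E] (f : (Fin (n + 1) → ℝ) → E),
        ∫ x, f x ∂(Measure.pi fun _ : Fin (n + 1) => μ)
          = ∫ q : ℝ × (Fin n → ℝ), f (Fin.cons q.1 q.2) ∂(μ.prod π) := by
      intro E _ _ f
      rw [← hmp.integral_comp (MeasurableEquiv.measurableEmbedding _)]
      simp only [hcons]
      rfl
    have hcc : Continuous fun q : ℝ × (Fin n → ℝ) =>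
        (Fin.cons q.1 q.2 : Fin (n + 1) → ℝ) := by
      fun_prop
    have hswap : ∀ {E : Type} [NormedAddCommGroup E] [NormedSpace ℝ E]
        (f : (Fin (n + 1) → ℝ) → E) (D : ℝ), Continuous f → (∀ x, ‖f x‖ ≤ D) →
        ∫ x, f x ∂(Measure.pi fun _ : Fin (n + 1) => μ)
          = ∫ y, ∫ a, f (Fin.cons a y) ∂μ ∂π := by
      intro E _ _ f D hf hD
      rw [hint, integral_prod_symm]
      have : SecondCountableTopologyEither (ℝ × (Fin n → ℝ)) E := inferInstance
      exact Integrable.of_bound (hf.comp hcc).aestronglyMeasurable D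
        (Eventually.of_forall fun q => hD _)
    set H : (Fin n → ℝ) → ℂ := fun y => ∫ a, F (Fin.cons a y) ∂μ with hH
    have hHb : ∀ y, ‖H y‖ ≤ K := fun y => by
      refine (norm_integral_le_of_norm_le_const (Eventually.of_forall fun a => hK _)).trans ?_
      simp
    have hcontint : ∀ (f : (Fin (n + 1) → ℝ) → ℂ) (D : ℝ), Continuous f → (∀ x, ‖f x‖ ≤ D) →
        Continuous fun y => ∫ a, f (Fin.cons a y) ∂μ := by
      intro f D hf hD
      refine continuous_of_dominated (bound := fun _ => D) (fun y => ?_) (fun y => ?_)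
        (integrable_const _) (Eventually.of_forall fun a => ?_)
      · exact (hf.comp (by fun_prop)).aestronglyMeasurable
      · exact Eventually.of_forall fun a => hD _
      · exact hf.comp (by fun_prop)
    have hHc : Continuous H := hcontint F K hF hK
    have hupd : ∀ (a : ℝ) (y : Fin n → ℝ) (p : Fin n) (s : ℝ),
        (Fin.cons a (Function.update y p s) : Fin (n + 1) → ℝ)
          = Function.update (Fin.cons a y) p.succ s := fun a y p s => by rw [Fin.cons_update]
    have hHd : ∀ p y t, HasDerivAt (fun s => H (Function.update y p s))
        (∫ a, F' p.succ (Fin.cons a (Function.update y p t)) ∂μ) t := by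
      intro p y t
      refine (hasDerivAt_integral_of_dominated_loc_of_deriv_le (s := Set.univ)
        (bound := fun _ => K')
        (F := fun s a => F (Fin.cons a (Function.update y p s)))
        (F' := fun s a => F' p.succ (Fin.cons a (Function.update y p s)))
        Filter.univ_mem (Eventually.of_forall fun s => ?_) ?_ ?_
        (Eventually.of_forall fun a s _ => hK' _ _) (integrable_const _)
        (Eventually.of_forall fun a s _ => ?_)).2
      · exact (hF.comp (by fun_prop)).aestronglyMeasurable
      · exact Integrable.of_bound (hF.comp (by fun_prop)).aestronglyMeasurable K
          (Eventually.of_forall fun a => hK _)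
      · exact ((hF' _).comp (by fun_prop)).aestronglyMeasurable
      · simp only [hupd]
        exact hd p.succ (Fin.cons a y) s
    have hIH := ih H (fun p y => ∫ a, F' p.succ (Fin.cons a y) ∂μ) K K' hHc
      (fun p => hcontint _ K' (hF' _) (hK' _)) hHb (fun p y => by
        refine (norm_integral_le_of_norm_le_const (Eventually.of_forall fun a => hK' _ _)).trans ?_
        simp) hHd
    have h1D : ∀ y, ∫ a, ‖F (Fin.cons a y) - H y‖ ^ 2 ∂μ
        ≤ C * ∫ a, ‖F' 0 (Fin.cons a y)‖ ^ 2 ∂μ := by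
      intro y
      refine hC (fun a => F (Fin.cons a y)) (fun a => F' 0 (Fin.cons a y)) K K'
        ((hF' 0).comp (by fun_prop)) (fun a => ?_) (fun a => hK _) (fun a => hK' _ _)
      have := hd 0 (Fin.cons a y) a
      simpa [Fin.update_cons_zero] using this
    have hsqK : ∀ x, ‖‖F x‖ ^ 2‖ ≤ K ^ 2 := fun x => by
      rw [norm_pow, norm_norm]; exact pow_le_pow_left₀ (norm_nonneg _) (hK x) 2
    have hsqK' : ∀ p x, ‖‖F' p x‖ ^ 2‖ ≤ K' ^ 2 := fun p x => by
      rw [norm_pow, norm_norm]; exact pow_le_pow_left₀ (norm_nonneg _) (hK' p x) 2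
    have hm : ∫ x, F x ∂(Measure.pi fun _ : Fin (n + 1) => μ) = ∫ y, H y ∂π := hswap F K hF hK
    have hint2 : ∀ (f : (Fin (n + 1) → ℝ) → ℝ) (D : ℝ), Continuous f → (∀ x, ‖f x‖ ≤ D) →
        Integrable (fun y => ∫ a, f (Fin.cons a y) ∂μ) π := by
      intro f D hf hD
      have : Integrable (fun q : ℝ × (Fin n → ℝ) => f (Fin.cons q.1 q.2)) (μ.prod π) :=
        Integrable.of_bound (hf.comp hcc).aestronglyMeasurable D
          (Eventually.of_forall fun q => hD _)
      exact this.integral_prod_right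
    have hFc : ∀ y : Fin n → ℝ, Continuous fun a : ℝ => F (Fin.cons a y) := fun y =>
      hF.comp (by fun_prop)
    have e1 : ∫ x, ‖F x - ∫ y, F y ∂(Measure.pi fun _ : Fin (n + 1) => μ)‖ ^ 2
          ∂(Measure.pi fun _ : Fin (n + 1) => μ)
        = ∫ y, ∫ a, ‖F (Fin.cons a y) - H y‖ ^ 2 ∂μ ∂π
          + ∫ y, ‖H y - ∫ y, H y ∂π‖ ^ 2 ∂π := by
      rw [integral_norm_sub_integral_sq (memLp_two_of_continuous_bounded hF hK),
        integral_norm_sub_integral_sq (memLp_two_of_continuous_bounded hHc hHb), hm,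
        hswap (fun x => ‖F x‖ ^ 2) (K ^ 2) (by fun_prop) hsqK]
      have : ∀ y, ∫ a, ‖F (Fin.cons a y) - H y‖ ^ 2 ∂μ
          = ∫ a, ‖F (Fin.cons a y)‖ ^ 2 ∂μ - ‖H y‖ ^ 2 := fun y =>
        integral_norm_sub_integral_sq (f := fun a => F (Fin.cons a y))
          (memLp_two_of_continuous_bounded (hFc y) fun a => hK _)
      simp_rw [this]
      rw [integral_sub (hint2 (fun x => ‖F x‖ ^ 2) (K ^ 2) (by fun_prop) hsqK)
        (memLp_two_of_continuous_bounded hHc hHb).norm.integrable_sq]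
      ring
    rw [e1, Fin.sum_univ_succ, mul_add]
    refine add_le_add ?_ (hIH.trans ?_)
    · rw [hswap (fun x => ‖F' 0 x‖ ^ 2) (K' ^ 2) (by have := hF' 0; fun_prop) (hsqK' 0),
        ← integral_const_mul]
      refine integral_mono_of_nonneg (Eventually.of_forall fun y =>
        integral_nonneg fun a => by positivity) ?_ (Eventually.of_forall h1D)
      exact (hint2 _ (K' ^ 2) (by have := hF' 0; fun_prop) (hsqK' 0)).const_mul C
    · refine mul_le_mul_of_nonneg_left (Finset.sum_le_sum fun p _ => ?_) hC0
      rw [hswap (fun x => ‖F' p.succ x‖ ^ 2) (K' ^ 2) (by have := hF' p.succ; fun_prop) (hsqK' _)]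
      refine integral_mono_of_nonneg (Eventually.of_forall fun y => by positivity)
        (hint2 _ (K' ^ 2) (by have := hF' p.succ; fun_prop) (hsqK' _))
        (Eventually.of_forall fun y => ?_)
      exact norm_integral_sq_le (f := fun a => F' p.succ (Fin.cons a y))
        (memLp_two_of_continuous_bounded ((hF' _).comp (by fun_prop)) fun a => hK' _ _)

/-- Tensorization of the Poincaré inequality. -/
theorem HasPoincareConst.pi {μ : Measure ℝ} [IsProbabilityMeasure μ] {C : ℝ}
    (hC : HasPoincareConst μ C) (hC0 : 0 ≤ C) {ι : Type*} [Fintype ι] [DecidableEq ι]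
    {F : (ι → ℝ) → ℂ} {F' : ι → (ι → ℝ) → ℂ} {K K' : ℝ} (hF : Continuous F)
    (hF' : ∀ p, Continuous (F' p)) (hK : ∀ x, ‖F x‖ ≤ K) (hK' : ∀ p x, ‖F' p x‖ ≤ K')
    (hd : ∀ p x t, HasDerivAt (fun s => F (Function.update x p s))
      (F' p (Function.update x p t)) t) :
    ∫ x, ‖F x - ∫ y, F y ∂(Measure.pi fun _ : ι => μ)‖ ^ 2 ∂(Measure.pi fun _ : ι => μ)
      ≤ C * ∑ p, ∫ x, ‖F' p x‖ ^ 2 ∂(Measure.pi fun _ : ι => μ) := by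
  let e := Fintype.equivFin ι
  let E := MeasurableEquiv.piCongrLeft (fun _ : ι => ℝ) e.symm
  have hE : ∀ (x : Fin (Fintype.card ι) → ℝ), E x = fun i => x (e i) := by
    intro x
    ext i
    have := Equiv.piCongrLeft_apply_apply (fun _ : ι => ℝ) e.symm x (e i)
    rw [Equiv.symm_apply_apply] at this
    exact this
  have hmp : MeasurePreserving E (Measure.pi fun _ => μ) (Measure.pi fun _ : ι => μ) :=
    measurePreserving_piCongrLeft (fun _ : ι => μ) e.symm
  have hint : ∀ {E' : Type} [NormedAddCommGroup E'] [NormedSpace ℝ E'] (f : (ι → ℝ) → E'),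
      ∫ x, f x ∂(Measure.pi fun _ : ι => μ)
        = ∫ x, f (fun i => x (e i)) ∂(Measure.pi fun _ : Fin (Fintype.card ι) => μ) := by
    intro E' _ _ f
    rw [← hmp.integral_comp (MeasurableEquiv.measurableEmbedding _)]
    simp only [hE]
  have hupd : ∀ (x : Fin (Fintype.card ι) → ℝ) (p : Fin (Fintype.card ι)) (s : ℝ),
      (fun i => Function.update x p s (e i)) = Function.update (fun i => x (e i)) (e.symm p) s := by
    intro x p s
    ext i
    by_cases h : i = e.symm p
    · subst h; simp
    · rw [Function.update_of_ne h, Function.update_of_ne]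
      rintro rfl
      simp at h
  rw [hint, hint]
  have := hC.pi_fin hC0 (Fintype.card ι) (fun x => F fun i => x (e i))
    (fun p x => F' (e.symm p) fun i => x (e i)) K K' (hF.comp (by fun_prop))
    (fun p => (hF' _).comp (by fun_prop)) (fun x => hK _) (fun p x => hK' _ _)
    (fun p x t => by
      simp only [hupd]
      exact hd _ _ _)
  refine this.trans_eq ?_
  congr 1
  rw [← e.symm.sum_comp]
  refine Finset.sum_congr rfl fun p _ => ?_
  rw [hint]

/-- Resampling one coordinate of a product measure preserves it. -/
lemma measurePreserving_update {ι : Type*} [Fintype ι] [DecidableEq ι] (μ : Measure ℝ)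
    [IsProbabilityMeasure μ] (p : ι) :
    MeasurePreserving (fun q : (ι → ℝ) × ℝ => Function.update q.1 p q.2)
      ((Measure.pi fun _ : ι => μ).prod μ) (Measure.pi fun _ : ι => μ) := by
  have hmeas : Measurable fun q : (ι → ℝ) × ℝ => Function.update q.1 p q.2 := by
    refine measurable_pi_lambda _ fun i => ?_
    by_cases h : i = p
    · subst h; simpa using measurable_snd
    · simp only [Function.update_of_ne h]
      exact (measurable_pi_apply i).comp measurable_fst
  refine ⟨hmeas, (Measure.pi_eq fun s hs => ?_).symm⟩
  rw [Measure.map_apply hmeas (MeasurableSet.univ_pi hs)]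
  have : (fun q : (ι → ℝ) × ℝ => Function.update q.1 p q.2) ⁻¹' Set.univ.pi s
      = (Set.univ.pi (Function.update s p Set.univ)) ×ˢ s p := by
    ext q
    simp only [Set.mem_preimage, Set.mem_pi, Set.mem_univ, true_imp_iff, Set.mem_prod]
    constructor
    · intro h
      refine ⟨fun i => ?_, by simpa using h p⟩
      by_cases hi : i = p
      · subst hi; simp
      · simpa [Function.update_of_ne hi] using h i
    · rintro ⟨h1, h2⟩ i
      by_cases hi : i = p
      · subst hi; simpa using h2
      · simpa [Function.update_of_ne hi] using h1 i
  rw [this, Measure.prod_prod, Measure.pi_pi]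
  rw [← Finset.mul_prod_erase _ _ (Finset.mem_univ p),
    ← Finset.mul_prod_erase _ (fun i => μ (s i)) (Finset.mem_univ p)]
  simp only [Function.update_self, measure_univ, one_mul]
  rw [mul_comm]
  congr 1
  refine Finset.prod_congr rfl fun i hi => ?_
  rw [Function.update_of_ne (Finset.ne_of_mem_erase hi)]

lemma integral_pi_eq_integral_update {ι : Type*} [Fintype ι] [DecidableEq ι] {μ : Measure ℝ}
    [IsProbabilityMeasure μ] (p : ι) {E : Type*} [NormedAddCommGroup E] [NormedSpace ℝ E]
    {f : (ι → ℝ) → E} (hf : Integrable f (Measure.pi fun _ : ι => μ)) :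
    ∫ x, f x ∂(Measure.pi fun _ : ι => μ)
      = ∫ x, ∫ t, f (Function.update x p t) ∂μ ∂(Measure.pi fun _ : ι => μ) := by
  have hmp := measurePreserving_update μ p
  rw [← hmp.map_eq, integral_map hmp.measurable.aemeasurable, integral_prod]
  · rw [hmp.map_eq]
  · exact hmp.integrable_comp_of_integrable hf
  · rw [hmp.map_eq]; exact hf.aestronglyMeasurable

/-! ### Cumulant expansion -/

section Cumulant

lemma norm_mul_chain_le {𝔸 : Type*} [NormedRing 𝔸] {r b : ℝ} (hr : 0 ≤ r) (hb : 0 ≤ b)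
    {R B Y : 𝔸} {m : ℕ} (hR : ‖R‖ ≤ r)
    (hB : ‖B‖ ≤ b) (hY : ‖Y‖ ≤ b ^ m * r ^ (m + 1)) :
    ‖R * B * Y‖ ≤ b ^ (m + 1) * r ^ (m + 2) := by
  calc ‖R * B * Y‖ ≤ ‖R‖ * ‖B‖ * ‖Y‖ :=
        (norm_mul_le _ _).trans (by gcongr; exact norm_mul_le _ _)
    _ ≤ r * b * (b ^ m * r ^ (m + 1)) := by gcongr
    _ = b ^ (m + 1) * r ^ (m + 2) := by ring

variable {𝔸 : Type*} [NormedRing 𝔸] [NormedAlgebra ℝ 𝔸]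

/-- The remainder in the fourth order cumulant expansion of `∫ x • R x`, for a resolvent-type
function `R`. -/
def cumulantDefect (σ κ : ℝ) (B : 𝔸) (R : ℝ → 𝔸) (x : ℝ) : 𝔸 :=
  x • R x - σ ^ 2 • (R x * B * R x) - κ • (R x * B * R x * B * R x * B * R x)

lemma cumulantDefect_eq (σ κ x : ℝ) {B R₀ : 𝔸} {R : ℝ → 𝔸}
    (hR : R x = R₀ + x • (R₀ * B * R x)) :
    cumulantDefect σ κ B R x =
      (x • R₀ + (x ^ 2 - σ ^ 2) • (R₀ * B * R₀)
        + (x ^ 3 - 2 * σ ^ 2 * x) • (R₀ * B * (R₀ * B * R₀))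
        + (x ^ 4 - 3 * σ ^ 2 * x ^ 2 - κ) • (R₀ * B * (R₀ * B * (R₀ * B * R₀)))
        + (x ^ 5 - 4 * σ ^ 2 * x ^ 3 - 4 * κ * x) •
          (R₀ * B * (R₀ * B * (R₀ * B * (R₀ * B * R₀)))))
      + ((x ^ 6 - 4 * σ ^ 2 * x ^ 4 - 4 * κ * x ^ 2) •
          (R₀ * B * (R₀ * B * (R₀ * B * (R₀ * B * (R₀ * B * R x)))))
        - (σ ^ 2 * x ^ 4 + 3 * κ * x ^ 2) •
          (R₀ * B * (R₀ * B * (R₀ * B * (R₀ * B * (R x * B * R x)))))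
        - (2 * κ * x ^ 2) • (R₀ * B * (R₀ * B * (R₀ * B * (R x * B * R x * B * R x))))
        - (κ * x ^ 2) • (R₀ * B * (R₀ * B * (R x * B * R x * B * R x * B * R x)))) := by
  unfold cumulantDefect
  set T := R₀ * B with hT
  set r := R x with hr
  have h1 : r = R₀ + x • (T * r) := hR
  have hcomp : ∀ Y : 𝔸, r * B * Y = T * Y + x • (T * (r * B * Y)) := by
    intro Y
    conv_lhs => rw [h1]
    simp only [add_mul, smul_mul_assoc, mul_assoc, hT]
  have h2 := hcomp r
  have h3 := hcomp (r * B * r)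
  have h4 := hcomp (r * B * (r * B * r))
  have a3 : r * B * r * B * r = r * B * (r * B * r) := by simp only [mul_assoc]
  have a4 : r * B * r * B * r * B * r = r * B * (r * B * (r * B * r)) := by simp only [mul_assoc]
  rw [a4, a3]
  generalize r * B * (r * B * (r * B * r)) = U at *
  generalize r * B * (r * B * r) = S₃ at *
  generalize r * B * r = S at *
  clear_value r T
  clear hcomp a3 a4 hR hT
  have hS : S = T * R₀ + (2 * x) • (T * (T * R₀)) + (3 * x ^ 2) • (T * (T * (T * R₀)))
      + (4 * x ^ 3) • (T * (T * (T * (T * R₀)))) + x ^ 4 • ((4 : ℝ) • (T * (T * (T * (T * (T * r)))))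
        + T * (T * (T * (T * S)))) := by
    have g1 := congrArg (fun Y => T * Y) h1
    have g2 := congrArg (fun Y => T * (T * Y)) h1
    have g3 := congrArg (fun Y => T * (T * (T * Y))) h1
    have g4 := congrArg (fun Y => T * (T * (T * (T * Y)))) h1
    have k1 := congrArg (fun Y => T * Y) h2
    have k2 := congrArg (fun Y => T * (T * Y)) h2
    have k3 := congrArg (fun Y => T * (T * (T * Y))) h2
    simp only [mul_add, mul_smul_comm] at g1 g2 g3 g4 k1 k2 k3
    linear_combination (norm := module) h2 + x • k1 + x ^ 2 • k2 + x ^ 3 • k3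
      + g1 + (2 * x) • g2 + (3 * x ^ 2) • g3 + (4 * x ^ 3) • g4
  have hr' : r = R₀ + x • (T * R₀) + x ^ 2 • (T * (T * R₀)) + x ^ 3 • (T * (T * (T * R₀)))
      + x ^ 4 • (T * (T * (T * (T * R₀)))) + x ^ 5 • (T * (T * (T * (T * (T * r))))) := by
    have g1 := congrArg (fun Y => T * Y) h1
    have g2 := congrArg (fun Y => T * (T * Y)) h1
    have g3 := congrArg (fun Y => T * (T * (T * Y))) h1
    have g4 := congrArg (fun Y => T * (T * (T * (T * Y)))) h1
    simp only [mul_add, mul_smul_comm] at g1 g2 g3 g4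
    linear_combination (norm := module) h1 + x • g1 + x ^ 2 • g2 + x ^ 3 • g3 + x ^ 4 • g4
  have hU : U = T * (T * (T * R₀)) + (4 * x) • (T * (T * (T * (T * R₀))))
      + x ^ 2 • ((4 : ℝ) • (T * (T * (T * (T * (T * r))))) + (3 : ℝ) • (T * (T * (T * (T * S))))
        + (2 : ℝ) • (T * (T * (T * S₃))) + T * (T * U)) := by
    have g3 := congrArg (fun Y => T * (T * (T * Y))) h1
    have g4 := congrArg (fun Y => T * (T * (T * (T * Y)))) h1
    have k2 := congrArg (fun Y => T * (T * Y)) h2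
    have k3 := congrArg (fun Y => T * (T * (T * Y))) h2
    have l1 := congrArg (fun Y => T * Y) h3
    have l2 := congrArg (fun Y => T * (T * Y)) h3
    have j1 := congrArg (fun Y => T * Y) h4
    simp only [mul_add, mul_smul_comm] at g3 g4 k2 k3 l1 l2 j1
    linear_combination (norm := module) h4 + x • j1 + l1 + (2 * x) • l2 + k2 + (3 * x) • k3 + g3
      + (4 * x) • g4
  linear_combination (norm := module) x • hr' - σ ^ 2 • hS - κ • hU

variable {μ : Measure ℝ} {σ : ℝ}

/-- The constant in the fourth order cumulant expansion. -/
def cumulantConst (μ : Measure ℝ) (σ κ : ℝ) : ℝ :=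
  ∫ x, (x ^ 6 + 5 * σ ^ 2 * x ^ 4 + 10 * |κ| * x ^ 2) ∂μ

lemma IsEntryLaw.cumulantConst_nonneg (κ : ℝ) : 0 ≤ cumulantConst μ σ κ :=
  integral_nonneg fun x => by positivity

theorem IsEntryLaw.norm_integral_cumulantDefect_le (hμ : IsEntryLaw μ σ) [CompleteSpace 𝔸]
    {B : 𝔸} {R : ℝ → 𝔸} (hcont : Continuous R) {r b : ℝ} (hr : ∀ x, ‖R x‖ ≤ r) (hb : ‖B‖ ≤ b)
    (hR : ∀ x, R x = R 0 + x • (R 0 * B * R x)) :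
    ‖∫ x, cumulantDefect σ (fourthCumulant μ) B R x ∂μ‖
      ≤ cumulantConst μ σ (fourthCumulant μ) * (b ^ 5 * r ^ 6) := by
  have := hμ.isProbabilityMeasure
  set κ := fourthCumulant μ with hκ
  have hr0 : 0 ≤ r := (norm_nonneg _).trans (hr 0)
  have hb0 : 0 ≤ b := (norm_nonneg _).trans hb
  have hp : ∀ {k : ℕ}, k ≤ 6 → Integrable (fun x : ℝ => x ^ k) μ := fun hk => hμ.integrable_pow hk
  have hp1 : Integrable (fun x : ℝ => x) μ := by simpa using hp (k := 1) (by norm_num)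
  set q : ℝ → 𝔸 := fun x => x • R 0 + (x ^ 2 - σ ^ 2) • (R 0 * B * R 0)
        + (x ^ 3 - 2 * σ ^ 2 * x) • (R 0 * B * (R 0 * B * R 0))
        + (x ^ 4 - 3 * σ ^ 2 * x ^ 2 - κ) • (R 0 * B * (R 0 * B * (R 0 * B * R 0)))
        + (x ^ 5 - 4 * σ ^ 2 * x ^ 3 - 4 * κ * x) •
          (R 0 * B * (R 0 * B * (R 0 * B * (R 0 * B * R 0)))) with hq
  have i2 : Integrable (fun x : ℝ => x ^ 2 - σ ^ 2) μ := (hp (by norm_num)).sub (integrable_const _)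
  have i3 : Integrable (fun x : ℝ => x ^ 3 - 2 * σ ^ 2 * x) μ :=
    (hp (by norm_num)).sub (hp1.const_mul _)
  have i4 : Integrable (fun x : ℝ => x ^ 4 - 3 * σ ^ 2 * x ^ 2 - κ) μ :=
    ((hp (by norm_num)).sub ((hp (by norm_num)).const_mul _)).sub (integrable_const _)
  have i5 : Integrable (fun x : ℝ => x ^ 5 - 4 * σ ^ 2 * x ^ 3 - 4 * κ * x) μ :=
    ((hp (by norm_num)).sub ((hp (by norm_num)).const_mul _)).sub (hp1.const_mul _)
  have z1 : ∫ x : ℝ, x ∂μ = 0 := hμ.integral_odd fun _ => rfl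
  have z2 : ∫ x : ℝ, (x ^ 2 - σ ^ 2) ∂μ = 0 := by
    rw [integral_sub (hp (by norm_num)) (integrable_const _), hμ.integral_sq]; simp
  have z3 : ∫ x : ℝ, (x ^ 3 - 2 * σ ^ 2 * x) ∂μ = 0 := hμ.integral_odd fun x => by ring
  have z4 : ∫ x : ℝ, (x ^ 4 - 3 * σ ^ 2 * x ^ 2 - κ) ∂μ = 0 := by
    have j4 : Integrable (fun x : ℝ => x ^ 4 - 3 * σ ^ 2 * x ^ 2) μ :=
      (hp (by norm_num)).sub ((hp (by norm_num)).const_mul _)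
    rw [integral_sub j4 (integrable_const _),
      integral_sub (hp (by norm_num)) ((hp (by norm_num)).const_mul _),
      integral_const_mul, hμ.integral_sq, hκ, hμ.fourthCumulant_eq]
    simp
    ring
  have z5 : ∫ x : ℝ, (x ^ 5 - 4 * σ ^ 2 * x ^ 3 - 4 * κ * x) ∂μ = 0 :=
    hμ.integral_odd fun x => by ring
  have hqi : Integrable q μ := ((((hp1.smul_const _).add (i2.smul_const _)).add
    (i3.smul_const _)).add (i4.smul_const _)).add (i5.smul_const _)
  have hq0 : ∫ x, q x ∂μ = 0 := by
    rw [hq, integral_add, integral_add, integral_add, integral_add]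
    · simp only [integral_smul_const, z1, z2, z3, z4, z5, zero_smul, add_zero]
    · exact hp1.smul_const _
    · exact i2.smul_const _
    · exact (hp1.smul_const _).add (i2.smul_const _)
    · exact i3.smul_const _
    · exact ((hp1.smul_const _).add (i2.smul_const _)).add (i3.smul_const _)
    · exact i4.smul_const _
    · exact (((hp1.smul_const _).add (i2.smul_const _)).add (i3.smul_const _)).add (i4.smul_const _)
    · exact i5.smul_const _
  have hbound : ∀ x, ‖cumulantDefect σ κ B R x - q x‖
      ≤ (x ^ 6 + 5 * σ ^ 2 * x ^ 4 + 10 * |κ| * x ^ 2) * (b ^ 5 * r ^ 6) := by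
    intro x
    rw [cumulantDefect_eq σ κ x (hR x), hq, add_sub_cancel_left]
    have s0 : ‖R x‖ ≤ b ^ 0 * r ^ (0 + 1) := by simpa using hr x
    have c := fun (X : ℝ) (Y : 𝔸) (m : ℕ) => norm_mul_chain_le (m := m) hr0 hb0 (hr X) hb (Y := Y)
    have t1 := c 0 _ _ (c 0 _ _ (c 0 _ _ (c 0 _ _ (c 0 _ _ s0))))
    have t2 := c 0 _ _ (c 0 _ _ (c 0 _ _ (c 0 _ _ (c x _ _ s0))))
    have t3 := c 0 _ _ (c 0 _ _ (c 0 _ _ (c x _ _ (c x _ _ s0))))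
    have t4 := c 0 _ _ (c 0 _ _ (c x _ _ (c x _ _ (c x _ _ s0))))
    simp only [zero_add, Nat.reduceAdd] at t1 t2 t3 t4
    have a3 : R x * B * R x * B * R x = R x * B * (R x * B * R x) := by simp only [mul_assoc]
    have a4 : R x * B * R x * B * R x * B * R x = R x * B * (R x * B * (R x * B * R x)) := by
      simp only [mul_assoc]
    rw [a4, a3]
    set β := b ^ 5 * r ^ 6
    have hκ0 := abs_nonneg κ
    have sm : ∀ (c : ℝ) (Y : 𝔸), ‖Y‖ ≤ β → ‖c • Y‖ ≤ ‖c‖ * β := fun c Y hY => by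
      rw [norm_smul]; gcongr
    refine (norm_sub_le_of_le (norm_sub_le_of_le (norm_sub_le_of_le
      (sm _ _ t1) (sm _ _ t2))
      (sm _ _ t3)) (sm _ _ t4)).trans ?_
    have n1 : ‖x ^ 6 - 4 * σ ^ 2 * x ^ 4 - 4 * κ * x ^ 2‖
        ≤ x ^ 6 + 4 * σ ^ 2 * x ^ 4 + 4 * |κ| * x ^ 2 := by
      refine (norm_sub_le_of_le (norm_sub_le _ _) le_rfl).trans_eq ?_
      simp only [Real.norm_eq_abs, abs_mul, abs_pow, Nat.abs_ofNat]
      simp only [sq_abs, show |x| ^ 6 = x ^ 6 from by rw [← abs_pow]; exact abs_of_nonneg (by positivity),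
        show |x| ^ 4 = x ^ 4 from by rw [← abs_pow]; exact abs_of_nonneg (by positivity)]
    have n2 : ‖σ ^ 2 * x ^ 4 + 3 * κ * x ^ 2‖ ≤ σ ^ 2 * x ^ 4 + 3 * |κ| * x ^ 2 := by
      refine (norm_add_le _ _).trans_eq ?_
      simp only [Real.norm_eq_abs, abs_mul, abs_pow, Nat.abs_ofNat]
      simp only [sq_abs, show |x| ^ 4 = x ^ 4 from by rw [← abs_pow]; exact abs_of_nonneg (by positivity)]
    have n3 : ‖2 * κ * x ^ 2‖ = 2 * |κ| * x ^ 2 := by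
      simp only [Real.norm_eq_abs, abs_mul, abs_pow, Nat.abs_ofNat, sq_abs]
    have n4 : ‖κ * x ^ 2‖ = |κ| * x ^ 2 := by
      simp only [Real.norm_eq_abs, abs_mul, abs_pow, sq_abs]
    rw [n3, n4]
    have hβ : 0 ≤ β := by positivity
    nlinarith [mul_le_mul_of_nonneg_right n1 hβ, mul_le_mul_of_nonneg_right n2 hβ]
  have hgi : Integrable (fun x : ℝ =>
      (x ^ 6 + 5 * σ ^ 2 * x ^ 4 + 10 * |κ| * x ^ 2) * (b ^ 5 * r ^ 6)) μ :=
    (((hp le_rfl).add ((hp (by norm_num)).const_mul _)).add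
      ((hp (by norm_num)).const_mul _)).mul_const _
  have hdc : Continuous (cumulantDefect σ κ B R) := by
    unfold cumulantDefect; fun_prop
  have hqc : Continuous q := by rw [hq]; fun_prop
  have hdi : Integrable (fun x => cumulantDefect σ κ B R x - q x) μ :=
    hgi.mono' (hdc.sub hqc).aestronglyMeasurable (Eventually.of_forall hbound)
  have : ∫ x, cumulantDefect σ κ B R x ∂μ = ∫ x, (cumulantDefect σ κ B R x - q x) ∂μ := by
    have h := integral_add hdi hqi
    rw [hq0, add_zero] at h
    rw [← h]
    exact integral_congr_ae (Eventually.of_forall fun x => by simp)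
  rw [this, cumulantConst, ← integral_mul_const]
  exact norm_integral_le_of_norm_le hgi (Eventually.of_forall hbound)

end Cumulant

end DeformedWigner

namespace DeformedWigner

open scoped Matrix.Norms.L2Operator Matrix

/-! ### Hermitian matrices and their resolvents -/

section MatrixTools

variable {n : Type*} [Fintype n] [DecidableEq n]

/-- The squared Hilbert–Schmidt norm. -/
def hsSq (X : Matrix n n ℂ) : ℝ := ∑ j, ∑ i, ‖X i j‖ ^ 2

lemma hsSq_nonneg (X : Matrix n n ℂ) : 0 ≤ hsSq X :=
  Finset.sum_nonneg fun _ _ => Finset.sum_nonneg fun _ _ => by positivity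

lemma sum_norm_mulVec_sq_le (X : Matrix n n ℂ) (v : n → ℂ) :
    ∑ i, ‖(X *ᵥ v) i‖ ^ 2 ≤ ‖X‖ ^ 2 * ∑ i, ‖v i‖ ^ 2 := by
  have h := Matrix.l2_opNorm_mulVec X (WithLp.toLp 2 v)
  have h2 := pow_le_pow_left₀ (norm_nonneg _) h 2
  rw [mul_pow, EuclideanSpace.norm_sq_eq, EuclideanSpace.norm_sq_eq] at h2
  exact h2

lemma hsSq_mul_le (X Y : Matrix n n ℂ) : hsSq (X * Y) ≤ ‖X‖ ^ 2 * hsSq Y := by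
  rw [hsSq, hsSq, Finset.mul_sum]
  refine Finset.sum_le_sum fun j _ => ?_
  have := sum_norm_mulVec_sq_le X (fun i => Y i j)
  simpa [Matrix.mul_apply, Matrix.mulVec, dotProduct] using this

lemma hsSq_conjTranspose (X : Matrix n n ℂ) : hsSq Xᴴ = hsSq X := by
  rw [hsSq, Finset.sum_comm]
  simp [hsSq]

lemma hsSq_mul_le' (X Y : Matrix n n ℂ) : hsSq (X * Y) ≤ hsSq X * ‖Y‖ ^ 2 := by
  rw [← hsSq_conjTranspose, Matrix.conjTranspose_mul, ← hsSq_conjTranspose X,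
    ← Matrix.l2_opNorm_conjTranspose Y, mul_comm]
  exact hsSq_mul_le _ _

lemma hsSq_diagonal (d : n → ℂ) : hsSq (Matrix.diagonal d) = ∑ i, ‖d i‖ ^ 2 := by
  refine Finset.sum_congr rfl fun j _ => ?_
  rw [Finset.sum_eq_single j]
  · simp
  · intro i _ h; simp [Matrix.diagonal_apply_ne _ h]
  · simp

lemma hsSq_smul (c : ℂ) (X : Matrix n n ℂ) : hsSq (c • X) = ‖c‖ ^ 2 * hsSq X := by
  simp [hsSq, Finset.mul_sum, mul_pow]

lemma hsSq_le (X : Matrix n n ℂ) : hsSq X ≤ Fintype.card n * ‖X‖ ^ 2 := by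
  have h := hsSq_mul_le' (1 : Matrix n n ℂ) X
  rw [one_mul, ← Matrix.diagonal_one, hsSq_diagonal] at h
  simpa using h

lemma norm_apply_le (X : Matrix n n ℂ) (i j : n) : ‖X i j‖ ≤ ‖X‖ := by
  have h := sum_norm_mulVec_sq_le X (Pi.single j 1)
  have h1 : ∑ k, ‖(Pi.single j (1 : ℂ) : n → ℂ) k‖ ^ 2 = 1 := by
    rw [Finset.sum_eq_single j]
    · simp
    · intro b _ hb; simp [Pi.single_eq_of_ne hb]
    · simp
  rw [h1, mul_one] at h
  have h2 : ‖X i j‖ ^ 2 ≤ ∑ i, ‖(X *ᵥ Pi.single j 1) i‖ ^ 2 := by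
    have := Finset.single_le_sum (f := fun i => ‖(X *ᵥ Pi.single j 1) i‖ ^ 2)
      (fun i _ => by positivity) (Finset.mem_univ i)
    simpa using this
  exact (sq_le_sq₀ (norm_nonneg _) (norm_nonneg _)).1 (h2.trans h)

lemma norm_trace_le (X : Matrix n n ℂ) : ‖X.trace‖ ≤ Fintype.card n * ‖X‖ := by
  refine (norm_sum_le _ _).trans ?_
  refine (Finset.sum_le_sum fun i _ => norm_apply_le X i i).trans ?_
  simp

lemma norm_one_le_one : ‖(1 : Matrix n n ℂ)‖ ≤ 1 := by
  rw [← Matrix.diagonal_one, Matrix.l2_opNorm_diagonal]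
  exact (pi_norm_le_iff_of_nonneg zero_le_one).2 fun i => by simp

lemma norm_conj_unitary_le {U : Matrix n n ℂ} (hU : U ∈ Matrix.unitaryGroup n ℂ)
    (D : Matrix n n ℂ) : ‖U * D * star U‖ ≤ ‖D‖ := by
  rw [CStarRing.norm_mul_mem_unitary (U * D) (Unitary.star_mem hU), CStarRing.norm_mem_unitary_mul D hU]

lemma opNorm_le_of_bilin (X : Matrix n n ℂ) {K : ℝ} (hK : 0 ≤ K)
    (h : ∀ u v : n → ℂ, ‖star u ⬝ᵥ (X *ᵥ v)‖ ≤ K * √(∑ i, ‖u i‖ ^ 2) * √(∑ i, ‖v i‖ ^ 2)) :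
    ‖X‖ ≤ K := by
  rw [Matrix.cstar_norm_def]
  refine ContinuousLinearMap.opNorm_le_bound _ hK fun v => ?_
  set w := Matrix.toEuclideanCLM (n := n) (𝕜 := ℂ) X v with hw
  have h1 := h w.ofLp v.ofLp
  rw [← EuclideanSpace.norm_eq, ← EuclideanSpace.norm_eq, ← Matrix.ofLp_toEuclideanCLM, ← hw] at h1
  have h2 : ‖star w.ofLp ⬝ᵥ w.ofLp‖ = ‖w‖ ^ 2 := by
    rw [EuclideanSpace.norm_sq_eq, dotProduct]
    have : ∀ i, star w.ofLp i * w.ofLp i = ((‖w.ofLp i‖ ^ 2 : ℝ) : ℂ) := fun i => by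
      simp [← Complex.conj_mul']
    simp_rw [this]
    rw [← Complex.ofReal_sum, Complex.norm_real, Real.norm_eq_abs, abs_of_nonneg]
    exact Finset.sum_nonneg fun i _ => by positivity
  rw [h2] at h1
  rcases (norm_nonneg w).eq_or_lt with h0 | h0
  · rw [← h0]; positivity
  · nlinarith

/-- The resolvent `(z - M)⁻¹`. -/
def green (z : ℂ) (M : Matrix n n ℂ) : Matrix n n ℂ := (z • (1 : Matrix n n ℂ) - M)⁻¹

lemma conj_unitary_mul {U : Matrix n n ℂ} (hU : U ∈ Matrix.unitaryGroup n ℂ)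
    (D E : Matrix n n ℂ) : (U * D * star U) * (U * E * star U) = U * (D * E) * star U := by
  have h := Matrix.mem_unitaryGroup_iff'.1 hU
  calc (U * D * star U) * (U * E * star U) = U * D * (star U * U) * E * star U := by
        simp only [mul_assoc]
    _ = U * (D * E) * star U := by rw [h, mul_one]; simp only [mul_assoc]

lemma trace_conj_unitary {U : Matrix n n ℂ} (hU : U ∈ Matrix.unitaryGroup n ℂ)
    (D : Matrix n n ℂ) : (U * D * star U).trace = D.trace := by
  rw [Matrix.trace_mul_comm, ← mul_assoc, Matrix.mem_unitaryGroup_iff'.1 hU, one_mul]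

lemma green_conj_diagonal {U : Matrix n n ℂ} (hU : U ∈ Matrix.unitaryGroup n ℂ) (d : n → ℝ)
    {z : ℂ} (hz : z.im ≠ 0) :
    (z • (1 : Matrix n n ℂ) - U * Matrix.diagonal (fun i => (d i : ℂ)) * star U)
        * (U * Matrix.diagonal (fun i => (z - d i)⁻¹) * star U) = 1 ∧
      green z (U * Matrix.diagonal (fun i => (d i : ℂ)) * star U)
        = U * Matrix.diagonal (fun i => (z - d i)⁻¹) * star U := by
  have h1 : (1 : Matrix n n ℂ) = U * 1 * star U := by
    rw [mul_one, Matrix.mem_unitaryGroup_iff.1 hU]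
  have key : (z • (1 : Matrix n n ℂ) - U * Matrix.diagonal (fun i => (d i : ℂ)) * star U)
        * (U * Matrix.diagonal (fun i => (z - d i)⁻¹) * star U) = 1 := by
    have h2 : (z • (1 : Matrix n n ℂ) - U * Matrix.diagonal (fun i => (d i : ℂ)) * star U)
        = U * Matrix.diagonal (fun i => z - (d i : ℂ)) * star U := by
      have h3 : Matrix.diagonal (fun i => z - (d i : ℂ))
          = z • (1 : Matrix n n ℂ) - Matrix.diagonal (fun i => (d i : ℂ)) := by
        rw [← Matrix.diagonal_one, ← Matrix.diagonal_smul, Matrix.diagonal_sub]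
        congr 1; ext i; simp
      rw [h3, mul_sub, sub_mul, mul_smul_comm, smul_mul_assoc, ← h1]
    rw [h2, conj_unitary_mul hU, Matrix.diagonal_mul_diagonal]
    have h4 : (fun i => (z - (d i : ℂ)) * (z - (d i : ℂ))⁻¹) = fun _ : n => (1 : ℂ) := by
      ext i
      refine mul_inv_cancel₀ fun h => hz ?_
      have := congrArg Complex.im h
      simpa using this
    rw [h4, Matrix.diagonal_one, ← h1]
  exact ⟨key, Matrix.inv_eq_right_inv key⟩

variable {M M' : Matrix n n ℂ} {z : ℂ}

lemma spectral_eq (hM : M.IsHermitian) :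
    M = (hM.eigenvectorUnitary : Matrix n n ℂ) * Matrix.diagonal (fun i => (hM.eigenvalues i : ℂ))
      * star (hM.eigenvectorUnitary : Matrix n n ℂ) :=
  hM.spectral_theorem

lemma mul_green (hM : M.IsHermitian) (hz : z.im ≠ 0) : (z • 1 - M) * green z M = 1 := by
  have h := green_conj_diagonal hM.eigenvectorUnitary.2 hM.eigenvalues hz
  rw [← spectral_eq hM] at h
  rw [h.2, h.1]

lemma green_mul (hM : M.IsHermitian) (hz : z.im ≠ 0) : green z M * (z • 1 - M) = 1 :=
  mul_eq_one_comm.1 (mul_green hM hz)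

lemma norm_green_le (hM : M.IsHermitian) (hz : z.im ≠ 0) : ‖green z M‖ ≤ |z.im|⁻¹ := by
  have h := green_conj_diagonal hM.eigenvectorUnitary.2 hM.eigenvalues hz
  rw [← spectral_eq hM] at h
  rw [h.2]
  refine (norm_conj_unitary_le hM.eigenvectorUnitary.2 _).trans ?_
  rw [Matrix.l2_opNorm_diagonal]
  refine (pi_norm_le_iff_of_nonneg (by positivity)).2 fun i => ?_
  rw [norm_inv]
  refine inv_anti₀ (abs_pos.2 hz) ?_
  have := Complex.abs_im_le_norm (z - hM.eigenvalues i)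
  simpa using this

lemma trace_green (hM : M.IsHermitian) (hz : z.im ≠ 0) :
    (green z M).trace = ∑ i, (z - hM.eigenvalues i)⁻¹ := by
  have h := green_conj_diagonal hM.eigenvectorUnitary.2 hM.eigenvalues hz
  rw [← spectral_eq hM] at h
  rw [h.2, trace_conj_unitary hM.eigenvectorUnitary.2, Matrix.trace_diagonal]

lemma green_sub_green (hM : M.IsHermitian) (hM' : M'.IsHermitian) (hz : z.im ≠ 0) :
    green z M - green z M' = green z M * (M - M') * green z M' := by
  have h1 := green_mul hM hz
  have h2 := mul_green hM' hz
  calc green z M - green z M'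
      = green z M * ((z • 1 - M') * green z M') - (green z M * (z • 1 - M)) * green z M' := by
        rw [h1, h2, mul_one, one_mul]
    _ = green z M * (M - M') * green z M' := by noncomm_ring

lemma green_sub_green_param {w : ℂ} (hM : M.IsHermitian) (hz : z.im ≠ 0) (hw : w.im ≠ 0) :
    green z M - green w M = (w - z) • (green z M * green w M) := by
  have h1 := green_mul hM hz
  have h2 := mul_green hM hw
  calc green z M - green w M
      = green z M * ((w • 1 - M) * green w M) - (green z M * (z • 1 - M)) * green w M := by
        rw [h1, h2, mul_one, one_mul]
    _ = green z M * ((w - z) • 1) * green w M := by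
        rw [sub_smul]; noncomm_ring
    _ = (w - z) • (green z M * green w M) := by
        rw [mul_smul_comm, mul_one, smul_mul_assoc]

lemma transpose_green (hT : Mᵀ = M) : (green z M)ᵀ = green z M := by
  rw [green, Matrix.transpose_nonsing_inv, Matrix.transpose_sub, Matrix.transpose_smul,
    Matrix.transpose_one, hT]

lemma im_trace_green_nonpos (hM : M.IsHermitian) (hz : 0 < z.im) : (green z M).trace.im ≤ 0 := by
  rw [trace_green hM hz.ne', Complex.im_sum]
  refine Finset.sum_nonpos fun i _ => ?_
  rw [Complex.inv_im]
  refine div_nonpos_of_nonpos_of_nonneg ?_ (Complex.normSq_nonneg _)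
  simp [hz.le]

lemma continuousAt_green (hM : M.IsHermitian) (hz : z.im ≠ 0) :
    ContinuousAt (fun p : ℂ × Matrix n n ℂ => green p.1 p.2) (z, M) := by
  have hu : IsUnit (z • (1 : Matrix n n ℂ) - M) :=
    ⟨⟨_, _, mul_green hM hz, green_mul hM hz⟩, rfl⟩
  have h1 : ContinuousAt (fun X : Matrix n n ℂ => X⁻¹) (z • (1 : Matrix n n ℂ) - M) := by
    simp only [Matrix.nonsing_inv_eq_ringInverse]
    have := NormedRing.inverse_continuousAt hu.unit
    simpa using this
  have h2 : Continuous fun p : ℂ × Matrix n n ℂ => p.1 • (1 : Matrix n n ℂ) - p.2 := by fun_prop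
  exact ContinuousAt.comp (f := fun p : ℂ × Matrix n n ℂ => p.1 • (1 : Matrix n n ℂ) - p.2)
    (g := fun X : Matrix n n ℂ => X⁻¹) h1 h2.continuousAt

lemma continuous_green_comp {α : Type*} [TopologicalSpace α] {f : α → Matrix n n ℂ}
    (hf : Continuous f) (hH : ∀ a, (f a).IsHermitian) (hz : z.im ≠ 0) :
    Continuous fun a => green z (f a) := by
  refine continuous_iff_continuousAt.2 fun a => ?_
  exact ContinuousAt.comp (f := fun a => (z, f a)) (g := fun p : ℂ × Matrix n n ℂ => green p.1 p.2)
    (continuousAt_green (hH a) hz) (by fun_prop)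

/-- Derivative of the resolvent along a line of Hermitian matrices. -/
lemma hasDerivAt_green {H B : Matrix n n ℂ} (hH : H.IsHermitian) (hB : B.IsHermitian)
    (hz : z.im ≠ 0) (t : ℝ) :
    HasDerivAt (fun s : ℝ => green z (H + s • B))
      (green z (H + t • B) * B * green z (H + t • B)) t := by
  have hherm : ∀ s : ℝ, (H + s • B).IsHermitian := fun s => hH.add (by
    rw [Matrix.IsHermitian, Matrix.conjTranspose_smul, hB.eq]; simp)
  have hcont : Continuous fun s : ℝ => green z (H + s • B) :=
    continuous_green_comp (by fun_prop) hherm hz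
  rw [hasDerivAt_iff_tendsto_slope]
  have h1 : Tendsto (fun s : ℝ => green z (H + s • B) * B * green z (H + t • B)) (𝓝[≠] t)
      (𝓝 (green z (H + t • B) * B * green z (H + t • B))) :=
    ((((hcont.mul continuous_const).mul continuous_const).tendsto t)).mono_left nhdsWithin_le_nhds
  refine h1.congr' ?_
  filter_upwards [self_mem_nhdsWithin] with s hs
  have hst : s - t ≠ 0 := sub_ne_zero.2 hs
  rw [slope_def_module, green_sub_green (hherm s) (hherm t) hz]
  have : H + s • B - (H + t • B) = (s - t) • B := by rw [sub_smul]; abel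
  rw [this, mul_smul_comm, smul_mul_assoc, smul_smul, inv_mul_cancel₀ hst, one_smul]

/-- Derivative of the resolvent in the spectral parameter. -/
lemma hasDerivAt_green_param (hM : M.IsHermitian) (hz : z.im ≠ 0) :
    HasDerivAt (fun w : ℂ => green w M) (-(green z M * green z M)) z := by
  have hcont : ContinuousAt (fun w : ℂ => green w M) z :=
    ContinuousAt.comp (f := fun w => (w, M)) (g := fun p : ℂ × Matrix n n ℂ => green p.1 p.2)
      (continuousAt_green hM hz) (by fun_prop)
  rw [hasDerivAt_iff_tendsto_slope]
  have h1 : Tendsto (fun w : ℂ => -(green w M * green z M)) (𝓝[≠] z)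
      (𝓝 (-(green z M * green z M))) :=
    ((hcont.mul continuousAt_const).neg).tendsto.mono_left nhdsWithin_le_nhds
  refine h1.congr' ?_
  have hev : ∀ᶠ w : ℂ in 𝓝[≠] z, w.im ≠ 0 :=
    (Complex.continuous_im.continuousAt.eventually_ne hz).filter_mono nhdsWithin_le_nhds
  filter_upwards [self_mem_nhdsWithin, hev] with w hw hw0
  have hst : w - z ≠ 0 := sub_ne_zero.2 hw
  rw [slope_def_module, green_sub_green_param hM hw0 hz, smul_smul, ← neg_sub w z, mul_neg,
    inv_mul_cancel₀ hst, neg_smul, one_smul]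

end MatrixTools

end DeformedWigner

namespace DeformedWigner

/-! ### Stieltjes transforms of finite measures -/

section Stieltjes

lemma sub_ofReal_ne_zero {z : ℂ} (hz : z.im ≠ 0) (x : ℝ) : z - (x : ℂ) ≠ 0 := by
  intro h
  have := congrArg Complex.im h
  exact hz (by simpa using this)

lemma norm_inv_sub_ofReal_le {z : ℂ} (hz : z.im ≠ 0) (x : ℝ) : ‖(z - (x : ℂ))⁻¹‖ ≤ |z.im|⁻¹ := by
  rw [norm_inv]
  refine inv_anti₀ (abs_pos.2 hz) ?_
  have := Complex.abs_im_le_norm (z - (x : ℂ))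
  simpa using this

lemma continuous_inv_sub_ofReal {z : ℂ} (hz : z.im ≠ 0) :
    Continuous fun x : ℝ => (z - (x : ℂ))⁻¹ :=
  Continuous.inv₀ (by fun_prop) (sub_ofReal_ne_zero hz)

lemma integrable_inv_sub_ofReal {m : Measure ℝ} [IsFiniteMeasure m] {z : ℂ} (hz : z.im ≠ 0) :
    Integrable (fun x : ℝ => (z - (x : ℂ))⁻¹) m :=
  Integrable.of_bound (continuous_inv_sub_ofReal hz).aestronglyMeasurable _
    (Eventually.of_forall (norm_inv_sub_ofReal_le hz))

lemma half_abs_im_le_of_mem_ball {z w : ℂ} (hw : w ∈ Metric.ball z (|z.im| / 2)) :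
    |z.im| / 2 ≤ |w.im| := by
  rw [Metric.mem_ball, Complex.dist_eq] at hw
  have h1 := (Complex.abs_im_le_norm (w - z)).trans hw.le
  rw [Complex.sub_im] at h1
  have h2 := abs_sub_abs_le_abs_sub z.im w.im
  rw [abs_sub_comm] at h2
  linarith

lemma hasDerivAt_stieltjes (m : Measure ℝ) [IsFiniteMeasure m] {z : ℂ} (hz : z.im ≠ 0) :
    HasDerivAt (fun w : ℂ => ∫ x, (w - (x : ℂ))⁻¹ ∂m) (-∫ x, ((z - (x : ℂ)) ^ 2)⁻¹ ∂m) z := by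
  rw [← integral_neg]
  have hy : 0 < |z.im| := abs_pos.2 hz
  have hb : ∀ w ∈ Metric.ball z (|z.im| / 2), w.im ≠ 0 := fun w hw =>
    abs_pos.1 (lt_of_lt_of_le (by linarith) (half_abs_im_le_of_mem_ball hw))
  refine (hasDerivAt_integral_of_dominated_loc_of_deriv_le (s := Metric.ball z (|z.im| / 2))
    (bound := fun _ => ((|z.im| / 2)⁻¹) ^ 2) (F := fun w (x : ℝ) => (w - (x : ℂ))⁻¹)
    (F' := fun w (x : ℝ) => -((w - (x : ℂ)) ^ 2)⁻¹) (Metric.ball_mem_nhds _ (by linarith))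
    ?_ (integrable_inv_sub_ofReal hz) ?_ (Eventually.of_forall fun x w hw => ?_)
    (integrable_const _) (Eventually.of_forall fun x w hw => ?_)).2
  · filter_upwards [Metric.ball_mem_nhds z (by linarith : 0 < |z.im| / 2)] with w hw
    exact (continuous_inv_sub_ofReal (hb w hw)).aestronglyMeasurable
  · refine (Continuous.neg (Continuous.inv₀ (by fun_prop) fun x => ?_)).aestronglyMeasurable
    exact pow_ne_zero 2 (sub_ofReal_ne_zero hz x)
  · rw [norm_neg, ← inv_pow, norm_pow]
    refine pow_le_pow_left₀ (norm_nonneg _) ((norm_inv_sub_ofReal_le (hb w hw) x).trans ?_) 2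
    exact inv_anti₀ (by linarith) (half_abs_im_le_of_mem_ball hw)
  · have h := ((hasDerivAt_id w).sub_const (x : ℂ)).inv (sub_ofReal_ne_zero (hb w hw) x)
    refine h.congr_deriv ?_
    simp [neg_div]

/-- `T` is the Stieltjes transform of a difference of two finite measures carried by `K`, with total
mass `m`. -/
def IsStieltjesDiff (K : Set ℝ) (m : ℝ) (T : ℂ → ℂ) : Prop :=
  ∃ ν₁ ν₂ : Measure ℝ, IsFiniteMeasure ν₁ ∧ IsFiniteMeasure ν₂ ∧ ν₁ Kᶜ = 0 ∧ ν₂ Kᶜ = 0 ∧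
    ν₁.real Set.univ - ν₂.real Set.univ = m ∧
    ∀ z : ℂ, z.im ≠ 0 → T z = ∫ x, (z - (x : ℂ))⁻¹ ∂ν₁ - ∫ x, (z - (x : ℂ))⁻¹ ∂ν₂

variable {K : Set ℝ} {m m' : ℝ} {T T' : ℂ → ℂ}

lemma IsStieltjesDiff.congr (h : IsStieltjesDiff K m T) (hm : m' = m)
    (hT : ∀ z : ℂ, z.im ≠ 0 → T' z = T z) : IsStieltjesDiff K m' T' := by
  obtain ⟨ν₁, ν₂, h1, h2, h3, h4, h5, h6⟩ := h
  exact ⟨ν₁, ν₂, h1, h2, h3, h4, h5.trans hm.symm, fun z hz => (hT z hz).trans (h6 z hz)⟩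

lemma isStieltjesDiff_zero : IsStieltjesDiff K 0 (fun _ => 0) :=
  ⟨0, 0, inferInstance, inferInstance, by simp, by simp, by simp, by simp⟩

lemma IsStieltjesDiff.add (h : IsStieltjesDiff K m T) (h' : IsStieltjesDiff K m' T') :
    IsStieltjesDiff K (m + m') (fun z => T z + T' z) := by
  obtain ⟨ν₁, ν₂, h1, h2, h3, h4, h5, h6⟩ := h
  obtain ⟨ν₁', ν₂', h1', h2', h3', h4', h5', h6'⟩ := h'
  refine ⟨ν₁ + ν₁', ν₂ + ν₂', inferInstance, inferInstance, by simp [h3, h3'], by simp [h4, h4'],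
    ?_, fun z hz => ?_⟩
  · rw [← h5, ← h5', measureReal_add_apply, measureReal_add_apply]; ring
  · simp only [h6 z hz, h6' z hz]
    rw [integral_add_measure (integrable_inv_sub_ofReal hz)
      (integrable_inv_sub_ofReal hz), integral_add_measure (integrable_inv_sub_ofReal hz)
      (integrable_inv_sub_ofReal hz)]
    ring

lemma IsStieltjesDiff.neg (h : IsStieltjesDiff K m T) :
    IsStieltjesDiff K (-m) (fun z => -T z) := by
  obtain ⟨ν₁, ν₂, h1, h2, h3, h4, h5, h6⟩ := h
  exact ⟨ν₂, ν₁, h2, h1, h4, h3, by rw [← h5]; ring, fun z hz => by simp only [h6 z hz]; ring⟩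

lemma IsStieltjesDiff.const_mul (h : IsStieltjesDiff K m T) (c : ℝ) :
    IsStieltjesDiff K (c * m) (fun z => c * T z) := by
  wlog hc : 0 ≤ c generalizing c
  · have := (this (-c) (by linarith)).neg
    exact this.congr (by ring) fun z _ => by push_cast; ring
  obtain ⟨ν₁, ν₂, h1, h2, h3, h4, h5, h6⟩ := h
  lift c to NNReal using hc
  refine ⟨c • ν₁, c • ν₂, inferInstance, inferInstance, by simp [h3], by simp [h4], ?_,
    fun z hz => ?_⟩
  · rw [← h5, measureReal_nnreal_smul_apply, measureReal_nnreal_smul_apply]; ring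
  · simp only [h6 z hz]
    rw [integral_smul_nnreal_measure, integral_smul_nnreal_measure, NNReal.smul_def,
      NNReal.smul_def, Complex.real_smul, Complex.real_smul]
    ring

lemma isStieltjesDiff_sum {α : Type*} (s : Finset α) {T : α → ℂ → ℂ}
    (h : ∀ a ∈ s, IsStieltjesDiff K 0 (T a)) :
    IsStieltjesDiff K 0 (fun z => ∑ a ∈ s, T a z) := by
  classical
  induction s using Finset.induction_on with
  | empty => simpa using isStieltjesDiff_zero
  | insert a s ha ih =>
    have h1 := (h a (Finset.mem_insert_self a s)).add
      (ih fun b hb => h b (Finset.mem_insert_of_mem hb))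
    exact h1.congr (by simp) fun z _ => Finset.sum_insert ha

lemma isStieltjesDiff_dirac {a : ℝ} (ha : a ∈ K) (hK : MeasurableSet K) :
    IsStieltjesDiff K 1 (fun z => (z - (a : ℂ))⁻¹) :=
  ⟨Measure.dirac a, 0, inferInstance, inferInstance, by
    rw [Measure.dirac_apply' _ hK.compl]; simp [ha], by simp, by simp, fun z hz => by simp⟩

lemma isStieltjesDiff_density {α : Measure ℝ} [IsFiniteMeasure α] (hα : α Kᶜ = 0) {p : ℝ → ℝ}
    (hp : Integrable p α) :
    IsStieltjesDiff K (∫ x, p x ∂α) (fun z => ∫ x, (z - (x : ℂ))⁻¹ * p x ∂α) := by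
  have hfin : ∀ q : ℝ → ℝ, Integrable q α →
      IsFiniteMeasure (α.withDensity fun x => ENNReal.ofReal (q x)) :=
    fun q hq => isFiniteMeasure_withDensity_ofReal hq.2
  have hac : ∀ q : ℝ → ℝ, (α.withDensity fun x => ENNReal.ofReal (q x)) Kᶜ = 0 :=
    fun q => withDensity_absolutelyContinuous _ _ hα
  have hmeas : ∀ q : ℝ → ℝ, Integrable q α → AEMeasurable (fun x => ENNReal.ofReal (q x)) α :=
    fun q hq => hq.1.aemeasurable.ennreal_ofReal
  have hint : ∀ q : ℝ → ℝ, Integrable q α → ∀ f : ℝ → ℂ,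
      ∫ x, f x ∂(α.withDensity fun x => ENNReal.ofReal (q x))
        = ∫ x, (max (q x) 0 : ℝ) • f x ∂α := by
    intro q hq f
    rw [integral_withDensity_eq_integral_toReal_smul₀ (hmeas q hq)
      (Eventually.of_forall fun x => ENNReal.ofReal_lt_top)]
    simp [ENNReal.toReal_ofReal']
  have hmax : ∀ t : ℝ, max t 0 - max (-t) 0 = t := fun t => by
    rcases le_total 0 t with h | h
    · rw [max_eq_left h, max_eq_right (by linarith)]; ring
    · rw [max_eq_right h, max_eq_left (by linarith)]; ring
  have := hfin p hp
  have := hfin (-p) hp.neg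
  refine ⟨α.withDensity fun x => ENNReal.ofReal (p x), α.withDensity fun x => ENNReal.ofReal ((-p) x),
    inferInstance, inferInstance, hac _, hac _, ?_, fun z hz => ?_⟩
  · have e : ∀ q : ℝ → ℝ, Integrable q α →
        (α.withDensity fun x => ENNReal.ofReal (q x)).real Set.univ = ∫ x, max (q x) 0 ∂α := by
      intro q hq
      rw [measureReal_def, withDensity_apply _ MeasurableSet.univ, Measure.restrict_univ,
        integral_eq_lintegral_of_nonneg_ae (f := fun x => max (q x) 0)
          (Eventually.of_forall fun x => le_max_right _ _) hq.pos_part.1]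
      congr 1
      refine lintegral_congr fun x => ?_
      rcases le_total 0 (q x) with h | h <;> simp [h]
    rw [e p hp, e (-p) hp.neg, ← integral_sub hp.pos_part hp.neg.pos_part]
    simp only [Pi.neg_apply, hmax]
  · have hI : ∀ q : ℝ → ℝ, Integrable q α →
        Integrable (fun x => (max (q x) 0 : ℝ) • (z - (x : ℂ))⁻¹) α := by
      intro q hq
      have := (hq.pos_part.ofReal (𝕜 := ℂ)).bdd_mul (c := |z.im|⁻¹)
        (continuous_inv_sub_ofReal hz).aestronglyMeasurable
        (Eventually.of_forall (norm_inv_sub_ofReal_le hz))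
      refine this.congr (Eventually.of_forall fun x => ?_)
      simp [Complex.real_smul, mul_comm]
    rw [hint p hp, hint (-p) hp.neg, ← integral_sub (hI p hp) (hI (-p) hp.neg)]
    refine integral_congr_ae (Eventually.of_forall fun x => ?_)
    simp only [Pi.neg_apply, Complex.real_smul]
    rw [← sub_mul, ← Complex.ofReal_sub, hmax, mul_comm]

end Stieltjes

/-! ### The semicircle and arcsine laws -/

section Semicircle

variable {σ : ℝ}

lemma integral_semicircle (hσ : 0 < σ) {f : ℝ → ℂ} (hf : Continuous f) :
    ∫ x, f x ∂(semicircle σ)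
      = (2 / Real.pi : ℝ) * ∫ t in (0 : ℝ)..Real.pi, f (2 * σ * Real.cos t) * (Real.sin t ^ 2 : ℝ) := by
  have hmeas : Measurable fun x : ℝ =>
      ENNReal.ofReal (1 / (2 * Real.pi * σ ^ 2) * √(4 * σ ^ 2 - x ^ 2)) := by fun_prop
  rw [semicircle, integral_withDensity_eq_integral_toReal_smul hmeas
    (Eventually.of_forall fun x => ENNReal.ofReal_lt_top)]
  have h1 : ∀ x : ℝ, (ENNReal.ofReal (1 / (2 * Real.pi * σ ^ 2) * √(4 * σ ^ 2 - x ^ 2))).toReal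
      = 1 / (2 * Real.pi * σ ^ 2) * √(4 * σ ^ 2 - x ^ 2) := fun x =>
    ENNReal.toReal_ofReal (by positivity)
  simp_rw [h1]
  rw [integral_Icc_eq_integral_Ioc, ← intervalIntegral.integral_of_le (by linarith)]
  set h : ℝ → ℂ := fun x => (1 / (2 * Real.pi * σ ^ 2) * √(4 * σ ^ 2 - x ^ 2)) • f x with hh
  have hhc : Continuous h := by rw [hh]; fun_prop
  have hsub := intervalIntegral.integral_deriv_smul_comp (a := 0) (b := Real.pi)
    (f := fun t => 2 * σ * Real.cos t) (f' := fun t => 2 * σ * (-Real.sin t)) (g := h)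
    (fun t _ => (Real.hasDerivAt_cos t).const_mul _) (by fun_prop) hhc
  simp only [Real.cos_zero, Real.cos_pi, mul_one, mul_neg, Function.comp] at hsub
  rw [intervalIntegral.integral_symm, show -2 * σ = -(2 * σ) by ring, ← hsub,
    ← intervalIntegral.integral_neg, ← intervalIntegral.integral_const_mul]
  refine intervalIntegral.integral_congr fun t ht => ?_
  rw [Set.uIcc_of_le Real.pi_pos.le] at ht
  have hs : 0 ≤ Real.sin t := Real.sin_nonneg_of_mem_Icc ht
  have hsq : √(4 * σ ^ 2 - (2 * σ * Real.cos t) ^ 2) = 2 * σ * Real.sin t := by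
    rw [show 4 * σ ^ 2 - (2 * σ * Real.cos t) ^ 2 = (2 * σ * Real.sin t) ^ 2 by
      nlinarith [Real.sin_sq_add_cos_sq t]]
    exact Real.sqrt_sq (by positivity)
  simp only [hh, hsq, Complex.real_smul]
  push_cast
  have hp : (Real.pi : ℂ) ≠ 0 := by exact_mod_cast Real.pi_ne_zero
  have hs' : (σ : ℂ) ≠ 0 := by exact_mod_cast hσ.ne'
  field_simp

/-- The arcsine law on `[-2σ, 2σ]`. -/
def arcsine (σ : ℝ) : Measure ℝ :=
  Measure.map (fun t => 2 * σ * Real.cos t)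
    (ENNReal.ofReal (1 / Real.pi) • volume.restrict (Set.Ioc 0 Real.pi))

instance : IsFiniteMeasure (arcsine σ) := by
  have : IsFiniteMeasure (ENNReal.ofReal (1 / Real.pi) • volume.restrict (Set.Ioc 0 Real.pi)) :=
    Measure.smul_finite _ ENNReal.ofReal_ne_top
  unfold arcsine
  infer_instance

lemma integral_arcsine (f : ℝ → ℂ) (hf : AEStronglyMeasurable f (arcsine σ)) :
    ∫ x, f x ∂(arcsine σ)
      = (1 / Real.pi : ℝ) * ∫ t in (0 : ℝ)..Real.pi, f (2 * σ * Real.cos t) := by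
  rw [arcsine, integral_map (by fun_prop) hf, integral_smul_measure,
    intervalIntegral.integral_of_le Real.pi_pos.le, ENNReal.toReal_ofReal (by positivity),
    Complex.real_smul]

lemma arcsine_compl_Icc (hσ : 0 < σ) : arcsine σ (Set.Icc (-2 * σ) (2 * σ))ᶜ = 0 := by
  rw [arcsine, Measure.map_apply (by fun_prop) measurableSet_Icc.compl]
  refine (congrArg _ ?_).trans measure_empty
  ext t
  simp only [Set.preimage_compl, Set.mem_compl_iff, Set.mem_preimage, Set.mem_Icc,
    Set.mem_empty_iff_false, iff_false, not_not]
  constructor <;> nlinarith [Real.neg_one_le_cos t, Real.cos_le_one t]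

/-- Joukowski parametrization of the complement of `[-2σ, 2σ]`. -/
structure IsJoukowski (σ : ℝ) (z u : ℂ) : Prop where
  norm_lt : ‖u‖ < 1
  ne_zero : u ≠ 0
  eq : z = σ * (u + u⁻¹)

lemma exists_isJoukowski (hσ : 0 < σ) {z : ℂ} (hz : z.im ≠ 0) : ∃ u, IsJoukowski σ z u := by
  have hs' : (σ : ℂ) ≠ 0 := by exact_mod_cast hσ.ne'
  obtain ⟨s, hs⟩ := IsAlgClosed.exists_pow_nat_eq ((z / σ) ^ 2 - 4) (n := 2) two_pos
  have hu : ∀ u : ℂ, u ^ 2 - z / σ * u + 1 = 0 → u ≠ 0 ∧ z = σ * (u + u⁻¹) := by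
    intro u hu
    have h0 : u ≠ 0 := by rintro rfl; simp at hu
    refine ⟨h0, ?_⟩
    field_simp at hu ⊢
    linear_combination (-1 : ℂ) * hu
  have hne : ∀ u : ℂ, u ^ 2 - z / σ * u + 1 = 0 → ‖u‖ ≠ 1 := by
    intro u h h1
    obtain ⟨h0, h2⟩ := hu u h
    have h3 : u⁻¹ = (starRingEnd ℂ) u := by rw [Complex.inv_eq_conj h1]
    rw [h3, Complex.add_conj] at h2
    apply hz
    rw [h2]
    simp
  have hroot : ∀ e : ℂ, e ^ 2 = 1 →
      ((z / σ + e * s) / 2) ^ 2 - z / σ * ((z / σ + e * s) / 2) + 1 = 0 := by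
    intro e he
    linear_combination (1 / 4 : ℂ) * s ^ 2 * he + (1 / 4 : ℂ) * hs
  have r1 := hroot 1 (by norm_num)
  have r2 := hroot (-1) (by norm_num)
  have hprod : ((z / σ + 1 * s) / 2) * ((z / σ + -1 * s) / 2) = 1 := by
    linear_combination (-1 / 4 : ℂ) * hs
  rcases lt_or_gt_of_ne (hne _ r1) with h | h
  · exact ⟨_, h, (hu _ r1).1, (hu _ r1).2⟩
  · refine ⟨(z / σ + -1 * s) / 2, ?_, (hu _ r2).1, (hu _ r2).2⟩
    have := congrArg norm hprod
    rw [norm_mul, norm_one] at this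
    by_contra! h'
    nlinarith [norm_nonneg ((z / σ + 1 * s) / 2)]

namespace IsJoukowski

variable {z u : ℂ}

lemma sub_ne_zero (h : IsJoukowski σ z u) (hσ : 0 < σ) (t : ℝ) :
    z - 2 * σ * Real.cos t ≠ 0 := by
  intro h0
  have hs' : (σ : ℂ) ≠ 0 := by exact_mod_cast hσ.ne'
  have hu0 := h.ne_zero
  have hc1 := Real.neg_one_le_cos t
  have hc2 := Real.cos_le_one t
  rw [h.eq] at h0
  generalize Real.cos t = c at *
  have h1 : u ^ 2 - 2 * c * u + 1 = 0 := by
    have h2 : (σ : ℂ) * (u ^ 2 - 2 * c * u + 1) = 0 := by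
      have h3 : u * (σ * (u + u⁻¹) - 2 * σ * c) = u * 0 := by rw [h0]
      have h4 := mul_inv_cancel₀ hu0
      linear_combination h3 - σ * h4
    exact (mul_eq_zero.1 h2).resolve_left hs'
  have hre := congrArg Complex.re h1
  have him := congrArg Complex.im h1
  have hn : u.re * u.re + u.im * u.im < 1 := by
    have := h.norm_lt
    have h2 : Complex.normSq u < 1 := by
      rw [Complex.normSq_eq_norm_sq]; nlinarith [norm_nonneg u]
    rwa [Complex.normSq_apply] at h2
  simp [pow_two] at hre him
  rcases eq_or_ne u.im 0 with hb | hb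
  · rw [hb] at hre hn
    nlinarith [sq_nonneg (u.re - c)]
  · have : u.re = c := mul_right_cancel₀ hb (by linear_combination him / 2)
    rw [this] at hre hn
    nlinarith

lemma one_sub_sq_ne_zero (h : IsJoukowski σ z u) : 1 - u ^ 2 ≠ 0 := by
  intro h0
  have h1 : u ^ 2 = 1 := by linear_combination -h0
  have := congrArg norm h1
  rw [norm_pow, norm_one] at this
  nlinarith [norm_nonneg u, h.norm_lt]

/-- The Fourier coefficients of the Cauchy kernel on `[-2σ, 2σ]`. -/
lemma integral_cos_div (h : IsJoukowski σ z u) (hσ : 0 < σ) (n : ℕ) :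
    (1 / Real.pi : ℝ) * ∫ t in (0 : ℝ)..Real.pi,
        (z - 2 * σ * Real.cos t)⁻¹ * (Real.cos (n * t) : ℝ) = u ^ (n + 1) / (σ * (1 - u ^ 2)) := by
  have hs' : (σ : ℂ) ≠ 0 := by exact_mod_cast hσ.ne'
  have hu0 := h.ne_zero
  have hu2 := h.one_sub_sq_ne_zero
  have hden := h.sub_ne_zero hσ
  have hpi : (Real.pi : ℂ) ≠ 0 := by exact_mod_cast Real.pi_ne_zero
  have hcont0 : Continuous fun t : ℝ => (z - 2 * σ * (Real.cos t : ℂ))⁻¹ :=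
    Continuous.inv₀ (by fun_prop) hden
  set I : ℕ → ℂ := fun n => (1 / Real.pi : ℝ) * ∫ t in (0 : ℝ)..Real.pi,
        (z - 2 * σ * Real.cos t)⁻¹ * (Real.cos (n * t) : ℝ) with hI
  have hcont : ∀ n : ℕ, Continuous fun t : ℝ =>
      (z - 2 * σ * (Real.cos t : ℂ))⁻¹ * (Real.cos (n * t) : ℝ) := fun n =>
    hcont0.mul (by fun_prop)
  have hii : ∀ n : ℕ, IntervalIntegrable (fun t : ℝ =>
      (z - 2 * σ * (Real.cos t : ℂ))⁻¹ * (Real.cos (n * t) : ℝ)) volume 0 Real.pi := fun n =>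
    (hcont n).intervalIntegrable _ _
  obtain ⟨D, hD⟩ : ∃ D, ∀ n, ‖I n‖ ≤ D := by
    obtain ⟨D, hD⟩ := (isCompact_Icc (a := (0 : ℝ)) (b := Real.pi)).exists_bound_of_continuousOn
      hcont0.continuousOn
    refine ⟨‖((1 / Real.pi : ℝ) : ℂ)‖ * (D * |Real.pi - 0|), fun n => ?_⟩
    rw [hI, norm_mul]
    gcongr
    refine intervalIntegral.norm_integral_le_of_norm_le_const fun t ht => ?_
    rw [Set.uIoc_of_le Real.pi_pos.le] at ht
    have h1 := hD t ⟨ht.1.le, ht.2⟩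
    rw [norm_mul, Complex.norm_real, Real.norm_eq_abs]
    calc _ ≤ D * 1 := mul_le_mul h1 (Real.abs_cos_le_one _) (abs_nonneg _)
          ((norm_nonneg _).trans h1)
      _ = D := mul_one D
  have hrec : ∀ n : ℕ, z * I (n + 1) = σ * (I (n + 2) + I n) := by
    intro n
    have hzero : ∫ t in (0 : ℝ)..Real.pi, ((Real.cos ((n + 1 : ℕ) * t) : ℝ) : ℂ) = 0 := by
      rw [intervalIntegral.integral_ofReal, intervalIntegral.integral_comp_mul_left (f := Real.cos)
        (by positivity), integral_cos]
      simp
      right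
      exact_mod_cast Real.sin_nat_mul_pi (n + 1)
    have e : ∀ t : ℝ, z * ((z - 2 * σ * (Real.cos t : ℂ))⁻¹ * (Real.cos ((n + 1 : ℕ) * t) : ℝ))
        = σ * ((z - 2 * σ * (Real.cos t : ℂ))⁻¹ * (Real.cos ((n + 2 : ℕ) * t) : ℝ)
          + (z - 2 * σ * (Real.cos t : ℂ))⁻¹ * (Real.cos (n * t) : ℝ))
          + (Real.cos ((n + 1 : ℕ) * t) : ℝ) := by
      intro t
      have hc : Real.cos ((n + 2 : ℕ) * t) + Real.cos (n * t)
          = 2 * Real.cos t * Real.cos ((n + 1 : ℕ) * t) := by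
        rw [Real.cos_add_cos]
        push_cast
        rw [show ((n + 2 : ℝ) * t + n * t) / 2 = (n + 1) * t by ring,
          show ((n + 2 : ℝ) * t - n * t) / 2 = t by ring]
        ring
      have hc' : (Real.cos ((n + 2 : ℕ) * t) : ℂ) = 2 * Real.cos t * Real.cos ((n + 1 : ℕ) * t)
          - Real.cos (n * t) := by
        rw [eq_sub_iff_add_eq]; exact_mod_cast hc
      rw [hc']
      have := hden t
      field_simp
      ring
    have e2 : z * ∫ t in (0 : ℝ)..Real.pi,
        ((z - 2 * σ * (Real.cos t : ℂ))⁻¹ * (Real.cos ((n + 1 : ℕ) * t) : ℝ))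
        = σ * ((∫ t in (0 : ℝ)..Real.pi,
          (z - 2 * σ * (Real.cos t : ℂ))⁻¹ * (Real.cos ((n + 2 : ℕ) * t) : ℝ))
          + ∫ t in (0 : ℝ)..Real.pi,
            (z - 2 * σ * (Real.cos t : ℂ))⁻¹ * (Real.cos (n * t) : ℝ)) := by
      rw [← intervalIntegral.integral_const_mul]
      simp_rw [e]
      rw [intervalIntegral.integral_add (((hii _).add (hii _)).const_mul _)
        (Continuous.intervalIntegrable (by fun_prop) _ _), hzero, add_zero,
        intervalIntegral.integral_const_mul, intervalIntegral.integral_add (hii _) (hii _)]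
    simp only [hI]
    linear_combination ((1 / Real.pi : ℝ) : ℂ) * e2
  have hrec0 : z * I 0 = 2 * σ * I 1 + 1 := by
    have e : ∀ t : ℝ, z * ((z - 2 * σ * (Real.cos t : ℂ))⁻¹ * (Real.cos ((0 : ℕ) * t) : ℝ))
        = 2 * σ * ((z - 2 * σ * (Real.cos t : ℂ))⁻¹ * (Real.cos ((1 : ℕ) * t) : ℝ)) + 1 := by
      intro t
      have := hden t
      simp only [Nat.cast_zero, zero_mul, Real.cos_zero, Nat.cast_one, one_mul, Complex.ofReal_one]
      field_simp
      ring
    have e2 : z * ∫ t in (0 : ℝ)..Real.pi,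
        ((z - 2 * σ * (Real.cos t : ℂ))⁻¹ * (Real.cos ((0 : ℕ) * t) : ℝ))
        = 2 * σ * (∫ t in (0 : ℝ)..Real.pi,
          (z - 2 * σ * (Real.cos t : ℂ))⁻¹ * (Real.cos ((1 : ℕ) * t) : ℝ)) + Real.pi := by
      rw [← intervalIntegral.integral_const_mul]
      simp_rw [e]
      rw [intervalIntegral.integral_add ((hii _).const_mul _)
        (Continuous.intervalIntegrable (by fun_prop) _ _),
        intervalIntegral.integral_const_mul]
      simp
    have hpp : ((1 / Real.pi : ℝ) : ℂ) * Real.pi = 1 := by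
      push_cast; field_simp
    simp only [hI]
    linear_combination ((1 / Real.pi : ℝ) : ℂ) * e2 + hpp
  have hd : ∀ n, I 1 - u * I 0 = u ^ n * (I (n + 1) - u * I n) := by
    intro n
    induction n with
    | zero => simp
    | succ n ih =>
      rw [ih]
      have h1 := hrec n
      rw [h.eq] at h1
      field_simp at h1
      rw [pow_succ]
      linear_combination u ^ n * h1
  have hd0 : I 1 - u * I 0 = 0 := by
    have hlim : Tendsto (fun n : ℕ => u ^ n * (I (n + 1) - u * I n)) atTop (𝓝 0) := by
      refine (tendsto_pow_atTop_nhds_zero_of_norm_lt_one h.norm_lt).zero_mul_isBoundedUnder_le ?_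
      refine isBoundedUnder_of ⟨D + ‖u‖ * D, fun n => ?_⟩
      refine (norm_sub_le _ _).trans (add_le_add (hD _) ?_)
      rw [norm_mul]
      gcongr
      exact hD n
    refine tendsto_nhds_unique ?_ hlim
    exact tendsto_const_nhds.congr hd
  have hstep : ∀ n, I (n + 1) = u * I n := by
    intro n
    have := hd n
    rw [hd0] at this
    have h2 := (mul_eq_zero.1 this.symm).resolve_left (pow_ne_zero _ hu0)
    linear_combination h2
  have hI0 : I 0 = u / (σ * (1 - u ^ 2)) := by
    rw [hstep 0, h.eq] at hrec0
    rw [eq_div_iff (mul_ne_zero hs' hu2)]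
    field_simp at hrec0
    linear_combination hrec0
  change I n = _
  induction n with
  | zero => rw [hI0, zero_add, pow_one]
  | succ n ih => rw [hstep, ih, pow_succ u (n + 1)]; ring

end IsJoukowski

end Semicircle

section Semicircle

variable {σ : ℝ}

lemma isProbabilityMeasure_semicircle (hσ : 0 < σ) : IsProbabilityMeasure (semicircle σ) := by
  have h := integral_semicircle hσ (f := fun _ => 1) continuous_const
  have hpi : (Real.pi : ℂ) ≠ 0 := by exact_mod_cast Real.pi_ne_zero
  simp only [one_mul, intervalIntegral.integral_ofReal, integral_sin_sq] at h
  simp only [integral_const, Real.sin_zero, Real.sin_pi, zero_mul, sub_self, zero_add, sub_zero] at h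
  have h2 : (semicircle σ).real Set.univ = 1 := by
    have : (((semicircle σ).real Set.univ : ℝ) : ℂ) = 1 := by
      simp only [Complex.real_smul, mul_one] at h
      rw [h]; push_cast; field_simp
    exact_mod_cast this
  rw [measureReal_def, ENNReal.toReal_eq_one_iff] at h2
  exact ⟨h2⟩

lemma IsJoukowski.gSC_eq {z u : ℂ} (h : IsJoukowski σ z u) (hσ : 0 < σ) (hz : z.im ≠ 0) :
    gSC σ z = u / σ := by
  have hs' : (σ : ℂ) ≠ 0 := by exact_mod_cast hσ.ne'
  have hpi : (Real.pi : ℂ) ≠ 0 := by exact_mod_cast Real.pi_ne_zero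
  have hu2 := h.one_sub_sq_ne_zero
  have hden := h.sub_ne_zero hσ
  have hcont0 : Continuous fun t : ℝ => (z - 2 * σ * (Real.cos t : ℂ))⁻¹ :=
    Continuous.inv₀ (by fun_prop) hden
  have i0 := h.integral_cos_div hσ 0
  have i2 := h.integral_cos_div hσ 2
  rw [gSC, integral_semicircle hσ (continuous_inv_sub_ofReal hz)]
  have e : ∀ t : ℝ, (z - ((2 * σ * Real.cos t : ℝ) : ℂ))⁻¹ * ((Real.sin t ^ 2 : ℝ) : ℂ)
      = (1 / 2 : ℂ) * ((z - 2 * σ * (Real.cos t : ℂ))⁻¹ * (Real.cos ((0 : ℕ) * t) : ℝ)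
        - (z - 2 * σ * (Real.cos t : ℂ))⁻¹ * (Real.cos ((2 : ℕ) * t) : ℝ)) := by
    intro t
    have hc : Real.sin t ^ 2 = (1 - Real.cos (2 * t)) / 2 := by
      rw [Real.cos_two_mul]; linarith [Real.sin_sq_add_cos_sq t]
    rw [hc]
    push_cast
    simp
    ring
  simp_rw [e]
  have hii : ∀ n : ℕ, IntervalIntegrable (fun t : ℝ =>
      (z - 2 * σ * (Real.cos t : ℂ))⁻¹ * (Real.cos (n * t) : ℝ)) volume 0 Real.pi := fun n =>
    Continuous.intervalIntegrable (hcont0.mul (by fun_prop)) _ _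
  rw [intervalIntegral.integral_const_mul, intervalIntegral.integral_sub (hii 0) (hii 2)]
  have e3 : u / σ = u ^ (0 + 1) / (σ * (1 - u ^ 2)) - u ^ (2 + 1) / (σ * (1 - u ^ 2)) := by
    field_simp
    ring
  rw [e3, ← i0, ← i2]
  push_cast
  ring

lemma gSC_quadratic (hσ : 0 < σ) {z : ℂ} (hz : z.im ≠ 0) :
    z * gSC σ z = 1 + (σ : ℂ) ^ 2 * gSC σ z ^ 2 := by
  obtain ⟨u, hu⟩ := exists_isJoukowski hσ hz
  have hs' : (σ : ℂ) ≠ 0 := by exact_mod_cast hσ.ne'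
  have := hu.ne_zero
  rw [hu.gSC_eq hσ hz, hu.eq]
  field_simp
  ring

lemma gSC_ne_zero (hσ : 0 < σ) {z : ℂ} (hz : z.im ≠ 0) : gSC σ z ≠ 0 := by
  intro h
  have := gSC_quadratic hσ hz
  simp [h] at this

lemma hasDerivAt_gSC (hσ : 0 < σ) {z : ℂ} (hz : z.im ≠ 0) :
    HasDerivAt (gSC σ) (-gSC₂ σ z) z := by
  have := isProbabilityMeasure_semicircle hσ
  exact hasDerivAt_stieltjes (semicircle σ) hz

lemma norm_gSC_le (hσ : 0 < σ) {z : ℂ} (hz : z.im ≠ 0) : ‖gSC σ z‖ ≤ |z.im|⁻¹ := by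
  have := isProbabilityMeasure_semicircle hσ
  refine (norm_integral_le_of_norm_le_const
    (Eventually.of_forall (norm_inv_sub_ofReal_le hz))).trans ?_
  simp

lemma im_gSC_nonpos (hσ : 0 < σ) {z : ℂ} (hz : 0 < z.im) : (gSC σ z).im ≤ 0 := by
  have := isProbabilityMeasure_semicircle hσ
  have h := integral_im (𝕜 := ℂ) (integrable_inv_sub_ofReal (m := semicircle σ) hz.ne')
  simp only [RCLike.im_eq_complex_im] at h
  rw [gSC, ← h]
  refine integral_nonpos fun x => ?_
  simp only [Complex.inv_im, Pi.zero_apply]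
  refine div_nonpos_of_nonpos_of_nonneg ?_ (Complex.normSq_nonneg _)
  simp [hz.le]

lemma gSC₂_mul (hσ : 0 < σ) {z : ℂ} (hz : z.im ≠ 0) :
    gSC₂ σ z * (z - 2 * (σ : ℂ) ^ 2 * gSC σ z) = gSC σ z := by
  have hd := hasDerivAt_gSC hσ hz
  have h1 := (hasDerivAt_id z).mul hd
  have h2 := ((hd.pow 2).const_mul ((σ : ℂ) ^ 2)).const_add 1
  have heq : (fun w : ℂ => 1 + (σ : ℂ) ^ 2 * (gSC σ ^ 2) w) =ᶠ[𝓝 z] (id * gSC σ) := by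
    filter_upwards [Complex.continuous_im.continuousAt.eventually_ne hz] with w hw
    simpa using (gSC_quadratic hσ hw).symm
  have := (h1.congr_of_eventuallyEq heq).unique h2
  simp at this
  linear_combination (-1 : ℂ) * this

lemma IsJoukowski.gSC₂_eq {z u : ℂ} (h : IsJoukowski σ z u) (hσ : 0 < σ) (hz : z.im ≠ 0) :
    gSC₂ σ z = u ^ 2 / (σ ^ 2 * (1 - u ^ 2)) := by
  have h1 := gSC₂_mul hσ hz
  have hs' : (σ : ℂ) ≠ 0 := by exact_mod_cast hσ.ne'
  have h0 := h.ne_zero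
  have hu2 := h.one_sub_sq_ne_zero
  rw [h.gSC_eq hσ hz] at h1
  have h2 : z * u = σ * (u ^ 2 + 1) := by rw [h.eq]; field_simp
  rw [eq_div_iff (mul_ne_zero (pow_ne_zero 2 hs') hu2)]
  field_simp at h1
  linear_combination u * h1 - gSC₂ σ z * σ * h2

end Semicircle

/-! ### The correction to the semicircle law -/

section Correction

variable {σ : ℝ}

lemma IsJoukowski.integral_arcsine_inv {z u : ℂ} (h : IsJoukowski σ z u) (hσ : 0 < σ) :
    ∫ x, (z - (x : ℂ))⁻¹ ∂(arcsine σ) = u / (σ * (1 - u ^ 2)) := by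
  have i0 := h.integral_cos_div hσ 0
  rw [integral_arcsine]
  · simpa using i0
  · exact (Measurable.inv (by fun_prop)).aestronglyMeasurable

lemma IsJoukowski.gSC_ratio {z u : ℂ} (h : IsJoukowski σ z u) (hσ : 0 < σ) (hz : z.im ≠ 0) :
    (gSC σ z)⁻¹ * gSC₂ σ z = u / (σ * (1 - u ^ 2)) := by
  have hs' : (σ : ℂ) ≠ 0 := by exact_mod_cast hσ.ne'
  have h0 := h.ne_zero
  have hu2 := h.one_sub_sq_ne_zero
  rw [h.gSC_eq hσ hz, h.gSC₂_eq hσ hz]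
  field_simp

lemma integral_arcsine_one : ∫ _, (1 : ℝ) ∂(arcsine σ) = 1 := by
  have h := integral_arcsine (σ := σ) (fun _ => 1) aestronglyMeasurable_const
  have hpi : (Real.pi : ℂ) ≠ 0 := by exact_mod_cast Real.pi_ne_zero
  have h2 : ((∫ _, (1 : ℝ) ∂(arcsine σ) : ℝ) : ℂ) = 1 := by
    rw [← integral_complex_ofReal]
    simp only [Complex.ofReal_one]
    rw [h]
    simp [hpi]
  exact_mod_cast h2

variable {K : Set ℝ}

lemma arcsine_compl (hσ : 0 < σ) (hK : Set.Icc (-2 * σ) (2 * σ) ⊆ K) : arcsine σ Kᶜ = 0 :=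
  measure_mono_null (Set.compl_subset_compl.2 hK) (arcsine_compl_Icc hσ)

lemma isStieltjesDiff_arcsine (hσ : 0 < σ) (hK : Set.Icc (-2 * σ) (2 * σ) ⊆ K) :
    IsStieltjesDiff K 1 (fun z => (gSC σ z)⁻¹ * gSC₂ σ z) := by
  refine (isStieltjesDiff_density (p := fun _ => 1) (arcsine_compl hσ hK)
    (integrable_const 1)).congr integral_arcsine_one.symm fun z hz => ?_
  obtain ⟨u, hu⟩ := exists_isJoukowski hσ hz
  rw [hu.gSC_ratio hσ hz, ← hu.integral_arcsine_inv hσ]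
  simp

lemma cos_four_mul (t : ℝ) : Real.cos (4 * t) = 8 * Real.cos t ^ 4 - 8 * Real.cos t ^ 2 + 1 := by
  rw [show 4 * t = 2 * (2 * t) by ring, Real.cos_two_mul, Real.cos_two_mul]
  ring

lemma isStieltjesDiff_cumulant (hσ : 0 < σ) (hK : Set.Icc (-2 * σ) (2 * σ) ⊆ K) :
    IsStieltjesDiff K 0 (fun z => (gSC σ z)⁻¹ * gSC₂ σ z * gSC σ z ^ 4) := by
  have hs' : (σ : ℂ) ≠ 0 := by exact_mod_cast hσ.ne'
  set p : ℝ → ℝ := fun x => 8 * (x / (2 * σ)) ^ 4 - 8 * (x / (2 * σ)) ^ 2 + 1 with hp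
  have hpc : Continuous p := by rw [hp]; fun_prop
  have hpcos : ∀ t, p (2 * σ * Real.cos t) = Real.cos ((4 : ℕ) * t) := by
    intro t
    have : 2 * σ * Real.cos t / (2 * σ) = Real.cos t := by field_simp
    simp only [hp, this, Nat.cast_ofNat, cos_four_mul]
  have hae : ∀ᵐ x ∂(arcsine σ), x ∈ Set.Icc (-2 * σ) (2 * σ) := by
    rw [ae_iff]; exact arcsine_compl_Icc hσ
  obtain ⟨D, hD⟩ := (isCompact_Icc (a := -2 * σ) (b := 2 * σ)).exists_bound_of_continuousOn
      hpc.continuousOn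
  have hpi : Integrable p (arcsine σ) := Integrable.of_bound hpc.aestronglyMeasurable D
    (hae.mono fun x hx => hD x hx)
  have hm : ∫ x, p x ∂(arcsine σ) = 0 := by
    have h := integral_arcsine (σ := σ) (fun x => (p x : ℂ))
      (Complex.continuous_ofReal.comp hpc).aestronglyMeasurable
    have h2 : ((∫ x, p x ∂(arcsine σ) : ℝ) : ℂ) = 0 := by
      rw [← integral_complex_ofReal, h]
      simp only [hpcos]
      rw [intervalIntegral.integral_ofReal, intervalIntegral.integral_comp_mul_left (f := Real.cos)
        (by norm_num), integral_cos]
      have := Real.sin_nat_mul_pi 4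
      simp at this
      simp [this]
    exact_mod_cast h2
  refine ((isStieltjesDiff_density (arcsine_compl hσ hK) hpi).const_mul (1 / σ ^ 4)).congr
    (by rw [hm, mul_zero]) fun z hz => ?_
  obtain ⟨u, hu⟩ := exists_isJoukowski hσ hz
  have hu2 := hu.one_sub_sq_ne_zero
  have i4 := hu.integral_cos_div hσ 4
  rw [hu.gSC_ratio hσ hz, hu.gSC_eq hσ hz, integral_arcsine]
  · simp only [hpcos]
    push_cast at i4 ⊢
    rw [i4]
    field_simp
  · exact ((continuous_inv_sub_ofReal hz).mul
      (Complex.continuous_ofReal.comp hpc)).aestronglyMeasurable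

lemma isStieltjesDiff_resolvent (hσ : 0 < σ) (hK : Set.Icc (-2 * σ) (2 * σ) ⊆ K) {q : ℝ}
    (hq0 : q ≠ 0) (hq1 : |q| < 1) :
    IsStieltjesDiff K (q / (σ * (1 - q ^ 2))) (fun z =>
      ((q : ℂ) / (σ * (1 - q ^ 2)) - (gSC σ z)⁻¹ * gSC₂ σ z)
        / (z - ((σ * (q + q⁻¹) : ℝ) : ℂ))) := by
  set ρ := σ * (q + q⁻¹) with hρ
  have hJ : IsJoukowski σ (ρ : ℂ) (q : ℂ) :=
    ⟨by simpa using hq1, by exact_mod_cast hq0, by rw [hρ]; push_cast; ring⟩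
  set p : ℝ → ℝ := fun x => (ρ - x)⁻¹ with hp
  have hpm : Measurable p := by rw [hp]; fun_prop
  have hden : ∀ x ∈ Set.Icc (-2 * σ) (2 * σ), ρ - x ≠ 0 := by
    intro x hx h0
    have h1 : -1 ≤ x / (2 * σ) := by rw [le_div_iff₀ (by positivity)]; linarith [hx.1]
    have h2 : x / (2 * σ) ≤ 1 := by rw [div_le_iff₀ (by positivity)]; linarith [hx.2]
    refine hJ.sub_ne_zero hσ (Real.arccos (x / (2 * σ))) ?_
    rw [Real.cos_arccos h1 h2]
    have : (ρ : ℂ) - x = 0 := by exact_mod_cast h0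
    rw [← this]
    push_cast
    have hs' : (σ : ℂ) ≠ 0 := by exact_mod_cast hσ.ne'
    field_simp
  have hae : ∀ᵐ x ∂(arcsine σ), x ∈ Set.Icc (-2 * σ) (2 * σ) := by
    rw [ae_iff]; exact arcsine_compl_Icc hσ
  have hpcont : ContinuousOn p (Set.Icc (-2 * σ) (2 * σ)) :=
    ContinuousOn.inv₀ (by fun_prop) hden
  obtain ⟨D, hD⟩ := (isCompact_Icc (a := -2 * σ) (b := 2 * σ)).exists_bound_of_continuousOn hpcont
  have hpi : Integrable p (arcsine σ) := Integrable.of_bound hpm.aestronglyMeasurable D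
    (hae.mono fun x hx => hD x hx)
  have hcast : ∀ x : ℝ, ((p x : ℝ) : ℂ) = ((ρ : ℂ) - x)⁻¹ := fun x => by simp [hp]
  have hm : ∫ x, p x ∂(arcsine σ) = q / (σ * (1 - q ^ 2)) := by
    have h2 : ((∫ x, p x ∂(arcsine σ) : ℝ) : ℂ) = ((q / (σ * (1 - q ^ 2)) : ℝ) : ℂ) := by
      rw [← integral_complex_ofReal]
      simp only [hcast]
      rw [hJ.integral_arcsine_inv hσ]
      push_cast
      ring
    exact_mod_cast h2
  refine (isStieltjesDiff_density (arcsine_compl hσ hK) hpi).congr hm.symm fun z hz => ?_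
  obtain ⟨u, hu⟩ := exists_isJoukowski hσ hz
  have hzρ := sub_ofReal_ne_zero hz ρ
  rw [div_eq_iff hzρ, hu.gSC_ratio hσ hz, ← hu.integral_arcsine_inv hσ, ← hJ.integral_arcsine_inv hσ,
    ← integral_mul_const, ← integral_sub]
  · refine integral_congr_ae (hae.mono fun x hx => ?_)
    have h1 := sub_ofReal_ne_zero hz x
    have h2 : (ρ : ℂ) - x ≠ 0 := by exact_mod_cast hden x hx
    simp only [hcast]
    field_simp
    ring
  · exact (hpi.ofReal (𝕜 := ℂ)).congr (Eventually.of_forall fun x => hcast x)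
  · exact integrable_inv_sub_ofReal hz

lemma isStieltjesDiff_spike (hσ : 0 < σ) (hKm : MeasurableSet K)
    (hK : Set.Icc (-2 * σ) (2 * σ) ⊆ K) {θ : ℝ} (hθ : θ ≠ 0)
    (hout : (σ < θ ∨ θ < -σ) → θ + σ ^ 2 / θ ∈ K) :
    IsStieltjesDiff K 0 (fun z => (gSC σ z)⁻¹ * gSC₂ σ z *
      ((θ : ℂ) / (z - (σ : ℂ) ^ 2 * gSC σ z - θ))) := by
  have hs' : (σ : ℂ) ≠ 0 := by exact_mod_cast hσ.ne'
  have hθ' : (θ : ℂ) ≠ 0 := by exact_mod_cast hθ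
  have hE0 := isStieltjesDiff_arcsine hσ hK
  have hzu : ∀ {z u : ℂ}, IsJoukowski σ z u → z.im ≠ 0 →
      z - (σ : ℂ) ^ 2 * gSC σ z = σ * u⁻¹ := by
    intro z u hu hz
    have := hu.ne_zero
    rw [hu.gSC_eq hσ hz, hu.eq]
    field_simp
    ring
  have hne : ∀ {z u : ℂ}, IsJoukowski σ z u → z.im ≠ 0 → (σ : ℂ) - θ * u ≠ 0 := by
    intro z u hu hz h0
    have h0' := hu.ne_zero
    have h1 : u = ((σ / θ : ℝ) : ℂ) := by
      push_cast
      rw [eq_div_iff hθ']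
      linear_combination -h0
    apply hz
    rw [hu.eq, h1, ← Complex.ofReal_inv, ← Complex.ofReal_add, ← Complex.ofReal_mul,
      Complex.ofReal_im]
  have hq : ∀ q : ℝ, q ≠ 0 → |q| < 1 → 1 - q ^ 2 ≠ 0 := by
    intro q _ hq1
    have := (sq_lt_one_iff_abs_lt_one q).2 hq1
    linarith
  have key : ∀ {z u : ℂ} (q : ℝ), IsJoukowski σ z u → z.im ≠ 0 → q ≠ 0 →
      z - ((σ * (q + q⁻¹) : ℝ) : ℂ) = σ * (u - q) * (u * q - 1) / (u * q) ∧
        (u - q) ≠ 0 ∧ u * q - 1 ≠ 0 := by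
    intro z u q hu hz hq0
    have h0 := hu.ne_zero
    have hq0' : (q : ℂ) ≠ 0 := by exact_mod_cast hq0
    have e : z - ((σ * (q + q⁻¹) : ℝ) : ℂ) = σ * (u - q) * (u * q - 1) / (u * q) := by
      rw [hu.eq]; push_cast; field_simp; ring
    have h1 := sub_ofReal_ne_zero hz (σ * (q + q⁻¹))
    rw [e] at h1
    refine ⟨e, fun h => h1 (by rw [h]; simp), fun h => h1 (by rw [h]; simp)⟩
  rcases lt_trichotomy |θ| σ with hlt | heq | hgt
  · have hq0 : θ / σ ≠ 0 := div_ne_zero hθ hσ.ne'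
    have hq1 : |θ / σ| < 1 := by rw [abs_div, abs_of_pos hσ, div_lt_one hσ]; exact hlt
    set q := θ / σ with hqd
    have hqq := hq q hq0 hq1
    refine ((hE0.const_mul (-1 / 2)).add ((isStieltjesDiff_resolvent hσ hK hq0 hq1).const_mul
      ((1 - q ^ 2) * σ / (2 * q)))).congr (by field_simp; ring) fun z hz => ?_
    obtain ⟨u, hu⟩ := exists_isJoukowski hσ hz
    obtain ⟨e, k1, k2⟩ := key q hu hz hq0
    have hu2 := hu.one_sub_sq_ne_zero
    have hu0 := hu.ne_zero
    have hn := hne hu hz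
    have hq0' : (q : ℂ) ≠ 0 := by exact_mod_cast hq0
    have hqq' : (1 : ℂ) - (q : ℂ) ^ 2 ≠ 0 := by exact_mod_cast hqq
    have hθq : (θ : ℂ) = q * σ := by rw [hqd]; push_cast; field_simp
    have k3 : 1 - u * q ≠ 0 := fun h => k2 (by linear_combination -h)
    rw [e, hzu hu hz, hu.gSC_ratio hσ hz, hθq]
    have e2 : (σ : ℂ) * u⁻¹ - q * σ = σ * (1 - u * q) / u := by field_simp
    rw [e2]
    push_cast
    rw [show u * (q : ℂ) - 1 = -(1 - u * q) by ring]
    field_simp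
    ring
  · have hE := isStieltjesDiff_dirac (K := K) (a := 2 * θ) (hK (by
      constructor <;> nlinarith [abs_le.1 heq.le])) hKm
    refine ((hE.const_mul (1 / 2)).add (hE0.const_mul (-1 / 2))).congr (by norm_num)
      fun z hz => ?_
    obtain ⟨u, hu⟩ := exists_isJoukowski hσ hz
    have hu2 := hu.one_sub_sq_ne_zero
    have hu0 := hu.ne_zero
    have hn := hne hu hz
    have hsq : (σ : ℂ) ^ 2 = θ ^ 2 := by rw [← heq]; exact_mod_cast sq_abs θ
    have hzd : z - ((2 * θ : ℝ) : ℂ) = (σ - θ * u) ^ 2 / (σ * u) := by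
      rw [hu.eq]; push_cast; field_simp
      linear_combination u ^ 2 * hsq
    rw [hzd, hzu hu hz, hu.gSC_ratio hσ hz]
    have e2 : (σ : ℂ) * u⁻¹ - θ = (σ - θ * u) / u := by field_simp
    rw [e2]
    push_cast
    obtain ⟨D, hD⟩ : ∃ D : ℂ, D = σ - θ * u := ⟨_, rfl⟩
    rw [← hD] at hn ⊢
    obtain ⟨V, hV⟩ : ∃ V : ℂ, V = 1 - u ^ 2 := ⟨_, rfl⟩
    rw [← hV] at hu2 ⊢
    field_simp
    rw [hV, hD]
    linear_combination (u ^ 2 : ℂ) * hsq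
  · have hq0 : σ / θ ≠ 0 := div_ne_zero hσ.ne' hθ
    have hq1 : |σ / θ| < 1 := by
      rw [abs_div, abs_of_pos hσ, div_lt_one (abs_pos.2 hθ)]; exact hgt
    have hmem : θ + σ ^ 2 / θ ∈ K := hout (by
      rcases lt_abs.1 hgt with h | h
      · exact Or.inl h
      · exact Or.inr (by linarith))
    set q := σ / θ with hqd
    have hqq := hq q hq0 hq1
    have hρ : θ + σ ^ 2 / θ = σ * (q + q⁻¹) := by rw [hqd]; field_simp; ring
    rw [hρ] at hmem
    refine (((isStieltjesDiff_dirac hmem hKm).add (hE0.const_mul (-1 / 2))).add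
      ((isStieltjesDiff_resolvent hσ hK hq0 hq1).const_mul
      (-((1 - q ^ 2) * σ / (2 * q))))).congr (by field_simp; ring) fun z hz => ?_
    obtain ⟨u, hu⟩ := exists_isJoukowski hσ hz
    obtain ⟨e, k1, k2⟩ := key q hu hz hq0
    have hu2 := hu.one_sub_sq_ne_zero
    have hu0 := hu.ne_zero
    have hn := hne hu hz
    have hq0' : (q : ℂ) ≠ 0 := by exact_mod_cast hq0
    have hqq' : (1 : ℂ) - (q : ℂ) ^ 2 ≠ 0 := by exact_mod_cast hqq
    have hθq : (θ : ℂ) = σ / q := by rw [hqd]; push_cast; field_simp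
    rw [e, hzu hu hz, hu.gSC_ratio hσ hz, hθq]
    have e2 : (σ : ℂ) * u⁻¹ - σ / q = -(σ * (u - q) / (u * q)) := by field_simp; ring
    rw [e2]
    push_cast
    field_simp
    ring

lemma isStieltjesDiff_edge (hσ : 0 < σ) (hKm : MeasurableSet K)
    (hK : Set.Icc (-2 * σ) (2 * σ) ⊆ K) :
    IsStieltjesDiff K 0 (fun z => (gSC σ z)⁻¹ * gSC₂ σ z * ((σ : ℂ) ^ 2 * gSC₂ σ z)) := by
  have hs' : (σ : ℂ) ≠ 0 := by exact_mod_cast hσ.ne'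
  have h1 := isStieltjesDiff_dirac (K := K) (a := 2 * σ) (hK (by constructor <;> linarith)) hKm
  have h2 := isStieltjesDiff_dirac (K := K) (a := -2 * σ) (hK (by constructor <;> linarith)) hKm
  refine (((h1.const_mul (1 / 4)).add (h2.const_mul (1 / 4))).add
    ((isStieltjesDiff_arcsine hσ hK).const_mul (-1 / 2))).congr (by norm_num) fun z hz => ?_
  obtain ⟨u, hu⟩ := exists_isJoukowski hσ hz
  have hu2 := hu.one_sub_sq_ne_zero
  have hu0 := hu.ne_zero
  rw [hu.gSC_ratio hσ hz, hu.gSC₂_eq hσ hz]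
  have hfac : (1 - u) * (1 + u) ≠ 0 := by
    rw [show (1 - u) * (1 + u) = 1 - u ^ 2 by ring]; exact hu2
  have f1 := left_ne_zero_of_mul hfac
  have f2 := right_ne_zero_of_mul hfac
  have e1 : z - ((2 * σ : ℝ) : ℂ) = σ * (1 - u) ^ 2 / u := by
    rw [hu.eq]; push_cast; field_simp; ring
  have e2 : z - ((-2 * σ : ℝ) : ℂ) = σ * (1 + u) ^ 2 / u := by
    rw [hu.eq]; push_cast; field_simp; ring
  rw [e1, e2, show 1 - u ^ 2 = (1 - u) * (1 + u) by ring]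
  push_cast
  field_simp
  ring

end Correction

end DeformedWigner

namespace DeformedWigner

open scoped Matrix.Norms.L2Operator Matrix

/-! ### Orthonormal bases of Wigner ensembles -/

section WignerBasis

/-- The algebraic properties of the matrices `B p` for which `∑ p, x p • B p` is a Wigner matrix
when the `x p` are independent and identically distributed. -/
structure IsWignerBasis {N : ℕ} {ι : Type} [Fintype ι] (ε c₄ : ℝ)
    (B : ι → Matrix (Fin N) (Fin N) ℂ) : Prop where
  eps_nonneg : 0 ≤ ε
  eps_le : ε ≤ 1
  isHermitian : ∀ p, (B p).IsHermitian
  norm_le : ∀ p, ‖B p‖ ≤ 2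
  norm_trace_mul_le : ∀ p X, ‖(B p * X).trace‖ ≤ 2 * ‖X‖
  card_le : (Fintype.card ι : ℝ) ≤ (N : ℝ) ^ 2
  tensor : ∀ a b c d, ∑ p, B p a b * B p c d =
    (if a = d ∧ b = c then 1 else 0) + (ε : ℂ) * (if a = c ∧ b = d then 1 else 0)
  fourth : ∀ X : Matrix (Fin N) (Fin N) ℂ,
    ‖∑ p, ((B p * X) ^ 4).trace - (c₄ : ℂ) * (∑ i, X i i ^ 2) ^ 2‖ ≤ 100 * N * ‖X‖ ^ 4
  transpose_eq : ε ≠ 0 → ∀ p, (B p)ᵀ = B p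

variable {N : ℕ} {ι : Type} [Fintype ι] {ε c₄ : ℝ} {B : ι → Matrix (Fin N) (Fin N) ℂ}

lemma IsWignerBasis.sum_mul_mul (hB : IsWignerBasis ε c₄ B) (X : Matrix (Fin N) (Fin N) ℂ) :
    ∑ p, B p * X * B p = X.trace • (1 : Matrix (Fin N) (Fin N) ℂ) + (ε : ℂ) • Xᵀ := by
  ext a d
  have h1 : (∑ p, B p * X * B p) a d = ∑ c, ∑ b, X b c * ∑ p, B p a b * B p c d := by
    rw [Matrix.sum_apply]
    simp only [Matrix.mul_apply, Finset.sum_mul, Finset.mul_sum]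
    rw [Finset.sum_comm]
    refine Finset.sum_congr rfl fun c _ => ?_
    rw [Finset.sum_comm]
    refine Finset.sum_congr rfl fun b _ => Finset.sum_congr rfl fun p _ => by ring
  rw [h1]
  simp only [hB.tensor, mul_add, Finset.sum_add_distrib]
  congr 1
  · by_cases had : a = d
    · simp [had, Matrix.trace]
    · simp [had]
  · simp only [Matrix.smul_apply, Matrix.transpose_apply, smul_eq_mul]
    rw [Finset.sum_eq_single a, Finset.sum_eq_single d]
    · simp; ring
    · intro b _ hb; simp [hb]
    · simp
    · intro c _ hc; simp [Ne.symm hc]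
    · simp

lemma IsWignerBasis.sum_trace_mul_trace (hB : IsWignerBasis ε c₄ B)
    (X Y : Matrix (Fin N) (Fin N) ℂ) :
    ∑ p, (B p * X).trace * (B p * Y).trace = (X * Y).trace + (ε : ℂ) * (X * Yᵀ).trace := by
  have h1 : ∑ p, (B p * X).trace * (B p * Y).trace
      = ∑ a, ∑ b, ∑ c, ∑ d, X b a * Y d c * ∑ p, B p a b * B p c d := by
    simp only [Matrix.trace, Matrix.diag_apply, Matrix.mul_apply, Finset.sum_mul, Finset.mul_sum]
    rw [Finset.sum_comm]
    simp only [Finset.sum_comm (s := (Finset.univ : Finset ι))]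
    have hc : ∀ f : Fin N → Fin N → Fin N → Fin N → ℂ,
        ∑ c, ∑ d, ∑ a, ∑ b, f a b c d = ∑ a, ∑ b, ∑ c, ∑ d, f a b c d := by
      intro f
      calc ∑ c, ∑ d, ∑ a, ∑ b, f a b c d = ∑ c, ∑ a, ∑ d, ∑ b, f a b c d :=
            Finset.sum_congr rfl fun c _ => Finset.sum_comm
        _ = ∑ a, ∑ c, ∑ d, ∑ b, f a b c d := Finset.sum_comm
        _ = ∑ a, ∑ c, ∑ b, ∑ d, f a b c d :=
            Finset.sum_congr rfl fun a _ => Finset.sum_congr rfl fun c _ => Finset.sum_comm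
        _ = ∑ a, ∑ b, ∑ c, ∑ d, f a b c d := Finset.sum_congr rfl fun a _ => Finset.sum_comm
    rw [hc]
    refine Finset.sum_congr rfl fun a _ => Finset.sum_congr rfl fun b _ =>
      Finset.sum_congr rfl fun c _ => Finset.sum_congr rfl fun d _ =>
      Finset.sum_congr rfl fun p _ => by ring
  rw [h1]
  simp only [hB.tensor, mul_add, Finset.sum_add_distrib]
  congr 1
  · rw [Finset.sum_comm]
    simp only [Matrix.trace, Matrix.diag_apply, Matrix.mul_apply]
    refine Finset.sum_congr rfl fun b _ => Finset.sum_congr rfl fun a _ => ?_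
    rw [Finset.sum_eq_single b, Finset.sum_eq_single a]
    · simp
    · intro d _ hd; simp [Ne.symm hd]
    · simp
    · intro c _ hc; simp [Ne.symm hc]
    · simp
  · rw [Finset.sum_comm]
    simp only [Matrix.trace, Matrix.diag_apply, Matrix.mul_apply, Matrix.transpose_apply,
      Finset.mul_sum]
    refine Finset.sum_congr rfl fun b _ => Finset.sum_congr rfl fun a _ => ?_
    rw [Finset.sum_eq_single a, Finset.sum_eq_single b]
    · simp; ring
    · intro d _ hd; simp [Ne.symm hd]
    · simp
    · intro c _ hc; simp [Ne.symm hc]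
    · simp

lemma trace_mul_conjTranspose_self (X : Matrix (Fin N) (Fin N) ℂ) :
    (X * Xᴴ).trace = (hsSq X : ℂ) := by
  rw [hsSq, Finset.sum_comm]
  simp only [Matrix.trace, Matrix.diag_apply, Matrix.mul_apply, Matrix.conjTranspose_apply]
  push_cast
  exact Finset.sum_congr rfl fun i _ => Finset.sum_congr rfl fun j _ => Complex.mul_conj' _

lemma norm_trace_mul_star_le (X : Matrix (Fin N) (Fin N) ℂ) :
    ‖(X * Xᴴᵀ).trace‖ ≤ hsSq X := by
  have h1 : ‖(X * Xᴴᵀ).trace‖ ≤ ∑ i, ∑ j, ‖X i j‖ * ‖X j i‖ := by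
    simp only [Matrix.trace, Matrix.diag_apply, Matrix.mul_apply, Matrix.conjTranspose_apply,
      Matrix.transpose_apply]
    refine (norm_sum_le _ _).trans (Finset.sum_le_sum fun i _ => (norm_sum_le _ _).trans ?_)
    exact Finset.sum_le_sum fun j _ => by simp
  have h2 : ∑ i, ∑ j, ‖X i j‖ * ‖X j i‖
      ≤ ∑ i, ∑ j, (1 / 2 * ‖X i j‖ ^ 2 + 1 / 2 * ‖X j i‖ ^ 2) :=
    Finset.sum_le_sum fun i _ => Finset.sum_le_sum fun j _ => by
      nlinarith [sq_nonneg (‖X i j‖ - ‖X j i‖)]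
  refine h1.trans (h2.trans (le_of_eq ?_))
  simp only [Finset.sum_add_distrib, ← Finset.mul_sum]
  rw [Finset.sum_comm]
  simp only [hsSq]
  ring

lemma IsWignerBasis.sum_norm_trace_sq_le (hB : IsWignerBasis ε c₄ B)
    (X : Matrix (Fin N) (Fin N) ℂ) : ∑ p, ‖(B p * X).trace‖ ^ 2 ≤ 2 * hsSq X := by
  have h1 : ∀ p, (((‖(B p * X).trace‖ ^ 2 : ℝ)) : ℂ) = (B p * X).trace * (B p * Xᴴ).trace := by
    intro p
    have : (B p * Xᴴ).trace = star (B p * X).trace := by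
      rw [← Matrix.trace_conjTranspose, Matrix.conjTranspose_mul, (hB.isHermitian p).eq,
        Matrix.trace_mul_comm]
    rw [this]
    push_cast
    exact (Complex.mul_conj' _).symm
  have h2 : ((∑ p, ‖(B p * X).trace‖ ^ 2 : ℝ) : ℂ)
      = (hsSq X : ℂ) + (ε : ℂ) * (X * Xᴴᵀ).trace := by
    rw [Complex.ofReal_sum]
    simp only [h1]
    rw [hB.sum_trace_mul_trace, trace_mul_conjTranspose_self]
  have h3 := congrArg norm h2
  rw [Complex.norm_real, Real.norm_of_nonneg (Finset.sum_nonneg fun _ _ => by positivity)] at h3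
  rw [h3]
  have h0 := hsSq_nonneg X
  have h4 := norm_add_le (hsSq X : ℂ) ((ε : ℂ) * (X * Xᴴᵀ).trace)
  rw [norm_mul, Complex.norm_real, Complex.norm_real, Real.norm_of_nonneg hB.eps_nonneg,
    Real.norm_of_nonneg h0] at h4
  nlinarith [norm_trace_mul_star_le X, hB.eps_le, hB.eps_nonneg,
    norm_nonneg (X * Xᴴᵀ).trace]

lemma IsWignerBasis.sum_mulVec_sq_le (hB : IsWignerBasis ε c₄ B) (u : Fin N → ℂ) :
    ∑ p, ∑ i, ‖(B p *ᵥ u) i‖ ^ 2 ≤ (N + 1) * ∑ i, ‖u i‖ ^ 2 := by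
  have hsq : ∀ w : Fin N → ℂ, star w ⬝ᵥ w = ((∑ i, ‖w i‖ ^ 2 : ℝ) : ℂ) := by
    intro w
    rw [Complex.ofReal_sum]
    refine Finset.sum_congr rfl fun i _ => ?_
    push_cast
    exact Complex.conj_mul' _
  have h1 : ∀ p, star (B p *ᵥ u) ⬝ᵥ (B p *ᵥ u) = star u ⬝ᵥ ((B p * 1 * B p) *ᵥ u) := by
    intro p
    rw [Matrix.star_mulVec, (hB.isHermitian p).eq, mul_one, ← Matrix.mulVec_mulVec,
      ← Matrix.dotProduct_mulVec]
  have h2 : ((∑ p, ∑ i, ‖(B p *ᵥ u) i‖ ^ 2 : ℝ) : ℂ)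
      = (((N + ε) * ∑ i, ‖u i‖ ^ 2 : ℝ) : ℂ) := by
    rw [Complex.ofReal_sum]
    simp only [← hsq, h1]
    rw [← dotProduct_sum, ← Matrix.sum_mulVec, hB.sum_mul_mul]
    rw [Complex.ofReal_mul, ← hsq, Matrix.transpose_one, ← add_smul, Matrix.smul_mulVec,
      Matrix.one_mulVec, dotProduct_smul, Matrix.trace_one]
    simp
  have h3 : ∑ p, ∑ i, ‖(B p *ᵥ u) i‖ ^ 2 = (N + ε) * ∑ i, ‖u i‖ ^ 2 := by exact_mod_cast h2
  rw [h3]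
  have := hB.eps_le
  gcongr

lemma IsWignerBasis.norm_sum_mul_mul_le (hB : IsWignerBasis ε c₄ B)
    (X : ι → Matrix (Fin N) (Fin N) ℂ) {m : ℝ} (hm : 0 ≤ m) (hX : ∀ p, ‖X p‖ ≤ m) :
    ‖∑ p, B p * X p * B p‖ ≤ (N + 1) * m := by
  refine opNorm_le_of_bilin _ (by positivity) fun u v => ?_
  have hcs : ∀ w y : Fin N → ℂ, ‖star w ⬝ᵥ y‖ ≤ √(∑ i, ‖w i‖ ^ 2) * √(∑ i, ‖y i‖ ^ 2) := by
    intro w y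
    refine (norm_sum_le _ _).trans ?_
    simp only [norm_mul, Pi.star_apply, norm_star]
    exact Real.sum_mul_le_sqrt_mul_sqrt _ _ _
  have h1 : star u ⬝ᵥ ((∑ p, B p * X p * B p) *ᵥ v)
      = ∑ p, star (B p *ᵥ u) ⬝ᵥ (X p *ᵥ (B p *ᵥ v)) := by
    rw [Matrix.sum_mulVec, dotProduct_sum]
    refine Finset.sum_congr rfl fun p _ => ?_
    rw [Matrix.star_mulVec, (hB.isHermitian p).eq, ← Matrix.dotProduct_mulVec,
      Matrix.mulVec_mulVec, Matrix.mulVec_mulVec, mul_assoc]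
  have h2 : ∀ p, ‖star (B p *ᵥ u) ⬝ᵥ (X p *ᵥ (B p *ᵥ v))‖
      ≤ m * (√(∑ i, ‖(B p *ᵥ u) i‖ ^ 2) * √(∑ i, ‖(B p *ᵥ v) i‖ ^ 2)) := by
    intro p
    have h3 := sum_norm_mulVec_sq_le (X p) (B p *ᵥ v)
    have h4 : √(∑ i, ‖(X p *ᵥ (B p *ᵥ v)) i‖ ^ 2) ≤ m * √(∑ i, ‖(B p *ᵥ v) i‖ ^ 2) := by
      refine (Real.sqrt_le_sqrt h3).trans ?_
      rw [Real.sqrt_mul (by positivity), Real.sqrt_sq (norm_nonneg _)]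
      gcongr
      exact hX p
    refine (hcs _ _).trans ?_
    calc _ ≤ √(∑ i, ‖(B p *ᵥ u) i‖ ^ 2) * (m * √(∑ i, ‖(B p *ᵥ v) i‖ ^ 2)) := by gcongr
      _ = _ := by ring
  rw [h1]
  refine (norm_sum_le _ _).trans ((Finset.sum_le_sum fun p _ => h2 p).trans ?_)
  rw [← Finset.mul_sum]
  have h5 := Real.sum_mul_le_sqrt_mul_sqrt Finset.univ
    (fun p => √(∑ i, ‖(B p *ᵥ u) i‖ ^ 2)) (fun p => √(∑ i, ‖(B p *ᵥ v) i‖ ^ 2))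
  have h6 : ∀ w : Fin N → ℂ, √(∑ p, √(∑ i, ‖(B p *ᵥ w) i‖ ^ 2) ^ 2)
      ≤ √(N + 1) * √(∑ i, ‖w i‖ ^ 2) := by
    intro w
    rw [← Real.sqrt_mul (by positivity)]
    refine Real.sqrt_le_sqrt (le_trans (le_of_eq ?_) (hB.sum_mulVec_sq_le w))
    exact Finset.sum_congr rfl fun p _ =>
      Real.sq_sqrt (Finset.sum_nonneg fun _ _ => by positivity)
  calc _ ≤ m * ((√(N + 1) * √(∑ i, ‖u i‖ ^ 2)) * (√(N + 1) * √(∑ i, ‖v i‖ ^ 2))) := by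
        gcongr
        exact h5.trans (mul_le_mul (h6 u) (h6 v) (Real.sqrt_nonneg _) (by positivity))
    _ = (√(N + 1) * √(N + 1)) * m * √(∑ i, ‖u i‖ ^ 2) * √(∑ i, ‖v i‖ ^ 2) := by ring
    _ = _ := by rw [Real.mul_self_sqrt (by positivity)]

end WignerBasis

/-! ### The deformation -/

section Deformation

variable {J : ℕ} {θ : Fin J → ℝ} {j₀ : Fin J} {k : Fin J → ℕ} {N : ℕ}

/-- The trace norm of the deformation. -/
def spikeMass (θ : Fin J → ℝ) (j₀ : Fin J) (k : Fin J → ℕ) : ℝ :=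
  ∑ j ∈ Finset.univ.erase j₀, k j * |θ j|

lemma spikeMass_nonneg : 0 ≤ spikeMass θ j₀ k :=
  Finset.sum_nonneg fun _ _ => by positivity

lemma sum_deformation {E : Type*} [AddCommGroup E] [Module ℝ E] (hθ : Function.Injective θ)
    (hj₀ : θ j₀ = 0) {d : Fin N → ℝ}
    (hd : ∀ i, ∃ j, d i = θ j) (hk : ∀ j, j ≠ j₀ → Nat.card {i // d i = θ j} = k j)
    (h : ℝ → E) (h0 : h 0 = 0) :
    ∑ i, h (d i) = ∑ j ∈ Finset.univ.erase j₀, (k j : ℝ) • h (θ j) := by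
  choose f hf using hd
  rw [← Finset.sum_fiberwise Finset.univ f, ← Finset.add_sum_erase _ _ (Finset.mem_univ j₀)]
  have hz : ∑ i with f i = j₀, h (d i) = 0 := by
    refine Finset.sum_eq_zero fun i hi => ?_
    rw [hf i, (Finset.mem_filter.1 hi).2, hj₀, h0]
  rw [hz, zero_add]
  refine Finset.sum_congr rfl fun j hj => ?_
  rw [← hk j (Finset.ne_of_mem_erase hj)]
  have hc : Nat.card {i // d i = θ j} = (Finset.univ.filter fun i => f i = j).card := by
    rw [Nat.card_eq_fintype_card, Fintype.card_subtype]
    congr 1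
    ext i
    simp only [Finset.mem_filter, Finset.mem_univ, true_and, hf i]
    exact hθ.eq_iff
  rw [hc, Nat.cast_smul_eq_nsmul, ← Finset.sum_const]
  exact Finset.sum_congr rfl fun i hi => by rw [hf i, (Finset.mem_filter.1 hi).2]

variable {A : Matrix (Fin N) (Fin N) ℂ}

lemma IsDeformation.exists_eq_conj (hA : IsDeformation θ j₀ k A) :
    ∃ U ∈ Matrix.unitaryGroup (Fin N) ℂ, ∃ d : Fin N → ℝ,
      A = U * Matrix.diagonal (fun i => (d i : ℂ)) * star U ∧ (∀ i, ∃ j, d i = θ j) ∧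
      ∀ j, j ≠ j₀ → Nat.card {i // d i = θ j} = k j := hA

lemma IsDeformation.isHermitian (hA : IsDeformation θ j₀ k A) : A.IsHermitian := by
  obtain ⟨U, _, d, rfl, -, -⟩ := hA.exists_eq_conj
  rw [Matrix.IsHermitian, Matrix.star_eq_conjTranspose, Matrix.conjTranspose_mul,
    Matrix.conjTranspose_mul, Matrix.conjTranspose_conjTranspose, Matrix.diagonal_conjTranspose,
    mul_assoc]
  congr 3
  ext i
  simp

lemma IsDeformation.norm_trace_mul_le (hA : IsDeformation θ j₀ k A)
    (hθ : Function.Injective θ) (hj₀ : θ j₀ = 0) (X : Matrix (Fin N) (Fin N) ℂ) :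
    ‖(A * X).trace‖ ≤ spikeMass θ j₀ k * ‖X‖ := by
  obtain ⟨U, hU, d, rfl, hd, hk⟩ := hA.exists_eq_conj
  have h1 : (U * Matrix.diagonal (fun i => (d i : ℂ)) * star U * X).trace
      = ∑ i, (d i : ℂ) * (star U * X * U) i i := by
    rw [mul_assoc, mul_assoc, Matrix.trace_mul_comm, mul_assoc]
    simp [Matrix.trace, Matrix.diagonal_mul]
  have h2 : ‖star U * X * U‖ ≤ ‖X‖ := by
    have := norm_conj_unitary_le (Unitary.star_mem hU) X
    rwa [star_star] at this
  rw [h1]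
  refine (norm_sum_le _ _).trans ?_
  have h3 := sum_deformation hθ hj₀ hd hk (fun x => |x|) (by simp)
  simp only [smul_eq_mul] at h3
  rw [spikeMass, ← h3, Finset.sum_mul]
  refine Finset.sum_le_sum fun i _ => ?_
  rw [norm_mul, Complex.norm_real, Real.norm_eq_abs]
  exact mul_le_mul_of_nonneg_left ((norm_apply_le _ i i).trans h2) (abs_nonneg _)

lemma IsDeformation.sum_norm_diag_mul_le (hA : IsDeformation θ j₀ k A)
    (hθ : Function.Injective θ) (hj₀ : θ j₀ = 0) (X : Matrix (Fin N) (Fin N) ℂ) :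
    ∑ i, ‖(A * X) i i‖ ≤ spikeMass θ j₀ k * ‖X‖ := by
  have hφ : ∀ w : ℂ, ∃ φ : ℂ, ‖φ‖ ≤ 1 ∧ w * φ = ‖w‖ := by
    intro w
    by_cases hw : w = 0
    · exact ⟨0, by simp, by simp [hw]⟩
    · have hn : (‖w‖ : ℂ) ≠ 0 := by exact_mod_cast norm_ne_zero_iff.2 hw
      refine ⟨(starRingEnd ℂ) w / ‖w‖, ?_, ?_⟩
      · rw [norm_div, RCLike.norm_conj, Complex.norm_real, norm_norm]
        exact div_self_le_one _
      · rw [mul_div_assoc', Complex.mul_conj', div_eq_iff hn]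
        ring
  choose φ hφ1 hφ2 using hφ
  set D := Matrix.diagonal fun i => φ ((A * X) i i) with hD
  have h1 : (A * (X * D)).trace = ((∑ i, ‖(A * X) i i‖ : ℝ) : ℂ) := by
    rw [← mul_assoc, Complex.ofReal_sum]
    simp only [Matrix.trace, Matrix.diag_apply, hD, Matrix.mul_diagonal, hφ2]
  have h2 : ‖D‖ ≤ 1 := by
    rw [hD, Matrix.l2_opNorm_diagonal]
    exact (pi_norm_le_iff_of_nonneg zero_le_one).2 fun i => hφ1 _
  have h3 := hA.norm_trace_mul_le hθ hj₀ (X * D)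
  rw [h1, Complex.norm_real, Real.norm_of_nonneg (Finset.sum_nonneg fun _ _ => norm_nonneg _)] at h3
  refine h3.trans (mul_le_mul_of_nonneg_left ?_ spikeMass_nonneg)
  exact (norm_mul_le _ _).trans (mul_le_of_le_one_right (norm_nonneg _) h2)

lemma IsDeformation.trace_mul_green (hA : IsDeformation θ j₀ k A)
    (hθ : Function.Injective θ) (hj₀ : θ j₀ = 0) {w : ℂ} (hw : w.im ≠ 0) :
    (A * green w A).trace
      = ∑ j ∈ Finset.univ.erase j₀, (k j : ℂ) * ((θ j : ℂ) / (w - (θ j : ℂ))) := by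
  obtain ⟨U, hU, d, rfl, hd, hk⟩ := hA.exists_eq_conj
  rw [(green_conj_diagonal hU d hw).2, conj_unitary_mul hU, trace_conj_unitary hU,
    Matrix.diagonal_mul_diagonal, Matrix.trace_diagonal]
  have h3 := sum_deformation hθ hj₀ hd hk (fun x => (x : ℂ) / (w - x)) (by simp)
  simp only [div_eq_mul_inv] at h3 ⊢
  rw [h3]
  simp

end Deformation

/-! ### The deformed Wigner model and its resolvent -/

section Model

variable {J : ℕ} {θ : Fin J → ℝ} {j₀ : Fin J} {k : Fin J → ℕ} {ε c₄ : ℝ}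

/-- A deformed Wigner model together with a point of the upper half plane. -/
structure Config {J : ℕ} (θ : Fin J → ℝ) (j₀ : Fin J) (k : Fin J → ℕ) (ε c₄ : ℝ) where
  N : ℕ
  N_pos : 0 < N
  ι : Type
  [fintype : Fintype ι]
  [decEq : DecidableEq ι]
  B : ι → Matrix (Fin N) (Fin N) ℂ
  basis : IsWignerBasis ε c₄ B
  A : Matrix (Fin N) (Fin N) ℂ
  deformation : IsDeformation θ j₀ k A
  transpose_A : ε ≠ 0 → Aᵀ = A
  z : ℂ
  im_pos : 0 < z.im

attribute [instance] Config.fintype Config.decEq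

namespace Config

variable (c : Config θ j₀ k ε c₄)

/-- The scaling factor `N ^ (-1/2)`. -/
def s : ℝ := (√(c.N : ℝ))⁻¹

/-- The matrix with coordinates `x`. -/
def M (x : c.ι → ℝ) : Matrix (Fin c.N) (Fin c.N) ℂ := c.A + c.s • ∑ p, x p • c.B p

/-- The resolvent at the point `z`. -/
def G (x : c.ι → ℝ) : Matrix (Fin c.N) (Fin c.N) ℂ := green c.z (c.M x)

/-- The control parameter `1 + 1 / Im z`. -/
def r : ℝ := 1 + c.z.im⁻¹

/-- The joint law of the coordinates. -/
abbrev law (μ : Measure ℝ) : Measure (c.ι → ℝ) := Measure.pi fun _ : c.ι => μ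

lemma N_pos' : (0 : ℝ) < c.N := by exact_mod_cast c.N_pos

lemma one_le_N : (1 : ℝ) ≤ c.N := by exact_mod_cast c.N_pos

lemma N_ne_zero : (c.N : ℂ) ≠ 0 := by exact_mod_cast c.N_pos.ne'

lemma s_nonneg : 0 ≤ c.s := by unfold s; positivity

lemma s_sq : c.s ^ 2 = (c.N : ℝ)⁻¹ := by
  rw [s, inv_pow, Real.sq_sqrt c.N_pos'.le]

lemma im_ne : c.z.im ≠ 0 := c.im_pos.ne'

lemma one_le_r : 1 ≤ c.r := by
  have := c.im_pos
  unfold r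
  linarith [inv_pos.2 this]

lemma r_pos : 0 < c.r := zero_lt_one.trans_le c.one_le_r

lemma inv_im_le_r : c.z.im⁻¹ ≤ c.r := by unfold r; linarith

lemma isHermitian_M (x : c.ι → ℝ) : (c.M x).IsHermitian := by
  refine c.deformation.isHermitian.add ?_
  have : ∀ (a : ℝ) (X : Matrix (Fin c.N) (Fin c.N) ℂ), X.IsHermitian → (a • X).IsHermitian := by
    intro a X hX
    rw [Matrix.IsHermitian, Matrix.conjTranspose_smul, hX.eq, star_trivial]
  refine this _ _ ?_
  rw [Matrix.IsHermitian, Matrix.conjTranspose_sum]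
  exact Finset.sum_congr rfl fun p _ => this _ _ (c.basis.isHermitian p)

lemma continuous_M : Continuous c.M := by
  unfold M
  fun_prop

lemma continuous_G : Continuous c.G :=
  continuous_green_comp c.continuous_M c.isHermitian_M c.im_ne

lemma norm_G_le_inv (x : c.ι → ℝ) : ‖c.G x‖ ≤ c.z.im⁻¹ := by
  have h := norm_green_le (c.isHermitian_M x) c.im_ne
  rwa [abs_of_pos c.im_pos] at h

lemma norm_G_le (x : c.ι → ℝ) : ‖c.G x‖ ≤ c.r := (c.norm_G_le_inv x).trans c.inv_im_le_r

lemma M_update (x : c.ι → ℝ) (p : c.ι) (t : ℝ) :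
    c.M (Function.update x p t) = c.M (Function.update x p 0) + t • (c.s • c.B p) := by
  have h : ∀ u : ℝ, ∑ q, Function.update x p u q • c.B q
      = u • c.B p + ∑ q ∈ Finset.univ.erase p, x q • c.B q := by
    intro u
    rw [← Finset.add_sum_erase _ _ (Finset.mem_univ p), Function.update_self]
    congr 1
    refine Finset.sum_congr rfl fun q hq => ?_
    rw [Function.update_of_ne (Finset.ne_of_mem_erase hq)]
  rw [M, M, h, h]
  module

lemma M_update_sub (x : c.ι → ℝ) (p : c.ι) (t t' : ℝ) :
    c.M (Function.update x p t) - c.M (Function.update x p t') = (t - t') • (c.s • c.B p) := by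
  rw [c.M_update x p t, c.M_update x p t']
  module

lemma isHermitian_smul_B (p : c.ι) : (c.s • c.B p).IsHermitian := by
  rw [Matrix.IsHermitian, Matrix.conjTranspose_smul, (c.basis.isHermitian p).eq, star_trivial]

lemma norm_smul_B_le (p : c.ι) : ‖c.s • c.B p‖ ≤ 2 * c.s := by
  rw [norm_smul, Real.norm_of_nonneg c.s_nonneg, mul_comm]
  exact mul_le_mul_of_nonneg_right (c.basis.norm_le p) c.s_nonneg

lemma G_update (x : c.ι → ℝ) (p : c.ι) (t : ℝ) :
    c.G (Function.update x p t) = c.G (Function.update x p 0)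
      + t • (c.G (Function.update x p 0) * (c.s • c.B p) * c.G (Function.update x p t)) := by
  have h := green_sub_green (c.isHermitian_M (Function.update x p 0))
    (c.isHermitian_M (Function.update x p t)) c.im_ne
  rw [M_update_sub] at h
  have h2 : c.G (Function.update x p 0) - c.G (Function.update x p t) = _ := h
  rw [zero_sub, neg_smul, mul_neg, neg_mul, mul_smul_comm, smul_mul_assoc] at h2
  simp only [G] at h2 ⊢
  rw [← neg_eq_iff_eq_neg.2 h2]
  abel

lemma hasDerivAt_G_update (x : c.ι → ℝ) (p : c.ι) (t : ℝ) :
    HasDerivAt (fun u => c.G (Function.update x p u))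
      (c.G (Function.update x p t) * (c.s • c.B p) * c.G (Function.update x p t)) t := by
  have h := hasDerivAt_green (c.isHermitian_M (Function.update x p 0)) (c.isHermitian_smul_B p)
    c.im_ne t
  simp only [← c.M_update x p] at h
  exact h

lemma transpose_G (hε : ε ≠ 0) (x : c.ι → ℝ) : (c.G x)ᵀ = c.G x := by
  refine transpose_green ?_
  rw [M, Matrix.transpose_add, Matrix.transpose_smul, Matrix.transpose_sum, c.transpose_A hε]
  simp only [Matrix.transpose_smul, c.basis.transpose_eq hε]

lemma integrable_of_bounded (μ : Measure ℝ) [IsProbabilityMeasure μ] {E : Type*}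
    [NormedAddCommGroup E] {f : (c.ι → ℝ) → E} (hf : Continuous f) (K : ℝ)
    (hK : ∀ x, ‖f x‖ ≤ K) : Integrable f (c.law μ) :=
  Integrable.of_bound hf.aestronglyMeasurable K (Eventually.of_forall hK)

/-- The difference between `x p • G` and its fourth order cumulant expansion. -/
def defect (μ : Measure ℝ) (σ : ℝ) (p : c.ι) (x : c.ι → ℝ) : Matrix (Fin c.N) (Fin c.N) ℂ :=
  cumulantDefect σ (fourthCumulant μ) (c.s • c.B p) (fun t => c.G (Function.update x p t)) (x p)

variable {μ : Measure ℝ} {σ : ℝ}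

lemma defect_update (p : c.ι) (x : c.ι → ℝ) (t : ℝ) :
    c.defect μ σ p (Function.update x p t) = cumulantDefect σ (fourthCumulant μ) (c.s • c.B p)
      (fun t => c.G (Function.update x p t)) t := by
  simp [defect, Function.update_idem]

lemma integrable_defect (hμ : IsEntryLaw μ σ) (p : c.ι) :
    Integrable (c.defect μ σ p) (c.law μ) := by
  have := hμ.isProbabilityMeasure
  have hG := c.continuous_G
  have e : c.defect μ σ p = fun x => x p • c.G x - σ ^ 2 • (c.G x * (c.s • c.B p) * c.G x)
      - fourthCumulant μ • (c.G x * (c.s • c.B p) * c.G x * (c.s • c.B p) * c.G x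
        * (c.s • c.B p) * c.G x) := by
    funext x
    simp [defect, cumulantDefect]
  rw [e]
  have hx : Integrable (fun x : c.ι → ℝ => x p) (c.law μ) := by
    have h1 : Integrable (fun x : ℝ => x) μ := by simpa using hμ.integrable_pow (k := 1) (by norm_num)
    exact (measurePreserving_eval (fun _ : c.ι => μ) p).integrable_comp_of_integrable h1
  have hr := c.r_pos.le
  have hs := c.s_nonneg
  have s0 : ∀ x, ‖c.G x‖ ≤ (2 * c.s) ^ 0 * c.r ^ (0 + 1) := fun x => by simpa using c.norm_G_le x
  have ch := fun (x : c.ι → ℝ) (Y : Matrix (Fin c.N) (Fin c.N) ℂ) (m : ℕ) =>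
    norm_mul_chain_le (m := m) hr (by positivity : 0 ≤ 2 * c.s) (c.norm_G_le x)
      (c.norm_smul_B_le p) (Y := Y)
  refine (Integrable.sub ?_ ?_).sub ?_
  · exact hx.smul_bdd c.r hG.aestronglyMeasurable (Eventually.of_forall c.norm_G_le)
  · refine Integrable.smul (σ ^ 2) (c.integrable_of_bounded μ
      (f := fun x => c.G x * (c.s • c.B p) * c.G x) (by fun_prop) ((2 * c.s) ^ 1 * c.r ^ 2)
      fun x => ?_)
    exact ch x _ _ (s0 x)
  · refine Integrable.smul (fourthCumulant μ) (c.integrable_of_bounded μ (by fun_prop)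
      ((2 * c.s) ^ 3 * c.r ^ 4) fun x => ?_)
    have := ch x _ _ (ch x _ _ (ch x _ _ (s0 x)))
    simpa only [mul_assoc] using this

lemma norm_integral_defect_le (hμ : IsEntryLaw μ σ) (p : c.ι) :
    ‖∫ x, c.defect μ σ p x ∂(c.law μ)‖
      ≤ cumulantConst μ σ (fourthCumulant μ) * ((2 * c.s) ^ 5 * c.r ^ 6) := by
  have := hμ.isProbabilityMeasure
  rw [integral_pi_eq_integral_update p (c.integrable_defect hμ p)]
  have h : ∀ x : c.ι → ℝ, ‖∫ t, c.defect μ σ p (Function.update x p t) ∂μ‖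
      ≤ cumulantConst μ σ (fourthCumulant μ) * ((2 * c.s) ^ 5 * c.r ^ 6) := by
    intro x
    simp only [defect_update]
    refine hμ.norm_integral_cumulantDefect_le ?_ (fun t => c.norm_G_le _) (c.norm_smul_B_le p)
      (c.G_update x p)
    exact c.continuous_G.comp (continuous_const.update p continuous_id)
  refine (norm_integral_le_of_norm_le_const (Eventually.of_forall h)).trans ?_
  simp

lemma smul_sum_mul_defect (x : c.ι → ℝ) :
    (c.s : ℂ) • ∑ p, c.B p * c.defect μ σ p x
      = c.z • c.G x - 1 - c.A * c.G x - ((σ : ℂ) ^ 2 / c.N) • ((c.G x).trace • c.G x)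
        - ((ε : ℂ) * σ ^ 2 / c.N) • (c.G x * c.G x)
        - ((fourthCumulant μ : ℂ) / (c.N : ℂ) ^ 2) • ∑ p, (c.B p * c.G x) ^ 4 := by
  set κ := fourthCumulant μ with hκ
  set G := c.G x with hG
  have hs2 : (c.s : ℂ) ^ 2 = (c.N : ℂ)⁻¹ := by
    rw [← Complex.ofReal_pow, c.s_sq]; push_cast; rfl
  have h1 : ∀ p, c.B p * c.defect μ σ p x = (x p : ℂ) • (c.B p * G)
      - ((σ : ℂ) ^ 2 * c.s) • (c.B p * G * c.B p * G)
      - ((κ : ℂ) * c.s ^ 3) • (c.B p * G) ^ 4 := by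
    intro p
    simp only [defect, cumulantDefect, Function.update_eq_self, ← hG, ← hκ, ← Complex.coe_smul,
      mul_smul_comm, smul_mul_assoc, mul_sub, pow_succ, pow_zero, one_mul, ← mul_assoc, smul_smul]
    push_cast
    rfl
  have h2 : c.M x * G = c.z • G - 1 := by
    have := mul_green (c.isHermitian_M x) c.im_ne
    rw [sub_mul, smul_mul_assoc, one_mul] at this
    rw [← this, hG, Config.G]
    abel
  have h3 : c.A * G + (c.s : ℂ) • ∑ p, (x p : ℂ) • (c.B p * G) = c.z • G - 1 := by
    rw [← h2, M, add_mul]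
    simp only [← Complex.coe_smul, smul_mul_assoc, Finset.sum_mul]
  have h4 : ∑ p, c.B p * G * c.B p * G = G.trace • G + (ε : ℂ) • (G * G) := by
    rw [← Finset.sum_mul, c.basis.sum_mul_mul, add_mul, smul_mul_assoc, one_mul, smul_mul_assoc]
    by_cases hε : ε = 0
    · simp [hε]
    · rw [hG, c.transpose_G hε]
  simp only [h1, Finset.sum_sub_distrib, ← Finset.smul_sum, h4]
  have h5 : c.z • G - 1 - c.A * G = (c.s : ℂ) • ∑ p, (x p : ℂ) • (c.B p * G) := by
    rw [← h3]; abel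
  rw [h5]
  have e1 : (σ : ℂ) ^ 2 / c.N = c.s * (σ ^ 2 * c.s) := by rw [div_eq_mul_inv, ← hs2]; ring
  have e2 : (ε : ℂ) * σ ^ 2 / c.N = c.s * (σ ^ 2 * c.s) * ε := by
    rw [div_eq_mul_inv, ← hs2]; ring
  have e3 : (κ : ℂ) / (c.N : ℂ) ^ 2 = c.s * (κ * c.s ^ 3) := by
    rw [div_eq_mul_inv, ← inv_pow, ← hs2]; ring
  rw [e1, e2, e3]
  module

end Config

end Model

/-! ### Orders of magnitude -/

section Small

variable {J : ℕ} {θ : Fin J → ℝ} {j₀ : Fin J} {k : Fin J → ℕ} {ε c₄ : ℝ}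

/-- `f` is bounded by a polynomial in `1 / Im z` times `N ^ (-m)`, uniformly over all models. -/
def IsSmall (m : ℕ) (f : Config θ j₀ k ε c₄ → ℝ) : Prop :=
  ∃ (C : ℝ) (p : ℕ), 0 ≤ C ∧ ∀ c, f c ≤ C * c.r ^ p / (c.N : ℝ) ^ m

namespace IsSmall

variable {m m' : ℕ} {f g : Config θ j₀ k ε c₄ → ℝ}

lemma mono (hf : IsSmall m f) (h : ∀ c, g c ≤ f c) : IsSmall m g := by
  obtain ⟨C, p, hC, hf⟩ := hf
  exact ⟨C, p, hC, fun c => (h c).trans (hf c)⟩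

lemma add (hf : IsSmall m f) (hg : IsSmall m g) : IsSmall m fun c => f c + g c := by
  obtain ⟨C, p, hC, hf⟩ := hf
  obtain ⟨D, q, hD, hg⟩ := hg
  refine ⟨C + D, p + q, by positivity, fun c => ?_⟩
  have h1 := c.one_le_r
  have hN := c.N_pos'
  have e1 : c.r ^ p ≤ c.r ^ (p + q) := pow_le_pow_right₀ h1 (by omega)
  have e2 : c.r ^ q ≤ c.r ^ (p + q) := pow_le_pow_right₀ h1 (by omega)
  calc f c + g c ≤ C * c.r ^ p / (c.N : ℝ) ^ m + D * c.r ^ q / (c.N : ℝ) ^ m :=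
        add_le_add (hf c) (hg c)
    _ ≤ C * c.r ^ (p + q) / (c.N : ℝ) ^ m + D * c.r ^ (p + q) / (c.N : ℝ) ^ m := by gcongr
    _ = _ := by ring

lemma mul (hf : IsSmall m f) (hg : IsSmall m' g) (hf0 : ∀ c, 0 ≤ f c) (hg0 : ∀ c, 0 ≤ g c) :
    IsSmall (m + m') fun c => f c * g c := by
  obtain ⟨C, p, hC, hf⟩ := hf
  obtain ⟨D, q, hD, hg⟩ := hg
  refine ⟨C * D, p + q, by positivity, fun c => ?_⟩
  refine (mul_le_mul (hf c) (hg c) (hg0 c) ((hf0 c).trans (hf c))).trans (le_of_eq ?_)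
  rw [pow_add, pow_add]
  ring

lemma const_mul (hf : IsSmall m f) {a : ℝ} (ha : 0 ≤ a) : IsSmall m fun c => a * f c := by
  obtain ⟨C, p, hC, hf⟩ := hf
  refine ⟨a * C, p, by positivity, fun c => ?_⟩
  refine (mul_le_mul_of_nonneg_left (hf c) ha).trans (le_of_eq ?_)
  ring

lemma weaken (hf : IsSmall m f) (h : m' ≤ m) : IsSmall m' f := by
  obtain ⟨C, p, hC, hf⟩ := hf
  refine ⟨C, p, hC, fun c => (hf c).trans ?_⟩
  have h1 := c.one_le_N
  have := c.r_pos
  have := pow_le_pow_right₀ h1 h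
  have := c.N_pos'
  gcongr

lemma of_sq (hf : IsSmall (2 * m) fun c => f c ^ 2) : IsSmall m f := by
  obtain ⟨C, p, hC, hf⟩ := hf
  refine ⟨√C, p, by positivity, fun c => ?_⟩
  have h1 := c.one_le_r
  have h0 := c.r_pos
  have hN := c.N_pos'
  refine (abs_le_of_sq_le_sq' ?_ (by positivity)).2
  refine (hf c).trans ?_
  rw [div_pow, mul_pow, Real.sq_sqrt hC, ← pow_mul, ← pow_mul, mul_comm m 2]
  gcongr
  omega

end IsSmall

lemma isSmall_r (p : ℕ) : IsSmall 0 fun c : Config θ j₀ k ε c₄ => c.r ^ p :=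
  ⟨1, p, zero_le_one, fun c => by simp⟩

end Small

/-! ### Variance bounds -/

section Variance

variable {J : ℕ} {θ : Fin J → ℝ} {j₀ : Fin J} {k : Fin J → ℕ} {ε c₄ : ℝ} {μ : Measure ℝ}
  {σ : ℝ}

namespace Config

lemma variance_trace_mul_G_le (c : Config θ j₀ k ε c₄) [IsProbabilityMeasure μ] {C : ℝ}
    (hC : HasPoincareConst μ C) (hC0 : 0 ≤ C) (Y : Matrix (Fin c.N) (Fin c.N) ℂ) :
    ∫ x, ‖(Y * c.G x).trace - ∫ y, (Y * c.G y).trace ∂(c.law μ)‖ ^ 2 ∂(c.law μ)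
      ≤ 2 * C * c.r ^ 4 / c.N * hsSq Y := by
  have hG := c.continuous_G
  have hr := c.r_pos
  have hs := c.s_nonneg
  have hN := c.N_pos'
  have hF' : ∀ p, Continuous fun x => (Y * (c.G x * (c.s • c.B p) * c.G x)).trace :=
    fun p => Continuous.matrix_trace (by fun_prop)
  have hK' : ∀ p x, ‖(Y * (c.G x * (c.s • c.B p) * c.G x)).trace‖
      ≤ Fintype.card (Fin c.N) * (‖Y‖ * (c.r * (2 * c.s) * c.r)) := by
    intro p x
    refine (norm_trace_le _).trans ?_
    have h1 := c.norm_G_le x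
    have h2 := c.norm_smul_B_le p
    gcongr
    refine (norm_mul_le _ _).trans ?_
    gcongr
    refine (norm_mul_le _ _).trans ?_
    gcongr
    refine (norm_mul_le _ _).trans ?_
    gcongr
  have h := hC.pi hC0 (ι := c.ι) (F := fun x => (Y * c.G x).trace)
    (F' := fun p x => (Y * (c.G x * (c.s • c.B p) * c.G x)).trace)
    (K := Fintype.card (Fin c.N) * (‖Y‖ * c.r))
    (Continuous.matrix_trace (by fun_prop)) hF'
    (fun x => (norm_trace_le _).trans (by
      have := c.norm_G_le x
      gcongr
      refine (norm_mul_le _ _).trans ?_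
      gcongr)) hK' ?_
  · refine h.trans ?_
    have hint : ∀ p, Integrable (fun x => ‖(Y * (c.G x * (c.s • c.B p) * c.G x)).trace‖ ^ 2)
        (c.law μ) := fun p =>
      c.integrable_of_bounded μ ((hF' p).norm.pow 2)
        ((Fintype.card (Fin c.N) * (‖Y‖ * (c.r * (2 * c.s) * c.r))) ^ 2) fun x => by
          rw [norm_pow, norm_norm]
          exact pow_le_pow_left₀ (norm_nonneg _) (hK' p x) 2
    have hb : ∀ x, ∑ p, ‖(Y * (c.G x * (c.s • c.B p) * c.G x)).trace‖ ^ 2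
        ≤ 2 * c.r ^ 4 / c.N * hsSq Y := by
      intro x
      have e : ∀ p, ‖(Y * (c.G x * (c.s • c.B p) * c.G x)).trace‖ ^ 2
          = (c.N : ℝ)⁻¹ * ‖(c.B p * (c.G x * Y * c.G x)).trace‖ ^ 2 := by
        intro p
        have : (Y * (c.G x * (c.s • c.B p) * c.G x)).trace
            = c.s • (c.B p * (c.G x * Y * c.G x)).trace := by
          rw [mul_smul_comm, smul_mul_assoc, mul_smul_comm, Matrix.trace_smul]
          congr 1
          rw [← mul_assoc, Matrix.trace_mul_comm, ← mul_assoc, ← mul_assoc, Matrix.trace_mul_comm]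
        rw [this, norm_smul, mul_pow, Real.norm_eq_abs, sq_abs, c.s_sq]
      simp only [e]
      rw [← Finset.mul_sum]
      have h1 := c.basis.sum_norm_trace_sq_le (c.G x * Y * c.G x)
      have h2 : hsSq (c.G x * Y * c.G x) ≤ c.r ^ 2 * hsSq Y * c.r ^ 2 := by
        refine (hsSq_mul_le' _ _).trans ?_
        have hG1 := c.norm_G_le x
        have := hsSq_nonneg Y
        have := hsSq_mul_le (c.G x) Y
        have : hsSq (c.G x * Y) ≤ c.r ^ 2 * hsSq Y := this.trans (by gcongr)
        gcongr
      calc (c.N : ℝ)⁻¹ * ∑ p, ‖(c.B p * (c.G x * Y * c.G x)).trace‖ ^ 2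
          ≤ (c.N : ℝ)⁻¹ * (2 * (c.r ^ 2 * hsSq Y * c.r ^ 2)) := by
            gcongr
            exact h1.trans (by gcongr)
        _ = _ := by ring
    rw [← integral_finsetSum _ fun p _ => hint p]
    have h3 : ∫ x, ∑ p, ‖(Y * (c.G x * (c.s • c.B p) * c.G x)).trace‖ ^ 2 ∂(c.law μ)
        ≤ ∫ _, 2 * c.r ^ 4 / c.N * hsSq Y ∂(c.law μ) :=
      integral_mono (integrable_finsetSum _ fun p _ => hint p) (integrable_const _) hb
    rw [integral_const, probReal_univ, one_smul] at h3
    refine (mul_le_mul_of_nonneg_left h3 hC0).trans (le_of_eq ?_)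
    ring
  · intro p x t
    have h1 := c.hasDerivAt_G_update x p t
    have h2 := h1.const_mul Y
    exact ((Matrix.traceLinearMap (Fin c.N) ℝ ℂ).toContinuousLinearMap.hasFDerivAt.comp_hasDerivAt t
      h2)

end Config

lemma sq_integral_norm_le {α : Type*} [MeasurableSpace α] [TopologicalSpace α]
    [OpensMeasurableSpace α] [SecondCountableTopology α] {P : Measure α} [IsProbabilityMeasure P]
    {f : α → ℂ} (hf : Continuous f) {K : ℝ} (hK : ∀ x, ‖f x‖ ≤ K) :
    (∫ x, ‖f x‖ ∂P) ^ 2 ≤ ∫ x, ‖f x‖ ^ 2 ∂P := by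
  have h := norm_integral_sq_le (P := P) (f := fun x => ((‖f x‖ : ℝ) : ℂ))
    (memLp_two_of_continuous_bounded (by fun_prop) (K := K) fun x => by
      rw [Complex.norm_real, norm_norm]; exact hK x)
  rw [integral_complex_ofReal, Complex.norm_real, Real.norm_eq_abs, sq_abs] at h
  refine h.trans (le_of_eq ?_)
  simp

end Variance

/-! ### The master equation -/

section Master

variable {J : ℕ} {θ : Fin J → ℝ} {j₀ : Fin J} {k : Fin J → ℕ} {ε c₄ : ℝ} {μ : Measure ℝ}
  {σ : ℝ}

namespace Config

variable (c : Config θ j₀ k ε c₄)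

lemma exists_bound_comp_G {E : Type*} [NormedAddCommGroup E]
    {h : Matrix (Fin c.N) (Fin c.N) ℂ → E} (hh : Continuous h) :
    ∃ K, ∀ x, ‖h (c.G x)‖ ≤ K := by
  have : ProperSpace (Matrix (Fin c.N) (Fin c.N) ℂ) := FiniteDimensional.proper ℂ _
  obtain ⟨K, hK⟩ := (isCompact_closedBall (0 : Matrix (Fin c.N) (Fin c.N) ℂ)
    c.r).exists_bound_of_continuousOn hh.continuousOn
  exact ⟨K, fun x => hK _ (by simpa using c.norm_G_le x)⟩

lemma integrable_comp_G (μ : Measure ℝ) [IsProbabilityMeasure μ] {E : Type*}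
    [NormedAddCommGroup E] {h : Matrix (Fin c.N) (Fin c.N) ℂ → E} (hh : Continuous h) :
    Integrable (fun x => h (c.G x)) (c.law μ) := by
  obtain ⟨K, hK⟩ := c.exists_bound_comp_G hh
  exact c.integrable_of_bounded μ (hh.comp c.continuous_G) K hK

/-- The normalized trace of the resolvent. -/
def t (x : c.ι → ℝ) : ℂ := (c.G x).trace / c.N

/-- The expected normalized trace of the resolvent. -/
def gN (μ : Measure ℝ) : ℂ := ∫ x, c.t x ∂(c.law μ)

/-- The expected resolvent. -/
def EG (μ : Measure ℝ) : Matrix (Fin c.N) (Fin c.N) ℂ := ∫ x, c.G x ∂(c.law μ)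

/-- The contribution of the deformation to the master equation. -/
def aN (μ : Measure ℝ) : ℂ := (c.A * c.EG μ).trace / c.N

/-- The expected normalized trace of the squared resolvent. -/
def qN (μ : Measure ℝ) : ℂ := ∫ x, (c.G x * c.G x).trace / c.N ∂(c.law μ)

/-- The contribution of the fourth cumulant to the master equation. -/
def fN (μ : Measure ℝ) : ℂ := ∫ x, (∑ p, ((c.B p * c.G x) ^ 4).trace) / (c.N : ℂ) ^ 2 ∂(c.law μ)

/-- The error in the matrix master equation. -/
def err (μ : Measure ℝ) (σ : ℝ) : Matrix (Fin c.N) (Fin c.N) ℂ :=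
  (c.s : ℂ) • ∑ p, c.B p * ∫ x, c.defect μ σ p x ∂(c.law μ)

lemma trace_integral {α : Type*} [MeasurableSpace α] {P : Measure α} {n : Type*} [Fintype n]
    [DecidableEq n] {f : α → Matrix n n ℂ} (hf : Integrable f P) :
    (∫ x, f x ∂P).trace = ∫ x, (f x).trace ∂P :=
  ((Matrix.traceLinearMap n ℂ ℂ).toContinuousLinearMap.integral_comp_comm hf).symm

lemma mul_integral {α : Type*} [MeasurableSpace α] {P : Measure α} {n : Type*} [Fintype n]
    [DecidableEq n] {f : α → Matrix n n ℂ} (hf : Integrable f P) (Y : Matrix n n ℂ) :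
    Y * (∫ x, f x ∂P) = ∫ x, Y * f x ∂P :=
  ((LinearMap.mulLeft ℂ Y).toContinuousLinearMap.integral_comp_comm hf).symm

lemma err_eq (hμ : IsEntryLaw μ σ) :
    c.err μ σ = c.z • c.EG μ - 1 - c.A * c.EG μ
      - ((σ : ℂ) ^ 2 / c.N) • (∫ x, (c.G x).trace • c.G x ∂(c.law μ))
      - ((ε : ℂ) * σ ^ 2 / c.N) • (∫ x, c.G x * c.G x ∂(c.law μ))
      - ((fourthCumulant μ : ℂ) / (c.N : ℂ) ^ 2) •
          ∫ x, ∑ p, (c.B p * c.G x) ^ 4 ∂(c.law μ) := by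
  have := hμ.isProbabilityMeasure
  have hd := fun p => c.integrable_defect hμ p
  have h1 : c.err μ σ = ∫ x, (c.s : ℂ) • ∑ p, c.B p * c.defect μ σ p x ∂(c.law μ) := by
    rw [integral_smul, integral_finsetSum]
    · simp only [err, mul_integral (hd _)]
    · exact fun p _ => (hd p).const_mul _
  rw [h1]
  simp only [smul_sum_mul_defect]
  have ig := fun {h : Matrix (Fin c.N) (Fin c.N) ℂ → Matrix (Fin c.N) (Fin c.N) ℂ}
    (hh : Continuous h) => c.integrable_comp_G μ hh
  have i1 : Integrable (fun x => c.G x) (c.law μ) := ig (h := fun X => X) continuous_id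
  have i2 : Integrable (fun x => c.z • c.G x) (c.law μ) := i1.smul c.z
  have i3 : Integrable (fun x => c.A * c.G x) (c.law μ) := i1.const_mul _
  have i4 : Integrable (fun x => (c.G x).trace • c.G x) (c.law μ) :=
    ig (h := fun X => X.trace • X) ((Continuous.matrix_trace continuous_id).smul continuous_id)
  have i5 : Integrable (fun x => c.G x * c.G x) (c.law μ) := ig (h := fun X => X * X) (by fun_prop)
  have i6 : Integrable (fun x => ∑ p, (c.B p * c.G x) ^ 4) (c.law μ) :=
    ig (h := fun X => ∑ p, (c.B p * X) ^ 4) (by fun_prop)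
  have k4 := i4.smul ((σ : ℂ) ^ 2 / c.N)
  have k5 := i5.smul ((ε : ℂ) * σ ^ 2 / c.N)
  have k6 := i6.smul ((fourthCumulant μ : ℂ) / (c.N : ℂ) ^ 2)
  have l1 := i2.sub (integrable_const (μ := c.law μ) (1 : Matrix (Fin c.N) (Fin c.N) ℂ))
  have l3 := l1.sub i3
  have l4 := l3.sub k4
  have l5 := l4.sub k5
  simp only [Pi.sub_def, Pi.smul_def] at k4 k5 k6 l1 l3 l4 l5
  rw [integral_sub l5 k6, integral_sub l4 k5, integral_sub l3 k4, integral_sub l1 i3,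
    integral_sub i2 (integrable_const _),
    integral_smul, integral_smul, integral_smul, integral_smul, ← mul_integral i1,
    integral_const, probReal_univ, one_smul]
  rfl

lemma card_mul_le {a : ℝ} (ha : 0 ≤ a) :
    (Fintype.card c.ι : ℝ) * (c.s ^ 6 * a) ≤ a / c.N := by
  have hN := c.N_pos'
  have h6 : c.s ^ 6 = ((c.N : ℝ)⁻¹) ^ 3 := by rw [← c.s_sq]; ring
  rw [h6]
  calc (Fintype.card c.ι : ℝ) * (((c.N : ℝ)⁻¹) ^ 3 * a)
      ≤ (c.N : ℝ) ^ 2 * (((c.N : ℝ)⁻¹) ^ 3 * a) := by gcongr; exact c.basis.card_le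
    _ = a / c.N := by field_simp

lemma norm_err_le (hμ : IsEntryLaw μ σ) :
    ‖c.err μ σ‖ ≤ 64 * cumulantConst μ σ (fourthCumulant μ) * c.r ^ 6 / c.N := by
  have hK := IsEntryLaw.cumulantConst_nonneg (μ := μ) (σ := σ) (fourthCumulant μ)
  have hs := c.s_nonneg
  have hr := c.r_pos
  rw [err, norm_smul, Complex.norm_real, Real.norm_of_nonneg hs]
  have h : ‖∑ p, c.B p * ∫ x, c.defect μ σ p x ∂(c.law μ)‖ ≤ ∑ _p : c.ι,
      2 * (cumulantConst μ σ (fourthCumulant μ) * ((2 * c.s) ^ 5 * c.r ^ 6)) := by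
    refine (norm_sum_le _ _).trans (Finset.sum_le_sum fun p _ => (norm_mul_le _ _).trans ?_)
    exact mul_le_mul (c.basis.norm_le p) (c.norm_integral_defect_le hμ p) (norm_nonneg _)
      (by norm_num)
  refine (mul_le_mul_of_nonneg_left h hs).trans ?_
  rw [Finset.sum_const, Finset.card_univ, nsmul_eq_mul]
  refine le_trans (le_of_eq ?_) (c.card_mul_le
    (a := 64 * cumulantConst μ σ (fourthCumulant μ) * c.r ^ 6) (by positivity))
  ring

lemma norm_trace_err_le (hμ : IsEntryLaw μ σ) :
    ‖(c.err μ σ).trace / c.N‖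
      ≤ 64 * cumulantConst μ σ (fourthCumulant μ) * c.r ^ 6 / (c.N : ℝ) ^ 2 := by
  have hK := IsEntryLaw.cumulantConst_nonneg (μ := μ) (σ := σ) (fourthCumulant μ)
  have hs := c.s_nonneg
  have hr := c.r_pos
  have hN := c.N_pos'
  have h : ‖(c.err μ σ).trace‖ ≤ 64 * cumulantConst μ σ (fourthCumulant μ) * c.r ^ 6 / c.N := by
    rw [err, Matrix.trace_smul, Matrix.trace_sum, norm_smul, Complex.norm_real,
      Real.norm_of_nonneg hs]
    have h : ‖∑ p, (c.B p * ∫ x, c.defect μ σ p x ∂(c.law μ)).trace‖ ≤ ∑ _p : c.ι,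
        2 * (cumulantConst μ σ (fourthCumulant μ) * ((2 * c.s) ^ 5 * c.r ^ 6)) := by
      refine (norm_sum_le _ _).trans (Finset.sum_le_sum fun p _ =>
        (c.basis.norm_trace_mul_le p _).trans ?_)
      exact mul_le_mul_of_nonneg_left (c.norm_integral_defect_le hμ p) (by norm_num)
    refine (mul_le_mul_of_nonneg_left h hs).trans ?_
    rw [Finset.sum_const, Finset.card_univ, nsmul_eq_mul]
    refine le_trans (le_of_eq ?_) (c.card_mul_le
      (a := 64 * cumulantConst μ σ (fourthCumulant μ) * c.r ^ 6) (by positivity))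
    ring
  rw [norm_div, Complex.norm_natCast, sq, ← div_div]
  gcongr

lemma trace_err_eq (hμ : IsEntryLaw μ σ) :
    (c.err μ σ).trace / c.N = c.z * c.gN μ - 1 - c.aN μ
      - (σ : ℂ) ^ 2 * (∫ x, c.t x ^ 2 ∂(c.law μ)) - ((ε : ℂ) * σ ^ 2 / c.N) * c.qN μ
      - ((fourthCumulant μ : ℂ) / c.N) * c.fN μ := by
  have := hμ.isProbabilityMeasure
  have hN := c.N_ne_zero
  have ig := fun {h : Matrix (Fin c.N) (Fin c.N) ℂ → Matrix (Fin c.N) (Fin c.N) ℂ}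
    (hh : Continuous h) => c.integrable_comp_G μ hh
  have e1 : c.gN μ = (c.EG μ).trace / c.N := by
    rw [EG, trace_integral (ig (h := fun X => X) continuous_id), ← integral_div]
    rfl
  have e2 : c.qN μ = (∫ x, c.G x * c.G x ∂(c.law μ)).trace / c.N := by
    rw [trace_integral (ig (h := fun X => X * X) (by fun_prop)), ← integral_div]
    rfl
  have e3 : c.fN μ = (∫ x, ∑ p, (c.B p * c.G x) ^ 4 ∂(c.law μ)).trace / (c.N : ℂ) ^ 2 := by
    rw [trace_integral (ig (h := fun X => ∑ p, (c.B p * X) ^ 4) (by fun_prop)), ← integral_div]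
    simp only [fN, Matrix.trace_sum]
  have e4 : ∫ x, c.t x ^ 2 ∂(c.law μ)
      = (∫ x, (c.G x).trace • c.G x ∂(c.law μ)).trace / (c.N : ℂ) ^ 2 := by
    rw [trace_integral (ig (h := fun X => X.trace • X)
      ((Continuous.matrix_trace continuous_id).smul continuous_id)), ← integral_div]
    simp only [t, Matrix.trace_smul, smul_eq_mul]
    congr 1
    funext x
    ring
  rw [c.err_eq hμ, e1, e2, e3, e4, aN]
  simp only [Matrix.trace_sub, Matrix.trace_smul, Matrix.trace_one, smul_eq_mul, Fintype.card_fin]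
  field_simp

lemma continuous_t : Continuous c.t := by
  unfold t
  exact (Continuous.matrix_trace c.continuous_G).div_const _

lemma norm_t_le (x : c.ι → ℝ) : ‖c.t x‖ ≤ c.r := by
  have hN := c.N_pos'
  rw [t, norm_div, Complex.norm_natCast, div_le_iff₀ hN, mul_comm]
  refine (norm_trace_le _).trans ?_
  rw [Fintype.card_fin]
  gcongr
  exact c.norm_G_le x

lemma norm_integral_le_of_bound [IsProbabilityMeasure μ] {E : Type*} [NormedAddCommGroup E]
    [NormedSpace ℝ E] {f : (c.ι → ℝ) → E} {K : ℝ} (hK : ∀ x, ‖f x‖ ≤ K) :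
    ‖∫ x, f x ∂(c.law μ)‖ ≤ K := by
  refine (norm_integral_le_of_norm_le_const (Eventually.of_forall hK)).trans ?_
  simp

lemma norm_gN_le [IsProbabilityMeasure μ] : ‖c.gN μ‖ ≤ c.r :=
  c.norm_integral_le_of_bound c.norm_t_le

lemma norm_EG_le [IsProbabilityMeasure μ] : ‖c.EG μ‖ ≤ c.r :=
  c.norm_integral_le_of_bound c.norm_G_le

lemma im_gN_nonpos [IsProbabilityMeasure μ] : (c.gN μ).im ≤ 0 := by
  have hi : Integrable c.t (c.law μ) := c.integrable_of_bounded μ c.continuous_t _ c.norm_t_le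
  have h : (c.gN μ).im = ∫ x, (c.t x).im ∂(c.law μ) :=
    (Complex.imCLM.integral_comp_comm hi).symm
  rw [h]
  refine integral_nonpos fun x => ?_
  have := im_trace_green_nonpos (c.isHermitian_M x) c.im_pos
  simp only [t, Pi.zero_apply]
  rw [Complex.div_natCast_im]
  exact div_nonpos_of_nonpos_of_nonneg this c.N_pos'.le

lemma variance_t_le [IsProbabilityMeasure μ] {C : ℝ} (hC : HasPoincareConst μ C) (hC0 : 0 ≤ C) :
    ∫ x, ‖c.t x - c.gN μ‖ ^ 2 ∂(c.law μ) ≤ 2 * C * c.r ^ 4 / (c.N : ℝ) ^ 2 := by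
  have hN := c.N_pos'
  have h := c.variance_trace_mul_G_le hC hC0 ((c.N : ℂ)⁻¹ • 1)
  have e : ∀ x, ((c.N : ℂ)⁻¹ • (1 : Matrix (Fin c.N) (Fin c.N) ℂ) * c.G x).trace = c.t x := by
    intro x
    rw [smul_mul_assoc, one_mul, Matrix.trace_smul, t, smul_eq_mul]
    ring
  simp only [e] at h
  refine h.trans (le_of_eq ?_)
  rw [hsSq_smul, ← Matrix.diagonal_one, hsSq_diagonal]
  simp
  field_simp

lemma integral_t_sq_sub [IsProbabilityMeasure μ] :
    ‖(∫ x, c.t x ^ 2 ∂(c.law μ)) - c.gN μ ^ 2‖ ≤ ∫ x, ‖c.t x - c.gN μ‖ ^ 2 ∂(c.law μ) := by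
  have hi : Integrable c.t (c.law μ) := c.integrable_of_bounded μ c.continuous_t _ c.norm_t_le
  have hi2 : Integrable (fun x => c.t x ^ 2) (c.law μ) :=
    c.integrable_of_bounded μ (c.continuous_t.pow 2) (c.r ^ 2) fun x => by
      rw [norm_pow]; exact pow_le_pow_left₀ (norm_nonneg _) (c.norm_t_le x) 2
  have e : (∫ x, c.t x ^ 2 ∂(c.law μ)) - c.gN μ ^ 2
      = ∫ x, (c.t x - c.gN μ) ^ 2 ∂(c.law μ) := by
    have : ∀ x, (c.t x - c.gN μ) ^ 2 = c.t x ^ 2 - 2 * c.gN μ * c.t x + c.gN μ ^ 2 := by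
      intro x; ring
    simp only [this]
    rw [integral_add (f := fun x => c.t x ^ 2 - 2 * c.gN μ * c.t x)
      (hi2.sub (hi.const_mul _)) (integrable_const _), integral_sub hi2 (hi.const_mul _),
      integral_const_mul, integral_const, probReal_univ, one_smul]
    have : ∫ x, c.t x ∂(c.law μ) = c.gN μ := rfl
    rw [this]
    ring
  rw [e]
  refine (norm_integral_le_integral_norm _).trans (le_of_eq ?_)
  simp

end Config

end Master

/-! ### The expansion of the expected Stieltjes transform -/

section Expansion

variable {J : ℕ} {θ : Fin J → ℝ} {j₀ : Fin J} {k : Fin J → ℕ} {ε c₄ : ℝ} {μ : Measure ℝ}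
  {σ : ℝ}

namespace Config

variable (c : Config θ j₀ k ε c₄)

/-- The scalar error in the master equation. -/
def scalarErr (μ : Measure ℝ) (σ : ℝ) : ℂ :=
  (σ : ℂ) ^ 2 * ((∫ x, c.t x ^ 2 ∂(c.law μ)) - c.gN μ ^ 2) + (c.err μ σ).trace / c.N

lemma gN_sub_mul (hσ : 0 < σ) (hμ : IsEntryLaw μ σ) :
    (c.gN μ - gSC σ c.z) * (c.z - (σ : ℂ) ^ 2 * (c.gN μ + gSC σ c.z))
      = c.aN μ + ((ε : ℂ) * σ ^ 2 / c.N) * c.qN μ + ((fourthCumulant μ : ℂ) / c.N) * c.fN μ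
        + c.scalarErr μ σ := by
  have h1 := c.trace_err_eq hμ
  have h2 := gSC_quadratic hσ c.im_ne
  rw [scalarErr]
  linear_combination -h1 - h2

lemma im_le_norm {w : ℂ} (h : c.z.im ≤ w.im) {u : ℂ} : ‖u‖ ≤ c.r * ‖u * w‖ := by
  have hy := c.im_pos
  have h1 : c.z.im ≤ ‖w‖ := h.trans ((le_abs_self _).trans (Complex.abs_im_le_norm w))
  have h2 := c.inv_im_le_r
  rw [norm_mul]
  calc ‖u‖ = c.z.im⁻¹ * (‖u‖ * c.z.im) := by field_simp
    _ ≤ c.r * (‖u‖ * ‖w‖) := by gcongr; exact c.r_pos.le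

lemma norm_gSC_le_r (hσ : 0 < σ) : ‖gSC σ c.z‖ ≤ c.r := by
  have h := norm_gSC_le hσ c.im_ne
  rw [abs_of_pos c.im_pos] at h
  exact h.trans c.inv_im_le_r

lemma im_sub_ge (σ : ℝ) {u : ℂ} (hu : u.im ≤ 0) : c.z.im ≤ (c.z - (σ : ℂ) ^ 2 * u).im := by
  rw [Complex.sub_im, ← Complex.ofReal_pow, Complex.im_ofReal_mul]
  nlinarith [sq_nonneg σ]

lemma norm_aN_le [IsProbabilityMeasure μ] (hθ : Function.Injective θ) (hj₀ : θ j₀ = 0) :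
    ‖c.aN μ‖ ≤ spikeMass θ j₀ k * c.r ^ 1 / (c.N : ℝ) ^ 1 := by
  have hN := c.N_pos'
  have h0 : 0 ≤ spikeMass θ j₀ k := spikeMass_nonneg
  rw [aN, norm_div, Complex.norm_natCast, pow_one, pow_one]
  gcongr
  exact (c.deformation.norm_trace_mul_le hθ hj₀ _).trans (by gcongr; exact c.norm_EG_le)

lemma norm_qN_le [IsProbabilityMeasure μ] : ‖c.qN μ‖ ≤ c.r ^ 2 := by
  refine c.norm_integral_le_of_bound fun x => ?_
  have hN := c.N_pos'
  rw [norm_div, Complex.norm_natCast, div_le_iff₀ hN, mul_comm]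
  refine (norm_trace_le _).trans ?_
  rw [Fintype.card_fin]
  gcongr
  refine (norm_mul_le _ _).trans ?_
  rw [sq]
  have := c.norm_G_le x
  have := c.r_pos
  gcongr

/-- The average of the squared diagonal entries of the resolvent. -/
def diagSq (x : c.ι → ℝ) : ℂ := (∑ i, c.G x i i ^ 2) / c.N

lemma norm_diagSq_le (x : c.ι → ℝ) : ‖c.diagSq x‖ ≤ c.r ^ 2 := by
  have hN := c.N_pos'
  rw [diagSq, norm_div, Complex.norm_natCast, div_le_iff₀ hN, mul_comm]
  refine (norm_sum_le _ _).trans ((Finset.sum_le_sum fun i _ => ?_).trans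
    (le_of_eq (a := ∑ _i : Fin c.N, c.r ^ 2) (by simp)))
  rw [norm_pow]
  exact pow_le_pow_left₀ (norm_nonneg _) ((norm_apply_le _ i i).trans (c.norm_G_le x)) 2

lemma norm_fourth_sub_le (x : c.ι → ℝ) :
    ‖(∑ p, ((c.B p * c.G x) ^ 4).trace) / (c.N : ℂ) ^ 2 - (c₄ : ℂ) * c.diagSq x ^ 2‖
      ≤ 100 * c.r ^ 4 / (c.N : ℝ) ^ 1 := by
  have hN := c.N_pos'
  have hN' := c.N_ne_zero
  have h := c.basis.fourth (c.G x)
  have e : (∑ p, ((c.B p * c.G x) ^ 4).trace) / (c.N : ℂ) ^ 2 - (c₄ : ℂ) * c.diagSq x ^ 2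
      = (∑ p, ((c.B p * c.G x) ^ 4).trace - (c₄ : ℂ) * (∑ i, c.G x i i ^ 2) ^ 2)
        / (c.N : ℂ) ^ 2 := by
    rw [diagSq]; field_simp
  rw [e, norm_div, norm_pow, Complex.norm_natCast, div_le_iff₀ (by positivity)]
  refine h.trans ?_
  have := c.norm_G_le x
  calc 100 * (c.N : ℝ) * ‖c.G x‖ ^ 4 ≤ 100 * (c.N : ℝ) * c.r ^ 4 := by gcongr
    _ = _ := by field_simp

lemma continuous_apply_G (i j : Fin c.N) : Continuous fun x => c.G x i j :=
  c.continuous_G.matrix_elem i j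

lemma continuous_diagSq : Continuous c.diagSq := by
  unfold diagSq
  have := fun i => c.continuous_apply_G i i
  fun_prop

lemma norm_fN_le [IsProbabilityMeasure μ] : ‖c.fN μ‖ ≤ (100 + |c₄|) * c.r ^ 4 := by
  refine c.norm_integral_le_of_bound fun x => ?_
  have h1 := c.norm_fourth_sub_le x
  have h2 : ‖(c₄ : ℂ) * c.diagSq x ^ 2‖ ≤ |c₄| * c.r ^ 4 := by
    rw [norm_mul, norm_pow, Complex.norm_real, Real.norm_eq_abs, show c.r ^ 4 = (c.r ^ 2) ^ 2 by ring]
    have := c.norm_diagSq_le x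
    gcongr
  have h3 : 100 * c.r ^ 4 / (c.N : ℝ) ^ 1 ≤ 100 * c.r ^ 4 := by
    have := c.r_pos
    rw [pow_one]
    exact div_le_self (by positivity) c.one_le_N
  have h4 := norm_add_le ((∑ p, ((c.B p * c.G x) ^ 4).trace) / (c.N : ℂ) ^ 2
    - (c₄ : ℂ) * c.diagSq x ^ 2) ((c₄ : ℂ) * c.diagSq x ^ 2)
  rw [sub_add_cancel] at h4
  linarith

lemma norm_sum_fourth_le (x : c.ι → ℝ) :
    ‖∑ p, (c.B p * c.G x) ^ 4‖ ≤ 8 * c.r ^ 4 * c.N := by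
  have e : ∑ p, (c.B p * c.G x) ^ 4
      = (∑ p, c.B p * (c.G x * c.B p * (c.G x * c.B p * c.G x)) * c.B p) * c.G x := by
    rw [Finset.sum_mul]
    refine Finset.sum_congr rfl fun p _ => ?_
    simp only [pow_succ, pow_zero, one_mul, mul_assoc]
  have hr := c.r_pos
  have hG := c.norm_G_le x
  have h1 : ∀ p, ‖c.G x * c.B p * (c.G x * c.B p * c.G x)‖ ≤ 2 ^ 2 * c.r ^ 3 := fun p =>
    norm_mul_chain_le (m := 1) hr.le zero_le_two hG (c.basis.norm_le p)
      (norm_mul_chain_le (m := 0) hr.le zero_le_two hG (c.basis.norm_le p) (by simpa using hG))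
  have h2 := c.basis.norm_sum_mul_mul_le _ (by positivity) h1
  rw [e]
  refine (norm_mul_le _ _).trans ?_
  have hN := c.one_le_N
  calc _ ≤ ((c.N + 1) * (2 ^ 2 * c.r ^ 3)) * c.r := by gcongr
    _ ≤ ((c.N + c.N) * (2 ^ 2 * c.r ^ 3)) * c.r := by gcongr
    _ = _ := by ring

/-- The deterministic approximation of the resolvent. -/
def Ghat (σ : ℝ) : Matrix (Fin c.N) (Fin c.N) ℂ := green (c.z - (σ : ℂ) ^ 2 * gSC σ c.z) c.A

lemma im_shift_ge (hσ : 0 < σ) : c.z.im ≤ (c.z - (σ : ℂ) ^ 2 * gSC σ c.z).im :=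
  c.im_sub_ge σ (im_gSC_nonpos hσ c.im_pos)

lemma norm_Ghat_le (hσ : 0 < σ) : ‖c.Ghat σ‖ ≤ c.r := by
  have h := c.im_shift_ge hσ
  have hy := c.im_pos
  have h' := hy.trans_le h
  refine (norm_green_le c.deformation.isHermitian h'.ne').trans ?_
  rw [abs_of_pos h']
  exact (inv_anti₀ hy h).trans c.inv_im_le_r

lemma norm_EG_sub_le (hσ : 0 < σ) (hμ : IsEntryLaw μ σ) :
    ‖c.EG μ - c.Ghat σ‖ ≤ c.r * (‖c.err μ σ‖ + σ ^ 2 * (∫ x, ‖c.t x - c.gN μ‖ ∂(c.law μ)) * c.r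
      + σ ^ 2 * ‖c.gN μ - gSC σ c.z‖ * c.r + |ε| * σ ^ 2 * c.r ^ 2 * (c.N : ℝ)⁻¹
      + 8 * |fourthCumulant μ| * c.r ^ 4 * (c.N : ℝ)⁻¹) := by
  have := hμ.isProbabilityMeasure
  have hr := c.r_pos
  have hN := c.N_pos'
  have hN' := c.N_ne_zero
  set w := c.z - (σ : ℂ) ^ 2 * gSC σ c.z with hw
  have hwim : w.im ≠ 0 := (c.im_pos.trans_le (c.im_shift_ge hσ)).ne'
  have hi : Integrable c.G (c.law μ) := c.integrable_of_bounded μ c.continuous_G _ c.norm_G_le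
  have hit : Integrable (fun x => (c.t x - c.gN μ) • c.G x) (c.law μ) :=
    c.integrable_of_bounded μ ((c.continuous_t.sub continuous_const).smul c.continuous_G)
      ((c.r + c.r) * c.r) fun x => by
        rw [norm_smul]
        exact mul_le_mul ((norm_sub_le _ _).trans (add_le_add (c.norm_t_le x) c.norm_gN_le))
          (c.norm_G_le x) (norm_nonneg _) (by positivity)
  have e1 : (∫ x, (c.G x).trace • c.G x ∂(c.law μ))
      = (c.N : ℂ) • (∫ x, (c.t x - c.gN μ) • c.G x ∂(c.law μ)) + ((c.N : ℂ) * c.gN μ) • c.EG μ := by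
    rw [EG, ← integral_smul, ← integral_smul, ← integral_add (f := fun x => (c.N : ℂ) • (c.t x - c.gN μ) • c.G x)
      (g := fun x => ((c.N : ℂ) * c.gN μ) • c.G x) (hit.smul (c.N : ℂ))
      (hi.smul ((c.N : ℂ) * c.gN μ))]
    congr 1
    funext x
    rw [smul_smul, ← add_smul]
    congr 1
    rw [t]
    field_simp
    ring
  set R := c.err μ σ + (σ : ℂ) ^ 2 • (∫ x, (c.t x - c.gN μ) • c.G x ∂(c.law μ))
    + ((σ : ℂ) ^ 2 * (c.gN μ - gSC σ c.z)) • c.EG μ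
    + ((ε : ℂ) * σ ^ 2 / c.N) • (∫ x, c.G x * c.G x ∂(c.law μ))
    + ((fourthCumulant μ : ℂ) / (c.N : ℂ) ^ 2) • ∫ x, ∑ p, (c.B p * c.G x) ^ 4 ∂(c.law μ) with hR
  have e2 : (w • 1 - c.A) * c.EG μ = 1 + R := by
    rw [hR, c.err_eq hμ, e1, sub_mul, smul_mul_assoc, one_mul, smul_add, smul_smul, smul_smul,
      show (σ : ℂ) ^ 2 / c.N * (c.N * c.gN μ) = σ ^ 2 * c.gN μ by field_simp,
      show (σ : ℂ) ^ 2 / c.N * c.N = σ ^ 2 by field_simp, hw]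
    module
  have e3 : c.EG μ - c.Ghat σ = c.Ghat σ * R := by
    have h1 := green_mul c.deformation.isHermitian hwim
    calc c.EG μ - c.Ghat σ = (green w c.A * (w • 1 - c.A)) * c.EG μ - c.Ghat σ := by
          rw [h1, one_mul]
      _ = c.Ghat σ * (1 + R) - c.Ghat σ := by rw [mul_assoc, e2]; rfl
      _ = _ := by rw [mul_add, mul_one]; abel
  have n2 : ‖(σ : ℂ) ^ 2 • (∫ x, (c.t x - c.gN μ) • c.G x ∂(c.law μ))‖
      ≤ σ ^ 2 * (∫ x, ‖c.t x - c.gN μ‖ ∂(c.law μ)) * c.r := by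
    rw [norm_smul, norm_pow, Complex.norm_real, Real.norm_eq_abs, sq_abs, mul_assoc]
    refine mul_le_mul_of_nonneg_left ?_ (sq_nonneg _)
    refine (norm_integral_le_integral_norm _).trans ?_
    rw [← integral_mul_const]
    refine integral_mono hit.norm ?_ fun x => ?_
    · refine c.integrable_of_bounded μ (((c.continuous_t.sub continuous_const).norm).mul
        continuous_const) ((c.r + c.r) * c.r) fun x => ?_
      rw [norm_mul, norm_norm, Real.norm_of_nonneg hr.le]
      exact mul_le_mul_of_nonneg_right
        ((norm_sub_le _ _).trans (add_le_add (c.norm_t_le x) c.norm_gN_le)) hr.le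
    · simp only [norm_smul]
      exact mul_le_mul_of_nonneg_left (c.norm_G_le x) (norm_nonneg _)
  have n3 : ‖((σ : ℂ) ^ 2 * (c.gN μ - gSC σ c.z)) • c.EG μ‖
      ≤ σ ^ 2 * ‖c.gN μ - gSC σ c.z‖ * c.r := by
    rw [norm_smul, norm_mul, norm_pow, Complex.norm_real, Real.norm_eq_abs, sq_abs]
    exact mul_le_mul_of_nonneg_left c.norm_EG_le (by positivity)
  have n4 : ‖((ε : ℂ) * σ ^ 2 / c.N) • (∫ x, c.G x * c.G x ∂(c.law μ))‖
      ≤ |ε| * σ ^ 2 * c.r ^ 2 * (c.N : ℝ)⁻¹ := by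
    have : ‖∫ x, c.G x * c.G x ∂(c.law μ)‖ ≤ c.r ^ 2 := c.norm_integral_le_of_bound fun x => by
      refine (norm_mul_le _ _).trans ?_
      rw [sq]
      have := c.norm_G_le x
      gcongr
    rw [norm_smul, norm_div, norm_mul, norm_pow, Complex.norm_real, Complex.norm_real,
      Complex.norm_natCast, Real.norm_eq_abs, Real.norm_eq_abs, sq_abs]
    calc _ ≤ |ε| * σ ^ 2 / c.N * c.r ^ 2 := by gcongr
      _ = _ := by ring
  have n5 : ‖((fourthCumulant μ : ℂ) / (c.N : ℂ) ^ 2) •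
      ∫ x, ∑ p, (c.B p * c.G x) ^ 4 ∂(c.law μ)‖
      ≤ 8 * |fourthCumulant μ| * c.r ^ 4 * (c.N : ℝ)⁻¹ := by
    have h := c.norm_integral_le_of_bound (μ := μ) c.norm_sum_fourth_le
    rw [norm_smul, norm_div, norm_pow, Complex.norm_real, Complex.norm_natCast, Real.norm_eq_abs]
    calc _ ≤ |fourthCumulant μ| / (c.N : ℝ) ^ 2 * (8 * c.r ^ 4 * c.N) := by gcongr
      _ = _ := by field_simp
  rw [e3]
  refine (norm_mul_le _ _).trans ?_
  have hG := c.norm_Ghat_le hσ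
  have hRn : ‖R‖ ≤ ‖c.err μ σ‖ + σ ^ 2 * (∫ x, ‖c.t x - c.gN μ‖ ∂(c.law μ)) * c.r
      + σ ^ 2 * ‖c.gN μ - gSC σ c.z‖ * c.r + |ε| * σ ^ 2 * c.r ^ 2 * (c.N : ℝ)⁻¹
      + 8 * |fourthCumulant μ| * c.r ^ 4 * (c.N : ℝ)⁻¹ := by
    rw [hR]
    refine (norm_add_le _ _).trans (add_le_add ((norm_add_le _ _).trans (add_le_add
      ((norm_add_le _ _).trans (add_le_add ((norm_add_le _ _).trans (add_le_add le_rfl n2)) n3))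
      n4)) n5)
  gcongr

end Config

lemma isSmall_variance_t (hμ : IsEntryLaw μ σ) : IsSmall 2
    fun c : Config θ j₀ k ε c₄ => ∫ x, ‖c.t x - c.gN μ‖ ^ 2 ∂(c.law μ) := by
  have := hμ.isProbabilityMeasure
  obtain ⟨C, hC0, hC⟩ := hμ.exists_hasPoincareConst
  exact ⟨2 * C, 4, by positivity, fun c => c.variance_t_le hC hC0.le⟩

lemma isSmall_abs_t_sub (hμ : IsEntryLaw μ σ) : IsSmall 1
    fun c : Config θ j₀ k ε c₄ => ∫ x, ‖c.t x - c.gN μ‖ ∂(c.law μ) := by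
  have := hμ.isProbabilityMeasure
  refine IsSmall.of_sq ((isSmall_variance_t hμ).mono fun c => ?_)
  exact sq_integral_norm_le (c.continuous_t.sub continuous_const) (K := c.r + c.r) fun x =>
    (norm_sub_le _ _).trans (add_le_add (c.norm_t_le x) c.norm_gN_le)

lemma isSmall_err (hμ : IsEntryLaw μ σ) :
    IsSmall 1 fun c : Config θ j₀ k ε c₄ => ‖c.err μ σ‖ :=
  ⟨64 * cumulantConst μ σ (fourthCumulant μ), 6, by
    have := IsEntryLaw.cumulantConst_nonneg (μ := μ) (σ := σ) (fourthCumulant μ)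
    positivity,
    fun c => by rw [pow_one]; exact c.norm_err_le hμ⟩

lemma isSmall_scalarErr (hμ : IsEntryLaw μ σ) :
    IsSmall 2 fun c : Config θ j₀ k ε c₄ => ‖c.scalarErr μ σ‖ := by
  have := hμ.isProbabilityMeasure
  have h1 : IsSmall 2 fun c : Config θ j₀ k ε c₄ => ‖(c.err μ σ).trace / c.N‖ :=
    ⟨64 * cumulantConst μ σ (fourthCumulant μ), 6, by
    have := IsEntryLaw.cumulantConst_nonneg (μ := μ) (σ := σ) (fourthCumulant μ)
    positivity,
      fun c => c.norm_trace_err_le hμ⟩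
  refine (((isSmall_variance_t hμ).const_mul (sq_nonneg σ)).add h1).mono fun c => ?_
  refine (norm_add_le _ _).trans (add_le_add ?_ le_rfl)
  rw [norm_mul, norm_pow, Complex.norm_real, Real.norm_eq_abs, sq_abs]
  exact mul_le_mul_of_nonneg_left c.integral_t_sq_sub (sq_nonneg _)

lemma isSmall_div_N {f : Config θ j₀ k ε c₄ → ℝ} {m : ℕ} (hf : IsSmall m f) :
    IsSmall (m + 1) fun c => f c * (c.N : ℝ)⁻¹ := by
  obtain ⟨C, p, hC, hf⟩ := hf
  refine ⟨C, p, hC, fun c => ?_⟩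
  have := c.N_pos'
  calc f c * (c.N : ℝ)⁻¹ ≤ C * c.r ^ p / (c.N : ℝ) ^ m * (c.N : ℝ)⁻¹ := by gcongr; exact hf c
    _ = _ := by rw [pow_succ]; field_simp

lemma isSmall_mul_r {f : Config θ j₀ k ε c₄ → ℝ} {m : ℕ} (hf : IsSmall m f) (q : ℕ) :
    IsSmall m fun c => f c * c.r ^ q := by
  obtain ⟨C, p, hC, hf⟩ := hf
  refine ⟨C, p + q, hC, fun c => ?_⟩
  have := c.r_pos
  calc f c * c.r ^ q ≤ C * c.r ^ p / (c.N : ℝ) ^ m * c.r ^ q := by gcongr; exact hf c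
    _ = _ := by rw [pow_add]; ring

theorem isSmall_gN_sub (hσ : 0 < σ) (hμ : IsEntryLaw μ σ) (hθ : Function.Injective θ)
    (hj₀ : θ j₀ = 0) : IsSmall 1 fun c : Config θ j₀ k ε c₄ => ‖c.gN μ - gSC σ c.z‖ := by
  have := hμ.isProbabilityMeasure
  have h1 : IsSmall 1 fun c : Config θ j₀ k ε c₄ => ‖c.aN μ‖ :=
    ⟨_, 1, spikeMass_nonneg, fun c => c.norm_aN_le hθ hj₀⟩
  have h2 : IsSmall 1 fun c : Config θ j₀ k ε c₄ => |ε| * σ ^ 2 * c.r ^ 2 * (c.N : ℝ)⁻¹ :=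
    isSmall_div_N ((isSmall_r 2).const_mul (by positivity))
  have h3 : IsSmall 1 fun c : Config θ j₀ k ε c₄ =>
      |fourthCumulant μ| * ((100 + |c₄|) * c.r ^ 4) * (c.N : ℝ)⁻¹ :=
    isSmall_div_N (((isSmall_r 4).const_mul (by positivity)).const_mul (by positivity))
  have h4 := (isSmall_scalarErr (θ := θ) (j₀ := j₀) (k := k) (ε := ε) (c₄ := c₄) hμ).weaken
    (m' := 1) (by norm_num)
  refine (isSmall_mul_r (((h1.add h2).add h3).add h4) 1).mono fun c => ?_
  have hge : c.z.im ≤ (c.z - (σ : ℂ) ^ 2 * (c.gN μ + gSC σ c.z)).im :=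
    c.im_sub_ge σ (by
      rw [Complex.add_im]; linarith [im_gSC_nonpos hσ c.im_pos, c.im_gN_nonpos (μ := μ)])
  refine (c.im_le_norm hge).trans ?_
  rw [c.gN_sub_mul hσ hμ, mul_comm, pow_one]
  refine mul_le_mul_of_nonneg_right ?_ c.r_pos.le
  refine (norm_add_le _ _).trans (add_le_add ((norm_add_le _ _).trans (add_le_add
    ((norm_add_le _ _).trans (add_le_add le_rfl ?_)) ?_)) le_rfl)
  · rw [norm_mul, norm_div, norm_mul, norm_pow, Complex.norm_real, Complex.norm_real,
      Complex.norm_natCast, Real.norm_eq_abs, Real.norm_eq_abs, sq_abs]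
    have := c.norm_qN_le (μ := μ)
    calc _ ≤ |ε| * σ ^ 2 / c.N * c.r ^ 2 := by gcongr
      _ = _ := by ring
  · rw [norm_mul, norm_div, Complex.norm_real, Complex.norm_natCast, Real.norm_eq_abs]
    have := c.norm_fN_le (μ := μ)
    calc _ ≤ |fourthCumulant μ| / c.N * ((100 + |c₄|) * c.r ^ 4) := by gcongr
      _ = _ := by ring

theorem isSmall_EG_sub (hσ : 0 < σ) (hμ : IsEntryLaw μ σ) (hθ : Function.Injective θ)
    (hj₀ : θ j₀ = 0) : IsSmall 1 fun c : Config θ j₀ k ε c₄ => ‖c.EG μ - c.Ghat σ‖ := by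
  have h1 := isSmall_err (θ := θ) (j₀ := j₀) (k := k) (ε := ε) (c₄ := c₄) hμ
  have h2 := isSmall_mul_r ((isSmall_abs_t_sub (θ := θ) (j₀ := j₀) (k := k) (ε := ε) (c₄ := c₄)
    hμ).const_mul (sq_nonneg σ)) 1
  have h3 := isSmall_mul_r ((isSmall_gN_sub (k := k) (ε := ε) (c₄ := c₄)
    hσ hμ hθ hj₀).const_mul (sq_nonneg σ)) 1
  have h4 : IsSmall 1 fun c : Config θ j₀ k ε c₄ => |ε| * σ ^ 2 * c.r ^ 2 * (c.N : ℝ)⁻¹ :=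
    isSmall_div_N ((isSmall_r 2).const_mul (by positivity))
  have h5 : IsSmall 1 fun c : Config θ j₀ k ε c₄ =>
      8 * |fourthCumulant μ| * c.r ^ 4 * (c.N : ℝ)⁻¹ :=
    isSmall_div_N ((isSmall_r 4).const_mul (by positivity))
  refine (isSmall_mul_r ((((h1.add h2).add h3).add h4).add h5) 1).mono fun c => ?_
  refine (c.norm_EG_sub_le hσ hμ).trans (le_of_eq ?_)
  simp only [pow_one]
  ring

lemma isSmall_aN_sub (hσ : 0 < σ) (hμ : IsEntryLaw μ σ) (hθ : Function.Injective θ)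
    (hj₀ : θ j₀ = 0) : IsSmall 2 fun c : Config θ j₀ k ε c₄ =>
      ‖c.aN μ - spikeTerm σ θ j₀ k c.z / c.N‖ := by
  refine (isSmall_div_N ((isSmall_EG_sub hσ hμ hθ hj₀).const_mul
    (spikeMass_nonneg (θ := θ) (j₀ := j₀) (k := k)))).mono fun c => ?_
  have hw : (c.z - (σ : ℂ) ^ 2 * gSC σ c.z).im ≠ 0 :=
    (c.im_pos.trans_le (c.im_shift_ge hσ)).ne'
  have h1 : spikeTerm σ θ j₀ k c.z = (c.A * c.Ghat σ).trace :=
    (c.deformation.trace_mul_green hθ hj₀ hw).symm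
  rw [h1, Config.aN, ← sub_div, ← Matrix.trace_sub, ← mul_sub, norm_div, Complex.norm_natCast,
    div_eq_mul_inv]
  have := c.N_pos'
  gcongr
  exact c.deformation.norm_trace_mul_le hθ hj₀ _

end Expansion

/-! ### Second order terms of the expansion -/

section SecondOrder

variable {J : ℕ} {θ : Fin J → ℝ} {j₀ : Fin J} {k : Fin J → ℕ} {ε c₄ : ℝ} {μ : Measure ℝ}
  {σ : ℝ}

namespace Config

/-- The same model at another point of the upper half plane. -/
def withZ (c : Config θ j₀ k ε c₄) (w : ℂ) (hw : 0 < w.im) : Config θ j₀ k ε c₄ :=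
  { c with z := w, im_pos := hw }

variable (c : Config θ j₀ k ε c₄)

/-- The expected normalized trace of the resolvent as a function of the spectral parameter. -/
def gFun (μ : Measure ℝ) (w : ℂ) : ℂ := ∫ x, (green w (c.M x)).trace / c.N ∂(c.law μ)

lemma hasDerivAt_gFun [IsProbabilityMeasure μ] {w : ℂ} (hw : 0 < w.im) :
    HasDerivAt (c.gFun μ) (-(c.withZ w hw).qN μ) w := by
  have hy : 0 < |w.im| := abs_pos.2 hw.ne'
  have hN := c.N_pos'
  have hb : ∀ v ∈ Metric.ball w (|w.im| / 2), v.im ≠ 0 := fun v hv =>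
    abs_pos.1 (lt_of_lt_of_le (by linarith) (half_abs_im_le_of_mem_ball hv))
  have hcg : ∀ {v : ℂ}, v.im ≠ 0 → Continuous fun x => green v (c.M x) := fun hv =>
    continuous_green_comp c.continuous_M c.isHermitian_M hv
  have hcont : ∀ {v : ℂ}, v.im ≠ 0 → Continuous fun x => (green v (c.M x)).trace / (c.N : ℂ) :=
    fun hv => (Continuous.matrix_trace (hcg hv)).div_const _
  rw [qN, ← integral_neg]
  refine (hasDerivAt_integral_of_dominated_loc_of_deriv_le (s := Metric.ball w (|w.im| / 2))
    (bound := fun _ => ((|w.im| / 2)⁻¹) ^ 2)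
    (F := fun v x => (green v (c.M x)).trace / (c.N : ℂ))
    (F' := fun v x => -((green v (c.M x) * green v (c.M x)).trace / (c.N : ℂ)))
    (Metric.ball_mem_nhds _ (by linarith))
    ?_ ?_ ?_ (Eventually.of_forall fun x v hv => ?_)
    (integrable_const _) (Eventually.of_forall fun x v hv => ?_)).2
  · filter_upwards [Metric.ball_mem_nhds w (by linarith : 0 < |w.im| / 2)] with v hv
    exact (hcont (hb v hv)).aestronglyMeasurable
  · exact (c.withZ w hw).integrable_of_bounded μ (c.withZ w hw).continuous_t _
      (c.withZ w hw).norm_t_le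
  · exact ((Continuous.matrix_trace ((hcg hw.ne').mul (hcg hw.ne'))).div_const
      _).neg.aestronglyMeasurable
  · rw [norm_neg, norm_div, Complex.norm_natCast, div_le_iff₀ hN, mul_comm]
    refine (norm_trace_le _).trans ?_
    rw [Fintype.card_fin]
    refine mul_le_mul_of_nonneg_left ?_ hN.le
    have h1 : ‖green v (c.M x)‖ ≤ (|w.im| / 2)⁻¹ :=
      (norm_green_le (c.isHermitian_M x) (hb v hv)).trans
        (inv_anti₀ (by linarith) (half_abs_im_le_of_mem_ball hv))
    rw [sq]
    exact (norm_mul_le _ _).trans (mul_le_mul h1 h1 (norm_nonneg _) (by positivity))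
  · have h := hasDerivAt_green_param (c.isHermitian_M x) (hb v hv)
    have h2 := (Matrix.traceLinearMap (Fin c.N) ℂ ℂ).toContinuousLinearMap.hasFDerivAt.comp_hasDerivAt
      v h
    refine (h2.div_const (c.N : ℂ)).congr_deriv ?_
    change (-(green v (c.M x) * green v (c.M x))).trace / (c.N : ℂ) = _
    rw [Matrix.trace_neg, neg_div]

end Config

lemma isSmall_qN_sub (hσ : 0 < σ) (hμ : IsEntryLaw μ σ) (hθ : Function.Injective θ)
    (hj₀ : θ j₀ = 0) : IsSmall 1 fun c : Config θ j₀ k ε c₄ => ‖c.qN μ - gSC₂ σ c.z‖ := by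
  have := hμ.isProbabilityMeasure
  obtain ⟨C, p, hC, h⟩ := isSmall_gN_sub (k := k) (ε := ε) (c₄ := c₄) hσ hμ hθ hj₀
  refine ⟨2 * C * 2 ^ p, p + 1, by positivity, fun c => ?_⟩
  have hy := c.im_pos
  have hN := c.N_pos'
  have hr := c.r_pos
  have him : ∀ w ∈ Metric.closedBall c.z (c.z.im / 2), c.z.im / 2 ≤ w.im := by
    intro w hw
    rw [Metric.mem_closedBall, Complex.dist_eq] at hw
    have h1 := (abs_le.1 ((Complex.abs_im_le_norm (w - c.z)).trans hw)).1
    rw [Complex.sub_im] at h1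
    linarith
  set f : ℂ → ℂ := fun w => c.gFun μ w - gSC σ w with hf
  have hd : ∀ w (hw : 0 < w.im), HasDerivAt f (-(c.withZ w hw).qN μ - -gSC₂ σ w) w :=
    fun w hw => (c.hasDerivAt_gFun hw).sub (hasDerivAt_gSC hσ hw.ne')
  have hdiff : DiffContOnCl ℂ f (Metric.ball c.z (c.z.im / 2)) := by
    refine DifferentiableOn.diffContOnCl_ball (U := Metric.closedBall c.z (c.z.im / 2)) ?_
      subset_rfl
    intro w hw
    have := him w hw
    exact (hd w (by linarith)).differentiableAt.differentiableWithinAt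
  have hbound : ∀ w ∈ Metric.sphere c.z (c.z.im / 2), ‖f w‖ ≤ C * (2 * c.r) ^ p / (c.N : ℝ) ^ 1 := by
    intro w hw
    have h1 := him w (Metric.sphere_subset_closedBall hw)
    have hw0 : 0 < w.im := by linarith
    have h2 := h (c.withZ w hw0)
    refine h2.trans ?_
    have hr' : (c.withZ w hw0).r ≤ 2 * c.r := by
      change 1 + w.im⁻¹ ≤ 2 * (1 + c.z.im⁻¹)
      have : w.im⁻¹ ≤ (c.z.im / 2)⁻¹ := inv_anti₀ (by linarith) h1
      rw [inv_div] at this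
      have e : 2 / c.z.im = 2 * c.z.im⁻¹ := by ring
      linarith
    have := (c.withZ w hw0).r_pos
    change C * (c.withZ w hw0).r ^ p / (c.N : ℝ) ^ 1 ≤ _
    gcongr
  have hc := Complex.norm_deriv_le_of_forall_mem_sphere_norm_le (by linarith) hdiff hbound
  rw [(hd c.z hy).deriv] at hc
  have e : -(c.withZ c.z hy).qN μ - -gSC₂ σ c.z = -(c.qN μ - gSC₂ σ c.z) := by
    rw [show (c.withZ c.z hy).qN μ = c.qN μ from rfl]
    ring
  rw [e, norm_neg] at hc
  refine hc.trans ?_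
  have h3 := c.inv_im_le_r
  calc C * (2 * c.r) ^ p / (c.N : ℝ) ^ 1 / (c.z.im / 2)
      = 2 * C * 2 ^ p * c.r ^ p / (c.N : ℝ) ^ 1 * c.z.im⁻¹ := by
        rw [mul_pow]; field_simp
    _ ≤ 2 * C * 2 ^ p * c.r ^ p / (c.N : ℝ) ^ 1 * c.r := by gcongr
    _ = _ := by rw [pow_succ]; ring

namespace Config

variable (c : Config θ j₀ k ε c₄)

lemma sum_norm_diag_Ghat_sub_le (hσ : 0 < σ) (hθ : Function.Injective θ) (hj₀ : θ j₀ = 0) :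
    ∑ i, ‖c.Ghat σ i i - gSC σ c.z‖ ≤ spikeMass θ j₀ k * c.r ^ 2 := by
  have hg := gSC_ne_zero hσ c.im_ne
  have hq := gSC_quadratic hσ c.im_ne
  set g := gSC σ c.z with hgdef
  have hw : (c.z - (σ : ℂ) ^ 2 * g).im ≠ 0 := (c.im_pos.trans_le (c.im_shift_ge hσ)).ne'
  have h1 := mul_green c.deformation.isHermitian hw
  have h2 : c.Ghat σ = g • 1 + g • (c.A * c.Ghat σ) := by
    have e : g * (c.z - (σ : ℂ) ^ 2 * g) = 1 := by linear_combination hq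
    rw [sub_mul, smul_mul_assoc, one_mul] at h1
    change (c.z - (σ : ℂ) ^ 2 * g) • c.Ghat σ - c.A * c.Ghat σ = 1 at h1
    rw [← h1, smul_sub, smul_smul, e, one_smul, sub_add_cancel]
  have h3 : ∀ i, c.Ghat σ i i - g = g * (c.A * c.Ghat σ) i i := by
    intro i
    have := congrFun (congrFun h2 i) i
    simp only [Matrix.add_apply, Matrix.smul_apply, Matrix.one_apply_eq, smul_eq_mul] at this
    linear_combination this
  simp only [h3, norm_mul]
  rw [← Finset.mul_sum]
  have h4 := c.deformation.sum_norm_diag_mul_le hθ hj₀ (c.Ghat σ)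
  have h5 := c.norm_gSC_le_r hσ
  have h6 := c.norm_Ghat_le hσ
  have h0 : 0 ≤ spikeMass θ j₀ k := spikeMass_nonneg
  calc ‖g‖ * ∑ i, ‖(c.A * c.Ghat σ) i i‖ ≤ c.r * (spikeMass θ j₀ k * c.r) := by
        refine mul_le_mul h5 (h4.trans ?_) (Finset.sum_nonneg fun _ _ => norm_nonneg _) c.r_pos.le
        gcongr
    _ = _ := by ring

lemma apply_EG [IsProbabilityMeasure μ] (i j : Fin c.N) :
    c.EG μ i j = ∫ x, c.G x i j ∂(c.law μ) := by
  have hi : Integrable c.G (c.law μ) := c.integrable_of_bounded μ c.continuous_G _ c.norm_G_le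
  exact ((Matrix.entryLinearMap ℂ ℂ i j).toContinuousLinearMap.integral_comp_comm hi).symm

lemma trace_diagonal_mul (d : Fin c.N → ℂ) (X : Matrix (Fin c.N) (Fin c.N) ℂ) :
    (Matrix.diagonal d * X).trace = ∑ i, d i * X i i := by
  simp [Matrix.trace, Matrix.diagonal_mul]

lemma integral_norm_diagSq_sub_le (hσ : 0 < σ) (hμ : IsEntryLaw μ σ) (hθ : Function.Injective θ)
    (hj₀ : θ j₀ = 0) {C : ℝ} (hC : HasPoincareConst μ C) (hC0 : 0 ≤ C) :
    ∫ x, ‖c.diagSq x - gSC σ c.z ^ 2‖ ∂(c.law μ) ≤ 2 * C * c.r ^ 4 * (c.N : ℝ)⁻¹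
      + 2 * (√(2 * C) * c.r ^ 3 * (c.N : ℝ)⁻¹)
      + (2 * (‖c.EG μ - c.Ghat σ‖ * c.r ^ 1)
        + 2 * (spikeMass θ j₀ k * c.r ^ 3 * (c.N : ℝ)⁻¹)) := by
  have := hμ.isProbabilityMeasure
  have hN := c.N_pos'
  have hN' := c.N_ne_zero
  have hr := c.r_pos
  set g := gSC σ c.z with hg
  set e : Fin c.N → ℂ := fun i => c.EG μ i i with he
  have he1 : ∀ i, ‖e i‖ ≤ c.r := fun i => (norm_apply_le _ i i).trans c.norm_EG_le
  set Y : Matrix (Fin c.N) (Fin c.N) ℂ := Matrix.diagonal fun i => e i / c.N with hY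
  set F : (c.ι → ℝ) → ℂ := fun x => (Y * c.G x).trace - ∫ y, (Y * c.G y).trace ∂(c.law μ) with hF
  have hYG : Continuous fun x => (Y * c.G x).trace :=
    Continuous.matrix_trace (continuous_const.mul c.continuous_G)
  have hFc : Continuous F := hYG.sub continuous_const
  have hGb : ∀ x i, ‖c.G x i i‖ ≤ c.r := fun x i => (norm_apply_le _ i i).trans (c.norm_G_le x)
  have hYs : ∀ x, (Y * c.G x).trace = (∑ i, e i * c.G x i i) / c.N := by
    intro x
    rw [hY, c.trace_diagonal_mul, Finset.sum_div]
    exact Finset.sum_congr rfl fun i _ => by ring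
  have hYint : ∫ y, (Y * c.G y).trace ∂(c.law μ) = (∑ i, e i * e i) / c.N := by
    simp only [hYs]
    rw [integral_div, integral_finsetSum]
    · congr 1
      refine Finset.sum_congr rfl fun i _ => ?_
      rw [integral_const_mul, ← c.apply_EG]
    · intro i _
      exact (c.integrable_of_bounded μ (c.continuous_apply_G i i) _ fun x => hGb x i).const_mul _
  have hsplit : ∀ x, c.diagSq x - g ^ 2 = (∑ i, (c.G x i i - e i) ^ 2) / c.N + 2 * F x
      + (∑ i, (e i ^ 2 - g ^ 2)) / c.N := by
    intro x
    have e1 : F x = (∑ i, e i * (c.G x i i - e i)) / c.N := by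
      simp only [hF]
      rw [hYint, hYs, ← sub_div, ← Finset.sum_sub_distrib]
      simp only [mul_sub]
    have e2 : g ^ 2 = (∑ _i : Fin c.N, g ^ 2) / c.N := by
      rw [Finset.sum_const, Finset.card_univ, Fintype.card_fin, nsmul_eq_mul]
      field_simp
    rw [e1, diagSq, e2, ← sub_div, mul_div_assoc', ← add_div, ← add_div, Finset.mul_sum,
      ← Finset.sum_sub_distrib, ← Finset.sum_add_distrib, ← e2, ← Finset.sum_add_distrib]
    congr 1
    refine Finset.sum_congr rfl fun i _ => by ring
  have hδc : ∀ i, Continuous fun x => c.G x i i - e i := fun i =>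
    (c.continuous_apply_G i i).sub continuous_const
  have hδb : ∀ i x, ‖c.G x i i - e i‖ ≤ c.r + c.r := fun i x =>
    (norm_sub_le _ _).trans (add_le_add (hGb x i) (he1 i))
  have hδi : ∀ i, Integrable (fun x => ‖c.G x i i - e i‖ ^ 2) (c.law μ) := fun i =>
    c.integrable_of_bounded μ ((hδc i).norm.pow 2) ((c.r + c.r) ^ 2) fun x => by
      rw [norm_pow, norm_norm]
      exact pow_le_pow_left₀ (norm_nonneg _) (hδb i x) 2
  have hδv : ∀ i, ∫ x, ‖c.G x i i - e i‖ ^ 2 ∂(c.law μ) ≤ 2 * C * c.r ^ 4 * (c.N : ℝ)⁻¹ := by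
    intro i
    have h := c.variance_trace_mul_G_le hC hC0 (Matrix.diagonal (Pi.single i 1))
    have e1 : ∀ x, (Matrix.diagonal (Pi.single i (1 : ℂ)) * c.G x).trace = c.G x i i := by
      intro x
      rw [c.trace_diagonal_mul, Finset.sum_eq_single i]
      · simp
      · intro j _ hj; simp [hj]
      · simp
    simp only [e1, ← c.apply_EG] at h
    refine h.trans (le_of_eq ?_)
    rw [hsSq_diagonal, Finset.sum_eq_single i]
    · simp; ring
    · intro j _ hj; simp [hj]
    · simp
  have hF2 : ∫ x, ‖F x‖ ∂(c.law μ) ≤ √(2 * C) * c.r ^ 3 * (c.N : ℝ)⁻¹ := by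
    have h := c.variance_trace_mul_G_le hC hC0 Y
    obtain ⟨K, hK⟩ := c.exists_bound_comp_G
      (h := fun X => (Y * X).trace - ∫ y, (Y * c.G y).trace ∂(c.law μ))
      ((Continuous.matrix_trace (by fun_prop)).sub continuous_const)
    have h1 := sq_integral_norm_le (P := c.law μ) hFc (K := K) hK
    have h2 : hsSq Y ≤ c.r ^ 2 * (c.N : ℝ)⁻¹ := by
      rw [hY, hsSq_diagonal]
      refine (Finset.sum_le_sum (g := fun _ => (c.r / c.N) ^ 2) fun i _ => ?_).trans
        (le_of_eq ?_)
      · rw [norm_div, Complex.norm_natCast]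
        have := he1 i
        gcongr
      · rw [Finset.sum_const, Finset.card_univ, Fintype.card_fin, nsmul_eq_mul]
        field_simp
    refine (abs_le_of_sq_le_sq' ?_ (by positivity)).2
    refine h1.trans (h.trans ?_)
    rw [mul_pow, mul_pow, Real.sq_sqrt (by positivity)]
    calc 2 * C * c.r ^ 4 / c.N * hsSq Y ≤ 2 * C * c.r ^ 4 / c.N * (c.r ^ 2 * (c.N : ℝ)⁻¹) := by
          gcongr
      _ = _ := by ring
  have hlast : ‖(∑ i, (e i ^ 2 - g ^ 2)) / (c.N : ℂ)‖ ≤ 2 * (‖c.EG μ - c.Ghat σ‖ * c.r ^ 1)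
        + 2 * (spikeMass θ j₀ k * c.r ^ 3 * (c.N : ℝ)⁻¹) := by
    have h1 : ∀ i, ‖e i ^ 2 - g ^ 2‖
        ≤ 2 * c.r * (‖c.EG μ - c.Ghat σ‖ + ‖c.Ghat σ i i - g‖) := by
      intro i
      have e1 : e i ^ 2 - g ^ 2 = (e i + g) * ((c.EG μ - c.Ghat σ) i i + (c.Ghat σ i i - g)) := by
        simp only [he, Matrix.sub_apply]; ring
      rw [e1, norm_mul]
      have h2 : ‖e i + g‖ ≤ 2 * c.r := (norm_add_le _ _).trans (by
        linarith [he1 i, c.norm_gSC_le_r hσ])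
      have h3 : ‖(c.EG μ - c.Ghat σ) i i + (c.Ghat σ i i - g)‖
          ≤ ‖c.EG μ - c.Ghat σ‖ + ‖c.Ghat σ i i - g‖ :=
        (norm_add_le _ _).trans (add_le_add (norm_apply_le _ i i) le_rfl)
      gcongr
    rw [norm_div, Complex.norm_natCast, div_le_iff₀ hN]
    refine (norm_sum_le _ _).trans ((Finset.sum_le_sum fun i _ => h1 i).trans ?_)
    rw [← Finset.mul_sum, Finset.sum_add_distrib, Finset.sum_const, Finset.card_univ,
      Fintype.card_fin, nsmul_eq_mul]
    have h4 := c.sum_norm_diag_Ghat_sub_le hσ hθ hj₀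
    calc _ ≤ 2 * c.r * (c.N * ‖c.EG μ - c.Ghat σ‖ + spikeMass θ j₀ k * c.r ^ 2) := by gcongr
      _ = _ := by field_simp
  have hpt : ∀ x, ‖c.diagSq x - g ^ 2‖ ≤ (∑ i, ‖c.G x i i - e i‖ ^ 2) / c.N + 2 * ‖F x‖
      + (2 * (‖c.EG μ - c.Ghat σ‖ * c.r ^ 1)
        + 2 * (spikeMass θ j₀ k * c.r ^ 3 * (c.N : ℝ)⁻¹)) := by
    intro x
    rw [hsplit x]
    refine (norm_add_le _ _).trans (add_le_add ((norm_add_le _ _).trans (add_le_add ?_ ?_)) hlast)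
    · rw [norm_div, Complex.norm_natCast]
      gcongr
      refine (norm_sum_le _ _).trans (le_of_eq ?_)
      simp only [norm_pow]
    · rw [norm_mul]; simp
  have i1 : Integrable (fun x => (∑ i, ‖c.G x i i - e i‖ ^ 2) / (c.N : ℝ)) (c.law μ) :=
    (integrable_finsetSum _ fun i _ => hδi i).div_const _
  have i2 : Integrable (fun x => 2 * ‖F x‖) (c.law μ) := by
    have := c.integrable_comp_G μ
      (h := fun X => (Y * X).trace - ∫ y, (Y * c.G y).trace ∂(c.law μ))
      ((Continuous.matrix_trace (by fun_prop)).sub continuous_const)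
    exact this.norm.const_mul 2
  have i12 := i1.add i2
  simp only [Pi.add_def] at i12
  have hc1 : Continuous fun x => ‖c.diagSq x - g ^ 2‖ := (c.continuous_diagSq.sub continuous_const).norm
  have h := integral_mono_of_nonneg (Eventually.of_forall fun x => norm_nonneg _)
    (i12.add (integrable_const _)) (Eventually.of_forall hpt)
  simp only [Pi.add_def] at h
  rw [integral_add i12 (integrable_const _), integral_add i1 i2, integral_div,
    integral_finsetSum _ fun i _ => hδi i, integral_const_mul, integral_const, probReal_univ,
    one_smul] at h
  refine h.trans (add_le_add (add_le_add ?_ ?_) le_rfl)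
  · rw [div_le_iff₀ hN]
    refine (Finset.sum_le_sum fun i _ => hδv i).trans (le_of_eq ?_)
    rw [Finset.sum_const, Finset.card_univ, Fintype.card_fin, nsmul_eq_mul]
    ring
  · gcongr

end Config

lemma isSmall_fN_sub (hσ : 0 < σ) (hμ : IsEntryLaw μ σ) (hθ : Function.Injective θ)
    (hj₀ : θ j₀ = 0) :
    IsSmall 1 fun c : Config θ j₀ k ε c₄ => ‖c.fN μ - (c₄ : ℂ) * gSC σ c.z ^ 4‖ := by
  have := hμ.isProbabilityMeasure
  obtain ⟨C, hC0, hC⟩ := hμ.exists_hasPoincareConst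
  have s1 : IsSmall 1 fun c : Config θ j₀ k ε c₄ => 2 * C * c.r ^ 4 * (c.N : ℝ)⁻¹ :=
    isSmall_div_N ((isSmall_r 4).const_mul (by positivity))
  have s2 : IsSmall 1 fun c : Config θ j₀ k ε c₄ => 2 * (√(2 * C) * c.r ^ 3 * (c.N : ℝ)⁻¹) :=
    (isSmall_div_N ((isSmall_r 3).const_mul (by positivity))).const_mul zero_le_two
  have s3 := (isSmall_mul_r (isSmall_EG_sub (k := k) (ε := ε) (c₄ := c₄) hσ hμ hθ hj₀) 1).const_mul
    zero_le_two
  have s4 : IsSmall 1 fun c : Config θ j₀ k ε c₄ =>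
      2 * (spikeMass θ j₀ k * c.r ^ 3 * (c.N : ℝ)⁻¹) :=
    (isSmall_div_N ((isSmall_r 3).const_mul spikeMass_nonneg)).const_mul zero_le_two
  have s5 : IsSmall 1 fun c : Config θ j₀ k ε c₄ =>
      ∫ x, ‖c.diagSq x - gSC σ c.z ^ 2‖ ∂(c.law μ) :=
    ((s1.add s2).add (s3.add s4)).mono fun c =>
      c.integral_norm_diagSq_sub_le hσ hμ hθ hj₀ hC hC0.le
  have s6 : IsSmall 1 fun c : Config θ j₀ k ε c₄ => 100 * c.r ^ 4 / (c.N : ℝ) ^ 1 :=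
    ⟨100, 4, by norm_num, fun c => le_rfl⟩
  refine (s6.add ((isSmall_mul_r s5 2).const_mul (by positivity : 0 ≤ |c₄| * 2))).mono fun c => ?_
  have hr := c.r_pos
  have hc1 := c.continuous_diagSq
  have i1 : Integrable (fun x => ‖c.diagSq x - gSC σ c.z ^ 2‖) (c.law μ) :=
    c.integrable_of_bounded μ (hc1.sub continuous_const).norm (c.r ^ 2 + ‖gSC σ c.z ^ 2‖)
      fun x => by
        rw [norm_norm]
        exact (norm_sub_le _ _).trans (add_le_add (c.norm_diagSq_le x) le_rfl)
  have i0 : Integrable (fun x => (∑ p, ((c.B p * c.G x) ^ 4).trace) / (c.N : ℂ) ^ 2) (c.law μ) :=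
    c.integrable_comp_G μ (h := fun X => (∑ p, ((c.B p * X) ^ 4).trace) / (c.N : ℂ) ^ 2)
      ((continuous_finsetSum _ fun p _ => Continuous.matrix_trace (by fun_prop)).div_const _)
  have hpt : ∀ x, ‖(∑ p, ((c.B p * c.G x) ^ 4).trace) / (c.N : ℂ) ^ 2 - (c₄ : ℂ) * gSC σ c.z ^ 4‖
      ≤ 100 * c.r ^ 4 / (c.N : ℝ) ^ 1
        + |c₄| * 2 * c.r ^ 2 * ‖c.diagSq x - gSC σ c.z ^ 2‖ := by
    intro x
    have h1 := c.norm_fourth_sub_le x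
    have e1 : (c₄ : ℂ) * c.diagSq x ^ 2 - c₄ * gSC σ c.z ^ 4
        = c₄ * (c.diagSq x + gSC σ c.z ^ 2) * (c.diagSq x - gSC σ c.z ^ 2) := by ring
    have h2 : ‖(c₄ : ℂ) * c.diagSq x ^ 2 - c₄ * gSC σ c.z ^ 4‖
        ≤ |c₄| * 2 * c.r ^ 2 * ‖c.diagSq x - gSC σ c.z ^ 2‖ := by
      rw [e1, norm_mul, norm_mul, Complex.norm_real, Real.norm_eq_abs, mul_assoc |c₄| 2]
      have : ‖c.diagSq x + gSC σ c.z ^ 2‖ ≤ 2 * c.r ^ 2 := by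
        have h3 : ‖gSC σ c.z ^ 2‖ ≤ c.r ^ 2 := by
          rw [norm_pow]
          exact pow_le_pow_left₀ (norm_nonneg _) (c.norm_gSC_le_r hσ) 2
        exact (norm_add_le _ _).trans (by linarith [c.norm_diagSq_le x])
      gcongr
    have h3 := norm_add_le ((∑ p, ((c.B p * c.G x) ^ 4).trace) / (c.N : ℂ) ^ 2
      - (c₄ : ℂ) * c.diagSq x ^ 2) ((c₄ : ℂ) * c.diagSq x ^ 2 - c₄ * gSC σ c.z ^ 4)
    rw [sub_add_sub_cancel] at h3
    linarith
  have e2 : c.fN μ - (c₄ : ℂ) * gSC σ c.z ^ 4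
      = ∫ x, ((∑ p, ((c.B p * c.G x) ^ 4).trace) / (c.N : ℂ) ^ 2
        - (c₄ : ℂ) * gSC σ c.z ^ 4) ∂(c.law μ) := by
    rw [integral_sub i0 (integrable_const _), integral_const, probReal_univ, one_smul]
    rfl
  rw [e2]
  refine (norm_integral_le_integral_norm _).trans ?_
  have h := integral_mono_of_nonneg (Eventually.of_forall fun x => norm_nonneg _)
    ((integrable_const (100 * c.r ^ 4 / (c.N : ℝ) ^ 1)).add
      (i1.const_mul (|c₄| * 2 * c.r ^ 2))) (Eventually.of_forall hpt)
  simp only [Pi.add_def] at h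
  rw [integral_add (integrable_const _) (i1.const_mul (|c₄| * 2 * c.r ^ 2)), integral_const_mul,
    integral_const, probReal_univ, one_smul] at h
  refine h.trans (le_of_eq ?_)
  ring

/-- The `1 / N` term in the expansion of the expected Stieltjes transform. -/
def secondOrder (μ : Measure ℝ) (σ : ℝ) {J : ℕ} (θ : Fin J → ℝ) (j₀ : Fin J) (k : Fin J → ℕ)
    (ε c₄ : ℝ) (z : ℂ) : ℂ :=
  (gSC σ z)⁻¹ * gSC₂ σ z * (spikeTerm σ θ j₀ k z + (fourthCumulant μ : ℂ) * c₄ * gSC σ z ^ 4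
    + (ε : ℂ) * ((σ : ℂ) ^ 2 * gSC₂ σ z))

theorem isSmall_expansion (hσ : 0 < σ) (hμ : IsEntryLaw μ σ) (hθ : Function.Injective θ)
    (hj₀ : θ j₀ = 0) : IsSmall 2 fun c : Config θ j₀ k ε c₄ =>
      ‖c.gN μ - gSC σ c.z - secondOrder μ σ θ j₀ k ε c₄ c.z / c.N‖ := by
  have h1 := isSmall_aN_sub (k := k) (ε := ε) (c₄ := c₄) hσ hμ hθ hj₀
  have h2 := (isSmall_div_N (isSmall_qN_sub (k := k) (ε := ε) (c₄ := c₄) hσ hμ hθ hj₀)).const_mul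
    (by positivity : 0 ≤ |ε| * σ ^ 2)
  have h3 := (isSmall_div_N (isSmall_fN_sub (k := k) (ε := ε) (c₄ := c₄) hσ hμ hθ hj₀)).const_mul
    (abs_nonneg (fourthCumulant μ))
  have h4 := isSmall_scalarErr (θ := θ) (j₀ := j₀) (k := k) (ε := ε) (c₄ := c₄) hμ
  have h5 := isSmall_gN_sub (k := k) (ε := ε) (c₄ := c₄) hσ hμ hθ hj₀
  have h6 := (h5.mul h5 (fun _ => norm_nonneg _) (fun _ => norm_nonneg _)).const_mul (sq_nonneg σ)
  refine (isSmall_mul_r ((((h1.add h2).add h3).add h4).add h6) 1).mono fun c => ?_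
  have hN := c.N_pos'
  have hN' := c.N_ne_zero
  have hg := gSC_ne_zero hσ c.im_ne
  have hm := gSC₂_mul hσ c.im_ne
  have hge : c.z.im ≤ (c.z - (σ : ℂ) ^ 2 * (2 * gSC σ c.z)).im := c.im_sub_ge σ (by
    have := im_gSC_nonpos hσ c.im_pos
    rw [two_mul, Complex.add_im]
    linarith)
  refine (c.im_le_norm hge).trans ?_
  rw [mul_comm, pow_one]
  refine mul_le_mul_of_nonneg_right ?_ c.r_pos.le
  have hmain := c.gN_sub_mul hσ hμ
  have hL : secondOrder μ σ θ j₀ k ε c₄ c.z * (c.z - (σ : ℂ) ^ 2 * (2 * gSC σ c.z))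
      = spikeTerm σ θ j₀ k c.z + (fourthCumulant μ : ℂ) * c₄ * gSC σ c.z ^ 4
        + (ε : ℂ) * ((σ : ℂ) ^ 2 * gSC₂ σ c.z) := by
    rw [secondOrder]
    have : (gSC σ c.z)⁻¹ * gSC₂ σ c.z * (c.z - (σ : ℂ) ^ 2 * (2 * gSC σ c.z)) = 1 := by
      rw [mul_assoc, show (σ : ℂ) ^ 2 * (2 * gSC σ c.z) = 2 * (σ : ℂ) ^ 2 * gSC σ c.z by ring, hm,
        inv_mul_cancel₀ hg]
    linear_combination (spikeTerm σ θ j₀ k c.z + (fourthCumulant μ : ℂ) * c₄ * gSC σ c.z ^ 4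
        + (ε : ℂ) * ((σ : ℂ) ^ 2 * gSC₂ σ c.z)) * this
  have e : (c.gN μ - gSC σ c.z - secondOrder μ σ θ j₀ k ε c₄ c.z / c.N)
      * (c.z - (σ : ℂ) ^ 2 * (2 * gSC σ c.z))
      = (c.aN μ - spikeTerm σ θ j₀ k c.z / c.N)
        + ((ε : ℂ) * σ ^ 2) * ((c.qN μ - gSC₂ σ c.z) * (c.N : ℂ)⁻¹)
        + (fourthCumulant μ : ℂ) * ((c.fN μ - (c₄ : ℂ) * gSC σ c.z ^ 4) * (c.N : ℂ)⁻¹)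
        + c.scalarErr μ σ
        + (σ : ℂ) ^ 2 * ((c.gN μ - gSC σ c.z) * (c.gN μ - gSC σ c.z)) := by
    linear_combination hmain - (c.N : ℂ)⁻¹ * hL
  rw [e]
  refine (norm_add_le _ _).trans (add_le_add ((norm_add_le _ _).trans (add_le_add
    ((norm_add_le _ _).trans (add_le_add ((norm_add_le _ _).trans (add_le_add le_rfl ?_)) ?_))
    le_rfl)) ?_)
  · rw [norm_mul, norm_mul, norm_mul, norm_pow, norm_inv, Complex.norm_real, Complex.norm_real,
      Complex.norm_natCast, Real.norm_eq_abs, Real.norm_eq_abs, sq_abs]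
  · rw [norm_mul, norm_mul, norm_inv, Complex.norm_real, Complex.norm_natCast, Real.norm_eq_abs]
  · rw [norm_mul, norm_mul, norm_pow, Complex.norm_real, Real.norm_eq_abs, sq_abs]

end SecondOrder

end DeformedWigner

namespace DeformedWigner

/-! ### Functions as superpositions of resolvents -/

section HelfferSjostrand

/-- The successive derivatives of a smooth function supported in `[-R, R]`. -/
structure IsDerivTower (ψ : ℕ → ℝ → ℝ) (R : ℝ) : Prop where
  hasDerivAt : ∀ j x, HasDerivAt (ψ j) (ψ (j + 1) x) x
  eq_zero : ∀ j x, x ∉ Set.Icc (-R) R → ψ j x = 0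

lemma exists_isDerivTower {φ : ℝ → ℝ} (hφ : ContDiff ℝ (⊤ : ℕ∞) φ) (hc : HasCompactSupport φ) :
    ∃ ψ R, IsDerivTower ψ R ∧ ψ 0 = φ := by
  obtain ⟨R, hR⟩ := hc.isCompact.isBounded.subset_closedBall 0
  refine ⟨fun j => iteratedDeriv j φ, R, ⟨fun j x => ?_, fun j x hx => ?_⟩, iteratedDeriv_zero⟩
  · have h := (hφ.differentiable_iteratedDeriv j (by exact_mod_cast ENat.natCast_lt_top j)) x
    simpa only [iteratedDeriv_succ] using h.hasDerivAt
  · have hsub : ∀ i, tsupport (iteratedDeriv i φ) ⊆ tsupport φ := by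
      intro i
      induction i with
      | zero => simp
      | succ i ih =>
        rw [iteratedDeriv_succ]
        exact tsupport_deriv_subset.trans ih
    refine image_eq_zero_of_notMem_tsupport fun h => hx ?_
    have := hR (hsub j h)
    rw [Real.closedBall_eq_Icc] at this
    simpa using this

lemma ofReal_add_mul_I_im (x y : ℝ) : ((x : ℂ) + y * Complex.I).im = y := by simp

variable {ψ : ℕ → ℝ → ℝ} {R : ℝ}

namespace IsDerivTower

lemma continuous (h : IsDerivTower ψ R) (j : ℕ) : Continuous (ψ j) :=
  continuous_iff_continuousAt.2 fun x => (h.hasDerivAt j x).continuousAt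

lemma hasCompactSupport (h : IsDerivTower ψ R) (j : ℕ) : HasCompactSupport (ψ j) :=
  HasCompactSupport.intro isCompact_Icc fun x hx => h.eq_zero j x hx

lemma integrable_mul (h : IsDerivTower ψ R) (j : ℕ) {f : ℝ → ℂ} (hf : Continuous f) :
    Integrable fun x => (ψ j x : ℂ) * f x := by
  have := h.continuous j
  refine Continuous.integrable_of_hasCompactSupport (by fun_prop) ?_
  refine HasCompactSupport.intro isCompact_Icc (K := Set.Icc (-R) R) fun x hx => ?_
  simp [h.eq_zero j x hx]

lemma continuous_kernel {y : ℝ} (hy : y ≠ 0) (t : ℝ) :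
    Continuous fun x : ℝ => ((x : ℂ) + y * Complex.I - t)⁻¹ := by
  refine Continuous.inv₀ (by fun_prop) fun x => sub_ofReal_ne_zero (by simpa using hy) t

lemma norm_kernel_le {y : ℝ} (hy : 0 < y) (x t : ℝ) :
    ‖((x : ℂ) + y * Complex.I - t)⁻¹‖ ≤ y⁻¹ := by
  have h := norm_inv_sub_ofReal_le (z := (x : ℂ) + y * Complex.I) (by simpa using hy.ne') t
  rwa [ofReal_add_mul_I_im, abs_of_pos hy] at h

/-- The Cauchy transform of the `j`-th derivative along a horizontal line. -/
def cauchy (ψ : ℕ → ℝ → ℝ) (t : ℝ) (j : ℕ) (y : ℝ) : ℂ :=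
  ∫ x : ℝ, (ψ j x : ℂ) * ((x : ℂ) + y * Complex.I - t)⁻¹

lemma hasDerivAt_cauchy (h : IsDerivTower ψ R) (t : ℝ) (j : ℕ) {y : ℝ} (hy : 0 < y) :
    HasDerivAt (cauchy ψ t j) (-Complex.I * cauchy ψ t (j + 1) y) y := by
  have hne : ∀ {v : ℝ}, 0 < v → ∀ x : ℝ, (x : ℂ) + v * Complex.I - t ≠ 0 := fun hv x =>
    sub_ofReal_ne_zero (by simpa using hv.ne') t
  have hpos : ∀ v ∈ Metric.ball y (y / 2), y / 2 < v := by
    intro v hv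
    rw [Metric.mem_ball, Real.dist_eq] at hv
    linarith [(abs_lt.1 hv).1]
  have hsq : ∀ {v : ℝ}, 0 < v →
      Continuous fun x : ℝ => -Complex.I * (((x : ℂ) + v * Complex.I - t)⁻¹) ^ 2 := fun hv =>
    continuous_const.mul ((continuous_kernel hv.ne' t).pow 2)
  have hint : ∫ x : ℝ, (ψ j x : ℂ) * (-Complex.I * (((x : ℂ) + y * Complex.I - t)⁻¹) ^ 2)
      = -Complex.I * cauchy ψ t (j + 1) y := by
    have hk : ∀ x : ℝ, HasDerivAt (fun x : ℝ => Complex.I * ((x : ℂ) + y * Complex.I - t)⁻¹)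
        (-Complex.I * (((x : ℂ) + y * Complex.I - t)⁻¹) ^ 2) x := by
      intro x
      have h1 := (((Complex.ofRealCLM.hasDerivAt (x := x)).add_const
        (y * Complex.I)).sub_const (t : ℂ)).inv (hne hy x)
      refine (h1.const_mul Complex.I).congr_deriv ?_
      simp [div_eq_mul_inv]
    have hu : ∀ x : ℝ, HasDerivAt (fun x => (ψ j x : ℂ)) (ψ (j + 1) x : ℂ) x := fun x =>
      (h.hasDerivAt j x).ofReal_comp
    have hck := (continuous_kernel hy.ne' t).const_mul Complex.I
    have := integral_mul_deriv_eq_deriv_mul_of_integrable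
      (u := fun x => (ψ j x : ℂ)) (fun x _ => hu x) (fun x _ => hk x)
      (h.integrable_mul j (hsq hy)) (h.integrable_mul (j + 1) hck) (h.integrable_mul j hck)
    rw [this, cauchy, neg_mul, ← integral_const_mul]
    congr 2
    funext x
    ring
  rw [← hint]
  refine (hasDerivAt_integral_of_dominated_loc_of_deriv_le (s := Metric.ball y (y / 2))
    (bound := fun x => ‖(ψ j x : ℂ) * (((y / 2)⁻¹ ^ 2 : ℝ) : ℂ)‖)
    (F := fun (v x : ℝ) => (ψ j x : ℂ) * ((x : ℂ) + v * Complex.I - t)⁻¹)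
    (F' := fun (v x : ℝ) => (ψ j x : ℂ) * (-Complex.I * (((x : ℂ) + v * Complex.I - t)⁻¹) ^ 2))
    (Metric.ball_mem_nhds _ (by linarith))
    ?_ (h.integrable_mul j (continuous_kernel hy.ne' t))
    (h.integrable_mul j (hsq hy)).aestronglyMeasurable
    (Eventually.of_forall fun x v hv => ?_)
    (h.integrable_mul j continuous_const).norm (Eventually.of_forall fun x v hv => ?_)).2
  · filter_upwards [Metric.ball_mem_nhds y (by linarith : 0 < y / 2)] with v hv
    have := hpos v hv
    exact (h.integrable_mul j (continuous_kernel (by linarith) t)).aestronglyMeasurable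
  · have hv' := hpos v hv
    rw [norm_mul, norm_mul, norm_mul, norm_neg, Complex.norm_I, one_mul, norm_pow]
    refine mul_le_mul_of_nonneg_left ?_ (norm_nonneg _)
    rw [Complex.norm_real, Real.norm_of_nonneg (by positivity)]
    refine pow_le_pow_left₀ (norm_nonneg _) ((norm_kernel_le (by linarith) x t).trans ?_) 2
    exact inv_anti₀ (by linarith) hv'.le
  · have hv' : 0 < v := by linarith [hpos v hv]
    have h1 := (((((Complex.ofRealCLM.hasDerivAt (x := v)).mul_const Complex.I).const_add
      (x : ℂ))).sub_const (t : ℂ)).inv (hne hv' x)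
    refine (h1.const_mul (ψ j x : ℂ)).congr_deriv ?_
    simp [div_eq_mul_inv]

/-- The Taylor type sum whose derivative telescopes. -/
def taylorSum (ψ : ℕ → ℝ → ℝ) (t : ℝ) (m : ℕ) (y : ℝ) : ℂ :=
  ∑ j ∈ Finset.range m, (Complex.I * y) ^ j / (j.factorial : ℂ) * cauchy ψ t j y

lemma hasDerivAt_taylorSum (h : IsDerivTower ψ R) (t : ℝ) (m : ℕ) {y : ℝ} (hy : 0 < y) :
    HasDerivAt (taylorSum ψ t (m + 1))
      (-Complex.I * ((Complex.I * y) ^ m / (m.factorial : ℂ)) * cauchy ψ t (m + 1) y) y := by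
  induction m with
  | zero =>
    have h1 := h.hasDerivAt_cauchy t 0 hy
    have e : taylorSum ψ t (0 + 1) = cauchy ψ t 0 := by
      funext v; simp [taylorSum]
    rw [e]
    refine h1.congr_deriv (by simp)
  | succ m ih =>
    have e : taylorSum ψ t (m + 1 + 1) = fun v => taylorSum ψ t (m + 1) v
        + (Complex.I * v) ^ (m + 1) / ((m + 1).factorial : ℂ) * cauchy ψ t (m + 1) v := by
      funext v; rw [taylorSum, Finset.sum_range_succ, taylorSum]
    rw [e]
    have hp : HasDerivAt (fun v : ℝ => (Complex.I * (v : ℂ)) ^ (m + 1) / ((m + 1).factorial : ℂ))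
        (((m + 1 : ℕ) : ℂ) * (Complex.I * y) ^ m * Complex.I / ((m + 1).factorial : ℂ)) y := by
      have h1 := (((Complex.ofRealCLM.hasDerivAt (x := y)).const_mul Complex.I).pow
        (m + 1)).div_const ((m + 1).factorial : ℂ)
      refine h1.congr_deriv ?_
      simp
    refine (ih.add (hp.mul (h.hasDerivAt_cauchy t (m + 1) hy))).congr_deriv ?_
    have hf : ((m + 1).factorial : ℂ) = ((m + 1 : ℕ) : ℂ) * (m.factorial : ℂ) := by
      rw [Nat.factorial_succ]; push_cast; ring
    have h1 : ((m + 1 : ℕ) : ℂ) ≠ 0 := by exact_mod_cast Nat.succ_ne_zero m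
    have h2 : (m.factorial : ℂ) ≠ 0 := by exact_mod_cast m.factorial_ne_zero
    rw [hf]
    field_simp
    ring

lemma tendsto_mul_cauchy (h : IsDerivTower ψ R) (t : ℝ) (j : ℕ) :
    Tendsto (fun y : ℝ => (y : ℂ) * cauchy ψ t j y) (𝓝[>] 0) (𝓝 0) := by
  have e : ∀ y : ℝ, (y : ℂ) * cauchy ψ t j y
      = ∫ x : ℝ, (ψ j x : ℂ) * (y * ((x : ℂ) + y * Complex.I - t)⁻¹) := by
    intro y
    rw [cauchy, ← integral_const_mul]
    congr 1
    funext x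
    ring
  simp only [e]
  have h0 : (0 : ℂ) = ∫ _x : ℝ, (0 : ℂ) := by simp
  rw [h0]
  have hi : Integrable fun x => (ψ j x : ℂ) * (1 : ℂ) := h.integrable_mul j continuous_const
  refine tendsto_integral_filter_of_dominated_convergence (fun x => ‖(ψ j x : ℂ) * (1 : ℂ)‖)
    ?_ ?_ hi.norm ?_
  · filter_upwards [self_mem_nhdsWithin] with y hy
    exact (h.integrable_mul j (continuous_const.mul
      (continuous_kernel (ne_of_gt hy) t))).aestronglyMeasurable
  · filter_upwards [self_mem_nhdsWithin] with y hy
    refine Eventually.of_forall fun x => ?_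
    have hy' : (0 : ℝ) < y := hy
    rw [norm_mul, norm_mul, norm_mul, norm_one, Complex.norm_real y, Real.norm_of_nonneg hy'.le]
    refine mul_le_mul_of_nonneg_left ?_ (norm_nonneg _)
    calc y * _ ≤ y * y⁻¹ := by gcongr; exact norm_kernel_le hy' x t
      _ = 1 := mul_inv_cancel₀ hy'.ne'
  · have hae : ∀ᵐ x : ℝ, x ≠ t := by simp [ae_iff]
    filter_upwards [hae] with x hx
    have hc : ContinuousAt (fun y : ℝ => (ψ j x : ℂ) * (y * ((x : ℂ) + y * Complex.I - t)⁻¹)) 0 := by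
      have hx' : (x : ℂ) + ((0 : ℝ) : ℂ) * Complex.I - t ≠ 0 := by
        simp only [Complex.ofReal_zero, zero_mul, add_zero]
        exact sub_ne_zero.2 (by exact_mod_cast hx)
      exact continuousAt_const.mul (Complex.continuous_ofReal.continuousAt.mul
        (ContinuousAt.inv₀ (by fun_prop) hx'))
    have := hc.tendsto
    simp only [Complex.ofReal_zero, zero_mul, mul_zero] at this
    exact this.mono_left nhdsWithin_le_nhds

lemma im_kernel {y : ℝ} (x t : ℝ) :
    (((x : ℂ) + y * Complex.I - t)⁻¹).im = -y / ((x - t) ^ 2 + y ^ 2) := by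
  rw [Complex.inv_im, Complex.normSq_apply]
  simp
  ring

lemma tendsto_im_cauchy (h : IsDerivTower ψ R) (t : ℝ) :
    Tendsto (fun y : ℝ => (cauchy ψ t 0 y).im) (𝓝[>] 0) (𝓝 (-(Real.pi * ψ 0 t))) := by
  have hc := h.continuous 0
  obtain ⟨K, hK⟩ := (h.hasCompactSupport 0).exists_bound_of_continuous hc
  have e : ∀ y : ℝ, 0 < y → (cauchy ψ t 0 y).im = -∫ u : ℝ, ψ 0 (t + y * u) * (1 + u ^ 2)⁻¹ := by
    intro y hy
    have h1 : (cauchy ψ t 0 y).im = ∫ x : ℝ, ψ 0 x * (-y / ((x - t) ^ 2 + y ^ 2)) := by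
      have := Complex.imCLM.integral_comp_comm
        (h.integrable_mul 0 (continuous_kernel hy.ne' t))
      rw [cauchy]
      refine this.symm.trans (integral_congr_ae (Eventually.of_forall fun x => ?_))
      simp only [Complex.imCLM_apply, Complex.im_ofReal_mul, im_kernel]
    have h2 := integral_add_left_eq_self (μ := volume)
      (fun x : ℝ => ψ 0 x * (-y / ((x - t) ^ 2 + y ^ 2))) t
    have h3 := Measure.integral_comp_mul_left
      (fun x : ℝ => ψ 0 (t + x) * (-y / ((t + x - t) ^ 2 + y ^ 2))) y
    rw [abs_of_pos (inv_pos.2 hy), h2, smul_eq_mul] at h3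
    rw [h1]
    have h4 : ∫ x : ℝ, ψ 0 x * (-y / ((x - t) ^ 2 + y ^ 2))
        = y * (y⁻¹ * ∫ x : ℝ, ψ 0 x * (-y / ((x - t) ^ 2 + y ^ 2))) := by
      rw [mul_inv_cancel_left₀ hy.ne']
    rw [h4, ← h3, ← integral_const_mul, ← integral_neg]
    congr 1
    funext u
    have : (1 : ℝ) + u ^ 2 ≠ 0 := by positivity
    have e2 : (t + y * u - t) ^ 2 + y ^ 2 = y ^ 2 * (1 + u ^ 2) := by ring
    rw [e2]
    field_simp
  have hlim : Tendsto (fun y : ℝ => -∫ u : ℝ, ψ 0 (t + y * u) * (1 + u ^ 2)⁻¹) (𝓝[>] 0)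
      (𝓝 (-∫ u : ℝ, ψ 0 t * (1 + u ^ 2)⁻¹)) := by
    refine Tendsto.neg ?_
    refine tendsto_integral_filter_of_dominated_convergence (fun u => K * (1 + u ^ 2)⁻¹)
      ?_ ?_ (integrable_inv_one_add_sq.const_mul K) ?_
    · refine Eventually.of_forall fun y => Continuous.aestronglyMeasurable ?_
      exact (hc.comp (by fun_prop)).mul
        (Continuous.inv₀ (by fun_prop) fun u => by positivity)
    · refine Eventually.of_forall fun y => Eventually.of_forall fun u => ?_
      rw [norm_mul, Real.norm_of_nonneg (by positivity : (0 : ℝ) ≤ (1 + u ^ 2)⁻¹)]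
      gcongr
      exact hK _
    · refine Eventually.of_forall fun u => ?_
      refine Tendsto.mul_const _ ?_
      have : ContinuousAt (fun y : ℝ => ψ 0 (t + y * u)) 0 := by
        exact (hc.comp (by fun_prop)).continuousAt
      have h1 := this.tendsto
      simp only [zero_mul, add_zero] at h1
      exact h1.mono_left nhdsWithin_le_nhds
  have hval : ∫ u : ℝ, ψ 0 t * (1 + u ^ 2)⁻¹ = Real.pi * ψ 0 t := by
    rw [integral_const_mul, integral_univ_inv_one_add_sq, mul_comm]
  rw [hval] at hlim
  refine hlim.congr' ?_
  filter_upwards [self_mem_nhdsWithin] with y hy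
  exact (e y hy).symm

/-- The density in the representation of a function as a superposition of resolvents. -/
def weight (ψ : ℕ → ℝ → ℝ) (m : ℕ) (q : ℝ × ℝ) : ℂ :=
  (q.1 : ℂ) ^ m * (((m + 1 : ℕ) : ℂ) * (∑ j ∈ Finset.range (m + 1),
      (Complex.I * q.1) ^ j / (j.factorial : ℂ) * (ψ j q.2 : ℂ))
    + Complex.I ^ (m + 1) / (m.factorial : ℂ) * (1 - (q.1 : ℂ) ^ (m + 1)) * (ψ (m + 1) q.2 : ℂ))

lemma continuous_weight (h : IsDerivTower ψ R) (m : ℕ) : Continuous (weight ψ m) := by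
  have := h.continuous
  unfold weight
  fun_prop

lemma exists_norm_weight_le (h : IsDerivTower ψ R) (m : ℕ) :
    ∃ V, 0 ≤ V ∧ ∀ q : ℝ × ℝ, 0 < q.1 → q.1 < 1 → ‖weight ψ m q‖ ≤ V * q.1 ^ m := by
  have hc := h.continuous
  set v : ℝ × ℝ → ℂ := fun q => ((m + 1 : ℕ) : ℂ) * (∑ j ∈ Finset.range (m + 1),
      (Complex.I * q.1) ^ j / (j.factorial : ℂ) * (ψ j q.2 : ℂ))
    + Complex.I ^ (m + 1) / (m.factorial : ℂ) * (1 - (q.1 : ℂ) ^ (m + 1)) * (ψ (m + 1) q.2 : ℂ)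
    with hv
  have hvc : Continuous v := by
    rw [hv]; fun_prop
  obtain ⟨V, hV⟩ := (isCompact_Icc.prod isCompact_Icc :
    IsCompact (Set.Icc (0 : ℝ) 1 ×ˢ Set.Icc (-R) R)).exists_bound_of_continuousOn hvc.continuousOn
  refine ⟨max V 0, le_max_right _ _, fun q h0 h1 => ?_⟩
  have e : weight ψ m q = (q.1 : ℂ) ^ m * v q := rfl
  rw [e, norm_mul, norm_pow, Complex.norm_real, Real.norm_of_nonneg h0.le, mul_comm]
  refine mul_le_mul_of_nonneg_right ?_ (by positivity)
  by_cases hq : q.2 ∈ Set.Icc (-R) R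
  · exact (hV q ⟨⟨h0.le, h1.le⟩, hq⟩).trans (le_max_left _ _)
  · have : v q = 0 := by simp [hv, h.eq_zero _ _ hq]
    rw [this, norm_zero]
    exact le_max_right _ _

lemma weight_eq_zero (h : IsDerivTower ψ R) (m : ℕ) (y : ℝ) {x : ℝ} (hx : x ∉ Set.Icc (-R) R) :
    weight ψ m (y, x) = 0 := by
  simp [weight, h.eq_zero _ _ hx]

lemma integral_weight (h : IsDerivTower ψ R) (m : ℕ) (t : ℝ) {y : ℝ} (hy : 0 < y) :
    ∫ x in Set.Icc (-R) R, weight ψ m (y, x) * ((x : ℂ) + y * Complex.I - t)⁻¹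
      = (y : ℂ) ^ m * (((m + 1 : ℕ) : ℂ) * taylorSum ψ t (m + 1) y
        + Complex.I ^ (m + 1) / (m.factorial : ℂ) * (1 - (y : ℂ) ^ (m + 1))
          * cauchy ψ t (m + 1) y) := by
  rw [setIntegral_eq_integral_of_forall_compl_eq_zero (fun x hx => by
    rw [h.weight_eq_zero m y hx, zero_mul])]
  have hi := fun j => h.integrable_mul j (continuous_kernel hy.ne' t)
  have e : ∀ x : ℝ, weight ψ m (y, x) * ((x : ℂ) + y * Complex.I - t)⁻¹
      = (∑ j ∈ Finset.range (m + 1), ((y : ℂ) ^ m * ((m + 1 : ℕ) : ℂ)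
        * ((Complex.I * y) ^ j / (j.factorial : ℂ))) *
          ((ψ j x : ℂ) * ((x : ℂ) + y * Complex.I - t)⁻¹))
        + ((y : ℂ) ^ m * (Complex.I ^ (m + 1) / (m.factorial : ℂ) * (1 - (y : ℂ) ^ (m + 1))))
          * ((ψ (m + 1) x : ℂ) * ((x : ℂ) + y * Complex.I - t)⁻¹) := by
    intro x
    simp only [weight]
    rw [mul_add, add_mul, Finset.mul_sum, Finset.mul_sum, Finset.sum_mul]
    congr 1
    · exact Finset.sum_congr rfl fun j _ => by ring
    · ring
  simp only [e]
  rw [integral_add (integrable_finsetSum _ fun j _ => (hi j).const_mul _) ((hi (m + 1)).const_mul _),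
    integral_finsetSum _ fun j _ => (hi j).const_mul _, integral_const_mul]
  simp only [integral_const_mul]
  rw [taylorSum, mul_add, Finset.mul_sum, Finset.mul_sum]
  congr 1
  · exact Finset.sum_congr rfl fun j _ => by rw [cauchy]; ring
  · rw [cauchy]; ring

lemma integrableOn_weight_mul (h : IsDerivTower ψ R) {m : ℕ} (hm : 1 ≤ m) {T : ℂ → ℂ} {K : ℝ}
    (hT : ContinuousOn T {z | 0 < z.im}) (hK : ∀ z : ℂ, 0 < z.im → ‖T z‖ ≤ K * z.im⁻¹) :
    IntegrableOn (fun q : ℝ × ℝ => weight ψ m q * T ((q.2 : ℂ) + q.1 * Complex.I))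
      (Set.Ioo 0 1 ×ˢ Set.Icc (-R) R) := by
  obtain ⟨V, hV0, hV⟩ := h.exists_norm_weight_le m
  have hms : MeasurableSet (Set.Ioo (0 : ℝ) 1 ×ˢ Set.Icc (-R) R) :=
    measurableSet_Ioo.prod measurableSet_Icc
  have hfin : IsFiniteMeasure (volume.restrict (Set.Ioo (0 : ℝ) 1 ×ˢ Set.Icc (-R) R)) := ⟨by
    rw [Measure.restrict_apply_univ, Measure.volume_eq_prod, Measure.prod_prod]
    simp⟩
  refine Integrable.of_bound (C := V * K) ?_ ?_
  · refine ContinuousOn.aestronglyMeasurable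
      (f := fun q : ℝ × ℝ => weight ψ m q * T ((q.2 : ℂ) + q.1 * Complex.I)) ?_ hms
    refine (h.continuous_weight m).continuousOn.mul (hT.comp (by fun_prop) ?_)
    rintro q ⟨hq, -⟩
    simpa using hq.1
  · refine (ae_restrict_iff' hms).2 (Eventually.of_forall fun q hq => ?_)
    have h0 : 0 < q.1 := hq.1.1
    have h1 := hV q h0 hq.1.2
    have h2 := hK ((q.2 : ℂ) + q.1 * Complex.I) (by simpa using h0)
    rw [ofReal_add_mul_I_im] at h2
    have hK0 : 0 ≤ K := by
      by_contra hneg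
      have := (norm_nonneg _).trans h2
      have h3 := inv_pos.2 h0
      nlinarith
    rw [norm_mul]
    calc _ ≤ (V * q.1 ^ m) * (K * q.1⁻¹) := mul_le_mul h1 h2 (norm_nonneg _) (by positivity)
      _ = V * K * q.1 ^ (m - 1) := by
          obtain ⟨n, rfl⟩ := Nat.exists_eq_add_of_le' hm
          rw [Nat.add_sub_cancel, pow_succ]
          field_simp
      _ ≤ V * K * 1 := by
          gcongr
          exact pow_le_one₀ h0.le hq.1.2.le
      _ = V * K := mul_one _

theorem integral_weight_kernel (h : IsDerivTower ψ R) {m : ℕ} (hm : 1 ≤ m) (t : ℝ) :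
    (∫ q in Set.Ioo (0 : ℝ) 1 ×ˢ Set.Icc (-R) R,
      weight ψ m q * ((q.2 : ℂ) + q.1 * Complex.I - t)⁻¹).im = -(Real.pi * ψ 0 t) := by
  have hint : IntegrableOn (fun q : ℝ × ℝ => weight ψ m q * ((q.2 : ℂ) + q.1 * Complex.I - t)⁻¹)
      (Set.Ioo 0 1 ×ˢ Set.Icc (-R) R) := by
    refine h.integrableOn_weight_mul hm (T := fun z => (z - t)⁻¹) (K := 1) ?_ ?_
    · refine ContinuousOn.inv₀ (by fun_prop) fun z hz => sub_ofReal_ne_zero (ne_of_gt hz) t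
    · intro z hz
      have := norm_inv_sub_ofReal_le hz.ne' t
      rw [abs_of_pos hz] at this
      simpa using this
  set H : ℝ → ℂ := fun y => (1 - (y : ℂ) ^ (m + 1)) * taylorSum ψ t (m + 1) y with hH
  set D : ℝ → ℂ := fun y => ∫ x in Set.Icc (-R) R,
    weight ψ m (y, x) * ((x : ℂ) + y * Complex.I - t)⁻¹ with hD
  have hderiv : ∀ y, 0 < y → HasDerivAt H (-D y) y := by
    intro y hy
    have h1 : HasDerivAt (fun v : ℝ => 1 - (v : ℂ) ^ (m + 1)) (-(((m + 1 : ℕ) : ℂ) * (y : ℂ) ^ m)) y := by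
      have := ((Complex.ofRealCLM.hasDerivAt (x := y)).pow (m + 1)).const_sub 1
      refine this.congr_deriv ?_
      simp
    refine (h1.mul (h.hasDerivAt_taylorSum t m hy)).congr_deriv ?_
    rw [hD]
    simp only [h.integral_weight m t hy]
    rw [mul_pow, pow_succ Complex.I m]
    ring
  have hDint : IntegrableOn D (Set.Ioo 0 1) := by
    have h1 : Integrable (fun q : ℝ × ℝ => weight ψ m q * ((q.2 : ℂ) + q.1 * Complex.I - t)⁻¹)
        ((volume.restrict (Set.Ioo 0 1)).prod (volume.restrict (Set.Icc (-R) R))) := by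
      rw [Measure.prod_restrict]
      exact hint
    exact h1.integral_prod_left
  have himD : IntegrableOn (fun y => (D y).im) (Set.Ioo 0 1) := hDint.im
  have hHd : ∀ y, 0 < y → HasDerivAt (fun y => (H y).im) (-(D y).im) y := by
    intro y hy
    have := Complex.imCLM.hasFDerivAt.comp_hasDerivAt y (hderiv y hy)
    refine this.congr_deriv ?_
    simp
  have hlim0 : Tendsto (fun y => (H y).im) (𝓝[>] 0) (𝓝 (-(Real.pi * ψ 0 t))) := by
    have hS : Tendsto (fun y : ℝ => taylorSum ψ t (m + 1) y - cauchy ψ t 0 y) (𝓝[>] 0) (𝓝 0) := by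
      have e : (fun y : ℝ => taylorSum ψ t (m + 1) y - cauchy ψ t 0 y)
          = fun y : ℝ => ∑ j ∈ Finset.range m, (Complex.I * y) ^ j * Complex.I /
            ((j + 1).factorial : ℂ) * ((y : ℂ) * cauchy ψ t (j + 1) y) := by
        funext y
        rw [taylorSum, Finset.sum_range_succ']
        simp only [pow_zero, Nat.factorial_zero, Nat.cast_one, div_one, one_mul, add_sub_cancel_right]
        refine Finset.sum_congr rfl fun j _ => ?_
        rw [pow_succ]
        ring
      rw [e]
      have h0 : (0 : ℂ) = ∑ j ∈ Finset.range m, (Complex.I * ((0 : ℝ) : ℂ)) ^ j * Complex.I /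
            ((j + 1).factorial : ℂ) * 0 := by simp
      rw [h0]
      refine tendsto_finsetSum _ fun j _ => Tendsto.mul ?_ (h.tendsto_mul_cauchy t (j + 1))
      have hc : Continuous fun y : ℝ => (Complex.I * (y : ℂ)) ^ j * Complex.I /
          ((j + 1).factorial : ℂ) := by fun_prop
      exact hc.continuousAt.tendsto.mono_left nhdsWithin_le_nhds
    have hyF : Tendsto (fun y : ℝ => (y : ℂ) ^ m * ((y : ℂ) * cauchy ψ t 0 y)) (𝓝[>] 0) (𝓝 0) := by
      have hc : Continuous fun y : ℝ => (y : ℂ) ^ m := by fun_prop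
      have := (hc.continuousAt.tendsto.mono_left nhdsWithin_le_nhds : Tendsto _ (𝓝[>] (0 : ℝ)) _).mul
        (h.tendsto_mul_cauchy t 0)
      simpa using this
    have h1c : Tendsto (fun y : ℝ => 1 - (y : ℂ) ^ (m + 1)) (𝓝[>] 0) (𝓝 1) := by
      have hc : Continuous fun y : ℝ => 1 - (y : ℂ) ^ (m + 1) := by fun_prop
      have := (hc.continuousAt (x := 0)).tendsto.mono_left
        (nhdsWithin_le_nhds : 𝓝[>] (0 : ℝ) ≤ 𝓝 0)
      simpa using this
    have hsmall : Tendsto (fun y : ℝ => H y - cauchy ψ t 0 y) (𝓝[>] 0) (𝓝 0) := by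
      have := (h1c.mul hS).sub hyF
      simp only [mul_zero, sub_zero] at this
      refine this.congr fun y => ?_
      rw [hH]
      ring
    have := ((Complex.continuous_im.tendsto 0).comp hsmall).add (h.tendsto_im_cauchy t)
    simp only [Complex.zero_im, zero_add] at this
    refine this.congr fun y => ?_
    simp
  have hlim1 : Tendsto (fun y => (H y).im) (𝓝[<] 1) (𝓝 0) := by
    have := (hHd 1 one_pos).continuousAt.tendsto
    have e : (H 1).im = 0 := by simp [hH]
    rw [e] at this
    exact this.mono_left nhdsWithin_le_nhds
  have hfund := intervalIntegral.integral_eq_sub_of_hasDerivAt_of_tendsto zero_lt_one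
    (fun y hy => hHd y hy.1)
    ((intervalIntegrable_iff_integrableOn_Ioo_of_le zero_le_one).2 himD.neg) hlim0 hlim1
  rw [intervalIntegral.integral_of_le zero_le_one, integral_Ioc_eq_integral_Ioo,
    integral_neg] at hfund
  have hprod : ∫ q in Set.Ioo (0 : ℝ) 1 ×ˢ Set.Icc (-R) R,
      weight ψ m q * ((q.2 : ℂ) + q.1 * Complex.I - t)⁻¹ = ∫ y in Set.Ioo (0 : ℝ) 1, D y := by
    rw [Measure.volume_eq_prod, setIntegral_prod _ hint]
  have him : (∫ y in Set.Ioo (0 : ℝ) 1, D y).im = ∫ y in Set.Ioo (0 : ℝ) 1, (D y).im :=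
    (Complex.imCLM.integral_comp_comm hDint).symm
  rw [hprod, him]
  linarith

end IsDerivTower

end HelfferSjostrand

end DeformedWigner

namespace DeformedWigner

open scoped Matrix.Norms.L2Operator Matrix

/-! ### Expansion for smooth linear statistics -/

section Mixture

open IsDerivTower

variable {ψ : ℕ → ℝ → ℝ} {R : ℝ}

/-- The domain of integration in the representation by resolvents. -/
def hsDomain (R : ℝ) : Set (ℝ × ℝ) := Set.Ioo (0 : ℝ) 1 ×ˢ Set.Icc (-R) R

/-- Superposition of the values of `T` on the upper half plane. -/
def hsTransform (ψ : ℕ → ℝ → ℝ) (R : ℝ) (m : ℕ) (T : ℂ → ℂ) : ℂ :=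
  ∫ q in hsDomain R, weight ψ m q * T ((q.2 : ℂ) + q.1 * Complex.I)

lemma measurableSet_hsDomain : MeasurableSet (hsDomain R) :=
  measurableSet_Ioo.prod measurableSet_Icc

lemma isFiniteMeasure_hsDomain : IsFiniteMeasure (volume.restrict (hsDomain R)) := ⟨by
  rw [Measure.restrict_apply_univ, hsDomain, Measure.volume_eq_prod, Measure.prod_prod]
  simp⟩

lemma IsDerivTower.integrable_mixture (h : IsDerivTower ψ R) {m : ℕ} (hm : 1 ≤ m) {Y : Type*}
    [TopologicalSpace Y] [MeasurableSpace Y] [OpensMeasurableSpace Y]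
    [SecondCountableTopology Y] {P : Measure Y} [IsFiniteMeasure P] {T : Y → ℂ → ℂ} {K : ℝ}
    (hT : ContinuousOn (fun p : Y × ℂ => T p.1 p.2) {p | 0 < p.2.im})
    (hK : ∀ y z, 0 < z.im → ‖T y z‖ ≤ K * z.im⁻¹) :
    Integrable (fun p : Y × (ℝ × ℝ) => weight ψ m p.2 * T p.1 ((p.2.2 : ℂ) + p.2.1 * Complex.I))
      (P.prod (volume.restrict (hsDomain R))) := by
  have hfin := isFiniteMeasure_hsDomain (R := R)
  obtain ⟨V, hV0, hV⟩ := h.exists_norm_weight_le m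
  have hms : MeasurableSet (Set.univ ×ˢ hsDomain R : Set (Y × (ℝ × ℝ))) :=
    MeasurableSet.univ.prod measurableSet_hsDomain
  have hμ : P.prod (volume.restrict (hsDomain R))
      = (P.prod volume).restrict (Set.univ ×ˢ hsDomain R) := by
    rw [← Measure.prod_restrict, Measure.restrict_univ]
  have hbd : ∀ᵐ p ∂(P.prod (volume.restrict (hsDomain R))),
      ‖weight ψ m p.2 * T p.1 ((p.2.2 : ℂ) + p.2.1 * Complex.I)‖ ≤ V * K := by
    rw [hμ]
    refine (ae_restrict_iff' hms).2 (Eventually.of_forall fun p hp => ?_)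
    have hq := hp.2
    have h0 : 0 < p.2.1 := hq.1.1
    have h1 := hV p.2 h0 hq.1.2
    have h2 := hK p.1 ((p.2.2 : ℂ) + p.2.1 * Complex.I) (by simpa using h0)
    rw [ofReal_add_mul_I_im] at h2
    have hK0 : 0 ≤ K := by
      by_contra hneg
      have := (norm_nonneg _).trans h2
      have h3 := inv_pos.2 h0
      nlinarith
    rw [norm_mul]
    calc _ ≤ (V * p.2.1 ^ m) * (K * p.2.1⁻¹) := mul_le_mul h1 h2 (norm_nonneg _) (by positivity)
      _ = V * K * p.2.1 ^ (m - 1) := by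
          obtain ⟨n, rfl⟩ := Nat.exists_eq_add_of_le' hm
          rw [Nat.add_sub_cancel, pow_succ]
          field_simp
      _ ≤ V * K * 1 := by
          gcongr
          exact pow_le_one₀ h0.le hq.1.2.le
      _ = V * K := mul_one _
  refine Integrable.of_bound (C := V * K) ?_ hbd
  rw [hμ]
  refine ContinuousOn.aestronglyMeasurable ?_ hms
  refine ((h.continuous_weight m).comp continuous_snd).continuousOn.mul ?_
  refine hT.comp (f := fun p : Y × (ℝ × ℝ) => (p.1, (p.2.2 : ℂ) + p.2.1 * Complex.I))
    (by fun_prop) ?_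
  rintro p ⟨-, hq⟩
  simpa using hq.1.1

lemma IsDerivTower.integral_hsTransform (h : IsDerivTower ψ R) {m : ℕ} (hm : 1 ≤ m) {Y : Type*}
    [TopologicalSpace Y] [MeasurableSpace Y] [OpensMeasurableSpace Y]
    [SecondCountableTopology Y] {P : Measure Y} [IsFiniteMeasure P] {T : Y → ℂ → ℂ} {K : ℝ}
    (hT : ContinuousOn (fun p : Y × ℂ => T p.1 p.2) {p | 0 < p.2.im})
    (hK : ∀ y z, 0 < z.im → ‖T y z‖ ≤ K * z.im⁻¹) :
    Integrable (fun y => hsTransform ψ R m (T y)) P ∧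
      IntegrableOn (fun q : ℝ × ℝ => weight ψ m q * ∫ y, T y ((q.2 : ℂ) + q.1 * Complex.I) ∂P)
        (hsDomain R) ∧
      ∫ y, hsTransform ψ R m (T y) ∂P = hsTransform ψ R m fun z => ∫ y, T y z ∂P := by
  have hfin := isFiniteMeasure_hsDomain (R := R)
  have hi := h.integrable_mixture hm (P := P) hT hK
  refine ⟨hi.integral_prod_left, ?_, ?_⟩
  · have := hi.integral_prod_right
    simp only [integral_const_mul] at this
    exact this
  · have := integral_integral_swap
      (f := fun y (q : ℝ × ℝ) => weight ψ m q * T y ((q.2 : ℂ) + q.1 * Complex.I)) hi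
    simp only [integral_const_mul] at this
    exact this

/-- A measure on the line integrates smooth functions through its Stieltjes transform. -/
lemma IsDerivTower.integral_measure (h : IsDerivTower ψ R) {m : ℕ} (hm : 1 ≤ m) (ν : Measure ℝ)
    [IsFiniteMeasure ν] :
    IntegrableOn (fun q : ℝ × ℝ => weight ψ m q * ∫ t : ℝ, ((q.2 : ℂ) + q.1 * Complex.I - t)⁻¹ ∂ν)
        (hsDomain R) ∧
      (hsTransform ψ R m fun z => ∫ t : ℝ, (z - t)⁻¹ ∂ν).im = -(Real.pi * ∫ t, ψ 0 t ∂ν) := by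
  obtain ⟨h1, h2, h3⟩ := h.integral_hsTransform hm (P := ν) (T := fun (t : ℝ) z => (z - t)⁻¹)
    (K := 1) (by
      refine ContinuousOn.inv₀ (by fun_prop) fun p hp => sub_ofReal_ne_zero (ne_of_gt hp) p.1)
    (by
      intro t z hz
      have := norm_inv_sub_ofReal_le hz.ne' t
      rw [abs_of_pos hz] at this
      simpa using this)
  refine ⟨h2, ?_⟩
  rw [← h3]
  have h4 := Complex.imCLM.integral_comp_comm h1
  simp only [Complex.imCLM_apply] at h4
  rw [← h4, ← integral_const_mul, ← integral_neg]
  exact integral_congr_ae (Eventually.of_forall fun t => h.integral_weight_kernel hm t)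

end Mixture

section Statistics

open IsDerivTower

variable {J : ℕ} {θ : Fin J → ℝ} {j₀ : Fin J} {k : Fin J → ℕ} {ε c₄ : ℝ} {μ : Measure ℝ}
  {σ : ℝ} {ψ : ℕ → ℝ → ℝ} {R : ℝ}

/-- The normalized linear eigenvalue statistic. -/
def eigenStat {N : ℕ} (φ : ℝ → ℝ) {M : Matrix (Fin N) (Fin N) ℂ} (hM : M.IsHermitian) : ℝ :=
  (∑ i, φ (hM.eigenvalues i)) / N

namespace Config

variable (c : Config θ j₀ k ε c₄)

lemma continuousOn_trace_green : ContinuousOn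
    (fun p : (c.ι → ℝ) × ℂ => (green p.2 (c.M p.1)).trace / (c.N : ℂ)) {p | 0 < p.2.im} := by
  intro p hp
  refine ContinuousAt.continuousWithinAt ?_
  have h1 : ContinuousAt (fun p : (c.ι → ℝ) × ℂ => green p.2 (c.M p.1)) p :=
    ContinuousAt.comp (f := fun p : (c.ι → ℝ) × ℂ => (p.2, c.M p.1))
      (g := fun p : ℂ × Matrix (Fin c.N) (Fin c.N) ℂ => green p.1 p.2)
      (continuousAt_green (c.isHermitian_M p.1) (ne_of_gt hp))
      (continuous_snd.prodMk (c.continuous_M.comp continuous_fst)).continuousAt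
  exact ((Continuous.matrix_trace continuous_id).continuousAt.comp h1).div_const _

lemma norm_trace_green_le (x : c.ι → ℝ) {w : ℂ} (hw : 0 < w.im) :
    ‖(green w (c.M x)).trace / (c.N : ℂ)‖ ≤ 1 * w.im⁻¹ := by
  have hN := c.N_pos'
  rw [norm_div, Complex.norm_natCast, div_le_iff₀ hN, one_mul, mul_comm]
  refine (norm_trace_le _).trans ?_
  rw [Fintype.card_fin]
  have := norm_green_le (c.isHermitian_M x) hw.ne'
  rw [abs_of_pos hw] at this
  gcongr

lemma im_hsTransform_trace (h : IsDerivTower ψ R) {m : ℕ} (hm : 1 ≤ m) (x : c.ι → ℝ) :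
    (hsTransform ψ R m fun w => (green w (c.M x)).trace / (c.N : ℂ)).im
      = -(Real.pi * eigenStat (ψ 0) (c.isHermitian_M x)) := by
  have hN := c.N_ne_zero
  have hM := c.isHermitian_M x
  have hi : ∀ t : ℝ, IntegrableOn (fun q : ℝ × ℝ => weight ψ m q *
      ((q.2 : ℂ) + q.1 * Complex.I - t)⁻¹) (hsDomain R) := fun t =>
    h.integrableOn_weight_mul hm (T := fun z => (z - t)⁻¹) (K := 1)
      (ContinuousOn.inv₀ (by fun_prop) fun z hz => sub_ofReal_ne_zero (ne_of_gt hz) t)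
      (fun z hz => by
        have := norm_inv_sub_ofReal_le hz.ne' t
        rw [abs_of_pos hz] at this
        simpa using this)
  have e : hsTransform ψ R m (fun w => (green w (c.M x)).trace / (c.N : ℂ))
      = (∑ i, ∫ q in hsDomain R, weight ψ m q *
        ((q.2 : ℂ) + q.1 * Complex.I - hM.eigenvalues i)⁻¹) / (c.N : ℂ) := by
    rw [← integral_finsetSum _ fun i _ => hi _, ← integral_div, hsTransform]
    refine setIntegral_congr_fun measurableSet_hsDomain fun q hq => ?_
    have hq0 : ((q.2 : ℂ) + q.1 * Complex.I).im ≠ 0 := by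
      rw [ofReal_add_mul_I_im]; exact (ne_of_gt hq.1.1)
    rw [trace_green hM hq0, ← Finset.mul_sum, mul_div_assoc]
  rw [e, Complex.div_natCast_im, Complex.im_sum]
  have h1 := fun t => h.integral_weight_kernel hm t
  simp only [hsDomain, h1]
  rw [eigenStat, Finset.sum_neg_distrib, ← Finset.mul_sum]
  ring

end Config

/-- The expansion of the expectation of smooth linear statistics. -/
theorem exists_expansion_bound (hσ : 0 < σ) (hμ : IsEntryLaw μ σ) (hθ : Function.Injective θ)
    (hj₀ : θ j₀ = 0) {ν₁ ν₂ : Measure ℝ} [IsFiniteMeasure ν₁] [IsFiniteMeasure ν₂]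
    (hν : ∀ z : ℂ, z.im ≠ 0 → secondOrder μ σ θ j₀ k ε c₄ z
      = (∫ x : ℝ, (z - x)⁻¹ ∂ν₁) - ∫ x : ℝ, (z - x)⁻¹ ∂ν₂)
    {φ : ℝ → ℝ} (hφ : ContDiff ℝ (⊤ : ℕ∞) φ) (hc : HasCompactSupport φ) :
    ∃ C, ∀ c : Config θ j₀ k ε c₄,
      Integrable (fun x => eigenStat φ (c.isHermitian_M x)) (c.law μ) ∧
      |∫ x, eigenStat φ (c.isHermitian_M x) ∂(c.law μ)
        - ((∫ x, φ x ∂(semicircle σ)) + 1 / (c.N : ℝ) * (∫ x, φ x ∂ν₁ - ∫ x, φ x ∂ν₂))|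
        ≤ C / (c.N : ℝ) ^ 2 := by
  have := hμ.isProbabilityMeasure
  have := isProbabilityMeasure_semicircle hσ
  obtain ⟨ψ, R, h, rfl⟩ := exists_isDerivTower hφ hc
  obtain ⟨C, p, hC, hexp⟩ := isSmall_expansion (k := k) (ε := ε) (c₄ := c₄) hσ hμ hθ hj₀
  set m := p + 1 with hmdef
  have hm : 1 ≤ m := by omega
  obtain ⟨V, hV0, hV⟩ := h.exists_norm_weight_le m
  have hfin := isFiniteMeasure_hsDomain (R := R)
  set A := volume.real (hsDomain R) with hA
  refine ⟨Real.pi⁻¹ * (V * C * 2 ^ p * A), fun c => ?_⟩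
  have hN := c.N_pos'
  have hN' := c.N_ne_zero
  obtain ⟨a1, a2, a3⟩ := h.integral_hsTransform hm (P := c.law μ)
    (T := fun x w => (green w (c.M x)).trace / (c.N : ℂ)) c.continuousOn_trace_green
    (fun x w hw => c.norm_trace_green_le x hw)
  have e1 : ∀ x, eigenStat (ψ 0) (c.isHermitian_M x) = -Real.pi⁻¹ *
      (hsTransform ψ R m fun w => (green w (c.M x)).trace / (c.N : ℂ)).im := by
    intro x
    rw [c.im_hsTransform_trace h hm]
    field_simp
  simp only [e1]
  have himi : Integrable (fun x => (hsTransform ψ R m fun w =>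
      (green w (c.M x)).trace / (c.N : ℂ)).im) (c.law μ) := a1.im
  refine ⟨himi.const_mul _, ?_⟩
  have e2 : ∫ x, (hsTransform ψ R m fun w => (green w (c.M x)).trace / (c.N : ℂ)).im ∂(c.law μ)
      = (hsTransform ψ R m (c.gFun μ)).im := by
    have h4 := Complex.imCLM.integral_comp_comm a1
    simp only [Complex.imCLM_apply] at h4
    rw [h4, a3]
    rfl
  obtain ⟨b1, b2⟩ := h.integral_measure hm (semicircle σ)
  obtain ⟨n1, n2⟩ := h.integral_measure hm ν₁
  obtain ⟨o1, o2⟩ := h.integral_measure hm ν₂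
  set E : ℂ → ℂ := fun z => c.gFun μ z - (∫ t : ℝ, (z - t)⁻¹ ∂(semicircle σ))
    - (c.N : ℂ)⁻¹ * ((∫ t : ℝ, (z - t)⁻¹ ∂ν₁) - ∫ t : ℝ, (z - t)⁻¹ ∂ν₂) with hE
  have hEs : hsTransform ψ R m E = hsTransform ψ R m (c.gFun μ)
      - (hsTransform ψ R m fun z => ∫ t : ℝ, (z - t)⁻¹ ∂(semicircle σ))
      - (c.N : ℂ)⁻¹ * ((hsTransform ψ R m fun z => ∫ t : ℝ, (z - t)⁻¹ ∂ν₁)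
        - hsTransform ψ R m fun z => ∫ t : ℝ, (z - t)⁻¹ ∂ν₂) := by
    simp only [hsTransform]
    have a2' : IntegrableOn (fun q : ℝ × ℝ => weight ψ m q *
      c.gFun μ ((q.2 : ℂ) + q.1 * Complex.I)) (hsDomain R) := a2
    have k1 := a2'.sub b1
    have k2 := (n1.sub o1).const_mul (c.N : ℂ)⁻¹
    simp only [Pi.sub_def] at k1 k2
    rw [← integral_sub n1 o1, ← integral_const_mul, ← integral_sub a2' b1, ← integral_sub k1 k2]
    congr 1
    funext q
    rw [hE]
    ring
  have hEb : ‖hsTransform ψ R m E‖ ≤ V * C * 2 ^ p * A / (c.N : ℝ) ^ 2 := by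
    have hpt : ∀ q ∈ hsDomain R, ‖weight ψ m q * E ((q.2 : ℂ) + q.1 * Complex.I)‖
        ≤ V * C * 2 ^ p / (c.N : ℝ) ^ 2 := by
      intro q hq
      have h0 : 0 < q.1 := hq.1.1
      have h1 : q.1 < 1 := hq.1.2
      have hz : 0 < ((q.2 : ℂ) + q.1 * Complex.I).im := by simpa using h0
      have h2 := hexp (c.withZ _ hz)
      have e3 : E ((q.2 : ℂ) + q.1 * Complex.I)
          = (c.withZ _ hz).gN μ - gSC σ (c.withZ _ hz).z
            - secondOrder μ σ θ j₀ k ε c₄ (c.withZ _ hz).z / (c.withZ _ hz).N := by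
        rw [hν _ (c.withZ _ hz).im_ne, hE, div_eq_inv_mul]
        rfl
      rw [norm_mul, e3]
      have hr : (c.withZ _ hz).r ≤ 2 * q.1⁻¹ := by
        change 1 + ((q.2 : ℂ) + q.1 * Complex.I).im⁻¹ ≤ _
        rw [ofReal_add_mul_I_im]
        have := (one_le_inv₀ h0).2 h1.le
        linarith
      have hr0 := (c.withZ _ hz).r_pos
      have h3 : C * (c.withZ _ hz).r ^ p / (c.N : ℝ) ^ 2
          ≤ C * (2 * q.1⁻¹) ^ p / (c.N : ℝ) ^ 2 := by gcongr
      have h4 := h2.trans h3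
      calc _ ≤ (V * q.1 ^ m) * (C * (2 * q.1⁻¹) ^ p / (c.N : ℝ) ^ 2) :=
            mul_le_mul (hV q h0 h1) h4 (norm_nonneg _) (by positivity)
        _ = V * C * 2 ^ p / (c.N : ℝ) ^ 2 * q.1 := by
            rw [hmdef, pow_succ, mul_pow, inv_pow]
            field_simp
        _ ≤ V * C * 2 ^ p / (c.N : ℝ) ^ 2 * 1 := by gcongr
        _ = _ := mul_one _
    have := norm_setIntegral_le_of_norm_le_const (μ := volume)
      (s := hsDomain R) (by
        have := hfin.measure_univ_lt_top
        rwa [Measure.restrict_apply_univ] at this) hpt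
    refine this.trans (le_of_eq ?_)
    rw [hA]
    ring
  have hfinal : ∫ x, -Real.pi⁻¹ * (hsTransform ψ R m fun w =>
        (green w (c.M x)).trace / (c.N : ℂ)).im ∂(c.law μ)
      - ((∫ x, ψ 0 x ∂(semicircle σ)) + 1 / (c.N : ℝ) * (∫ x, ψ 0 x ∂ν₁ - ∫ x, ψ 0 x ∂ν₂))
      = -Real.pi⁻¹ * (hsTransform ψ R m E).im := by
    rw [integral_const_mul, e2, hEs]
    have e5 : ∀ w : ℂ, ((c.N : ℂ)⁻¹ * w).im = (c.N : ℝ)⁻¹ * w.im := by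
      intro w
      rw [← Complex.ofReal_natCast, ← Complex.ofReal_inv, Complex.im_ofReal_mul]
    simp only [Complex.sub_im, e5, b2, n2, o2]
    have := Real.pi_ne_zero
    field_simp
    ring
  rw [hfinal, abs_mul, abs_neg, abs_of_pos (inv_pos.2 Real.pi_pos), mul_div_assoc]
  exact mul_le_mul_of_nonneg_left ((Complex.abs_im_le_norm _).trans hEb)
    (inv_pos.2 Real.pi_pos).le

end Statistics

/-! ### Variance of smooth linear statistics -/

section StatVariance

open IsDerivTower

variable {J : ℕ} {θ : Fin J → ℝ} {j₀ : Fin J} {k : Fin J → ℕ} {ε c₄ : ℝ} {μ : Measure ℝ}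
  {σ : ℝ} {ψ : ℕ → ℝ → ℝ} {R : ℝ}

lemma norm_weight_mul_le {m : ℕ} (hm : 2 ≤ m) {V : ℝ}
    (hV0 : 0 ≤ V) (hV : ∀ q : ℝ × ℝ, 0 < q.1 → q.1 < 1 → ‖weight ψ m q‖ ≤ V * q.1 ^ m)
    {K : ℝ} (hK0 : 0 ≤ K) {q : ℝ × ℝ} (hq : q ∈ hsDomain R) {w : ℂ} (hw : ‖w‖ ≤ K * (q.1⁻¹) ^ 2) :
    ‖weight ψ m q * w‖ ≤ V * K := by
  have h0 : 0 < q.1 := hq.1.1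
  rw [norm_mul]
  calc _ ≤ (V * q.1 ^ m) * (K * (q.1⁻¹) ^ 2) :=
        mul_le_mul (hV q h0 hq.1.2) hw (norm_nonneg _) (by positivity)
    _ = V * K * q.1 ^ (m - 2) := by
        obtain ⟨n, rfl⟩ := Nat.exists_eq_add_of_le' hm
        rw [Nat.add_sub_cancel, pow_add]
        field_simp
    _ ≤ V * K * 1 := by
        gcongr
        exact pow_le_one₀ h0.le hq.1.2.le
    _ = V * K := mul_one _

lemma IsDerivTower.im_integral_weight_sq (h : IsDerivTower ψ R) {m : ℕ} (hm : 2 ≤ m) (t : ℝ) :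
    IntegrableOn (fun q : ℝ × ℝ => weight ψ m q * (((q.2 : ℂ) + q.1 * Complex.I - t)⁻¹) ^ 2)
      (hsDomain R) ∧
    (∫ q in hsDomain R, weight ψ m q * (((q.2 : ℂ) + q.1 * Complex.I - t)⁻¹) ^ 2).im
      = -(Real.pi * ψ 1 t) := by
  have hfin := isFiniteMeasure_hsDomain (R := R)
  obtain ⟨V, hV0, hV⟩ := h.exists_norm_weight_le m
  have hms := measurableSet_hsDomain (R := R)
  have hne : ∀ (u : ℝ), ∀ q ∈ hsDomain R, (q.2 : ℂ) + q.1 * Complex.I - u ≠ 0 := fun u q hq =>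
    sub_ofReal_ne_zero (by rw [ofReal_add_mul_I_im]; exact ne_of_gt hq.1.1) u
  have hc : ∀ u : ℝ, ContinuousOn
      (fun q : ℝ × ℝ => ((q.2 : ℂ) + q.1 * Complex.I - u)⁻¹) (hsDomain R) := fun u =>
    ContinuousOn.inv₀ (by fun_prop) (hne u)
  have hw := (h.continuous_weight m).continuousOn (s := hsDomain R)
  have m1 : ∀ᶠ u : ℝ in 𝓝 t, AEStronglyMeasurable (fun q : ℝ × ℝ =>
      weight ψ m q * ((q.2 : ℂ) + q.1 * Complex.I - u)⁻¹) (volume.restrict (hsDomain R)) :=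
    Eventually.of_forall fun u => (hw.mul (hc u)).aestronglyMeasurable hms
  have m2 : IntegrableOn (fun q : ℝ × ℝ =>
      weight ψ m q * ((q.2 : ℂ) + q.1 * Complex.I - t)⁻¹) (hsDomain R) := by
    refine h.integrableOn_weight_mul (by omega) (T := fun z => (z - t)⁻¹) (K := 1) ?_ ?_
    · exact ContinuousOn.inv₀ (by fun_prop) fun z hz => sub_ofReal_ne_zero (ne_of_gt hz) t
    · intro z hz
      have := norm_inv_sub_ofReal_le hz.ne' t
      rw [abs_of_pos hz] at this
      simpa using this
  have m3 : AEStronglyMeasurable (fun q : ℝ × ℝ =>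
      weight ψ m q * (((q.2 : ℂ) + q.1 * Complex.I - t)⁻¹) ^ 2) (volume.restrict (hsDomain R)) :=
    (hw.mul ((hc t).pow 2)).aestronglyMeasurable hms
  have m4 : ∀ q ∈ hsDomain R, ∀ u ∈ (Set.univ : Set ℝ),
      ‖weight ψ m q * (((q.2 : ℂ) + q.1 * Complex.I - u)⁻¹) ^ 2‖ ≤ V * 1 := by
    intro q hq u _
    refine norm_weight_mul_le hm hV0 hV zero_le_one hq ?_
    rw [one_mul, norm_pow]
    exact pow_le_pow_left₀ (norm_nonneg _) (norm_kernel_le hq.1.1 q.2 u) 2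
  have m5 : ∀ q ∈ hsDomain R, ∀ u ∈ (Set.univ : Set ℝ),
      HasDerivAt (fun u : ℝ => weight ψ m q * ((q.2 : ℂ) + q.1 * Complex.I - u)⁻¹)
        (weight ψ m q * (((q.2 : ℂ) + q.1 * Complex.I - u)⁻¹) ^ 2) u := by
    intro q hq u _
    have h1 := ((Complex.ofRealCLM.hasDerivAt (x := u)).const_sub
      ((q.2 : ℂ) + q.1 * Complex.I)).inv (hne u q hq)
    refine (h1.const_mul (weight ψ m q)).congr_deriv ?_
    simp [div_eq_mul_inv]
  have key := hasDerivAt_integral_of_dominated_loc_of_deriv_le univ_mem m1 m2 m3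
    ((ae_restrict_iff' hms).2 (Eventually.of_forall m4)) (integrable_const (V * 1))
    ((ae_restrict_iff' hms).2 (Eventually.of_forall m5))
  refine ⟨key.1, ?_⟩
  have h1 := Complex.imCLM.hasFDerivAt.comp_hasDerivAt t key.2
  have e : (fun u : ℝ => -(Real.pi * ψ 0 u)) = (⇑Complex.imCLM ∘ fun u : ℝ =>
      ∫ q in hsDomain R, weight ψ m q * ((q.2 : ℂ) + q.1 * Complex.I - u)⁻¹) := by
    funext u
    exact (h.integral_weight_kernel (by omega) u).symm
  rw [← e] at h1
  exact h1.unique (((h.hasDerivAt 0 t).const_mul Real.pi).neg)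

/-- The spectral function of a Hermitian matrix. -/
def spectralFun {N : ℕ} (f : ℝ → ℝ) {M : Matrix (Fin N) (Fin N) ℂ} (hM : M.IsHermitian) :
    Matrix (Fin N) (Fin N) ℂ :=
  (hM.eigenvectorUnitary : Matrix (Fin N) (Fin N) ℂ)
    * Matrix.diagonal (fun i => (f (hM.eigenvalues i) : ℂ))
    * star (hM.eigenvectorUnitary : Matrix (Fin N) (Fin N) ℂ)

lemma norm_unitary_le_one {n : Type*} [Fintype n] [DecidableEq n] {U : Matrix n n ℂ}
    (hU : U ∈ Matrix.unitaryGroup n ℂ) : ‖U‖ ≤ 1 := by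
  have := CStarRing.norm_mem_unitary_mul (1 : Matrix n n ℂ) hU
  rw [mul_one] at this
  rw [this]
  exact norm_one_le_one

lemma hsSq_spectralFun_le {N : ℕ} (f : ℝ → ℝ) {M : Matrix (Fin N) (Fin N) ℂ}
    (hM : M.IsHermitian) : hsSq (spectralFun f hM) ≤ ∑ i, f (hM.eigenvalues i) ^ 2 := by
  have hU := norm_unitary_le_one hM.eigenvectorUnitary.2
  have hU' := norm_unitary_le_one (Unitary.star_mem hM.eigenvectorUnitary.2)
  have h1 := hsSq_mul_le' ((hM.eigenvectorUnitary : Matrix (Fin N) (Fin N) ℂ)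
    * Matrix.diagonal (fun i => (f (hM.eigenvalues i) : ℂ)))
    (star (hM.eigenvectorUnitary : Matrix (Fin N) (Fin N) ℂ))
  have h2 := hsSq_mul_le (hM.eigenvectorUnitary : Matrix (Fin N) (Fin N) ℂ)
    (Matrix.diagonal (fun i => (f (hM.eigenvalues i) : ℂ)))
  have h3 : hsSq (Matrix.diagonal (fun i => (f (hM.eigenvalues i) : ℂ)))
      = ∑ i, f (hM.eigenvalues i) ^ 2 := by
    rw [hsSq_diagonal]
    simp
  have p1 := pow_le_one₀ (n := 2) (norm_nonneg _) hU
  have p2 := pow_le_one₀ (n := 2) (norm_nonneg _) hU'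
  rw [← h3]
  refine h1.trans ((mul_le_of_le_one_right (hsSq_nonneg _) p2).trans (h2.trans ?_))
  exact mul_le_of_le_one_left (hsSq_nonneg _) p1

lemma trace_mul_conj_diagonal {n : Type*} [Fintype n] [DecidableEq n] (B U : Matrix n n ℂ)
    (d : n → ℂ) : (B * (U * Matrix.diagonal d * star U)).trace
      = ∑ i, (star U * B * U) i i * d i := by
  rw [← mul_assoc, ← mul_assoc, Matrix.trace_mul_comm, ← mul_assoc, ← mul_assoc]
  simp [Matrix.trace, Matrix.mul_diagonal]

lemma IsDerivTower.im_integral_trace (h : IsDerivTower ψ R) {m : ℕ} (hm : 2 ≤ m) {N : ℕ}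
    {M B : Matrix (Fin N) (Fin N) ℂ} (hM : M.IsHermitian) (hB : B.IsHermitian) :
    (∫ q in hsDomain R, weight ψ m q * (green ((q.2 : ℂ) + q.1 * Complex.I) M * B
      * green ((q.2 : ℂ) + q.1 * Complex.I) M).trace).im
      = -(Real.pi * (B * spectralFun (ψ 1) hM).trace.re) := by
  set U : Matrix (Fin N) (Fin N) ℂ := (↑hM.eigenvectorUnitary : Matrix (Fin N) (Fin N) ℂ)
  have hU : U ∈ Matrix.unitaryGroup (Fin N) ℂ := hM.eigenvectorUnitary.2
  have hreal : ∀ i, (star U * B * U) i i = (((star U * B * U) i i).re : ℂ) := by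
    intro i
    have hh : (star U * B * U).IsHermitian := by
      rw [Matrix.IsHermitian, Matrix.conjTranspose_mul, Matrix.conjTranspose_mul, hB.eq,
        Matrix.star_eq_conjTranspose, Matrix.conjTranspose_conjTranspose, mul_assoc]
    exact (Complex.conj_eq_iff_re.1 (hh.apply i i)).symm
  have h1 : ∀ q ∈ hsDomain R, weight ψ m q * (green ((q.2 : ℂ) + q.1 * Complex.I) M * B
      * green ((q.2 : ℂ) + q.1 * Complex.I) M).trace
      = ∑ i, (((star U * B * U) i i).re : ℂ) * (weight ψ m q *
        (((q.2 : ℂ) + q.1 * Complex.I - hM.eigenvalues i)⁻¹) ^ 2) := by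
    intro q hq
    have hz : ((q.2 : ℂ) + q.1 * Complex.I).im ≠ 0 := by
      rw [ofReal_add_mul_I_im]; exact ne_of_gt hq.1.1
    have hg := green_conj_diagonal hM.eigenvectorUnitary.2 hM.eigenvalues hz
    rw [← spectral_eq hM] at hg
    rw [mul_assoc, Matrix.trace_mul_comm, mul_assoc, hg.2, conj_unitary_mul hU,
      Matrix.diagonal_mul_diagonal, trace_mul_conj_diagonal, Finset.mul_sum]
    refine Finset.sum_congr rfl fun i _ => ?_
    rw [← hreal i]
    ring
  have h2 := fun t => (h.im_integral_weight_sq hm t).1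
  have h3 := fun t => (h.im_integral_weight_sq hm t).2
  rw [setIntegral_congr_fun measurableSet_hsDomain h1,
    integral_finsetSum _ fun i _ => (h2 _).const_mul _, Complex.im_sum]
  simp only [integral_const_mul, Complex.im_ofReal_mul, h3]
  rw [spectralFun, trace_mul_conj_diagonal, Complex.re_sum, Finset.mul_sum,
    ← Finset.sum_neg_distrib]
  refine Finset.sum_congr rfl fun i _ => ?_
  rw [Complex.re_mul_ofReal]
  ring

namespace Config

variable (c : Config θ j₀ k ε c₄)

/-- The complex derivative of the superposition of resolvent traces. -/
def statDeriv (ψ : ℕ → ℝ → ℝ) (R : ℝ) (m : ℕ) (p : c.ι) (x : c.ι → ℝ) : ℂ :=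
  ∫ q in hsDomain R, weight ψ m q * ((green ((q.2 : ℂ) + q.1 * Complex.I) (c.M x) * (c.s • c.B p)
    * green ((q.2 : ℂ) + q.1 * Complex.I) (c.M x)).trace / (c.N : ℂ))

lemma norm_trace_deriv_le (p : c.ι) (x : c.ι → ℝ) {q : ℝ × ℝ} (hq : q ∈ hsDomain R) :
    ‖(green ((q.2 : ℂ) + q.1 * Complex.I) (c.M x) * (c.s • c.B p)
      * green ((q.2 : ℂ) + q.1 * Complex.I) (c.M x)).trace / (c.N : ℂ)‖
      ≤ 2 * c.s * (q.1⁻¹) ^ 2 := by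
  have hN := c.N_pos'
  have hs := c.s_nonneg
  have h0 : 0 < q.1 := hq.1.1
  rw [norm_div, Complex.norm_natCast, div_le_iff₀ hN, mul_comm _ (c.N : ℝ)]
  refine (norm_trace_le _).trans ?_
  rw [Fintype.card_fin]
  refine mul_le_mul_of_nonneg_left ?_ hN.le
  have hg := norm_green_le (c.isHermitian_M x)
    (z := (q.2 : ℂ) + q.1 * Complex.I) (by rw [ofReal_add_mul_I_im]; exact h0.ne')
  rw [ofReal_add_mul_I_im, abs_of_pos h0] at hg
  have hb := c.norm_smul_B_le p
  calc _ ≤ q.1⁻¹ * (2 * c.s) * q.1⁻¹ := by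
        refine (norm_mul_le _ _).trans (mul_le_mul ((norm_mul_le _ _).trans
          (mul_le_mul hg hb (norm_nonneg _) (by positivity))) hg (norm_nonneg _) (by positivity))
    _ = _ := by ring

lemma continuousOn_green_param (x : c.ι → ℝ) : ContinuousOn
    (fun q : ℝ × ℝ => green ((q.2 : ℂ) + q.1 * Complex.I) (c.M x)) (hsDomain R) := by
  intro q hq
  refine ContinuousAt.continuousWithinAt ?_
  exact ContinuousAt.comp (f := fun q : ℝ × ℝ => ((q.2 : ℂ) + q.1 * Complex.I, c.M x))
    (g := fun p : ℂ × Matrix (Fin c.N) (Fin c.N) ℂ => green p.1 p.2)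
    (continuousAt_green (c.isHermitian_M x) (by
      rw [ofReal_add_mul_I_im]; exact ne_of_gt hq.1.1)) (by fun_prop)

lemma aestronglyMeasurable_deriv (h : IsDerivTower ψ R) (m : ℕ) (p : c.ι) (x : c.ι → ℝ) :
    AEStronglyMeasurable (fun q : ℝ × ℝ => weight ψ m q *
      ((green ((q.2 : ℂ) + q.1 * Complex.I) (c.M x) * (c.s • c.B p)
      * green ((q.2 : ℂ) + q.1 * Complex.I) (c.M x)).trace / (c.N : ℂ)))
      (volume.restrict (hsDomain R)) := by
  have hg := c.continuousOn_green_param (R := R) x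
  refine ContinuousOn.aestronglyMeasurable ?_ measurableSet_hsDomain
  refine (h.continuous_weight m).continuousOn.mul (ContinuousOn.div_const ?_ _)
  exact (Continuous.matrix_trace continuous_id).comp_continuousOn
    ((hg.mul continuousOn_const).mul hg)

lemma continuous_statDeriv (h : IsDerivTower ψ R) {m : ℕ} (hm : 2 ≤ m) (p : c.ι) :
    Continuous (c.statDeriv ψ R m p) := by
  have hfin := isFiniteMeasure_hsDomain (R := R)
  obtain ⟨V, hV0, hV⟩ := h.exists_norm_weight_le m
  have hs := c.s_nonneg
  refine continuous_of_dominated (bound := fun _ => V * (2 * c.s))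
    (fun x => c.aestronglyMeasurable_deriv h m p x) (fun x => ?_) (integrable_const _) ?_
  · exact (ae_restrict_iff' measurableSet_hsDomain).2 (Eventually.of_forall fun q hq =>
      norm_weight_mul_le hm hV0 hV (by positivity) hq (c.norm_trace_deriv_le p x hq))
  · refine (ae_restrict_iff' measurableSet_hsDomain).2 (Eventually.of_forall fun q hq => ?_)
    have hg := continuous_green_comp c.continuous_M c.isHermitian_M
      (z := (q.2 : ℂ) + q.1 * Complex.I) (by rw [ofReal_add_mul_I_im]; exact ne_of_gt hq.1.1)
    exact continuous_const.mul
      ((Continuous.matrix_trace ((hg.mul continuous_const).mul hg)).div_const _)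

lemma exists_norm_statDeriv_le (h : IsDerivTower ψ R) {m : ℕ} (hm : 2 ≤ m) :
    ∃ K, ∀ p x, ‖c.statDeriv ψ R m p x‖ ≤ K := by
  have hfin := isFiniteMeasure_hsDomain (R := R)
  obtain ⟨V, hV0, hV⟩ := h.exists_norm_weight_le m
  have hs := c.s_nonneg
  refine ⟨V * (2 * c.s) * volume.real (hsDomain R), fun p x => ?_⟩
  exact norm_setIntegral_le_of_norm_le_const (by
    have := hfin.measure_univ_lt_top
    rwa [Measure.restrict_apply_univ] at this) fun q hq =>
    norm_weight_mul_le hm hV0 hV (by positivity) hq (c.norm_trace_deriv_le p x hq)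

lemma hasDerivAt_hsTransform_update (h : IsDerivTower ψ R) {m : ℕ} (hm : 2 ≤ m) (p : c.ι)
    (x : c.ι → ℝ) (t : ℝ) :
    HasDerivAt (fun u => hsTransform ψ R m fun w =>
      (green w (c.M (Function.update x p u))).trace / (c.N : ℂ))
      (c.statDeriv ψ R m p (Function.update x p t)) t := by
  have hfin := isFiniteMeasure_hsDomain (R := R)
  obtain ⟨V, hV0, hV⟩ := h.exists_norm_weight_le m
  have hs := c.s_nonneg
  have hms := measurableSet_hsDomain (R := R)
  have hmeas : ∀ u : ℝ, AEStronglyMeasurable (fun q : ℝ × ℝ => weight ψ m q *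
      ((green ((q.2 : ℂ) + q.1 * Complex.I) (c.M (Function.update x p u))).trace / (c.N : ℂ)))
      (volume.restrict (hsDomain R)) := by
    intro u
    refine ContinuousOn.aestronglyMeasurable ?_ hms
    refine (h.continuous_weight m).continuousOn.mul (ContinuousOn.div_const ?_ _)
    exact (Continuous.matrix_trace continuous_id).comp_continuousOn
      (c.continuousOn_green_param _)
  refine (hasDerivAt_integral_of_dominated_loc_of_deriv_le (s := Set.univ) (x₀ := t)
    (μ := volume.restrict (hsDomain R)) (bound := fun _ => V * (2 * c.s))
    (F := fun (u : ℝ) (q : ℝ × ℝ) => weight ψ m q *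
      ((green ((q.2 : ℂ) + q.1 * Complex.I) (c.M (Function.update x p u))).trace / (c.N : ℂ)))
    (F' := fun (u : ℝ) (q : ℝ × ℝ) => weight ψ m q *
      ((green ((q.2 : ℂ) + q.1 * Complex.I) (c.M (Function.update x p u)) * (c.s • c.B p)
      * green ((q.2 : ℂ) + q.1 * Complex.I) (c.M (Function.update x p u))).trace / (c.N : ℂ)))
    univ_mem (Eventually.of_forall hmeas) ?_ (c.aestronglyMeasurable_deriv h m p _)
    ((ae_restrict_iff' hms).2 (Eventually.of_forall fun q hq u _ =>
      norm_weight_mul_le hm hV0 hV (by positivity) hq (c.norm_trace_deriv_le p _ hq)))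
    (integrable_const _) ((ae_restrict_iff' hms).2 (Eventually.of_forall fun q hq u _ => ?_))).2
  · refine h.integrableOn_weight_mul (by omega)
      (T := fun w => (green w (c.M (Function.update x p t))).trace / (c.N : ℂ)) (K := 1) ?_
      (fun w hw => c.norm_trace_green_le _ hw)
    exact c.continuousOn_trace_green.comp
      (f := fun w : ℂ => (Function.update x p t, w)) (by fun_prop) fun w hw => hw
  · have hz : ((q.2 : ℂ) + q.1 * Complex.I).im ≠ 0 := by
      rw [ofReal_add_mul_I_im]; exact ne_of_gt hq.1.1
    have h1 := hasDerivAt_green (c.isHermitian_M (Function.update x p 0)) (c.isHermitian_smul_B p)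
      hz u
    simp only [← c.M_update x p] at h1
    have h2 := (Matrix.traceLinearMap (Fin c.N) ℝ ℂ).toContinuousLinearMap.hasFDerivAt.comp_hasDerivAt
      u h1
    exact (h2.div_const (c.N : ℂ)).const_mul (weight ψ m q)

lemma sum_im_statDeriv_sq_le (h : IsDerivTower ψ R) {m : ℕ} (hm : 2 ≤ m) (x : c.ι → ℝ) :
    ∑ p, ‖((-Real.pi⁻¹ * (c.statDeriv ψ R m p x).im : ℝ) : ℂ)‖ ^ 2
      ≤ 2 / (c.N : ℝ) ^ 2 * eigenStat (fun t => ψ 1 t ^ 2) (c.isHermitian_M x) := by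
  have hN := c.N_pos'
  have hM := c.isHermitian_M x
  have e : ∀ p, (c.statDeriv ψ R m p x).im
      = -(Real.pi * ((c.s • c.B p) * spectralFun (ψ 1) hM).trace.re) / c.N := by
    intro p
    rw [← h.im_integral_trace hm hM (c.isHermitian_smul_B p), ← Complex.div_natCast_im,
      ← integral_div]
    simp only [statDeriv, mul_div_assoc]
  have hp : ∀ p, ‖((-Real.pi⁻¹ * (c.statDeriv ψ R m p x).im : ℝ) : ℂ)‖ ^ 2
      ≤ ((c.N : ℝ)⁻¹) ^ 3 * ‖(c.B p * spectralFun (ψ 1) hM).trace‖ ^ 2 := by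
    intro p
    rw [Complex.norm_real, e p, smul_mul_assoc, Matrix.trace_smul, Complex.smul_re, smul_eq_mul]
    have hpi := Real.pi_ne_zero
    have e2 : -Real.pi⁻¹ * (-(Real.pi * (c.s * (c.B p * spectralFun (ψ 1) hM).trace.re)) / c.N)
        = c.s * (c.N : ℝ)⁻¹ * (c.B p * spectralFun (ψ 1) hM).trace.re := by
      field_simp
    rw [e2, norm_mul, mul_pow, Real.norm_eq_abs, sq_abs, mul_pow, c.s_sq]
    have h3 := Complex.abs_re_le_norm (c.B p * spectralFun (ψ 1) hM).trace
    rw [show (c.N : ℝ)⁻¹ * (c.N : ℝ)⁻¹ ^ 2 = (c.N : ℝ)⁻¹ ^ 3 by ring, Real.norm_eq_abs]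
    gcongr
  refine (Finset.sum_le_sum fun p _ => hp p).trans ?_
  rw [← Finset.mul_sum]
  have h4 := c.basis.sum_norm_trace_sq_le (spectralFun (ψ 1) hM)
  have h5 := hsSq_spectralFun_le (ψ 1) hM
  calc _ ≤ ((c.N : ℝ)⁻¹) ^ 3 * (2 * ∑ i, ψ 1 (hM.eigenvalues i) ^ 2) := by
        gcongr
        exact h4.trans (by gcongr)
    _ = _ := by
        rw [eigenStat]
        field_simp

theorem variance_eigenStat_le [IsProbabilityMeasure μ] {C : ℝ} (hC : HasPoincareConst μ C)
    (hC0 : 0 ≤ C) (h : IsDerivTower ψ R)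
    (hint : Integrable (fun x => eigenStat (fun t => ψ 1 t ^ 2) (c.isHermitian_M x)) (c.law μ)) :
    ∫ x, (eigenStat (ψ 0) (c.isHermitian_M x)
        - ∫ y, eigenStat (ψ 0) (c.isHermitian_M y) ∂(c.law μ)) ^ 2 ∂(c.law μ)
      ≤ 2 * C / (c.N : ℝ) ^ 2 *
        ∫ x, eigenStat (fun t => ψ 1 t ^ 2) (c.isHermitian_M x) ∂(c.law μ) := by
  have hN := c.N_pos'
  have hd : ∀ p x t, HasDerivAt
      (fun u => ((eigenStat (ψ 0) (c.isHermitian_M (Function.update x p u)) : ℝ) : ℂ))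
      ((-Real.pi⁻¹ * (c.statDeriv ψ R 2 p (Function.update x p t)).im : ℝ) : ℂ) t := by
    intro p x t
    have h1 := (Complex.imCLM.hasFDerivAt.comp_hasDerivAt t
      (c.hasDerivAt_hsTransform_update h le_rfl p x t)).const_mul (-Real.pi⁻¹)
    have e : (fun u => eigenStat (ψ 0) (c.isHermitian_M (Function.update x p u)))
        = fun u => -Real.pi⁻¹ * (⇑Complex.imCLM ∘ fun u => hsTransform ψ R 2 fun w =>
          (green w (c.M (Function.update x p u))).trace / (c.N : ℂ)) u := by
      funext u
      simp only [Function.comp_apply, Complex.imCLM_apply]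
      rw [c.im_hsTransform_trace h (by norm_num)]
      have := Real.pi_ne_zero
      field_simp
    rw [← e] at h1
    exact h1.ofReal_comp
  obtain ⟨K0, hK0⟩ := (h.hasCompactSupport 0).exists_bound_of_continuous (h.continuous 0)
  obtain ⟨K1, hK1⟩ := c.exists_norm_statDeriv_le h (m := 2) le_rfl
  have hFb : ∀ x, ‖((eigenStat (ψ 0) (c.isHermitian_M x) : ℝ) : ℂ)‖ ≤ K0 := by
    intro x
    rw [Complex.norm_real, eigenStat, norm_div, Real.norm_natCast, div_le_iff₀ hN]
    refine (norm_sum_le _ _).trans ((Finset.sum_le_sum fun i _ => hK0 _).trans (le_of_eq ?_))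
    simp [mul_comm]
  have hFc : Continuous fun x => ((eigenStat (ψ 0) (c.isHermitian_M x) : ℝ) : ℂ) := by
    have e : (fun x => ((eigenStat (ψ 0) (c.isHermitian_M x) : ℝ) : ℂ))
        = fun x => ((-Real.pi⁻¹ * (hsTransform ψ R 2 fun w =>
          (green w (c.M x)).trace / (c.N : ℂ)).im : ℝ) : ℂ) := by
      funext x
      rw [c.im_hsTransform_trace h (by norm_num)]
      have := Real.pi_ne_zero
      congr 1
      field_simp
    rw [e]
    have hfin := isFiniteMeasure_hsDomain (R := R)
    obtain ⟨V, hV0, hV⟩ := h.exists_norm_weight_le 2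
    have hcont : Continuous fun x => hsTransform ψ R 2 fun w =>
        (green w (c.M x)).trace / (c.N : ℂ) := by
      refine continuous_of_dominated (bound := fun _ => V * 1) (fun x => ?_) (fun x => ?_)
        (integrable_const _) ?_
      · refine ContinuousOn.aestronglyMeasurable ?_ measurableSet_hsDomain
        refine (h.continuous_weight 2).continuousOn.mul (ContinuousOn.div_const ?_ _)
        exact (Continuous.matrix_trace continuous_id).comp_continuousOn
          (c.continuousOn_green_param _)
      · refine (ae_restrict_iff' measurableSet_hsDomain).2 (Eventually.of_forall fun q hq =>
          norm_weight_mul_le le_rfl hV0 hV zero_le_one hq ?_)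
        have h0 : 0 < q.1 := hq.1.1
        have h1 := c.norm_trace_green_le x (w := (q.2 : ℂ) + q.1 * Complex.I) (by
          rw [ofReal_add_mul_I_im]; exact h0)
        rw [ofReal_add_mul_I_im] at h1
        have h2 := (one_le_inv₀ h0).2 hq.1.2.le
        refine h1.trans ?_
        nlinarith
      · refine (ae_restrict_iff' measurableSet_hsDomain).2 (Eventually.of_forall fun q hq => ?_)
        have hg := continuous_green_comp c.continuous_M c.isHermitian_M
          (z := (q.2 : ℂ) + q.1 * Complex.I) (by
            rw [ofReal_add_mul_I_im]; exact ne_of_gt hq.1.1)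
        exact continuous_const.mul ((Continuous.matrix_trace hg).div_const _)
    exact Complex.continuous_ofReal.comp (continuous_const.mul (Complex.continuous_im.comp hcont))
  have hF'c : ∀ p, Continuous fun x =>
      ((-Real.pi⁻¹ * (c.statDeriv ψ R 2 p x).im : ℝ) : ℂ) := fun p =>
    Complex.continuous_ofReal.comp (continuous_const.mul
      (Complex.continuous_im.comp (c.continuous_statDeriv h le_rfl p)))
  have hF'b : ∀ p x, ‖((-Real.pi⁻¹ * (c.statDeriv ψ R 2 p x).im : ℝ) : ℂ)‖ ≤ Real.pi⁻¹ * K1 := by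
    intro p x
    rw [Complex.norm_real, norm_mul, norm_neg, Real.norm_of_nonneg (inv_pos.2 Real.pi_pos).le]
    exact mul_le_mul_of_nonneg_left ((Complex.abs_im_le_norm _).trans (hK1 p x))
      (inv_pos.2 Real.pi_pos).le
  have hmain := hC.pi hC0 hFc hF'c hFb hF'b hd
  have e1 : ∫ x, ‖((eigenStat (ψ 0) (c.isHermitian_M x) : ℝ) : ℂ)
      - ∫ y, ((eigenStat (ψ 0) (c.isHermitian_M y) : ℝ) : ℂ) ∂(c.law μ)‖ ^ 2 ∂(c.law μ)
      = ∫ x, (eigenStat (ψ 0) (c.isHermitian_M x)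
        - ∫ y, eigenStat (ψ 0) (c.isHermitian_M y) ∂(c.law μ)) ^ 2 ∂(c.law μ) := by
    rw [integral_complex_ofReal]
    congr 1
    funext x
    rw [← Complex.ofReal_sub, Complex.norm_real, Real.norm_eq_abs, sq_abs]
  rw [e1] at hmain
  refine hmain.trans ?_
  have hi : ∀ p, Integrable (fun x =>
      ‖((-Real.pi⁻¹ * (c.statDeriv ψ R 2 p x).im : ℝ) : ℂ)‖ ^ 2) (c.law μ) := fun p =>
    c.integrable_of_bounded μ ((hF'c p).norm.pow 2) ((Real.pi⁻¹ * K1) ^ 2) fun x => by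
      rw [norm_pow, norm_norm]
      exact pow_le_pow_left₀ (norm_nonneg _) (hF'b p x) 2
  rw [← integral_finsetSum _ fun p _ => hi p]
  have h2 := integral_mono (integrable_finsetSum _ fun p _ => hi p)
    (hint.const_mul (2 / (c.N : ℝ) ^ 2)) (fun x => c.sum_im_statDeriv_sq_le h le_rfl x)
  rw [integral_const_mul] at h2
  refine (mul_le_mul_of_nonneg_left h2 hC0).trans (le_of_eq ?_)
  ring

end Config

end StatVariance

/-! ### Consequences for realizations of the model -/

section Realization

variable {J : ℕ} {θ : Fin J → ℝ} {j₀ : Fin J} {k : Fin J → ℕ} {ε c₄ : ℝ} {μ : Measure ℝ}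
  {σ : ℝ} {K : Set ℝ}

lemma semicircle_compl (hK : Set.Icc (-2 * σ) (2 * σ) ⊆ K) : semicircle σ Kᶜ = 0 := by
  refine withDensity_absolutelyContinuous _ _ ?_
  refine measure_mono_null (Set.compl_subset_compl.2 hK) ?_
  rw [Measure.restrict_apply measurableSet_Icc.compl, Set.compl_inter_self, measure_empty]

lemma isStieltjesDiff_secondOrder (hσ : 0 < σ) (hθ : Function.Injective θ) (hj₀ : θ j₀ = 0)
    (hKm : MeasurableSet K) (hK : spectrumSet σ θ ⊆ K) :
    IsStieltjesDiff K 0 (secondOrder μ σ θ j₀ k ε c₄) := by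
  have hI : Set.Icc (-2 * σ) (2 * σ) ⊆ K := Set.subset_union_left.trans hK
  have h1 := isStieltjesDiff_sum (K := K) (Finset.univ.erase j₀)
    (T := fun j z => ((k j : ℝ) : ℂ) * ((gSC σ z)⁻¹ * gSC₂ σ z *
      ((θ j : ℂ) / (z - (σ : ℂ) ^ 2 * gSC σ z - θ j)))) (fun j hj => by
      have hne : θ j ≠ 0 := fun h => Finset.ne_of_mem_erase hj (hθ (h.trans hj₀.symm))
      have := (isStieltjesDiff_spike hσ hKm hI hne (fun h => hK (Or.inr ⟨j, h, rfl⟩))).const_mul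
        (k j : ℝ)
      rwa [mul_zero] at this)
  have h2 := (isStieltjesDiff_cumulant hσ hI).const_mul (fourthCumulant μ * c₄)
  have h3 := (isStieltjesDiff_edge hσ hKm hI).const_mul ε
  refine ((h1.add h2).add h3).congr (by simp) fun z _ => ?_
  rw [secondOrder, spikeTerm, mul_add, mul_add, Finset.mul_sum]
  refine congrArg₂ (· + ·) (congrArg₂ (· + ·) ?_ ?_) ?_
  · exact Finset.sum_congr rfl fun j _ => by push_cast; ring
  · push_cast; ring
  · ring

lemma integral_eq_of_eqOn {ν : Measure ℝ} (hν : ν Kᶜ = 0) {f : ℝ → ℝ} {a : ℝ}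
    (hf : ∀ x ∈ K, f x = a) : ∫ x, f x ∂ν = ν.real Set.univ * a := by
  have : f =ᵐ[ν] fun _ => a := by
    have : ∀ᵐ x ∂ν, x ∈ K := by rwa [ae_iff]
    filter_upwards [this] with x hx using hf x hx
  rw [integral_congr_ae this, integral_const, smul_eq_mul]

lemma abs_eigenStat_le {N : ℕ} (hN : 0 < N) {φ : ℝ → ℝ} {B : ℝ} (hB : ∀ x, ‖φ x‖ ≤ B)
    {M : Matrix (Fin N) (Fin N) ℂ} (hM : M.IsHermitian) : ‖eigenStat φ hM‖ ≤ B := by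
  have hN' : (0 : ℝ) < N := by exact_mod_cast hN
  rw [eigenStat, norm_div, Real.norm_natCast, div_le_iff₀ hN']
  refine (norm_sum_le _ _).trans ((Finset.sum_le_sum fun i _ => hB _).trans (le_of_eq ?_))
  simp [mul_comm]

/-- Second moment of a linear statistic whose test function is supported away from `K`. -/
theorem exists_second_moment_bound (hσ : 0 < σ) (hμ : IsEntryLaw μ σ) (hθ : Function.Injective θ)
    (hj₀ : θ j₀ = 0) {ν₁ ν₂ : Measure ℝ} [IsFiniteMeasure ν₁] [IsFiniteMeasure ν₂]
    (hν₁ : ν₁ Kᶜ = 0) (hν₂ : ν₂ Kᶜ = 0) (hm : ν₁.real Set.univ - ν₂.real Set.univ = 0)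
    (hK : Set.Icc (-2 * σ) (2 * σ) ⊆ K)
    (hν : ∀ z : ℂ, z.im ≠ 0 → secondOrder μ σ θ j₀ k ε c₄ z
      = (∫ x : ℝ, (z - x)⁻¹ ∂ν₁) - ∫ x : ℝ, (z - x)⁻¹ ∂ν₂)
    {φ : ℝ → ℝ} (hφ : ContDiff ℝ (⊤ : ℕ∞) φ)
    (hc : ∃ (a : ℝ) (S : Set ℝ), IsCompact S ∧ ∀ x ∉ S, φ x = a)
    (hdisj : Disjoint (tsupport φ) K) :
    ∃ C, ∀ c : Config θ j₀ k ε c₄,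
      Integrable (fun x => eigenStat φ (c.isHermitian_M x)) (c.law μ) ∧
      Integrable (fun x => eigenStat φ (c.isHermitian_M x) ^ 2) (c.law μ) ∧
      ∫ x, eigenStat φ (c.isHermitian_M x) ^ 2 ∂(c.law μ) ≤ C / (c.N : ℝ) ^ 4 := by
  have := hμ.isProbabilityMeasure
  have := isProbabilityMeasure_semicircle hσ
  obtain ⟨a, S, hS, ha⟩ := hc
  obtain ⟨D, hD0, hD⟩ := hμ.exists_hasPoincareConst
  have hsupp : HasCompactSupport fun x => φ x - a :=
    HasCompactSupport.intro hS fun x hx => by rw [ha x hx, sub_self]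
  obtain ⟨ψ, R, h, hψ⟩ := exists_isDerivTower (hφ.sub contDiff_const) hsupp
  have hψ0 : ∀ x, ψ 0 x = φ x - a := fun x => congrFun hψ x
  have hφK : ∀ x ∈ K, φ x = 0 := fun x hx =>
    image_eq_zero_of_notMem_tsupport fun hx' => Set.disjoint_left.1 hdisj hx' hx
  have hψ1 : ψ 1 = deriv φ := by
    funext x
    have h1 := h.hasDerivAt 0 x
    rw [hψ] at h1
    have h2 : HasDerivAt φ (ψ 1 x) x := by simpa using h1.add_const a
    exact h2.deriv.symm
  have hψ1K : ∀ x ∈ K, ψ 1 x ^ 2 = 0 := fun x hx => by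
    rw [hψ1, image_eq_zero_of_notMem_tsupport fun hx' =>
      Set.disjoint_left.1 hdisj (tsupport_deriv_subset hx') hx]
    simp
  have hsm : ContDiff ℝ (⊤ : ℕ∞) fun x => ψ 1 x ^ 2 := by
    rw [hψ1]
    exact ((contDiff_infty_iff_deriv.1 hφ).2).pow 2
  have hsc : HasCompactSupport fun x => ψ 1 x ^ 2 :=
    HasCompactSupport.intro isCompact_Icc fun x hx => by rw [h.eq_zero 1 x hx]; simp
  have hs0 : ContDiff ℝ (⊤ : ℕ∞) (ψ 0) := by rw [hψ]; exact hφ.sub contDiff_const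
  obtain ⟨C₁, h1⟩ := exists_expansion_bound hσ hμ hθ hj₀ hν hs0 (h.hasCompactSupport 0)
  obtain ⟨C₂, h2⟩ := exists_expansion_bound hσ hμ hθ hj₀ hν hsm hsc
  refine ⟨2 * D * C₂ + C₁ ^ 2, fun c => ?_⟩
  obtain ⟨i1, b1⟩ := h1 c
  obtain ⟨i2, b2⟩ := h2 c
  have hN := c.N_pos'
  have hsemi := semicircle_compl hK
  have z0 : ∀ x ∈ K, ψ 0 x = -a := fun x hx => by rw [hψ0, hφK x hx]; ring
  rw [integral_eq_of_eqOn hsemi z0, integral_eq_of_eqOn hν₁ z0, integral_eq_of_eqOn hν₂ z0,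
    ← sub_mul, hm, probReal_univ] at b1
  rw [integral_eq_of_eqOn hsemi hψ1K, integral_eq_of_eqOn hν₁ hψ1K,
    integral_eq_of_eqOn hν₂ hψ1K] at b2
  simp only [mul_zero, add_zero, sub_zero, one_mul, zero_mul] at b1 b2
  set Y : (c.ι → ℝ) → ℝ := fun x => eigenStat (ψ 0) (c.isHermitian_M x) with hY
  set e := ∫ x, Y x ∂(c.law μ) with he
  have hvar := c.variance_eigenStat_le hD hD0.le h i2
  have hXY : ∀ x, eigenStat φ (c.isHermitian_M x) = a + Y x := by
    intro x
    have hN' := hN.ne'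
    simp only [hY, eigenStat, hψ0, Finset.sum_sub_distrib, Finset.sum_const, Finset.card_univ,
      Fintype.card_fin, nsmul_eq_mul]
    field_simp
    ring
  obtain ⟨K0, hK0⟩ := (h.hasCompactSupport 0).exists_bound_of_continuous (h.continuous 0)
  have hYb : ∀ x, ‖Y x‖ ≤ K0 := fun x => abs_eigenStat_le c.N_pos hK0 _
  have iv : Integrable (fun x => (Y x - e) ^ 2) (c.law μ) := by
    refine Integrable.of_bound (C := (K0 + ‖e‖) ^ 2)
      ((i1.aestronglyMeasurable.sub aestronglyMeasurable_const).pow 2)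
      (Eventually.of_forall fun x => ?_)
    rw [norm_pow]
    exact pow_le_pow_left₀ (norm_nonneg _)
      ((norm_sub_le _ _).trans (add_le_add (hYb x) le_rfl)) 2
  have hsq : ∀ x, eigenStat φ (c.isHermitian_M x) ^ 2
      = (Y x - e) ^ 2 + 2 * (a + e) * (Y x - e) + (a + e) ^ 2 := by
    intro x; rw [hXY]; ring
  have iy : Integrable (fun x => 2 * (a + e) * (Y x - e)) (c.law μ) :=
    (i1.sub (integrable_const e)).const_mul _
  refine ⟨?_, ?_, ?_⟩
  · simp only [hXY]
    exact (integrable_const a).add i1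
  · simp only [hsq]
    exact (iv.add iy).add (integrable_const _)
  · simp only [hsq]
    have k1 := iv.add iy
    simp only [Pi.add_def] at k1
    rw [integral_add k1 (integrable_const _), integral_add iv iy, integral_const_mul,
      integral_sub i1 (integrable_const e), integral_const, integral_const, probReal_univ,
      one_smul, one_smul, ← he, sub_self, mul_zero, add_zero]
    have hv2 : ∫ x, (Y x - e) ^ 2 ∂(c.law μ) ≤ 2 * D * C₂ / (c.N : ℝ) ^ 4 := by
      refine hvar.trans ?_
      have h3 := (le_abs_self _).trans b2
      calc _ ≤ 2 * D / (c.N : ℝ) ^ 2 * (C₂ / (c.N : ℝ) ^ 2) := by gcongr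
        _ = _ := by field_simp
    have hm2 : (a + e) ^ 2 ≤ C₁ ^ 2 / (c.N : ℝ) ^ 4 := by
      have h4 : |a + e| ≤ C₁ / (c.N : ℝ) ^ 2 := by
        rwa [sub_neg_eq_add, add_comm] at b1
      calc (a + e) ^ 2 = |a + e| ^ 2 := (sq_abs _).symm
        _ ≤ (C₁ / (c.N : ℝ) ^ 2) ^ 2 := pow_le_pow_left₀ (abs_nonneg _) h4 2
        _ = _ := by field_simp
    rw [add_div]
    exact add_le_add hv2 hm2

lemma ae_isBigO_of_second_moment {Ω : Type*} [MeasurableSpace Ω] {P : Measure Ω}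
    {T : ℕ → Ω → ℝ} {C : ℝ} {n₀ : ℕ} (hn : 1 ≤ n₀)
    (hT : ∀ N, n₀ ≤ N → AEMeasurable (T N) P)
    (h : ∀ N, n₀ ≤ N → Integrable (fun ω => T N ω ^ 2) P ∧
      ∫ ω, T N ω ^ 2 ∂P ≤ C / (N : ℝ) ^ 4) :
    ∀ᵐ ω ∂P, (fun N => T N ω) =O[atTop] fun N : ℕ => (N : ℝ) ^ (-(4 / 3) : ℝ) := by
  set f : ℕ → Ω → ENNReal := fun N ω =>
    if n₀ ≤ N then ENNReal.ofReal ((N : ℝ) ^ (8 / 3 : ℝ) * T N ω ^ 2) else 0 with hf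
  have hfm : ∀ N, AEMeasurable (f N) P := by
    intro N
    by_cases hN : n₀ ≤ N
    · simp only [hf, if_pos hN]
      exact (((hT N hN).pow_const 2).const_mul _).ennreal_ofReal
    · simp only [hf, if_neg hN]
      exact aemeasurable_const
  have hbound : ∀ N, ∫⁻ ω, f N ω ∂P ≤ ENNReal.ofReal (C * (N : ℝ) ^ (-(4 / 3) : ℝ)) := by
    intro N
    by_cases hN : n₀ ≤ N
    · obtain ⟨hi, hb⟩ := h N hN
      have hN0 : (0 : ℝ) < N := by exact_mod_cast hn.trans hN
      simp only [hf, if_pos hN]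
      rw [← ofReal_integral_eq_lintegral_ofReal (hi.const_mul _)
        (Eventually.of_forall fun ω => by positivity), integral_const_mul]
      refine ENNReal.ofReal_le_ofReal ?_
      calc (N : ℝ) ^ (8 / 3 : ℝ) * ∫ ω, T N ω ^ 2 ∂P
          ≤ (N : ℝ) ^ (8 / 3 : ℝ) * (C / (N : ℝ) ^ 4) := by gcongr
        _ = C * ((N : ℝ) ^ (8 / 3 : ℝ) * ((N : ℝ) ^ 4)⁻¹) := by ring
        _ = C * (N : ℝ) ^ (-(4 / 3) : ℝ) := by
            rw [← Real.rpow_natCast, ← Real.rpow_neg hN0.le, ← Real.rpow_add hN0]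
            norm_num
    · simp [hf, if_neg hN]
  have hsum : ∫⁻ ω, ∑' N, f N ω ∂P ≠ ⊤ := by
    rw [lintegral_tsum hfm]
    refine ne_top_of_le_ne_top ?_ (ENNReal.tsum_le_tsum hbound)
    have hs : Summable fun N : ℕ => C * (N : ℝ) ^ (-(4 / 3) : ℝ) :=
      (Real.summable_nat_rpow.2 (by norm_num)).mul_left C
    exact hs.tsum_ofReal_ne_top
  filter_upwards [ae_lt_top' (AEMeasurable.tsum hfm) hsum] with ω hω
  set S := (∑' N, f N ω).toReal with hS
  refine IsBigO.of_bound (√S) ?_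
  filter_upwards [eventually_ge_atTop n₀] with N hN
  have hN0 : (0 : ℝ) < N := by exact_mod_cast hn.trans hN
  have h1 : f N ω ≤ ∑' N, f N ω := ENNReal.le_tsum N
  have h2 : (N : ℝ) ^ (8 / 3 : ℝ) * T N ω ^ 2 ≤ S := by
    have := ENNReal.toReal_mono hω.ne h1
    simp only [hf, if_pos hN] at this
    rwa [ENNReal.toReal_ofReal (by positivity)] at this
  have hS0 : 0 ≤ S := ENNReal.toReal_nonneg
  rw [Real.norm_eq_abs, Real.norm_of_nonneg (by positivity)]
  refine abs_le_of_sq_le_sq ?_ (by positivity)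
  rw [mul_pow, Real.sq_sqrt hS0, ← Real.rpow_natCast ((N : ℝ) ^ (-(4 / 3) : ℝ)), ← Real.rpow_mul hN0.le]
  have e : T N ω ^ 2 = ((N : ℝ) ^ (8 / 3 : ℝ) * T N ω ^ 2)
      * (N : ℝ) ^ (-(4 / 3) * ((2 : ℕ) : ℝ) : ℝ) := by
    rw [mul_right_comm, ← Real.rpow_add hN0]
    norm_num
  rw [e]
  gcongr

/-- The functionals `φ ↦ T φ` are the linear statistics of a deformed Wigner matrix of size `N`. -/
def IsRealization {Ω : Type*} [MeasurableSpace Ω] (P : Measure Ω) (μ : Measure ℝ) {J : ℕ}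
    (θ : Fin J → ℝ) (j₀ : Fin J) (k : Fin J → ℕ) (ε c₄ : ℝ) (N : ℕ)
    (T : (ℝ → ℝ) → Ω → ℝ) : Prop :=
  ∃ (c : Config θ j₀ k ε c₄) (X : Ω → c.ι → ℝ), c.N = N ∧ AEMeasurable X P ∧
    P.map X = c.law μ ∧ ∀ φ ω, T φ ω = eigenStat φ (c.isHermitian_M (X ω))

variable {Ω : Type*} [MeasurableSpace Ω] {P : Measure Ω} {T : ℕ → (ℝ → ℝ) → Ω → ℝ} {n₀ : ℕ}

lemma transfer_integral {α : Type*} [MeasurableSpace α] {X : Ω → α} {ρ : Measure α}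
    (hX : AEMeasurable X P) (hmap : P.map X = ρ) {f : α → ℝ} (hf : Integrable f ρ) :
    Integrable (fun ω => f (X ω)) P ∧ ∫ ω, f (X ω) ∂P = ∫ x, f x ∂ρ := by
  subst hmap
  exact ⟨hf.comp_aemeasurable hX, (integral_map hX hf.aestronglyMeasurable).symm⟩

theorem isBigO_expectation (hσ : 0 < σ) (hμ : IsEntryLaw μ σ) (hθ : Function.Injective θ)
    (hj₀ : θ j₀ = 0) {ν₁ ν₂ : Measure ℝ} [IsFiniteMeasure ν₁] [IsFiniteMeasure ν₂]
    (hν : ∀ z : ℂ, z.im ≠ 0 → secondOrder μ σ θ j₀ k ε c₄ z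
      = (∫ x : ℝ, (z - x)⁻¹ ∂ν₁) - ∫ x : ℝ, (z - x)⁻¹ ∂ν₂)
    (hT : ∀ N, n₀ ≤ N → IsRealization P μ θ j₀ k ε c₄ N (T N))
    {φ : ℝ → ℝ} (hφ : ContDiff ℝ (⊤ : ℕ∞) φ) (hc : HasCompactSupport φ) :
    (∀ N, n₀ ≤ N → Integrable (T N φ) P) ∧
      (fun N : ℕ => (∫ ω, T N φ ω ∂P)
        - ((∫ x, φ x ∂(semicircle σ)) + 1 / (N : ℝ) * (∫ x, φ x ∂ν₁ - ∫ x, φ x ∂ν₂)))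
        =O[atTop] (fun N : ℕ => 1 / (N : ℝ) ^ 2) := by
  obtain ⟨C, hC⟩ := exists_expansion_bound hσ hμ hθ hj₀ hν hφ hc
  have key : ∀ N, n₀ ≤ N → Integrable (T N φ) P ∧ |(∫ ω, T N φ ω ∂P)
        - ((∫ x, φ x ∂(semicircle σ)) + 1 / (N : ℝ) * (∫ x, φ x ∂ν₁ - ∫ x, φ x ∂ν₂))|
        ≤ C / (N : ℝ) ^ 2 := by
    intro N hN
    obtain ⟨c, X, rfl, hX, hmap, heq⟩ := hT N hN
    obtain ⟨h1, h2⟩ := hC c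
    obtain ⟨t1, t2⟩ := transfer_integral hX hmap h1
    have e : T c.N φ = fun ω => eigenStat φ (c.isHermitian_M (X ω)) := funext (heq φ)
    rw [e, t2]
    exact ⟨t1, h2⟩
  refine ⟨fun N hN => (key N hN).1, IsBigO.of_bound C ?_⟩
  filter_upwards [eventually_ge_atTop n₀] with N hN
  rw [Real.norm_eq_abs, Real.norm_of_nonneg (by positivity), mul_one_div]
  exact (key N hN).2

theorem ae_isBigO_statistic (hσ : 0 < σ) (hμ : IsEntryLaw μ σ) (hθ : Function.Injective θ)
    (hj₀ : θ j₀ = 0) {ν₁ ν₂ : Measure ℝ} [IsFiniteMeasure ν₁] [IsFiniteMeasure ν₂]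
    (hν₁ : ν₁ Kᶜ = 0) (hν₂ : ν₂ Kᶜ = 0) (hm : ν₁.real Set.univ - ν₂.real Set.univ = 0)
    (hK : Set.Icc (-2 * σ) (2 * σ) ⊆ K)
    (hν : ∀ z : ℂ, z.im ≠ 0 → secondOrder μ σ θ j₀ k ε c₄ z
      = (∫ x : ℝ, (z - x)⁻¹ ∂ν₁) - ∫ x : ℝ, (z - x)⁻¹ ∂ν₂)
    (hn : 1 ≤ n₀) (hT : ∀ N, n₀ ≤ N → IsRealization P μ θ j₀ k ε c₄ N (T N))
    {φ : ℝ → ℝ} (hφ : ContDiff ℝ (⊤ : ℕ∞) φ)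
    (hc : ∃ (a : ℝ) (S : Set ℝ), IsCompact S ∧ ∀ x ∉ S, φ x = a)
    (hdisj : Disjoint (tsupport φ) K) :
    ∀ᵐ ω ∂P, (fun N => T N φ ω) =O[atTop] fun N : ℕ => (N : ℝ) ^ (-(4 / 3) : ℝ) := by
  obtain ⟨C, hC⟩ := exists_second_moment_bound hσ hμ hθ hj₀ hν₁ hν₂ hm hK hν hφ hc hdisj
  have key : ∀ N, n₀ ≤ N → AEMeasurable (T N φ) P ∧ Integrable (fun ω => T N φ ω ^ 2) P ∧
      ∫ ω, T N φ ω ^ 2 ∂P ≤ C / (N : ℝ) ^ 4 := by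
    intro N hN
    obtain ⟨c, X, rfl, hX, hmap, heq⟩ := hT N hN
    obtain ⟨h0, h1, h2⟩ := hC c
    obtain ⟨s1, s2⟩ := transfer_integral hX hmap h0
    obtain ⟨t1, t2⟩ := transfer_integral hX hmap h1
    have e : T c.N φ = fun ω => eigenStat φ (c.isHermitian_M (X ω)) := funext (heq φ)
    rw [e]
    refine ⟨s1.aestronglyMeasurable.aemeasurable, t1, ?_⟩
    rw [t2]
    exact h2
  exact ae_isBigO_of_second_moment hn (fun N hN => (key N hN).1) fun N hN => (key N hN).2

end Realization

/-! ### The two Wigner ensembles -/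

section PairMatrix

variable {N : ℕ}

/-- The Hermitian matrix `γ E_{ab} + γ̄ E_{ba}`. -/
def pairMatrix (a b : Fin N) (γ : ℂ) : Matrix (Fin N) (Fin N) ℂ :=
  Matrix.single a b γ + Matrix.single b a (star γ)

lemma pairMatrix_apply (a b : Fin N) (γ : ℂ) (i j : Fin N) :
    pairMatrix a b γ i j = (if a = i ∧ b = j then γ else 0)
      + (if b = i ∧ a = j then star γ else 0) := by
  simp [pairMatrix, Matrix.single_apply]

lemma isHermitian_pairMatrix (a b : Fin N) (γ : ℂ) : (pairMatrix a b γ).IsHermitian := by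
  rw [Matrix.IsHermitian, pairMatrix, Matrix.conjTranspose_add, Matrix.conjTranspose_single,
    Matrix.conjTranspose_single, star_star, add_comm]

lemma transpose_pairMatrix (a b : Fin N) {γ : ℂ} (hγ : star γ = γ) :
    (pairMatrix a b γ)ᵀ = pairMatrix a b γ := by
  rw [pairMatrix, Matrix.transpose_add, Matrix.transpose_single, Matrix.transpose_single, hγ,
    add_comm]

lemma norm_single_le (a b : Fin N) (γ : ℂ) :
    ‖(Matrix.single a b γ : Matrix (Fin N) (Fin N) ℂ)‖ ≤ ‖γ‖ := by
  have h := Matrix.l2_opNorm_conjTranspose_mul_self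
    (Matrix.single a b γ : Matrix (Fin N) (Fin N) ℂ)
  rw [Matrix.conjTranspose_single, Matrix.single_mul_single_same, ← Matrix.diagonal_single,
    Matrix.l2_opNorm_diagonal, Pi.norm_single, norm_mul, norm_star] at h
  exact le_of_eq (mul_self_inj_of_nonneg (norm_nonneg _) (norm_nonneg _) |>.1 h.symm)

lemma trace_pairMatrix_mul (a b : Fin N) (γ : ℂ) (X : Matrix (Fin N) (Fin N) ℂ) :
    (pairMatrix a b γ * X).trace = γ * X b a + star γ * X a b := by
  simp [pairMatrix, add_mul, Matrix.trace_single_mul]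

lemma trace_pairMatrix_mul_pow_four (a b : Fin N) (γ : ℂ) (X : Matrix (Fin N) (Fin N) ℂ) :
    ((pairMatrix a b γ * X) ^ 4).trace
      = (γ * X b a) ^ 4 + (star γ * X a b) ^ 4
        + 4 * (γ * star γ) * (X a a * X b b) * ((γ * X b a) ^ 2 + (star γ * X a b) ^ 2
          + (γ * X b a) * (star γ * X a b))
        + 2 * (γ * star γ) ^ 2 * (X a a ^ 2 * X b b ^ 2) := by
  set U : Matrix (Fin N) (Fin 2) ℂ := Matrix.of fun i => ![if i = a then 1 else 0, if i = b then 1 else 0]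
    with hU
  set V : Matrix (Fin 2) (Fin N) ℂ := Matrix.of ![fun j => if b = j then γ else 0,
    fun j => if a = j then star γ else 0] with hV
  have hB : pairMatrix a b γ = U * V := by
    ext i j
    rw [pairMatrix_apply, Matrix.mul_apply, Fin.sum_univ_two]
    simp only [hU, hV, Matrix.of_apply, Matrix.cons_val_zero, Matrix.cons_val_one, ite_and,
      ite_mul, one_mul, zero_mul, eq_comm]
  have hK : V * X * U = !![γ * X b a, γ * X b b; star γ * X a a, star γ * X a b] := by
    ext i j
    fin_cases i <;> fin_cases j <;> simp [Matrix.mul_apply, Matrix.vecMul, dotProduct, hU, hV]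
  have hT : ((U * V * X) ^ 4).trace = ((V * X * U) ^ 4).trace := by
    have e : (U * V * X) ^ 4 = U * (V * X * U * (V * X * U) * (V * X * U) * (V * X)) := by
      simp only [pow_succ, pow_zero, one_mul, Matrix.mul_assoc]
    rw [e, Matrix.trace_mul_comm]
    simp only [pow_succ, pow_zero, one_mul, Matrix.mul_assoc]
  rw [hB, hT, hK]
  simp only [pow_succ, pow_zero, one_mul, Matrix.mul_fin_two, Matrix.trace_fin_two_of]
  ring

lemma norm_trace_pairMatrix_mul_pow_four_sub_le (a b : Fin N) {γ : ℂ} (hγ : ‖γ‖ ≤ 1)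
    (X : Matrix (Fin N) (Fin N) ℂ) :
    ‖((pairMatrix a b γ * X) ^ 4).trace - 2 * (‖γ‖ : ℂ) ^ 4 * (X a a ^ 2 * X b b ^ 2)‖
      ≤ 7 * ‖X‖ ^ 2 * (‖X a b‖ ^ 2 + ‖X b a‖ ^ 2) := by
  have h0 : γ * star γ = (‖γ‖ : ℂ) ^ 2 := Complex.mul_conj' γ
  have e : ((pairMatrix a b γ * X) ^ 4).trace - 2 * (‖γ‖ : ℂ) ^ 4 * (X a a ^ 2 * X b b ^ 2)
      = (γ * X b a) ^ 4 + (star γ * X a b) ^ 4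
        + 4 * (γ * star γ) * (X a a * X b b) * ((γ * X b a) ^ 2 + (star γ * X a b) ^ 2
          + (γ * X b a) * (star γ * X a b)) := by
    rw [trace_pairMatrix_mul_pow_four, h0]
    ring
  rw [e]
  set x := ‖X‖
  have hx : 0 ≤ x := norm_nonneg X
  have hq : ‖γ * X b a‖ ≤ ‖X b a‖ := by
    rw [norm_mul]; exact mul_le_of_le_one_left (norm_nonneg _) hγ
  have hp : ‖star γ * X a b‖ ≤ ‖X a b‖ := by
    rw [norm_mul, norm_star]; exact mul_le_of_le_one_left (norm_nonneg _) hγ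
  have hqx : ‖X b a‖ ≤ x := norm_apply_le X b a
  have hpx : ‖X a b‖ ≤ x := norm_apply_le X a b
  have hg : ‖γ * star γ‖ ≤ 1 := by
    rw [norm_mul, norm_star]; exact mul_le_one₀ hγ (norm_nonneg _) hγ
  have hrs : ‖X a a * X b b‖ ≤ x ^ 2 := by
    rw [norm_mul, sq]
    exact mul_le_mul (norm_apply_le X a a) (norm_apply_le X b b) (norm_nonneg _) hx
  generalize γ * X b a = u at *
  generalize star γ * X a b = v at *
  generalize γ * star γ = w at *
  generalize X a a * X b b = y at *
  generalize ‖X a b‖ = p at *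
  generalize ‖X b a‖ = q at *
  have hu0 := norm_nonneg u
  have hv0 := norm_nonneg v
  have t1 : ‖u ^ 4‖ ≤ x ^ 2 * q ^ 2 := by
    rw [norm_pow]
    calc ‖u‖ ^ 4 ≤ q ^ 4 := by gcongr
      _ = q ^ 2 * q ^ 2 := by ring
      _ ≤ x ^ 2 * q ^ 2 := by gcongr; linarith
  have t2 : ‖v ^ 4‖ ≤ x ^ 2 * p ^ 2 := by
    rw [norm_pow]
    calc ‖v‖ ^ 4 ≤ p ^ 4 := by gcongr
      _ = p ^ 2 * p ^ 2 := by ring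
      _ ≤ x ^ 2 * p ^ 2 := by gcongr; linarith
  have t3 : ‖u ^ 2 + v ^ 2 + u * v‖ ≤ 3 / 2 * (p ^ 2 + q ^ 2) := by
    calc ‖u ^ 2 + v ^ 2 + u * v‖ ≤ ‖u‖ ^ 2 + ‖v‖ ^ 2 + ‖u‖ * ‖v‖ := by
          refine (norm_add_le _ _).trans (add_le_add ((norm_add_le _ _).trans ?_) ?_)
          · simp
          · simp
      _ ≤ q ^ 2 + p ^ 2 + q * p := by gcongr; linarith
      _ ≤ _ := by nlinarith [sq_nonneg (p - q)]
  have t4 : ‖4 * w * y * (u ^ 2 + v ^ 2 + u * v)‖ ≤ 4 * 1 * x ^ 2 * (3 / 2 * (p ^ 2 + q ^ 2)) := by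
    rw [norm_mul, norm_mul, norm_mul]
    have : ‖(4 : ℂ)‖ = 4 := by norm_num
    rw [this]
    gcongr
  refine (norm_add₃_le).trans ?_
  nlinarith

end PairMatrix

section Ensemble

variable {N : ℕ} {ε c₄ : ℝ}

theorem isWignerBasis_pairMatrix {γ : Fin N → Fin N → ℂ} (h0 : 0 ≤ ε) (h1 : ε ≤ 1)
    (hc0 : 0 ≤ c₄) (hc1 : c₄ ≤ 1) (hγ : ∀ a b, ‖γ a b‖ ≤ 1)
    (hdiag : ∀ a, (γ a a + star (γ a a)) ^ 2 = 1 + ε)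
    (hsq : ∀ a b, a ≠ b → γ a b ^ 2 + star (γ b a) ^ 2 = ε)
    (hnorm : ∀ a b, a ≠ b → ‖γ a b‖ ^ 2 + ‖γ b a‖ ^ 2 = 1)
    (hfour : ∀ a b, a ≠ b → ‖γ a b‖ ^ 4 + ‖γ b a‖ ^ 4 = c₄)
    (hreal : ε ≠ 0 → ∀ a b, star (γ a b) = γ a b) :
    IsWignerBasis ε c₄ (fun p : Fin N × Fin N => pairMatrix p.1 p.2 (γ p.1 p.2)) where
  eps_nonneg := h0
  eps_le := h1
  isHermitian p := isHermitian_pairMatrix _ _ _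
  norm_le p := by
    refine (norm_add_le _ _).trans ?_
    have e1 := norm_single_le p.1 p.2 (γ p.1 p.2)
    have e2 := norm_single_le p.2 p.1 (star (γ p.1 p.2))
    rw [norm_star] at e2
    linarith [hγ p.1 p.2]
  norm_trace_mul_le p X := by
    rw [trace_pairMatrix_mul]
    refine (norm_add_le _ _).trans ?_
    rw [norm_mul, norm_mul, norm_star, two_mul]
    exact add_le_add
      ((mul_le_of_le_one_left (norm_nonneg _) (hγ _ _)).trans (norm_apply_le X _ _))
      ((mul_le_of_le_one_left (norm_nonneg _) (hγ _ _)).trans (norm_apply_le X _ _))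
  card_le := by simp [sq]
  tensor a b c d := by
    have key : ∀ f g : Fin N → Fin N → ℂ, ∑ p : Fin N × Fin N,
        ((if p.1 = a ∧ p.2 = b then f p.1 p.2 else 0)
          + (if p.2 = a ∧ p.1 = b then star (f p.1 p.2) else 0)) * g p.1 p.2
        = f a b * g a b + star (f b a) * g b a := by
      intro f g
      rw [Fintype.sum_prod_type]
      simp only [add_mul, Finset.sum_add_distrib, ite_and, ite_mul, zero_mul]
      simp
    simp only [pairMatrix_apply]
    rw [key γ fun i j => (if i = c ∧ j = d then γ i j else 0)
          + (if j = c ∧ i = d then star (γ i j) else 0)]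
    by_cases hab : a = b
    · subst hab
      by_cases hac : a = c
      · subst hac
        by_cases had : a = d
        · subst had
          simp only [and_self, if_true]
          linear_combination hdiag a
        · simp [had]
      · simp [hac]
    · have hn : γ a b * star (γ a b) + star (γ b a) * γ b a = 1 := by
        have e1 : γ a b * star (γ a b) = (‖γ a b‖ : ℂ) ^ 2 := Complex.mul_conj' _
        have e2 : star (γ b a) * γ b a = (‖γ b a‖ : ℂ) ^ 2 := Complex.conj_mul' _
        rw [e1, e2]
        exact_mod_cast hnorm a b hab
      by_cases hs : a = c ∧ b = d
      · obtain ⟨rfl, rfl⟩ := hs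
        simp only [hab, Ne.symm hab, and_self, if_true, if_false]
        linear_combination hsq a b hab
      · by_cases ht : a = d ∧ b = c
        · obtain ⟨rfl, rfl⟩ := ht
          simp only [hab, Ne.symm hab, and_self, if_true, if_false]
          linear_combination hn
        · have ht' : ¬ (b = c ∧ a = d) := fun h => ht ⟨h.2, h.1⟩
          simp [hs, ht, ht']
  fourth X := by
    set x := ‖X‖ with hxdef
    have hx : 0 ≤ x := norm_nonneg X
    set t : Fin N → ℂ := fun a => X a a ^ 2 with ht
    have ht1 : ∀ a, ‖t a‖ ≤ x ^ 2 := fun a => by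
      rw [ht, norm_pow]
      exact pow_le_pow_left₀ (norm_nonneg _) (norm_apply_le X a a) 2
    have hmain : ‖∑ p : Fin N × Fin N, (((pairMatrix p.1 p.2 (γ p.1 p.2) * X) ^ 4).trace
        - 2 * (‖γ p.1 p.2‖ : ℂ) ^ 4 * (t p.1 * t p.2))‖ ≤ 14 * N * x ^ 4 := by
      refine (norm_sum_le _ _).trans ((Finset.sum_le_sum fun p _ =>
        norm_trace_pairMatrix_mul_pow_four_sub_le p.1 p.2 (hγ _ _) X).trans ?_)
      rw [← Finset.mul_sum, Finset.sum_add_distrib, Fintype.sum_prod_type, Fintype.sum_prod_type]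
      have e1 : ∑ a, ∑ b, ‖X b a‖ ^ 2 = hsSq X := rfl
      have e2 : ∑ a, ∑ b, ‖X a b‖ ^ 2 = hsSq X := by rw [Finset.sum_comm]; rfl
      simp only [e1, e2]
      have := hsSq_le X
      rw [Fintype.card_fin] at this
      calc 7 * x ^ 2 * (hsSq X + hsSq X) ≤ 7 * x ^ 2 * (N * x ^ 2 + N * x ^ 2) := by gcongr
        _ = _ := by ring
    have hrest : 2 * (∑ p : Fin N × Fin N, 2 * (‖γ p.1 p.2‖ : ℂ) ^ 4 * (t p.1 * t p.2)
        - (c₄ : ℂ) * (∑ i, t i) ^ 2)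
        = ∑ a, (4 * (‖γ a a‖ : ℂ) ^ 4 - 2 * c₄) * t a ^ 2 := by
      have e1 : ∑ p : Fin N × Fin N, 2 * (‖γ p.1 p.2‖ : ℂ) ^ 4 * (t p.1 * t p.2)
          = ∑ a, ∑ b, 2 * (‖γ b a‖ : ℂ) ^ 4 * (t a * t b) := by
        rw [Fintype.sum_prod_type, Finset.sum_comm]
        exact Finset.sum_congr rfl fun a _ => Finset.sum_congr rfl fun b _ => by ring
      have e2 : 2 * (∑ p : Fin N × Fin N, 2 * (‖γ p.1 p.2‖ : ℂ) ^ 4 * (t p.1 * t p.2))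
          = ∑ a, ∑ b, (2 * (‖γ a b‖ : ℂ) ^ 4 + 2 * (‖γ b a‖ : ℂ) ^ 4) * (t a * t b) := by
        rw [two_mul]
        nth_rewrite 2 [e1]
        rw [Fintype.sum_prod_type, ← Finset.sum_add_distrib]
        refine Finset.sum_congr rfl fun a _ => ?_
        rw [← Finset.sum_add_distrib]
        exact Finset.sum_congr rfl fun b _ => by ring
      rw [mul_sub, e2, sq, Finset.sum_mul_sum, Finset.mul_sum, Finset.mul_sum,
        ← Finset.sum_sub_distrib]
      refine Finset.sum_congr rfl fun a _ => ?_
      rw [Finset.mul_sum, Finset.mul_sum, ← Finset.sum_sub_distrib, Finset.sum_eq_single a]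
      · ring
      · intro b _ hb
        have : (‖γ a b‖ : ℂ) ^ 4 + (‖γ b a‖ : ℂ) ^ 4 = c₄ := by
          exact_mod_cast hfour a b (Ne.symm hb)
        linear_combination 2 * (t a * t b) * this
      · simp
    have hrest' : ‖∑ p : Fin N × Fin N, 2 * (‖γ p.1 p.2‖ : ℂ) ^ 4 * (t p.1 * t p.2)
        - (c₄ : ℂ) * (∑ i, t i) ^ 2‖ ≤ 3 * N * x ^ 4 := by
      have e := congrArg norm hrest
      rw [norm_mul, Complex.norm_two] at e
      have : ‖∑ a, (4 * (‖γ a a‖ : ℂ) ^ 4 - 2 * c₄) * t a ^ 2‖ ≤ ∑ a : Fin N, 6 * x ^ 4 := by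
        refine norm_sum_le_of_le _ fun a _ => ?_
        rw [norm_mul, norm_pow]
        have n1 : ‖4 * (‖γ a a‖ : ℂ) ^ 4 - 2 * c₄‖ ≤ 6 := by
          refine (norm_sub_le _ _).trans ?_
          rw [norm_mul, norm_mul, norm_pow, Complex.norm_real, Complex.norm_real, norm_norm,
            Real.norm_of_nonneg hc0, Complex.norm_two]
          have : ‖(4 : ℂ)‖ = 4 := by norm_num
          rw [this]
          have := pow_le_one₀ (norm_nonneg _) (hγ a a) (n := 4)
          linarith
        calc _ ≤ 6 * (x ^ 2) ^ 2 := by gcongr; exact ht1 a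
          _ = _ := by ring
      rw [← e, Finset.sum_const, Finset.card_univ, Fintype.card_fin, nsmul_eq_mul] at this
      linarith
    have hsplit : ∑ p : Fin N × Fin N, ((pairMatrix p.1 p.2 (γ p.1 p.2) * X) ^ 4).trace
        - (c₄ : ℂ) * (∑ i, t i) ^ 2
        = ∑ p : Fin N × Fin N, (((pairMatrix p.1 p.2 (γ p.1 p.2) * X) ^ 4).trace
        - 2 * (‖γ p.1 p.2‖ : ℂ) ^ 4 * (t p.1 * t p.2))
        + (∑ p : Fin N × Fin N, 2 * (‖γ p.1 p.2‖ : ℂ) ^ 4 * (t p.1 * t p.2)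
        - (c₄ : ℂ) * (∑ i, t i) ^ 2) := by
      rw [Finset.sum_sub_distrib]
      ring
    rw [hsplit]
    refine (norm_add_le _ _).trans ((add_le_add hmain hrest').trans ?_)
    have : 0 ≤ (N : ℝ) * x ^ 4 := by positivity
    linarith
  transpose_eq h p := transpose_pairMatrix _ _ (hreal h _ _)

lemma sum_subtype_of_eq_zero {ι E : Type*} [Fintype ι] [AddCommMonoid E] {s : ι → Prop}
    [DecidablePred s] (f : ι → E) (hf : ∀ p, ¬ s p → f p = 0) :
    ∑ p : {p // s p}, f p = ∑ p, f p := by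
  rw [← Finset.sum_subtype (Finset.univ.filter s) (by simp) f]
  exact Finset.sum_filter_of_ne fun p _ hp => by_contra fun h => hp (hf p h)

theorem IsWignerBasis.subtype {ι : Type} [Fintype ι] {B : ι → Matrix (Fin N) (Fin N) ℂ}
    (hB : IsWignerBasis ε c₄ B) (s : ι → Prop) [DecidablePred s] (hs : ∀ p, ¬ s p → B p = 0) :
    IsWignerBasis ε c₄ (fun p : {p // s p} => B p) := by
  exact
  { eps_nonneg := hB.eps_nonneg
    eps_le := hB.eps_le
    isHermitian := fun p => hB.isHermitian p
    norm_le := fun p => hB.norm_le p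
    norm_trace_mul_le := fun p => hB.norm_trace_mul_le p
    card_le := le_trans (by exact_mod_cast Fintype.card_subtype_le s) hB.card_le
    tensor := fun a b c d => by
      rw [sum_subtype_of_eq_zero (fun p => B p a b * B p c d) fun p hp => by simp [hs p hp]]
      exact hB.tensor a b c d
    fourth := fun X => by
      rw [sum_subtype_of_eq_zero (fun p => ((B p * X) ^ 4).trace) fun p hp => by simp [hs p hp]]
      exact hB.fourth X
    transpose_eq := fun h p => hB.transpose_eq h p }

lemma sum_smul_pairMatrix_apply (γ : Fin N → Fin N → ℂ) (x : Fin N × Fin N → ℝ) (a b : Fin N) :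
    (∑ p : Fin N × Fin N, x p • pairMatrix p.1 p.2 (γ p.1 p.2)) a b
      = x (a, b) * γ a b + x (b, a) * star (γ b a) := by
  rw [Matrix.sum_apply, Fintype.sum_prod_type]
  simp only [Matrix.smul_apply, pairMatrix_apply, Complex.real_smul, mul_add,
    Finset.sum_add_distrib, ite_and, mul_ite, mul_zero]
  simp

end Ensemble

section Statistics

variable {N : ℕ}

lemma trN_eq {𝕜 : Type*} [RCLike 𝕜] (φ : ℝ → ℝ) {M : Matrix (Fin N) (Fin N) 𝕜}
    (hM : M.IsHermitian) : trN φ M = (∑ i, φ (hM.eigenvalues i)) / N := by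
  rw [trN, hM.cfc_eq, Matrix.IsHermitian.cfc, Unitary.conjStarAlgAut_apply, Matrix.trace_mul_comm,
    ← mul_assoc, Unitary.coe_star_mul_self, one_mul, Matrix.trace_diagonal]
  simp

lemma eigenStat_congr (φ : ℝ → ℝ) {M M' : Matrix (Fin N) (Fin N) ℂ} (h : M = M')
    (hM : M.IsHermitian) (hM' : M'.IsHermitian) : eigenStat φ hM = eigenStat φ hM' := by
  subst h; rfl

lemma trN_eq_eigenStat_map_ofReal (φ : ℝ → ℝ) {M : Matrix (Fin N) (Fin N) ℝ}
    (hM : M.IsHermitian) (hM' : (M.map ((↑) : ℝ → ℂ)).IsHermitian) :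
    trN φ M = eigenStat φ hM' := by
  have h1 := hM'.roots_charpoly_eq_eigenvalues
  have h2 : (M.map ((↑) : ℝ → ℂ)).charpoly = M.charpoly.map Complex.ofRealHom :=
    Matrix.charpoly_map M Complex.ofRealHom
  have h3 := hM.splits_charpoly.roots_map Complex.ofRealHom
  rw [h2, h3, hM.roots_charpoly_eq_eigenvalues, Multiset.map_map] at h1
  have h4 := congrArg (fun s : Multiset ℂ => (s.map fun w => φ w.re).sum) h1
  simp only [Multiset.map_map] at h4
  rw [trN_eq φ hM, eigenStat]
  congr 1

end Statistics

section HermitianModel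

variable {N : ℕ}

/-- The coefficients of the Hermitian ensemble. -/
def hermitianCoef (a b : Fin N) : ℂ :=
  if a = b then 1 / 2 else if a < b then ((√2)⁻¹ : ℝ) else -(((√2)⁻¹ : ℝ) * Complex.I)

/-- The coefficients of the real symmetric ensemble. -/
def symmetricCoef (a b : Fin N) : ℂ :=
  if a = b then (√2 / 2 : ℝ) else if a < b then 1 else 0

lemma star_symmetricCoef (a b : Fin N) : star (symmetricCoef a b) = symmetricCoef a b := by
  unfold symmetricCoef
  split_ifs
  · exact Complex.conj_ofReal _
  · simp
  · simp

lemma isWignerBasis_hermitian : IsWignerBasis 0 (1 / 2)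
    (fun p : Fin N × Fin N => pairMatrix p.1 p.2 (hermitianCoef p.1 p.2)) := by
  have hs : ((√2)⁻¹ : ℝ) ^ 2 = 1 / 2 := by rw [inv_pow, Real.sq_sqrt (by norm_num)]; norm_num
  have hs4 : ((√2)⁻¹ : ℝ) ^ 4 = 1 / 4 := by
    calc ((√2)⁻¹ : ℝ) ^ 4 = (((√2)⁻¹ : ℝ) ^ 2) ^ 2 := by ring
      _ = _ := by rw [hs]; norm_num
  have h0 : (0 : ℝ) ≤ (√2)⁻¹ := by positivity
  have hlt : ∀ a b : Fin N, a < b → hermitianCoef a b = ((√2)⁻¹ : ℝ) := fun a b h => by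
    rw [hermitianCoef, if_neg h.ne, if_pos h]
  have hgt : ∀ a b : Fin N, b < a → hermitianCoef a b = -(((√2)⁻¹ : ℝ) * Complex.I) :=
    fun a b h => by rw [hermitianCoef, if_neg h.ne', if_neg h.not_gt]
  have hn : ∀ a b : Fin N, a ≠ b → ‖hermitianCoef a b‖ = (√2)⁻¹ := by
    intro a b h
    rcases lt_or_gt_of_ne h with h | h
    · rw [hlt a b h, Complex.norm_real, Real.norm_of_nonneg h0]
    · rw [hgt a b h, norm_neg, norm_mul, Complex.norm_real, Real.norm_of_nonneg h0, Complex.norm_I,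
        mul_one]
  refine isWignerBasis_pairMatrix le_rfl zero_le_one (by norm_num) (by norm_num) ?_ ?_ ?_ ?_ ?_
    (fun h => absurd rfl h)
  · intro a b
    by_cases h : a = b
    · rw [hermitianCoef, if_pos h]; norm_num
    · rw [hn a b h]; nlinarith
  · intro a
    rw [hermitianCoef, if_pos rfl]
    have : star (1 / 2 : ℂ) = 1 / 2 := by simp
    rw [this]
    norm_num
  · intro a b h
    rcases lt_or_gt_of_ne h with h | h
    · rw [hlt a b h, hgt b a h]
      simp only [star_neg, star_mul', Complex.star_def, Complex.conj_ofReal, Complex.conj_I]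
      rw [Complex.ofReal_zero]
      linear_combination (((√2)⁻¹ : ℝ) : ℂ) ^ 2 * Complex.I_sq
    · rw [hgt a b h, hlt b a h]
      simp only [Complex.star_def, Complex.conj_ofReal]
      rw [Complex.ofReal_zero]
      linear_combination (((√2)⁻¹ : ℝ) : ℂ) ^ 2 * Complex.I_sq
  · intro a b h
    rw [hn a b h, hn b a h.symm, hs]; norm_num
  · intro a b h
    rw [hn a b h, hn b a h.symm, hs4]; norm_num

lemma isWignerBasis_symmetric : IsWignerBasis 1 1
    (fun p : {p : Fin N × Fin N // p.1 ≤ p.2} =>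
      pairMatrix p.1.1 p.1.2 (symmetricCoef p.1.1 p.1.2)) := by
  have hs : (√2 : ℝ) ^ 2 = 2 := Real.sq_sqrt (by norm_num)
  have hsC : ((√2 : ℝ) : ℂ) ^ 2 = 2 := by exact_mod_cast congrArg Complex.ofReal hs
  have hlt : ∀ a b : Fin N, a < b → symmetricCoef a b = 1 := fun a b h => by
    rw [symmetricCoef, if_neg h.ne, if_pos h]
  have hgt : ∀ a b : Fin N, b < a → symmetricCoef a b = 0 :=
    fun a b h => by rw [symmetricCoef, if_neg h.ne', if_neg h.not_gt]
  refine IsWignerBasis.subtype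
    (B := fun p : Fin N × Fin N => pairMatrix p.1 p.2 (symmetricCoef p.1 p.2))
    (isWignerBasis_pairMatrix zero_le_one le_rfl zero_le_one le_rfl ?_ ?_ ?_ ?_ ?_ ?_) _ ?_
  · intro a b
    rcases lt_trichotomy a b with h | h | h
    · simp [hlt a b h]
    · rw [symmetricCoef, if_pos h, Complex.norm_real, Real.norm_of_nonneg (by positivity)]
      nlinarith [Real.sqrt_nonneg 2]
    · simp [hgt a b h]
  · intro a
    rw [star_symmetricCoef, symmetricCoef, if_pos rfl]
    push_cast
    linear_combination hsC
  · intro a b h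
    rw [star_symmetricCoef]
    rcases lt_or_gt_of_ne h with h | h <;> simp [hlt _ _ h, hgt _ _ h]
  · intro a b h
    rcases lt_or_gt_of_ne h with h | h <;> simp [hlt _ _ h, hgt _ _ h]
  · intro a b h
    rcases lt_or_gt_of_ne h with h | h <;> simp [hlt _ _ h, hgt _ _ h]
  · exact fun _ => star_symmetricCoef
  · intro p hp
    rw [hgt _ _ (not_le.1 hp)]
    simp [pairMatrix]

lemma sum_hermitianCoord_smul {W : Matrix (Fin N) (Fin N) ℂ} (hW : W.IsHermitian) :
    ∑ p : Fin N × Fin N, hermitianCoord W p • pairMatrix p.1 p.2 (hermitianCoef p.1 p.2) = W := by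
  have h2 : ((√2 : ℝ) : ℂ) ≠ 0 := by exact_mod_cast (by positivity : (√2 : ℝ) ≠ 0)
  have key : ∀ a b, a < b → W a b = (hermitianCoord W (a, b) : ℂ) * hermitianCoef a b
      + (hermitianCoord W (b, a) : ℂ) * star (hermitianCoef b a) := by
    intro a b h
    simp only [hermitianCoord, hermitianCoef, h.ne, h.ne', h, h.not_gt, if_true, if_false,
      star_neg, star_mul', Complex.star_def, Complex.conj_ofReal, Complex.conj_I]
    nth_rewrite 1 [← Complex.re_add_im (W a b)]
    push_cast
    field_simp
  ext a b
  rw [sum_smul_pairMatrix_apply]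
  rcases lt_trichotomy a b with h | h | h
  · exact (key a b h).symm
  · subst h
    have : ((W a a).re : ℂ) = W a a := hW.coe_re_apply_self a
    simp only [hermitianCoord, hermitianCoef, if_true]
    rw [this]
    have : star (1 / 2 : ℂ) = 1 / 2 := by simp
    rw [this]
    ring
  · have e : W a b = star (W b a) := (hW.apply a b).symm
    rw [e, key b a h]
    simp only [star_add, star_mul', Complex.star_def, Complex.conj_ofReal,
      Complex.conj_conj]
    ring

lemma sum_symmetricCoord_smul {W : Matrix (Fin N) (Fin N) ℝ} (hW : W.IsSymm) :
    ∑ p : {p : Fin N × Fin N // p.1 ≤ p.2},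
      symmetricCoord W p • pairMatrix p.1.1 p.1.2 (symmetricCoef p.1.1 p.1.2)
      = W.map ((↑) : ℝ → ℂ) := by
  have h2 : (√2 : ℝ) ≠ 0 := by positivity
  set x : Fin N × Fin N → ℝ := fun p => if h : p.1 ≤ p.2 then symmetricCoord W ⟨p, h⟩ else 0
    with hx
  have hgt : ∀ a b : Fin N, b < a → symmetricCoef a b = 0 :=
    fun a b h => by rw [symmetricCoef, if_neg h.ne', if_neg h.not_gt]
  have e1 : ∑ p : {p : Fin N × Fin N // p.1 ≤ p.2},
      symmetricCoord W p • pairMatrix p.1.1 p.1.2 (symmetricCoef p.1.1 p.1.2)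
      = ∑ p : Fin N × Fin N, x p • pairMatrix p.1 p.2 (symmetricCoef p.1 p.2) := by
    rw [← sum_subtype_of_eq_zero (s := fun p : Fin N × Fin N => p.1 ≤ p.2)]
    · refine Finset.sum_congr rfl fun p _ => ?_
      rw [hx]
      simp only [dif_pos p.2]
    · intro p hp
      simp [hx, dif_neg hp]
  rw [e1]
  ext a b
  rw [sum_smul_pairMatrix_apply, star_symmetricCoef, Matrix.map_apply]
  rcases lt_trichotomy a b with h | h | h
  · simp [hx, symmetricCoord, symmetricCoef, h.ne, h.ne', h, h.not_gt, h.le]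
  · subst h
    simp only [hx, le_refl, dif_pos, symmetricCoord, symmetricCoef, if_true]
    rw [← Complex.ofReal_mul, ← Complex.ofReal_add]
    congr 1
    field_simp
    ring
  · simp [hx, symmetricCoord, symmetricCoef, h.ne, h.ne', h, h.not_gt, h.le, hW.apply]

end HermitianModel

section Realization

variable {Ω : Type*} [MeasurableSpace Ω] {P : Measure Ω} {μ : Measure ℝ} {J : ℕ} {θ : Fin J → ℝ}
  {j₀ : Fin J} {k : Fin J → ℕ} {N : ℕ}

lemma aemeasurable_and_map_eq_pi {ι : Type*} [Fintype ι] {X : ι → Ω → ℝ}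
    (hlaw : ∀ p, HasLaw (X p) μ P) (hind : iIndepFun X P) :
    AEMeasurable (fun ω p => X p ω) P ∧ P.map (fun ω p => X p ω) = Measure.pi fun _ => μ := by
  refine ⟨aemeasurable_pi_lambda _ fun p => (hlaw p).aemeasurable, ?_⟩
  rw [hind.map_fun_eq_pi_map fun p => (hlaw p).aemeasurable]
  simp only [(hlaw _).map_eq]

theorem isRealization_hermitian (hN : 0 < N) {W : Ω → Matrix (Fin N) (Fin N) ℂ}
    (hW : IsHermitianWigner P μ W) {A : Matrix (Fin N) (Fin N) ℂ} (hA : IsDeformation θ j₀ k A) :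
    IsRealization P μ θ j₀ k 0 (1 / 2) N (fun φ ω => trN φ (deformed (W ω) A)) := by
  obtain ⟨h1, h2⟩ := aemeasurable_and_map_eq_pi hW.hasLaw hW.indep
  refine ⟨⟨N, hN, Fin N × Fin N, _, isWignerBasis_hermitian, A, hA, fun h => absurd rfl h,
    Complex.I, by simp⟩, fun ω p => hermitianCoord (W ω) p, rfl, h1, h2, fun φ ω => ?_⟩
  have hM : deformed (W ω) A = Config.M ⟨N, hN, Fin N × Fin N, _, isWignerBasis_hermitian, A, hA,
      fun h => absurd rfl h, Complex.I, by simp⟩ (fun p => hermitianCoord (W ω) p) := by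
    rw [deformed, Config.M, Config.s, add_comm]
    congr 2
    exact (sum_hermitianCoord_smul (hW.isHermitian ω)).symm
  simp only [hM]
  exact trN_eq φ _

lemma IsDeformation.map_ofReal {A : Matrix (Fin N) (Fin N) ℝ} (hA : IsDeformation θ j₀ k A) :
    IsDeformation θ j₀ k (A.map ((↑) : ℝ → ℂ)) := by
  obtain ⟨U, hU, d, rfl, hd, hk⟩ := hA
  have hstar : (star U).map ((↑) : ℝ → ℂ) = star (U.map ((↑) : ℝ → ℂ)) := by
    ext i j
    simp [Matrix.star_apply]
  have hmul : ∀ X Y : Matrix (Fin N) (Fin N) ℝ, (X * Y).map ((↑) : ℝ → ℂ)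
      = X.map ((↑) : ℝ → ℂ) * Y.map ((↑) : ℝ → ℂ) :=
    fun X Y => Matrix.map_mul (f := Complex.ofRealHom)
  refine ⟨U.map ((↑) : ℝ → ℂ), ?_, d, ?_, hd, hk⟩
  · rw [Matrix.mem_unitaryGroup_iff] at hU ⊢
    rw [← hstar, ← hmul, hU]
    exact Matrix.map_one _ Complex.ofReal_zero Complex.ofReal_one
  · rw [hmul, hmul, hstar, Matrix.diagonal_map Complex.ofReal_zero]
    rfl

lemma IsDeformation.isSymm {A : Matrix (Fin N) (Fin N) ℝ} (hA : IsDeformation θ j₀ k A) :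
    A.IsSymm := by
  obtain ⟨U, _, d, rfl, -, -⟩ := hA
  have : star U = Uᵀ := Matrix.conjTranspose_eq_transpose_of_trivial U
  rw [this, Matrix.IsSymm, Matrix.transpose_mul, Matrix.transpose_mul, Matrix.transpose_transpose,
    Matrix.diagonal_transpose, mul_assoc]

theorem isRealization_symmetric (hN : 0 < N) {W : Ω → Matrix (Fin N) (Fin N) ℝ}
    (hW : IsSymmetricWigner P μ W) {A : Matrix (Fin N) (Fin N) ℝ} (hA : IsDeformation θ j₀ k A) :
    IsRealization P μ θ j₀ k 1 1 N (fun φ ω => trN φ (deformed (W ω) A)) := by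
  obtain ⟨h1, h2⟩ := aemeasurable_and_map_eq_pi hW.hasLaw hW.indep
  have hT : (1 : ℝ) ≠ 0 → (A.map ((↑) : ℝ → ℂ))ᵀ = A.map ((↑) : ℝ → ℂ) := fun _ => by
    rw [← Matrix.transpose_map, hA.isSymm.eq]
  refine ⟨⟨N, hN, {p : Fin N × Fin N // p.1 ≤ p.2}, _, isWignerBasis_symmetric,
    A.map ((↑) : ℝ → ℂ), hA.map_ofReal, hT, Complex.I, by simp⟩,
    fun ω p => symmetricCoord (W ω) p, rfl, h1, h2, fun φ ω => ?_⟩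
  have hM : (deformed (W ω) A).map ((↑) : ℝ → ℂ) = Config.M ⟨N, hN,
      {p : Fin N × Fin N // p.1 ≤ p.2}, _, isWignerBasis_symmetric, A.map ((↑) : ℝ → ℂ),
      hA.map_ofReal, hT, Complex.I, by simp⟩ (fun p => symmetricCoord (W ω) p) := by
    rw [deformed, Config.M, Config.s, add_comm]
    have := sum_symmetricCoord_smul (hW.isSymm ω)
    simp only [this]
    ext i j
    simp
  have hS : (deformed (W ω) A).IsHermitian := by
    rw [Matrix.IsHermitian, Matrix.conjTranspose_eq_transpose_of_trivial, deformed,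
      Matrix.transpose_add, Matrix.transpose_smul, (hW.isSymm ω).eq, hA.isSymm.eq]
  have hS' : ((deformed (W ω) A).map ((↑) : ℝ → ℂ)).IsHermitian := by
    rw [hM]; exact Config.isHermitian_M _ _
  simp only
  rw [trN_eq_eigenStat_map_ofReal φ hS hS']
  exact eigenStat_congr φ hM _ _

end Realization

end DeformedWigner

namespace DeformedWigner

/-! ### The limiting distribution -/

section LimitDistribution

/-- The test function on the line with given values. -/
def mkTest (f : ℝ → ℝ) (hf : ContDiff ℝ (⊤ : ℕ∞) f) (hc : HasCompactSupport f) :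
    𝓓((⊤ : TopologicalSpace.Opens ℝ), ℝ) :=
  ⟨f, hf, hc, fun _ _ => trivial⟩

@[simp] lemma mkTest_apply {f : ℝ → ℝ} (hf : ContDiff ℝ (⊤ : ℕ∞) f) (hc : HasCompactSupport f)
    (x : ℝ) : mkTest f hf hc x = f x := rfl

/-- A distribution vanishes on test functions supported away from its support. -/
theorem apply_eq_zero_of_disjoint_dsupport (Λ : 𝓓'((⊤ : TopologicalSpace.Opens ℝ), ℝ))
    (f : 𝓓((⊤ : TopologicalSpace.Opens ℝ), ℝ))
    (hf : Disjoint (tsupport f) (Distribution.dsupport Λ)) : Λ f = 0 := by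
  have hloc : ∀ x : tsupport f, ∃ s : Set ℝ, Distribution.IsVanishingOn Λ s ∧ IsOpen s ∧ (x : ℝ) ∈ s :=
    fun x => (Distribution.notMem_dsupport_iff (f := Λ) (x : ℝ)).1 (Set.disjoint_left.1 hf x.2)
  choose s hs hso hxs using hloc
  obtain ⟨t, ht⟩ := f.hasCompactSupport.isCompact.elim_finite_subcover s hso
    fun x hx => Set.mem_iUnion.2 ⟨⟨x, hx⟩, hxs _⟩
  obtain ⟨ρ, hρ⟩ := SmoothPartitionOfUnity.exists_isSubordinate (modelWithCornersSelf ℝ ℝ)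
    (isClosed_tsupport f) (fun i : t => s i) (fun i => hso i) (by
      intro x hx
      obtain ⟨i, hi, hxi⟩ := Set.mem_iUnion₂.1 (ht hx)
      exact Set.mem_iUnion.2 ⟨⟨i, hi⟩, hxi⟩)
  set F : t → 𝓓((⊤ : TopologicalSpace.Opens ℝ), ℝ) := fun i =>
    mkTest (fun x => ρ i x * f x) ((ρ i).contMDiff.contDiff.mul f.contDiff)
      f.hasCompactSupport.mul_left with hF
  have hsum : f = ∑ i, F i := by
    ext x
    have e : (∑ i, F i) x = ∑ i, F i x := by
      simp
    rw [e]
    simp only [hF, mkTest_apply, ← Finset.sum_mul]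
    by_cases hx : x ∈ tsupport f
    · have := ρ.sum_eq_one hx
      rw [finsum_eq_sum_of_fintype] at this
      rw [this, one_mul]
    · rw [image_eq_zero_of_notMem_tsupport hx, mul_zero]
  rw [hsum, map_sum]
  refine Finset.sum_eq_zero fun i _ => hs i (F i) ?_
  exact (tsupport_mul_subset_left).trans (hρ i)

/-- Integration of test functions against a measure. -/
def integralCLM (ν : Measure ℝ) : 𝓓((⊤ : TopologicalSpace.Opens ℝ), ℝ) →L[ℝ] ℝ :=
  TestFunction.integralAgainstBilinCLM (ContinuousLinearMap.mul ℝ ℝ) ν (fun _ => 1)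

/-- The distribution `φ ↦ ∫ φ dν₁ - ∫ φ dν₂`. -/
def diffDistribution (ν₁ ν₂ : Measure ℝ) : 𝓓'((⊤ : TopologicalSpace.Opens ℝ), ℝ) where
  toFun f := (integralCLM ν₁ - integralCLM ν₂) f
  map_add' f g := map_add (integralCLM ν₁ - integralCLM ν₂) f g
  map_smul' c f := map_smul (integralCLM ν₁ - integralCLM ν₂) c f
  cont := (integralCLM ν₁ - integralCLM ν₂).continuous

variable {ν₁ ν₂ : Measure ℝ} [IsFiniteMeasure ν₁] [IsFiniteMeasure ν₂] {K : Set ℝ}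

lemma diffDistribution_apply (f : 𝓓((⊤ : TopologicalSpace.Opens ℝ), ℝ)) :
    diffDistribution ν₁ ν₂ f = ∫ x, f x ∂ν₁ - ∫ x, f x ∂ν₂ := by
  have h : ∀ ν : Measure ℝ, IsFiniteMeasure ν → integralCLM ν f = ∫ x, f x ∂ν := by
    intro ν _
    rw [integralCLM, TestFunction.integralAgainstBilinCLM_eq_integral
      ((locallyIntegrable_const _).locallyIntegrableOn _)]
    simp
  rw [← h ν₁ inferInstance, ← h ν₂ inferInstance]
  rfl

lemma dsupport_diffDistribution_subset (hK : IsClosed K) (h₁ : ν₁ Kᶜ = 0) (h₂ : ν₂ Kᶜ = 0) :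
    Distribution.dsupport (diffDistribution ν₁ ν₂) ⊆ K := by
  refine Set.sInter_subset_of_mem ⟨fun f hf => ?_, hK⟩
  have h0 : ∀ x ∈ K, f x = 0 := fun x hx =>
    image_eq_zero_of_notMem_tsupport fun h => hf h hx
  rw [diffDistribution_apply, integral_eq_of_eqOn h₁ h0, integral_eq_of_eqOn h₂ h0]
  simp

lemma integrable_stieltjes {ν : Measure ℝ} [IsFiniteMeasure ν] {z : ℂ} (hz : z.im ≠ 0) :
    Integrable (fun x : ℝ => (z - x)⁻¹) ν := by
  have hne : ∀ x : ℝ, z - x ≠ 0 := fun x h => hz (by simpa using congrArg Complex.im h)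
  refine Integrable.of_bound (C := |z.im|⁻¹) ?_ (Eventually.of_forall fun x => ?_)
  · exact Continuous.aestronglyMeasurable (by fun_prop (disch := exact hne _))
  · rw [norm_inv]
    refine inv_anti₀ (abs_pos.2 hz) ?_
    have := Complex.abs_im_le_norm (z - x)
    simpa using this

theorem hasStieltjesTransform_diffDistribution (hK : IsCompact K) (h₁ : ν₁ Kᶜ = 0)
    (h₂ : ν₂ Kᶜ = 0) {T : ℂ → ℂ} (hT : ∀ z : ℂ, z.im ≠ 0 →
      T z = (∫ x : ℝ, (z - x)⁻¹ ∂ν₁) - ∫ x : ℝ, (z - x)⁻¹ ∂ν₂) :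
    HasStieltjesTransform (diffDistribution ν₁ ν₂) T := by
  set Λ := diffDistribution ν₁ ν₂ with hΛ
  have hsub : Distribution.dsupport Λ ⊆ K := dsupport_diffDistribution_subset hK.isClosed h₁ h₂
  refine ⟨hK.of_isClosed_subset Distribution.isClosed_dsupport hsub, fun z hz u v huv => ?_⟩
  have hne : ∀ x : ℝ, z - x ≠ 0 := fun x h => hz (by simpa using congrArg Complex.im h)
  have hsm : ContDiff ℝ (⊤ : ℕ∞) fun x : ℝ => (z - (x : ℂ))⁻¹ :=
    (contDiff_const.sub Complex.ofRealCLM.contDiff).inv hne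
  obtain ⟨R, hR0, hR⟩ : ∃ R : ℝ, 0 < R ∧ K ⊆ Metric.ball 0 R := by
    obtain ⟨R, hR⟩ := hK.isBounded.subset_ball (0 : ℝ)
    exact ⟨max R 1, by positivity, hR.trans (Metric.ball_subset_ball (le_max_left _ _))⟩
  let χ : ContDiffBump (0 : ℝ) := ⟨R, R + 1, hR0, by linarith⟩
  have hχ : ∀ x ∈ Metric.ball (0 : ℝ) R, χ x = 1 := fun x hx =>
    χ.one_of_mem_closedBall (Metric.ball_subset_closedBall hx)
  -- the value of `Λ` on a test function that agrees with `f` near the support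
  have key : ∀ (f : ℝ → ℝ) (hf : ContDiff ℝ (⊤ : ℕ∞) f) (w : 𝓓((⊤ : TopologicalSpace.Opens ℝ), ℝ)),
      (∀ᶠ x in 𝓝ˢ (Distribution.dsupport Λ), w x = f x) →
      Λ w = ∫ x, f x ∂ν₁ - ∫ x, f x ∂ν₂ := by
    intro f hf w hw
    let w' := mkTest (fun x => χ x * f x) (χ.contDiff.mul hf) χ.hasCompactSupport.mul_right
    have hw' : ∀ᶠ x in 𝓝ˢ (Distribution.dsupport Λ), w' x = f x := by
      filter_upwards [Metric.isOpen_ball.mem_nhdsSet.2 (hsub.trans hR)] with x hx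
      simp [w', hχ x hx]
    have h0 : Λ (w - w') = 0 := by
      refine apply_eq_zero_of_disjoint_dsupport Λ _ (Set.disjoint_right.2 fun x hx => ?_)
      rw [notMem_tsupport_iff_eventuallyEq]
      have := (hw.and hw').filter_mono (nhds_le_nhdsSet hx)
      filter_upwards [this] with y hy
      simp [hy.1, hy.2]
    have h1 : Λ w = Λ w' := by rwa [map_sub, sub_eq_zero] at h0
    have h2 : ∀ ν : Measure ℝ, ν Kᶜ = 0 → ∫ x, w' x ∂ν = ∫ x, f x ∂ν := by
      intro ν hν
      have : ∀ᵐ x ∂ν, x ∈ K := by rwa [ae_iff]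
      refine integral_congr_ae ?_
      filter_upwards [this] with x hx
      simp [w', hχ x (hR hx)]
    rw [h1, hΛ, diffDistribution_apply, h2 ν₁ h₁, h2 ν₂ h₂]
  have hu := key _ (Complex.reCLM.contDiff.comp hsm) u (huv.mono fun x hx => hx.1)
  have hv := key _ (Complex.imCLM.contDiff.comp hsm) v (huv.mono fun x hx => hx.2)
  have hre : ∀ ν : Measure ℝ, IsFiniteMeasure ν →
      ∫ x : ℝ, (z - (x : ℂ))⁻¹.re ∂ν = (∫ x : ℝ, (z - (x : ℂ))⁻¹ ∂ν).re := fun ν _ =>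
    integral_re (𝕜 := ℂ) (integrable_stieltjes hz)
  have him : ∀ ν : Measure ℝ, IsFiniteMeasure ν →
      ∫ x : ℝ, (z - (x : ℂ))⁻¹.im ∂ν = (∫ x : ℝ, (z - (x : ℂ))⁻¹ ∂ν).im := fun ν _ =>
    integral_im (𝕜 := ℂ) (integrable_stieltjes hz)
  simp only [Function.comp_def, Complex.reCLM_apply, Complex.imCLM_apply] at hu hv
  rw [hre ν₁ inferInstance, hre ν₂ inferInstance, ← Complex.sub_re, ← hT z hz] at hu
  rw [him ν₁ inferInstance, him ν₂ inferInstance, ← Complex.sub_im, ← hT z hz] at hv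
  rw [hu, hv, Complex.re_add_im]

lemma isCompact_spectrumSet (σ : ℝ) {J : ℕ} (θ : Fin J → ℝ) : IsCompact (spectrumSet σ θ) := by
  refine isCompact_Icc.union (Set.Finite.isCompact ?_)
  refine (Set.finite_range fun j => θ j + σ ^ 2 / θ j).subset ?_
  rintro x ⟨j, -, rfl⟩
  exact ⟨j, rfl⟩

end LimitDistribution

section Main

variable {Ω : Type*} [MeasurableSpace Ω] {P : Measure Ω}
  {μ : Measure ℝ} {σ : ℝ} {J : ℕ} {θ : Fin J → ℝ} {j₀ : Fin J} {k : Fin J → ℕ}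

lemma secondOrder_hermitian :
    secondOrder μ σ θ j₀ k 0 (1 / 2) = LHermitian μ σ θ j₀ k := by
  ext z
  rw [secondOrder, LHermitian]
  push_cast
  ring

lemma secondOrder_symmetric : secondOrder μ σ θ j₀ k 1 1 = LSymmetric μ σ θ j₀ k := by
  ext z
  rw [secondOrder, LSymmetric]
  push_cast
  ring

/-- Both asymptotic statements, for any family of realizations of the model. -/
theorem exists_distribution (hσ : 0 < σ) (hμ : IsEntryLaw μ σ) (hθ : Function.Injective θ)
    (hj₀ : θ j₀ = 0) (ε c₄ : ℝ) :
    ∃ Λ : 𝓓'((⊤ : TopologicalSpace.Opens ℝ), ℝ),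
      HasStieltjesTransform Λ (secondOrder μ σ θ j₀ k ε c₄) ∧
      Distribution.dsupport Λ ⊆ spectrumSet σ θ ∧
      ∀ T : ℕ → (ℝ → ℝ) → Ω → ℝ, (∀ φ, T 0 φ = 0) →
        (∀ N, 0 < N → spikeRank j₀ k ≤ N → IsRealization P μ θ j₀ k ε c₄ N (T N)) →
        (∀ φ : 𝓓((⊤ : TopologicalSpace.Opens ℝ), ℝ),
          (∀ N, spikeRank j₀ k ≤ N → Integrable (fun ω => T N φ ω) P) ∧
          (fun N : ℕ => (∫ ω, T N φ ω ∂P)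
              - ((∫ x, φ x ∂(semicircle σ)) + 1 / (N : ℝ) * Λ φ))
            =O[atTop] (fun N : ℕ => 1 / (N : ℝ) ^ 2)) ∧
        (∀ φ : ℝ → ℝ, ContDiff ℝ (⊤ : ℕ∞) φ →
          (∃ (c : ℝ) (S : Set ℝ), IsCompact S ∧ ∀ x ∉ S, φ x = c) →
          Disjoint (tsupport φ) (spectrumSet σ θ) →
          ∀ᵐ ω ∂P, (fun N : ℕ => T N φ ω) =O[atTop] (fun N : ℕ => (N : ℝ) ^ (-(4 / 3) : ℝ))) := by
  have hK := isCompact_spectrumSet σ θ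
  obtain ⟨ν₁, ν₂, _, _, h₁, h₂, hm, hν⟩ := isStieltjesDiff_secondOrder (μ := μ) (k := k) (ε := ε)
    (c₄ := c₄) hσ hθ hj₀ hK.isClosed.measurableSet subset_rfl
  refine ⟨diffDistribution ν₁ ν₂, hasStieltjesTransform_diffDistribution hK h₁ h₂ hν,
    dsupport_diffDistribution_subset hK.isClosed h₁ h₂, fun T h0 hT => ?_⟩
  have hT' : ∀ N, max 1 (spikeRank j₀ k) ≤ N → IsRealization P μ θ j₀ k ε c₄ N (T N) :=
    fun N hN => hT N ((le_max_left _ _).trans hN) ((le_max_right _ _).trans hN)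
  refine ⟨fun φ => ?_, fun φ hφ hc hd => ?_⟩
  · obtain ⟨e1, e2⟩ := isBigO_expectation hσ hμ hθ hj₀ hν hT' φ.contDiff φ.hasCompactSupport
    refine ⟨fun N hN => ?_, by simpa only [diffDistribution_apply] using e2⟩
    rcases Nat.eq_zero_or_pos N with rfl | hpos
    · rw [h0]
      exact integrable_zero _ _ _
    · exact e1 N (max_le hpos hN)
  · exact ae_isBigO_statistic hσ hμ hθ hj₀ h₁ h₂ hm Set.subset_union_left hν (le_max_left _ _)
      hT' hφ hc hd

lemma trN_zero {𝕜 : Type*} [RCLike 𝕜] (φ : ℝ → ℝ) (M : Matrix (Fin 0) (Fin 0) 𝕜) :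
    trN φ M = 0 := by
  simp [trN]

end Main

end DeformedWigner

end

theorem mainTheorem10
    {Ω : Type*} [MeasurableSpace Ω] (P : Measure Ω) [IsProbabilityMeasure P]
    (μ : Measure ℝ) (σ : ℝ) (hσ : 0 < σ) (hμ : DeformedWigner.IsEntryLaw μ σ)
    {J : ℕ} (θ : Fin J → ℝ) (hθ : StrictAnti θ) (j₀ : Fin J) (hj₀ : θ j₀ = 0)
    (k : Fin J → ℕ) (hk : ∀ j, j ≠ j₀ → 0 < k j) :
    -- the complex Hermitian model
    (∃ Λ : 𝓓'((⊤ : TopologicalSpace.Opens ℝ), ℝ),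
      DeformedWigner.HasStieltjesTransform Λ (DeformedWigner.LHermitian μ σ θ j₀ k) ∧
      Distribution.dsupport Λ ⊆ DeformedWigner.spectrumSet σ θ ∧
      ∀ (W : (N : ℕ) → Ω → Matrix (Fin N) (Fin N) ℂ) (A : (N : ℕ) → Matrix (Fin N) (Fin N) ℂ),
        (∀ N, DeformedWigner.IsHermitianWigner P μ (W N)) →
        (∀ N, DeformedWigner.spikeRank j₀ k ≤ N → DeformedWigner.IsDeformation θ j₀ k (A N)) →
        (∀ φ : 𝓓((⊤ : TopologicalSpace.Opens ℝ), ℝ),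
          (∀ N, DeformedWigner.spikeRank j₀ k ≤ N →
            Integrable (fun ω => DeformedWigner.trN φ (DeformedWigner.deformed (W N ω) (A N))) P) ∧
          (fun N : ℕ =>
            (∫ ω, DeformedWigner.trN φ (DeformedWigner.deformed (W N ω) (A N)) ∂P)
              - ((∫ x, φ x ∂(DeformedWigner.semicircle σ)) + 1 / (N : ℝ) * Λ φ))
            =O[atTop] (fun N : ℕ => 1 / (N : ℝ) ^ 2)) ∧
        (∀ φ : ℝ → ℝ, ContDiff ℝ (⊤ : ℕ∞) φ →
          (∃ (c : ℝ) (S : Set ℝ), IsCompact S ∧ ∀ x ∉ S, φ x = c) →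
          Disjoint (tsupport φ) (DeformedWigner.spectrumSet σ θ) →
          ∀ᵐ ω ∂P,
            (fun N : ℕ => DeformedWigner.trN φ (DeformedWigner.deformed (W N ω) (A N)))
              =O[atTop] (fun N : ℕ => (N : ℝ) ^ (-(4 / 3) : ℝ)))) ∧
    -- the real symmetric model
    (∃ Λ : 𝓓'((⊤ : TopologicalSpace.Opens ℝ), ℝ),
      DeformedWigner.HasStieltjesTransform Λ (DeformedWigner.LSymmetric μ σ θ j₀ k) ∧
      Distribution.dsupport Λ ⊆ DeformedWigner.spectrumSet σ θ ∧
      ∀ (W : (N : ℕ) → Ω → Matrix (Fin N) (Fin N) ℝ) (A : (N : ℕ) → Matrix (Fin N) (Fin N) ℝ),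
        (∀ N, DeformedWigner.IsSymmetricWigner P μ (W N)) →
        (∀ N, DeformedWigner.spikeRank j₀ k ≤ N → DeformedWigner.IsDeformation θ j₀ k (A N)) →
        (∀ φ : 𝓓((⊤ : TopologicalSpace.Opens ℝ), ℝ),
          (∀ N, DeformedWigner.spikeRank j₀ k ≤ N →
            Integrable (fun ω => DeformedWigner.trN φ (DeformedWigner.deformed (W N ω) (A N))) P) ∧
          (fun N : ℕ =>
            (∫ ω, DeformedWigner.trN φ (DeformedWigner.deformed (W N ω) (A N)) ∂P)
              - ((∫ x, φ x ∂(DeformedWigner.semicircle σ)) + 1 / (N : ℝ) * Λ φ))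
            =O[atTop] (fun N : ℕ => 1 / (N : ℝ) ^ 2)) ∧
        (∀ φ : ℝ → ℝ, ContDiff ℝ (⊤ : ℕ∞) φ →
          (∃ (c : ℝ) (S : Set ℝ), IsCompact S ∧ ∀ x ∉ S, φ x = c) →
          Disjoint (tsupport φ) (DeformedWigner.spectrumSet σ θ) →
          ∀ᵐ ω ∂P,
            (fun N : ℕ => DeformedWigner.trN φ (DeformedWigner.deformed (W N ω) (A N)))
              =O[atTop] (fun N : ℕ => (N : ℝ) ^ (-(4 / 3) : ℝ)))) := by
  constructor
  · obtain ⟨Λ, h1, h2, h3⟩ := DeformedWigner.exists_distribution (P := P) (k := k) hσ hμ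
      hθ.injective hj₀ 0 (1 / 2)
    rw [DeformedWigner.secondOrder_hermitian] at h1
    refine ⟨Λ, h1, h2, fun W A hW hA => ?_⟩
    exact h3 (fun N φ ω => DeformedWigner.trN φ (DeformedWigner.deformed (W N ω) (A N)))
      (fun φ => funext fun ω => DeformedWigner.trN_zero φ _)
      (fun N hN hr => DeformedWigner.isRealization_hermitian hN (hW N) (hA N hr))
  · obtain ⟨Λ, h1, h2, h3⟩ := DeformedWigner.exists_distribution (P := P) (k := k) hσ hμ
      hθ.injective hj₀ 1 1
    rw [DeformedWigner.secondOrder_symmetric] at h1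
    refine ⟨Λ, h1, h2, fun W A hW hA => ?_⟩
    exact h3 (fun N φ ω => DeformedWigner.trN φ (DeformedWigner.deformed (W N ω) (A N)))
      (fun φ => funext fun ω => DeformedWigner.trN_zero φ _)
      (fun N hN hr => DeformedWigner.isRealization_symmetric hN (hW N) (hA N hr))
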